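/- Let $c>2$ be an integer and $\eta>0$. For $A\in\mathbb Z^{n\times n}$ write $\log\|A\|$ for the bit size of the entries of $A$, that is, the largest number of binary digits of an absolute value $|a_{ij}|$, and at least $1$. A determinant certificate is a scheme that assigns to every square integer matrix $M$ a bit string $C=\mathrm{Cert}(M)$, together with a randomized test of triples $(M,\delta,C)$, such that $(M,\det M,\mathrm{Cert}(M))$ always passes and, if $\delta\neq\det M$, then for every bit string $C$ the triple $(M,\delta,C)$ passes with probability at most $\eta$. There are a determinant certificate and limits on the sizes of the messages (the binary digits of each coefficient of $g$ and of $\delta$, and the bits of $C$; functions of $n$ and $\log\|A\|$ only) for which the following interactive protocol, on input $A\in\mathbb Z^{n\times n}$ with $n\ge 1$, has the properties (i)-(iii). Peggy commits to $g\in\mathbb Z[X]$, claiming that $g=\det(XI-A)$. Victor sends $\lambda$ drawn uniformly from $\{0,1,\dots,cn-1\}$. Peggy responds with an integer $\delta$ and a bit string $C$; if she is honest, $\delta=\det(\lambda I-A)$ and $C=\mathrm{Cert}(\lambda I-A)$. Victor accepts if and only if the messages respect the size limits, $\deg g=n$, $\delta=g(\lambda)$, and $(\lambda I-A,\delta,C)$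 passes the test of the determinant certificate. (i) Perfect completeness: if $g=\det(XI-A)$ and Peggy responds honestly, Victor always accepts. (ii) Soundness: if $g\ne\det(XI-A)$, then for every $k\ge 0$ and every strategy of Peggy, whose responses may depend on all challenges received so far, the probability that Victor accepts in all of $k$ repetitions with the same $g$ and independent draws of $\lambda$ and of his other random bits is at most $(1/c+\eta)^k$. Thus for $\eta<1-1/c$ it can be made arbitrarily small. (iii) Efficiency: Victor's decisions are computed by one fixed program for a random access machine, independent of $n$ and $A$, in which every instruction is charged at least its number of bit operations by schoolbook arithmetic. The number of bit operations that Victor performs, whatever Peggy sends, including the bits needed to draw $\lambda$, and the total number of bits of the messages $g,\lambda,\delta,C$ of every accepted run (in particular, of every honest run), are bounded by $n^{2+o(1)}(\log\|A\|)^{1+o(1)}$; that is, for every $\varepsilon>0$ there is a constant $B$, depending only on $c,\eta,\varepsilon$ (and on the scheme and program chosen for $c,\eta$), such that for all $n\ge1$ and all $A\in\mathbb Z^{n\times n}$ both are at most $B\,n^{2+\varepsilon}(\log\|A\|)^{1+\varepsilon}$. -/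

import Mathlib

open Polynomial MeasureTheory ProbabilityTheory

/-! ### Random access machine with bit costs

The memory is an array of natural numbers of arbitrary size. Every instruction is charged at least
the number of bit operations that carrying it out by schoolbook arithmetic takes, including the bits
of an address that is computed at run time. The inputs are read-only bit strings. -/

/-- Instructions; `d`, `a`, `b` are fixed memory addresses. -/
inductive Instr
  /-- `mem[d] := k` -/
  | const (d k : ℕ)
  /-- `mem[d] := mem[a] + mem[b]` -/
  | add (d a b : ℕ)
  /-- `mem[d] := mem[a] - mem[b]`, truncated at `0` -/
  | sub (d a b : ℕ)
  /-- `mem[d] := mem[a] * mem[b]` -/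
  | mul (d a b : ℕ)
  /-- `mem[d] := ⌊mem[a] / mem[b]⌋` -/
  | div (d a b : ℕ)
  /-- `mem[d] := mem[a] mod mem[b]` -/
  | mod (d a b : ℕ)
  /-- `mem[d] := mem[mem[a]]` -/
  | load (d a : ℕ)
  /-- `mem[mem[d]] := mem[a]` -/
  | store (d a : ℕ)
  /-- `mem[d] :=` the bit at position `mem[a]` of input tape `i`, or `2` beyond the end -/
  | read (i d a : ℕ)
  /-- `mem[d] :=` a fresh random bit -/
  | toss (d : ℕ)
  /-- continue at instruction `l` if `mem[a] = 0` -/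
  | jumpZero (a l : ℕ)
  /-- stop and accept (`true`) or reject (`false`) -/
  | halt (verdict : Bool)

/-- A program is a finite list of instructions. -/
abbrev Program := List Instr

/-- Configuration: program counter, number of random bits used so far, memory. -/
structure Config where
  pc : ℕ
  tossed : ℕ
  mem : ℕ → ℕ

/-- The charge for one instruction, `Nat.size` being the number of binary digits. -/
def Instr.cost (m : ℕ → ℕ) : Instr → ℕ
  | const _ k => 1 + k.size
  | add _ a b => 1 + (m a).size + (m b).size
  | sub _ a b => 1 + (m a).size + (m b).size
  | mul _ a b => (1 + (m a).size) * (1 + (m b).size)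
  | div _ a b => (1 + (m a).size) * (1 + (m b).size)
  | mod _ a b => (1 + (m a).size) * (1 + (m b).size)
  | load _ a => 1 + (m a).size + (m (m a)).size
  | store d a => 1 + (m d).size + (m a).size
  | read _ _ a => 1 + (m a).size
  | toss _ => 1
  | jumpZero a _ => 1 + (m a).size
  | halt _ => 1

/-- The symbol of a tape at a position: a bit, or `2` beyond the end. -/
def tapeSymbol (w : List Bool) (i : ℕ) : ℕ :=
  match w[i]? with
  | some b => b.toNat
  | none => 2

/-- Write `v` into cell `d` and go on to the next instruction. -/
def Config.write (s : Config) (d v : ℕ) : Config :=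
  { s with pc := s.pc + 1, mem := Function.update s.mem d v }

/-- The effect of one instruction, on input tapes `tapes` and random bits `ω`. -/
def Instr.next (tapes : List (List Bool)) (ω : ℕ → Bool) (s : Config) : Instr → Config
  | const d k => s.write d k
  | add d a b => s.write d (s.mem a + s.mem b)
  | sub d a b => s.write d (s.mem a - s.mem b)
  | mul d a b => s.write d (s.mem a * s.mem b)
  | div d a b => s.write d (s.mem a / s.mem b)
  | mod d a b => s.write d (s.mem a % s.mem b)
  | load d a => s.write d (s.mem (s.mem a))
  | store d a => s.write (s.mem d) (s.mem a)
  | read i d a => s.write d (tapeSymbol (tapes.getD i []) (s.mem a))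
  | toss d => { s.write d (ω s.tossed).toNat with tossed := s.tossed + 1 }
  | jumpZero a l => { s with pc := if s.mem a = 0 then l else s.pc + 1 }
  | halt _ => s

/-- Run at most `fuel` instructions from configuration `s`, with cost `t` incurred so far; the
result is the verdict with the total cost. Leaving the program means rejection. -/
def Program.exec (V : Program) (tapes : List (List Bool)) (ω : ℕ → Bool) :
    (fuel : ℕ) → (s : Config) → (t : ℕ) → Option (Bool × ℕ)
  | 0, _, _ => none
  | fuel + 1, s, t =>
    match V[s.pc]? with
    | none => some (false, t + 1)
    | some (.halt v) => some (v, t + 1)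
    | some I => V.exec tapes ω fuel (I.next tapes ω s) (t + I.cost s.mem)

/-- Started with empty memory, the program stops with this verdict at this total cost. -/
def Program.HaltsWith (V : Program) (tapes : List (List Bool)) (ω : ℕ → Bool)
    (verdict : Bool) (cost : ℕ) : Prop :=
  ∃ fuel, V.exec tapes ω fuel ⟨0, 0, fun _ => 0⟩ 0 = some (verdict, cost)

/-! ### Binary encodings -/

/-- Self-delimiting code of a natural number: each binary digit (lowest first) is preceded by
`true`, and `false` marks the end. -/
def encodeNat (k : ℕ) : List Bool :=
  (k.bits.flatMap fun b => [true, b]) ++ [false]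

/-- A sign bit followed by the absolute value. -/
def encodeInt (z : ℤ) : List Bool :=
  decide (z < 0) :: encodeNat z.natAbs

/-- The dimension, followed by the entries row by row. -/
def encodeMatrix {n : ℕ} (A : Matrix (Fin n) (Fin n) ℤ) : List Bool :=
  encodeNat n ++
    (List.finRange n).flatMap fun i => (List.finRange n).flatMap fun j => encodeInt (A i j)

/-- The number of coefficients, followed by the coefficients, lowest first. -/
noncomputable def encodePoly (g : ℤ[X]) : List Bool :=
  encodeNat (g.natDegree + 1) ++
    (List.range (g.natDegree + 1)).flatMap fun i => encodeInt (g.coeff i)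

/-- `log ‖A‖` as the bit size of the entries: the largest number of binary digits of an entry,
and at least `1`. -/
def entryBits {n : ℕ} (A : Matrix (Fin n) (Fin n) ℤ) : ℕ :=
  max 1 (Finset.univ.sup fun p : Fin n × Fin n => (A p.1 p.2).natAbs.size)

/-! ### Interactive certificates -/

/-- The law of an infinite sequence of independent fair coin tosses. -/
noncomputable def fairCoins : Measure (ℕ → Bool) :=
  Measure.infinitePi fun _ => (PMF.uniformOfFintype Bool).toMeasure

/-- A two-round protocol: on the input `x` the prover commits to `y`, the verifier sends a uniformly
random challenge `q`, the prover responds with `r`, and the verifier, who may toss further coins,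
accepts or rejects. -/
structure InteractiveCertificate (X Y Q R : Type) where
  /-- the property of input and commitment that is to be certified -/
  claim : X → Y → Prop
  /-- the finite set from which the challenge is drawn -/
  challenges : X → Finset Q
  /-- the response of the honest prover -/
  respond : X → Y → Q → R
  /-- the decision of the verifier, given his private coins -/
  accepts : X → Y → Q → R → (ℕ → Bool) → Prop

namespace InteractiveCertificate

variable {X Y Q R : Type} (P : InteractiveCertificate X Y Q R)

/-- The honest prover always convinces the verifier of a true claim. -/
def PerfectlyComplete : Prop :=
  ∀ x y, P.claim x y → ∀ q ∈ P.challenges x, ∀ ω, P.accepts x y q (P.respond x y q) ω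

/-- The event that the verifier accepts in each of `k` repetitions (challenge, response, decision)
with the same commitment. The `i`-th draw `s i` consists of challenge and private coins. The
response is any function of all challenges received so far. -/
def acceptsAll (x : X) (y : Y) (prover : List Q → R) (k : ℕ) : Set (Fin k → Q × (ℕ → Bool)) :=
  {s | ∀ i : Fin k, P.accepts x y (s i).1
    (prover ((List.ofFn fun j => (s j).1).take (i + 1))) (s i).2}

/-- Whatever the prover does, a false claim is accepted in all of `k` independent repetitions with
probability at most `e ^ k`, for every `k`; for `k = 1` this is a single run. -/
def SoundWithError [MeasurableSpace Q] (e : ℝ) : Prop :=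
  ∀ x y, ¬ P.claim x y → ∀ (k : ℕ) (prover : List Q → R),
    Measure.pi (fun _ : Fin k => (uniformOn (P.challenges x : Set Q)).prod fairCoins)
      (P.acceptsAll x y prover k) ≤ ENNReal.ofReal (e ^ k)

end InteractiveCertificate

/-! ### Determinant certificates -/

/-- The data of a non-interactive certificate for `δ = det M` with randomized verification. -/
structure DetCertificate where
  /-- the certificate of the honest prover -/
  prove : {n : ℕ} → Matrix (Fin n) (Fin n) ℤ → List Bool
  /-- the decision of the verifier on matrix, claimed determinant, certificate and coins -/
  accepts : {n : ℕ} → Matrix (Fin n) (Fin n) ℤ → ℤ → List Bool → (ℕ → Bool) → Prop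

/-- The honest certificate for the correct determinant is accepted whatever the coins are. -/
def DetCertificate.PerfectlyComplete (K : DetCertificate) : Prop :=
  ∀ (n : ℕ) (M : Matrix (Fin n) (Fin n) ℤ) (ω : ℕ → Bool), K.accepts M M.det (K.prove M) ω

/-- For a wrong value of the determinant, no certificate is accepted with probability more than
`η`. -/
def DetCertificate.SoundWithError (K : DetCertificate) (η : ℝ) : Prop :=
  ∀ (n : ℕ) (M : Matrix (Fin n) (Fin n) ℤ) (δ : ℤ), δ ≠ M.det → ∀ C : List Bool,
    fairCoins {ω | K.accepts M δ C ω} ≤ ENNReal.ofReal η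

/-! ### The certificate for the characteristic polynomial -/

/-- Message sizes beyond which the verifier rejects, as functions of the dimension and the bit size
of the entries: binary digits of each coefficient of `g` and of `δ`, and bits of the determinant
certificate. -/
structure SizeLimits where
  numBits : ℕ → ℕ → ℕ
  certBits : ℕ → ℕ → ℕ

/-- The protocol. Peggy commits to `g`; Victor draws `lam` from the first `c * n` integers; Peggy
returns `δ = det (lam I - A)` with a determinant certificate; Victor checks the sizes,
`degree g = n`, `δ = g(lam)`, and the determinant certificate. -/
noncomputable def charpolyCertificate (K : DetCertificate) (F : SizeLimits) (c n : ℕ) :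
    InteractiveCertificate (Matrix (Fin n) (Fin n) ℤ) ℤ[X] ℕ (ℤ × List Bool) where
  claim A g := g = A.charpoly
  challenges _ := Finset.range (c * n)
  respond A _ lam := (((lam : ℤ) • (1 : Matrix (Fin n) (Fin n) ℤ) - A).det, K.prove ((lam : ℤ) • (1 : Matrix (Fin n) (Fin n) ℤ) - A))
  accepts A g lam r ω :=
    ((∀ i, (g.coeff i).natAbs.size ≤ F.numBits n (entryBits A)) ∧
      r.1.natAbs.size ≤ F.numBits n (entryBits A) ∧
      r.2.length ≤ F.certBits n (entryBits A)) ∧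
    g.degree = n ∧
    r.1 = g.eval (lam : ℤ) ∧
    K.accepts ((lam : ℤ) • (1 : Matrix (Fin n) (Fin n) ℤ) - A) r.1 r.2 ω

/-- What Victor's program reads: input, commitment, challenge, response. -/
noncomputable def verifierTapes {n : ℕ} (A : Matrix (Fin n) (Fin n) ℤ) (g : ℤ[X]) (lam : ℕ)
    (r : ℤ × List Bool) : List (List Bool) :=
  [encodeMatrix A, encodePoly g, encodeNat lam, encodeInt r.1, r.2]

/-- The number of bits of all messages exchanged. -/
noncomputable def transcriptBits (g : ℤ[X]) (lam : ℕ) (r : ℤ × List Bool) : ℕ :=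
  (encodePoly g).length + (encodeNat lam).length + (encodeInt r.1).length + r.2.length

/-!
The protocol is sound whatever the determinant certificate is: a wrong polynomial of degree `n`
agrees with the characteristic polynomial at no more than `n` of the `c * n` challenges, and at each
of the others the prover has to certify a wrong determinant (`soundWithError`). What has to be found
is a certificate of `n ^ (2 + o(1)) * log ‖A‖ ^ (1 + o(1))` bits with a test of that cost.

**The certificate** (`LinCheck`, `det_eq_of_roundCheck`). The Smith normal form `U M = D Q`, with
rows of `U` reduced modulo the entries of the diagonal matrix `D`, is written as an identity
`[I 0; W D] N = [M T; 0 I]` with `N = [M T; Q Y]`, so that `det M = det D` if `det N = 1`. All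
blocks have `n ^ (2 + o(1)) * log ‖M‖ ^ (1 + o(1))` bits in total: the entries of `D` may be long,
but their product is `det M`, and the `i`-th row of `W` is no longer than the `i`-th of them. A
singular `M` is dealt with likewise (`exists_primitive_covector`), and as `det D = 0` then, nothing
needs to be known about `N`. In the other case, that `N` is invertible over `ℤ` follows from a
sequence with `R₀ = 1`, `R_k ^ 2 = N P_k + X R_{k+1}`, `R_K = 0`, by `exists_mul_eq_one`. It exists
with `K = O(log n)` and small entries, since it is the expansion of `N⁻¹` in powers of `X`, in which
the number of known digits doubles with every step (`exists_chain`). The sign of `det N` is fixed by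
an identity `N A₃² A₂² A₁² A₀² = 1 + 3 Z`: matrices of determinant one over the field of three
elements are products of four squares (`exists_squares`), while `-1` is no square modulo three.
`exists_certificate` collects all of this.

**The test.** All identities are linear in a vector that they are applied to. In each round they are
tested modulo a random number, for a random vector of zeros and ones, at the cost of products of
matrices with vectors. An identity that fails over `ℤ` fails modulo all but few primes, and, modulo
such a prime, for at least half of the vectors (`card_passes_le`). A random number of `b` bits is a
prime with a probability of the order of `1 / b` (`two_pow_le_mul_primes`), so a number of rounds
proportional to `b` makes the error smaller than `η` (`detAccepts_le`). Only the copy of the matrix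
in the certificate and the value of the polynomial are compared exactly; this is done by arithmetic
on single bits, with time linear in the number of bits.

**The verifier** is written in a language with `for` loops, whose programs denote total functions.
It is compiled to the random access machine (`Stmt.code_spec`, `Stmt.toProgram`): a program that
executes `T` instructions on numbers of at most `w` digits costs `T * (2 * w + 12) ^ 2`. The random
moduli have `O(log (n log ‖A‖))` bits, so `w` is logarithmic and the number of instructions is all
that matters. It depends on a few registers that bound the loops and have been computed in advance
from the input (`par`, `Stmt.stb`). A prover who sends too much does not cause any further cost: of
each message only a part whose length is limited is read. `verify_spec` shows that the program
decides as the protocol says. The growth of its cost to `n ^ (2 + o(1)) * log ‖A‖ ^ (1 + o(1))` is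
decided by the nesting of the loops (`Growth`, `Stmt.degLe`, `growth_verify`).
-/

/-- Square matrices of integers. -/
abbrev IntMat (n : ℕ) := Matrix (Fin n) (Fin n) ℤ

/-! ### A structured language with total semantics -/

set_option linter.constructorNameAsVariable false

namespace RAM

open Finset

/-- The registers of the structured language. -/
inductive Reg
  | len | pos | sg | cnt | ps | val | pw | idx | s | t | b | lb | q | two | one | zero | three
  | acc | e | y | n | sz | L | m | n1 | m4 | cn | nm | nb | nb1 | cb | cb1 | S | S1 | G | nT
  | lenC | itC | x | h | big | bb | rr | lam | d | bad | k1 | k2 | prod | u | vv | d1 | d2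
  | iR | iA | idx0 | mult | carry | K | four | hd
  | jT | iM | jM | iC | iB | jB | kB | lB | oB | iX | jX
  deriving DecidableEq

/-- The arrays of the structured language: four for the tokens of each input tape, and vectors. -/
inductive Arr
  | pos (τ : Fin 5) | cnt (τ : Fin 5) | last (τ : Fin 5) | val (τ : Fin 5)
  | V | U | U1 | Y | Z | W | R | O | acc
  deriving DecidableEq

/-- State of the structured language; the number of coins tossed is part of it. -/
@[ext] structure State where
  reg : Reg → ℕ
  arr : Arr → ℕ → ℕ
  tossed : ℕ

namespace State

/-- Overwrite a register. -/
def setR (σ : State) (r : Reg) (v : ℕ) : State := { σ with reg := Function.update σ.reg r v }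

/-- Overwrite an array entry. -/
def setA (σ : State) (a : Arr) (i v : ℕ) : State :=
  { σ with arr := Function.update σ.arr a (Function.update (σ.arr a) i v) }

@[simp] lemma setR_reg (σ : State) (r r' : Reg) (v : ℕ) :
    (σ.setR r v).reg r' = if r' = r then v else σ.reg r' := by
  simp [setR, Function.update_apply]

@[simp] lemma setR_arr (σ : State) (r : Reg) (v : ℕ) : (σ.setR r v).arr = σ.arr := rfl

@[simp] lemma setR_tossed (σ : State) (r : Reg) (v : ℕ) : (σ.setR r v).tossed = σ.tossed := rfl

@[simp] lemma setA_reg (σ : State) (a : Arr) (i v : ℕ) : (σ.setA a i v).reg = σ.reg := rfl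

@[simp] lemma setA_arr (σ : State) (a a' : Arr) (i i' v : ℕ) :
    (σ.setA a i v).arr a' i' = if a' = a ∧ i' = i then v else σ.arr a' i' := by
  by_cases h : a' = a
  · subst h; simp [setA, Function.update_apply]
  · simp [setA, h]

@[simp] lemma setA_tossed (σ : State) (a : Arr) (i v : ℕ) : (σ.setA a i v).tossed = σ.tossed :=
  rfl

/-- All registers and array entries are at most `B`. -/
def Bd (B : ℕ) (σ : State) : Prop := (∀ r, σ.reg r ≤ B) ∧ ∀ a i, σ.arr a i ≤ B

lemma Bd.mono {B B' : ℕ} {σ : State} (h : σ.Bd B) (hB : B ≤ B') : σ.Bd B' :=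
  ⟨fun r => (h.1 r).trans hB, fun a i => (h.2 a i).trans hB⟩

lemma Bd.setR {B : ℕ} {σ : State} (h : σ.Bd B) {r : Reg} {v : ℕ} (hv : v ≤ B) :
    (σ.setR r v).Bd B := by
  refine ⟨fun r' => ?_, fun a i => h.2 a i⟩
  simp only [setR_reg]; split_ifs
  · exact hv
  · exact h.1 r'

lemma Bd.setA {B : ℕ} {σ : State} (h : σ.Bd B) {a : Arr} {i v : ℕ} (hv : v ≤ B) :
    (σ.setA a i v).Bd B := by
  refine ⟨fun r' => h.1 r', fun a' i' => ?_⟩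
  simp only [setA_arr]; split_ifs
  · exact hv
  · exact h.2 a' i'

end State

/-- Arithmetic operations. None of them yields more than the largest value around plus a constant,
which keeps all numbers short without any further argument. -/
inductive Op
  /-- a constant -/
  | const (k : ℕ)
  /-- `y + k` for a constant `k` -/
  | addc (y : Reg) (k : ℕ)
  /-- `y - z`, truncated -/
  | sub (y z : Reg)
  /-- `(a * b + c) mod (q + 1)` -/
  | mam (a b c q : Reg)
  /-- `⌊((a mod 2) * b + c) / 2⌋` -/
  | mah (a b c : Reg)
  /-- `((a mod 2) * b + c) mod 2` -/
  | mal (a b c : Reg)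
  /-- `y + z mod 2` -/
  | addp (y z : Reg)
  /-- `⌊y / 2⌋` -/
  | half (y : Reg)

/-- Value of an operation. -/
def Op.eval (ρ : Reg → ℕ) : Op → ℕ
  | const k => k
  | addc y k => ρ y + k
  | sub y z => ρ y - ρ z
  | mam a b c q => (ρ a * ρ b + ρ c) % (ρ q + 1)
  | mah a b c => ((ρ a % 2) * ρ b + ρ c) / 2
  | mal a b c => ((ρ a % 2) * ρ b + ρ c) % 2
  | addp y z => ρ y + ρ z % 2
  | half y => ρ y / 2

/-- The largest constant that occurs. -/
def Op.kb : Op → ℕ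
  | const k => k
  | addc _ k => k
  | _ => 1

lemma Op.eval_le {ρ : Reg → ℕ} {B κ : ℕ} (h : ∀ r, ρ r ≤ B) (o : Op) (hk : o.kb ≤ κ)
    (h1 : 1 ≤ κ) : o.eval ρ ≤ B + κ := by
  cases o with
  | const k => simp only [Op.eval, Op.kb] at *; omega
  | addc y k => simp only [Op.eval, Op.kb] at *; have := h y; omega
  | sub y z => simp only [Op.eval] at *; have := h y; omega
  | mam a b c q =>
    simp only [Op.eval]
    have := Nat.mod_lt (ρ a * ρ b + ρ c) (show 0 < ρ q + 1 by omega); have := h q; omega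
  | mah a b c =>
    simp only [Op.eval]
    have h1 : (ρ a % 2) * ρ b ≤ 1 * ρ b := Nat.mul_le_mul_right _ (by omega)
    have := h b; have := h c; omega
  | mal a b c => simp only [Op.eval]; omega
  | addp y z => simp only [Op.eval]; have := h y; omega
  | half y => simp only [Op.eval]; have := h y; omega

/-- Programs of the structured language. The only loops are `for` loops whose bound is a register
that the body leaves alone, so every program terminates. -/
inductive Stmt
  | skip
  | op (x : Reg) (o : Op)
  | load (x : Reg) (a : Arr) (i : Reg)
  | store (a : Arr) (i x : Reg)
  | read (x : Reg) (τ : Fin 5) (i : Reg)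
  | toss (x : Reg)
  | seq (s₁ s₂ : Stmt)
  /-- `s₁` if the register is zero, else `s₂` -/
  | ifz (x : Reg) (s₁ s₂ : Stmt)
  /-- repeat `s` with the index register `i` running from `0` up to the value of `x` -/
  | loop (i x : Reg) (s : Stmt)

infixr:60 " ;; " => Stmt.seq

/-- `k` rounds of a loop with body `f` and index register `i`. -/
def loopN (f : State → State) (i : Reg) : ℕ → State → State
  | 0, σ => σ.setR i 0
  | k + 1, σ => (f (loopN f i k σ)).setR i (k + 1)

namespace Stmt

variable (tapes : List (List Bool)) (ω : ℕ → Bool)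

/-- The state transformation that a program denotes. -/
def den : Stmt → State → State
  | skip, σ => σ
  | op x o, σ => σ.setR x (o.eval σ.reg)
  | load x a i, σ => σ.setR x (σ.arr a (σ.reg i))
  | store a i x, σ => σ.setA a (σ.reg i) (σ.reg x)
  | read x τ i, σ => σ.setR x (tapeSymbol (tapes.getD τ []) (σ.reg i))
  | toss x, σ => { σ.setR x (ω σ.tossed).toNat with tossed := σ.tossed + 1 }
  | seq a b, σ => den b (den a σ)
  | ifz x a b, σ => if σ.reg x = 0 then den a σ else den b σ
  | loop i x s, σ => loopN (den s) i (σ.reg x) σ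

/-- A bound for the number of instructions executed. -/
def tb : Stmt → State → ℕ
  | seq a b, σ => tb a σ + tb b (den tapes ω a σ)
  | ifz _ a b, σ => 3 + tb a σ + tb b σ
  | loop i x s, σ => 3 + ∑ k ∈ range (σ.reg x), (7 + tb s (loopN (den tapes ω s) i k σ))
  | _, _ => 5

/-- Whether the program may write the register. -/
def wr : Stmt → Reg → Bool
  | op x _, r => decide (r = x)
  | load x _ _, r => decide (r = x)
  | read x _ _, r => decide (r = x)
  | toss x, r => decide (r = x)
  | seq a b, r => wr a r || wr b r
  | ifz _ a b, r => wr a r || wr b r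
  | loop i _ s, r => decide (r = i) || wr s r
  | _, _ => false

/-- Whether the program may write to the array. -/
def wa : Stmt → Arr → Bool
  | store a _ _, a' => decide (a' = a)
  | seq s₁ s₂, a => wa s₁ a || wa s₂ a
  | ifz _ s₁ s₂, a => wa s₁ a || wa s₂ a
  | loop _ _ s, a => wa s a
  | _, _ => false

/-- Whether the program may toss a coin. -/
def wt : Stmt → Bool
  | toss _ => true
  | seq a b => wt a || wt b
  | ifz _ a b => wt a || wt b
  | loop _ _ s => wt s
  | _ => false

/-- Loop bodies change neither the index nor the bound. -/
def wf : Stmt → Bool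
  | seq a b => wf a && wf b
  | ifz _ a b => wf a && wf b
  | loop i x s => wf s && !wr s i && !wr s x && !decide (x = i)
  | _ => true

/-- The largest constant that occurs. -/
def kb : Stmt → ℕ
  | op _ o => o.kb
  | seq a b => max (kb a) (kb b)
  | ifz _ a b => max (kb a) (kb b)
  | loop _ _ s => kb s
  | _ => 1

variable {tapes ω}

lemma den_reg {s : Stmt} {r : Reg} (h : s.wr r = false) (σ : State) :
    (s.den tapes ω σ).reg r = σ.reg r := by
  induction s generalizing σ with
  | seq a b iha ihb =>
    simp only [wr, Bool.or_eq_false_iff] at h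
    simp [den, iha h.1, ihb h.2]
  | ifz x a b iha ihb =>
    simp only [wr, Bool.or_eq_false_iff] at h
    simp only [den]; split_ifs
    · exact iha h.1 σ
    · exact ihb h.2 σ
  | loop i x s ih =>
    simp only [wr, Bool.or_eq_false_iff, decide_eq_false_iff_not] at h
    simp only [den]
    induction σ.reg x with
    | zero => simp [loopN, h.1]
    | succ k ihk => simp [loopN, h.1, ih h.2, ihk]
  | _ => first | rfl | simp only [wr, decide_eq_false_iff_not] at h; simp [den, h]

lemma den_arr {s : Stmt} {a : Arr} (h : s.wa a = false) (σ : State) :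
    (s.den tapes ω σ).arr a = σ.arr a := by
  induction s generalizing σ with
  | store a i x =>
    simp only [wa, decide_eq_false_iff_not] at h
    funext j; simp [den, h]
  | seq a b iha ihb =>
    simp only [wa, Bool.or_eq_false_iff] at h
    simp [den, iha h.1, ihb h.2]
  | ifz x a b iha ihb =>
    simp only [wa, Bool.or_eq_false_iff] at h
    simp only [den]; split_ifs
    · exact iha h.1 σ
    · exact ihb h.2 σ
  | loop i x s ih =>
    simp only [wa] at h
    simp only [den]
    induction σ.reg x with
    | zero => simp [loopN]
    | succ k ihk => simp [loopN, ih h, ihk]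
  | _ => rfl

lemma den_tossed {s : Stmt} (h : s.wt = false) (σ : State) :
    (s.den tapes ω σ).tossed = σ.tossed := by
  induction s generalizing σ with
  | toss x => simp [wt] at h
  | seq a b iha ihb =>
    simp only [wt, Bool.or_eq_false_iff] at h
    simp [den, iha h.1, ihb h.2]
  | ifz x a b iha ihb =>
    simp only [wt, Bool.or_eq_false_iff] at h
    simp only [den]; split_ifs
    · exact iha h.1 σ
    · exact ihb h.2 σ
  | loop i x s ih =>
    simp only [wt] at h
    simp only [den]
    induction σ.reg x with
    | zero => simp [loopN]
    | succ k ihk => simp [loopN, ih h, ihk]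
  | _ => rfl

lemma loopN_reg_index (f : State → State) (i : Reg) (k : ℕ) (σ : State) :
    (loopN f i k σ).reg i = k := by
  cases k <;> simp [loopN]

lemma loopN_reg {s : Stmt} {i r : Reg} (h : s.wr r = false) (hi : r ≠ i) (k : ℕ) (σ : State) :
    (loopN (s.den tapes ω) i k σ).reg r = σ.reg r := by
  induction k with
  | zero => simp [loopN, hi]
  | succ k ih => simp [loopN, hi, den_reg h, ih]

/-- Induction over the rounds of a loop. -/
lemma loop_induction {i x : Reg} {s : Stmt} (P : ℕ → State → Prop) (σ : State)
    (h0 : P 0 (σ.setR i 0))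
    (hs : ∀ k < σ.reg x, ∀ τ, τ.reg i = k → P k τ → P (k + 1) ((s.den tapes ω τ).setR i (k + 1))) :
    P (σ.reg x) ((loop i x s).den tapes ω σ) := by
  simp only [den]
  suffices H : ∀ k ≤ σ.reg x, P k (loopN (s.den tapes ω) i k σ) from H _ le_rfl
  intro k
  induction k with
  | zero => intro _; exact h0
  | succ k ih =>
    intro hk
    exact hs k (by omega) _ (loopN_reg_index _ _ _ _) (ih (by omega))

/-- A static time bound, in terms of the values of the loop bounds. -/
def stb : Stmt → (Reg → ℕ) → ℕ
  | seq a b, ρ => stb a ρ + stb b ρ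
  | ifz _ a b, ρ => 3 + stb a ρ + stb b ρ
  | loop _ x s, ρ => 3 + ρ x * (7 + stb s ρ)
  | _, _ => 5

/-- Whether the register is the bound of some loop. -/
def isBound : Stmt → Reg → Bool
  | seq a b, r => isBound a r || isBound b r
  | ifz _ a b, r => isBound a r || isBound b r
  | loop _ x s, r => decide (r = x) || isBound s r
  | _, _ => false

lemma tb_le_stb (s : Stmt) (ρ : Reg → ℕ) (σ : State)
    (h : ∀ r, s.isBound r = true → s.wr r = false ∧ σ.reg r = ρ r) :
    s.tb tapes ω σ ≤ s.stb ρ := by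
  induction s generalizing σ with
  | seq a b iha ihb =>
    simp only [isBound, wr, Bool.or_eq_true, Bool.or_eq_false_iff] at h
    simp only [tb, stb]
    refine add_le_add (iha _ fun r hr => ⟨(h r (.inl hr)).1.1, (h r (.inl hr)).2⟩)
      (ihb _ fun r hr => ⟨(h r (.inr hr)).1.2, ?_⟩)
    rw [den_reg (h r (.inr hr)).1.1, (h r (.inr hr)).2]
  | ifz x a b iha ihb =>
    simp only [isBound, wr, Bool.or_eq_true, Bool.or_eq_false_iff] at h
    simp only [tb, stb]
    have h1 := iha σ fun r hr => ⟨(h r (.inl hr)).1.1, (h r (.inl hr)).2⟩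
    have h2 := ihb σ fun r hr => ⟨(h r (.inr hr)).1.2, (h r (.inr hr)).2⟩
    omega
  | loop i x s ih =>
    simp only [isBound, wr, Bool.or_eq_true, Bool.or_eq_false_iff, decide_eq_true_eq,
      decide_eq_false_iff_not] at h
    simp only [tb, stb]
    have hx := (h x (.inl rfl)).2
    have := sum_le_card_nsmul (range (σ.reg x))
      (fun k => 7 + s.tb tapes ω (loopN (s.den tapes ω) i k σ)) (7 + s.stb ρ) ?_
    · rw [card_range, smul_eq_mul, hx] at this
      rw [hx]; omega
    · intro k _
      refine Nat.add_le_add_left (ih _ fun r hr => ?_) 7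
      have := h r (.inr hr)
      exact ⟨this.1.2, by rw [loopN_reg this.1.2 this.1.1, this.2]⟩
  | _ => simp [tb, stb]

end Stmt

/-! ### Compilation to the machine -/

/-- Numbering of the registers. -/
def Reg.num (r : Reg) : ℕ := r.ctorIdx

lemma Reg.num_injective : Function.Injective Reg.num := by
  intro a b h
  have : ∀ r : Reg, Reg.ofNat r.num = r := by intro r; cases r <;> rfl
  rw [← this a, ← this b, h]

/-- Numbering of the arrays. -/
def Arr.num : Arr → ℕ
  | pos τ => 4 * τ
  | cnt τ => 4 * τ + 1
  | last τ => 4 * τ + 2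
  | val τ => 4 * τ + 3
  | V => 20 | U => 21 | U1 => 22 | Y => 23 | Z => 24 | W => 25 | R => 26 | O => 27 | acc => 28

lemma Arr.num_injective : Function.Injective Arr.num := by
  intro a b h
  cases a <;> cases b <;> simp only [Arr.num] at h <;>
    first | rfl | (exfalso; omega) | (congr 1; omega)

lemma Arr.num_lt (a : Arr) : a.num < 29 := by cases a <;> simp only [Arr.num] <;> omega

/-- The cell that holds a register. -/
def Reg.adr (r : Reg) : ℕ := 32 * r.num + 2

/-- The cell that holds an array entry; cells `0` and `1` are for intermediate results. -/
def Arr.adr (a : Arr) (i : ℕ) : ℕ := 32 * i + (3 + a.num)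

/-- A machine configuration holds a state. -/
def Repr (c : Config) (σ : State) : Prop :=
  c.tossed = σ.tossed ∧ (∀ r : Reg, c.mem r.adr = σ.reg r) ∧ ∀ a i, c.mem (Arr.adr a i) = σ.arr a i

lemma Reg.adr_inj {r r' : Reg} : r.adr = r'.adr ↔ r = r' :=
  ⟨fun h => Reg.num_injective (by unfold Reg.adr at h; omega), fun h => h ▸ rfl⟩

lemma Arr.adr_inj {a a' : Arr} {i i' : ℕ} : Arr.adr a i = Arr.adr a' i' ↔ a = a' ∧ i = i' := by
  constructor
  · intro h
    have h1 := a.num_lt; have h2 := a'.num_lt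
    unfold Arr.adr at h
    exact ⟨Arr.num_injective (by omega), by omega⟩
  · rintro ⟨rfl, rfl⟩; rfl

lemma Arr.adr_ne_reg {a : Arr} {i : ℕ} {r : Reg} : Arr.adr a i ≠ r.adr := by
  have := a.num_lt; unfold Arr.adr Reg.adr; omega

lemma Reg.two_le_adr (r : Reg) : 2 ≤ r.adr := by unfold Reg.adr; omega

lemma Arr.two_le_adr (a : Arr) (i : ℕ) : 2 ≤ a.adr i := by unfold Arr.adr; omega

/-- The machine gets from `c` to `c'` at cost at most `T`. -/
def Reach (V : Program) (tapes : List (List Bool)) (ω : ℕ → Bool) (c c' : Config) (T : ℕ) : Prop :=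
  ∃ k cost, cost ≤ T ∧ ∀ f t, V.exec tapes ω (f + k) c t = V.exec tapes ω f c' (t + cost)

lemma Reach.refl {V tapes ω} (c : Config) : Reach V tapes ω c c 0 := ⟨0, 0, le_rfl, fun _ _ => rfl⟩

lemma Reach.trans {V tapes ω} {c c' c'' : Config} {T T' : ℕ} (h : Reach V tapes ω c c' T)
    (h' : Reach V tapes ω c' c'' T') : Reach V tapes ω c c'' (T + T') := by
  obtain ⟨k, a, ha, hk⟩ := h
  obtain ⟨k', a', ha', hk'⟩ := h'
  refine ⟨k' + k, a + a', by omega, fun f t => ?_⟩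
  rw [← add_assoc, hk, hk', add_assoc]

lemma Reach.mono {V tapes ω} {c c' : Config} {T T' : ℕ} (h : Reach V tapes ω c c' T)
    (hT : T ≤ T') : Reach V tapes ω c c' T' := by
  obtain ⟨k, a, ha, hk⟩ := h
  exact ⟨k, a, ha.trans hT, hk⟩

/-- Instructions other than `halt`. -/
def notHalt : Instr → Bool
  | .halt _ => false
  | _ => true

lemma Reach.step {V tapes ω} {c : Config} {I : Instr} (h : V[c.pc]? = some I)
    (hI : notHalt I = true) : Reach V tapes ω c (I.next tapes ω c) (I.cost c.mem) := by
  refine ⟨1, _, le_rfl, fun f t => ?_⟩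
  rw [Program.exec, h]
  cases I <;> first | rfl | simp [notHalt] at hI

/-- Instructions that continue with the next one. -/
def straight : Instr → Bool
  | .halt _ => false
  | .jumpZero _ _ => false
  | _ => true

/-- Effect of a straight-line piece of code. -/
def runL (tapes : List (List Bool)) (ω : ℕ → Bool) : List Instr → Config → Config
  | [], c => c
  | I :: l, c => runL tapes ω l (I.next tapes ω c)

/-- Cost of a straight-line piece of code. -/
def costL (tapes : List (List Bool)) (ω : ℕ → Bool) : List Instr → Config → ℕ
  | [], _ => 0
  | I :: l, c => I.cost c.mem + costL tapes ω l (I.next tapes ω c)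

lemma straight_next {tapes ω} {I : Instr} (h : straight I = true) (c : Config) :
    (I.next tapes ω c).pc = c.pc + 1 := by
  cases I <;> first | rfl | simp [straight] at h

/-- The program contains a piece of code at a position. -/
def CodeAt (V : Program) : ℕ → List Instr → Prop
  | _, [] => True
  | o, I :: l => V[o]? = some I ∧ CodeAt V (o + 1) l

lemma codeAt_append {V : Program} {o : ℕ} {l l' : List Instr} :
    CodeAt V o (l ++ l') ↔ CodeAt V o l ∧ CodeAt V (o + l.length) l' := by
  induction l generalizing o with
  | nil => simp [CodeAt]
  | cons I l ih => simp [CodeAt, ih, and_assoc, add_assoc, add_comm 1]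

lemma codeAt_of_eq {V pre l post : List Instr} (h : V = pre ++ l ++ post) :
    CodeAt V pre.length l := by
  induction l generalizing pre with
  | nil => trivial
  | cons I l ih => exact ⟨by simp [h], by simpa using ih (pre := pre ++ [I]) (by simp [h])⟩

lemma Reach.straightLine {V : Program} {tapes ω} {l : List Instr} {c : Config} {p : ℕ}
    (hp : c.pc = p) (h : CodeAt V p l) (hl : l.all straight = true) :
    Reach V tapes ω c (runL tapes ω l c) (costL tapes ω l c) ∧
      (runL tapes ω l c).pc = p + l.length := by
  induction l generalizing c p with
  | nil => exact ⟨Reach.refl _, hp⟩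
  | cons I l ih =>
    rw [List.all_cons, Bool.and_eq_true] at hl
    have := ih (c := I.next tapes ω c) (by rw [straight_next hl.1, hp]) h.2 hl.2
    refine ⟨(Reach.step (hp ▸ h.1) ?_).trans this.1, ?_⟩
    · cases I <;> first | rfl | simp [straight] at hl
    · rw [runL, this.2, List.length_cons]; omega

lemma Reach.jump {V : Program} {tapes ω} {c : Config} {a l p : ℕ} (hp : c.pc = p)
    (h : V[p]? = some (.jumpZero a l)) :
    Reach V tapes ω c { c with pc := if c.mem a = 0 then l else p + 1 } (1 + (c.mem a).size) := by
  subst hp; exact Reach.step h rfl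

/-- Code of an operation. -/
def Op.code (x : Reg) : Op → List Instr
  | const k => [.const x.adr k]
  | addc y k => [.const 0 k, .add x.adr y.adr 0]
  | sub y z => [.sub x.adr y.adr z.adr]
  | mam a b c q => [.mul 0 a.adr b.adr, .add 0 0 c.adr, .const 1 1, .add 1 1 q.adr, .mod x.adr 0 1]
  | mah a b c => [.const 1 2, .mod 0 a.adr 1, .mul 0 0 b.adr, .add 0 0 c.adr, .div x.adr 0 1]
  | mal a b c => [.const 1 2, .mod 0 a.adr 1, .mul 0 0 b.adr, .add 0 0 c.adr, .mod x.adr 0 1]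
  | addp y z => [.const 1 2, .mod 0 z.adr 1, .add x.adr y.adr 0]
  | half y => [.const 1 2, .div x.adr y.adr 1]

/-- Code of a program, to be placed at position `o`. -/
def Stmt.code : Stmt → ℕ → List Instr
  | skip, _ => []
  | op x o, _ => o.code x
  | load x a i, _ => [.const 0 32, .mul 0 0 i.adr, .const 1 (3 + a.num), .add 0 0 1, .load x.adr 0]
  | store a i x, _ => [.const 0 32, .mul 0 0 i.adr, .const 1 (3 + a.num), .add 0 0 1,
      .store 0 x.adr]
  | read x τ i, _ => [.read τ x.adr i.adr]
  | toss x, _ => [.toss x.adr]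
  | seq a b, o => a.code o ++ b.code (o + (a.code o).length)
  | ifz x a b, o =>
    let p := o + 1 + (b.code (o + 1)).length + 1 + 1
    .jumpZero x.adr p :: (b.code (o + 1) ++
      .const 0 0 :: .jumpZero 0 (p + (a.code p).length) :: a.code p)
  | loop i x s, o =>
    let cs := s.code (o + 1 + 1 + 1)
    .const i.adr 0 :: .sub 0 x.adr i.adr :: .jumpZero 0 (o + 7 + cs.length) :: (cs ++
      [.const 0 1, .add i.adr i.adr 0, .const 0 0, .jumpZero 0 (o + 1)])

lemma Repr.setR {c c' : Config} {σ : State} (h : Repr c σ) {r : Reg} {v : ℕ}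
    (ht : c'.tossed = c.tossed)
    (hm : ∀ p, 2 ≤ p → c'.mem p = if p = r.adr then v else c.mem p) : Repr c' (σ.setR r v) := by
  refine ⟨by rw [ht, h.1]; rfl, fun r' => ?_, fun a i => ?_⟩
  · rw [hm _ r'.two_le_adr, h.2.1]; simp [Reg.adr_inj]
  · rw [hm _ (a.two_le_adr i), if_neg Arr.adr_ne_reg, h.2.2]; rfl

lemma Repr.setA {c c' : Config} {σ : State} (h : Repr c σ) {a : Arr} {i v : ℕ}
    (ht : c'.tossed = c.tossed)
    (hm : ∀ p, 2 ≤ p → c'.mem p = if p = a.adr i then v else c.mem p) : Repr c' (σ.setA a i v) := by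
  refine ⟨by rw [ht, h.1]; rfl, fun r' => ?_, fun a' i' => ?_⟩
  · rw [hm _ r'.two_le_adr, h.2.1, if_neg Arr.adr_ne_reg.symm]; rfl
  · rw [hm _ (a'.two_le_adr i'), h.2.2]; simp [Arr.adr_inj]

lemma Repr.congr {c c' : Config} {σ : State} (h : Repr c σ) (ht : c'.tossed = c.tossed)
    (hm : ∀ p, 2 ≤ p → c'.mem p = c.mem p) : Repr c' σ :=
  ⟨by rw [ht, h.1], fun r => by rw [hm _ r.two_le_adr, h.2.1],
    fun a i => by rw [hm _ (a.two_le_adr i), h.2.2]⟩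

lemma mul_cost_le {w x y : ℕ} (hx : x ≤ 2 * w + 9) (hy : y ≤ 2 * w + 9) :
    (1 + x) * (1 + y) ≤ (2 * w + 12) ^ 2 := by
  have : (1 + x) * (1 + y) ≤ (2 * w + 10) * (2 * w + 10) := Nat.mul_le_mul (by omega) (by omega)
  nlinarith

lemma add_cost_le {w x y : ℕ} (hx : x ≤ 2 * w + 9) (hy : y ≤ 2 * w + 9) :
    1 + x + y ≤ (2 * w + 12) ^ 2 := by
  nlinarith

lemma size_le_of_lt {v k : ℕ} (h : v < 2 ^ k) : v.size ≤ k := Nat.size_le.2 h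

lemma size_add_le {a b k : ℕ} (ha : a.size ≤ k) (hb : b.size ≤ k) : (a + b).size ≤ k + 1 := by
  rw [Nat.size_le] at *; rw [pow_succ]; omega

lemma size_mul_le {a b k l : ℕ} (ha : a.size ≤ k) (hb : b.size ≤ l) :
    (a * b).size ≤ k + l := by
  rw [Nat.size_le] at *; rw [pow_add]
  exact Nat.mul_lt_mul'' ha hb

lemma Reg.adr_ne_zero (r : Reg) : r.adr ≠ 0 := by have := r.two_le_adr; omega

lemma Reg.adr_ne_one (r : Reg) : r.adr ≠ 1 := by have := r.two_le_adr; omega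

section

variable (tapes : List (List Bool)) (ω : ℕ → Bool) {c : Config} {σ : State} {w : ℕ}

attribute [local simp] runL costL Instr.next Instr.cost Config.write Function.update_apply Op.eval
  Op.code Stmt.code Reg.adr_ne_zero Reg.adr_ne_one

/-- The code of an operation does what it should at the cost it should. -/
lemma Op.code_spec (o : Op) (x : Reg) (h : Repr c σ) (hr : ∀ r, (σ.reg r).size ≤ w)
    (hk : o.kb.size ≤ w) : Repr (runL tapes ω (o.code x) c) (σ.setR x (o.eval σ.reg)) ∧
      costL tapes ω (o.code x) c ≤ 5 * (2 * w + 12) ^ 2 := by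
  have s1 : Nat.size 1 ≤ 1 := by simp
  have s2 : Nat.size 2 ≤ 2 := by decide
  have s22 := add_cost_le (w := w) (s2.trans (by omega)) (s2.trans (by omega))
  have hr' : ∀ r, (σ.reg r).size ≤ 2 * w + 9 := fun r => (hr r).trans (by omega)
  have hm : ∀ a : Reg, (σ.reg a % 2).size ≤ 1 := fun a =>
    size_le_of_lt (by have := Nat.mod_lt (σ.reg a) two_pos; omega)
  refine ⟨h.setR (by cases o <;> rfl) fun p hp => ?_, ?_⟩
  · have h0 : p ≠ 0 := by omega
    have h1 : p ≠ 1 := by omega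
    cases o <;> simp [h.2.1, h0, h1, add_comm 1]
  cases o with
  | const k =>
    simp only [Op.code, costL, Instr.cost, Op.kb] at *
    nlinarith
  | addc y k =>
    have := hr y
    simp [h.2.1, Op.kb] at *
    nlinarith
  | sub y z =>
    have := add_cost_le (hr' y) (hr' z)
    simp [h.2.1]
    omega
  | mam a b e q =>
    have h1 := size_mul_le (hr a) (hr b)
    have h2 := size_add_le (k := w + w) h1 ((hr e).trans (by omega))
    have h3 := size_add_le (k := w + 1) (s1.trans (by omega)) ((hr q).trans (by omega))
    have e1 := mul_cost_le (hr' a) (hr' b)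
    have e2 := add_cost_le (h1.trans (by omega)) (hr' e)
    have e3 := add_cost_le (w := w) (s1.trans (by omega)) (hr' q)
    have e4 := mul_cost_le (w := w) (h2.trans (by omega)) (h3.trans (by omega))
    simp [h.2.1] at *
    omega
  | mah a b e | mal a b e =>
    have h1 := size_mul_le (hm a) (hr b)
    have h2 := size_add_le (k := 1 + w) h1 ((hr e).trans (by omega))
    have e1 := mul_cost_le (hr' a) (s2.trans (by omega))
    have e2 := mul_cost_le ((hm a).trans (by omega)) (hr' b)
    have e3 := add_cost_le (h1.trans (by omega)) (hr' e)
    have e4 := mul_cost_le (w := w) (h2.trans (by omega)) (s2.trans (by omega))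
    simp [h.2.1]
    omega
  | addp y z =>
    have e1 := mul_cost_le (hr' z) (s2.trans (by omega))
    have e3 := add_cost_le (hr' y) ((hm z).trans (by omega))
    simp [h.2.1]
    omega
  | half y =>
    have e1 := mul_cost_le (hr' y) (s2.trans (by omega))
    simp [h.2.1]
    omega

lemma Arr.size_adr_le (a : Arr) (i : Reg) (hr : (σ.reg i).size ≤ w) :
    (3 + a.num).size ≤ 6 ∧ (32 * σ.reg i).size ≤ 6 + w ∧ (a.adr (σ.reg i)).size ≤ 6 + w + 1 := by
  have h1 : (3 + a.num).size ≤ 6 := size_le_of_lt (by have := a.num_lt; omega)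
  have h2 := size_mul_le (show Nat.size 32 ≤ 6 by decide) hr
  exact ⟨h1, h2, size_add_le h2 (h1.trans (by omega))⟩

lemma load_spec (x : Reg) (a : Arr) (i : Reg) (o : ℕ) (h : Repr c σ)
    (hr : ∀ r, (σ.reg r).size ≤ w) (ha : ∀ i, (σ.arr a i).size ≤ w) :
    Repr (runL tapes ω ((Stmt.load x a i).code o) c) (σ.setR x (σ.arr a (σ.reg i))) ∧
      costL tapes ω ((Stmt.load x a i).code o) c ≤ 5 * (2 * w + 12) ^ 2 := by
  have hadr : 32 * σ.reg i + (3 + a.num) = a.adr (σ.reg i) := rfl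
  have h2 := a.two_le_adr (σ.reg i)
  have hadr0 : a.adr (σ.reg i) ≠ 0 := by omega
  have hadr1 : a.adr (σ.reg i) ≠ 1 := by omega
  refine ⟨h.setR rfl fun p hp => ?_, ?_⟩
  · have h0 : p ≠ 0 := by omega
    have h1 : p ≠ 1 := by omega
    simp [h.2.1, h0, h1, hadr, hadr0, hadr1, h.2.2]
  · obtain ⟨s3, h1, h2⟩ := a.size_adr_le i (hr i)
    have s32 : Nat.size 32 ≤ 6 := by decide
    have e1 := mul_cost_le (w := w) (s32.trans (by omega)) ((hr i).trans (by omega))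
    have e2 := add_cost_le (w := w) (h1.trans (by omega)) (s3.trans (by omega))
    have e3 := add_cost_le (w := w) (h2.trans (by omega)) ((ha (σ.reg i)).trans (by omega))
    have e4 := add_cost_le (w := w) (s32.trans (by omega)) (s3.trans (by omega))
    have e5 := add_cost_le (w := w) (s3.trans (by omega)) (s3.trans (by omega))
    simp [hadr, hadr0, hadr1, h.2.1, h.2.2]
    omega

lemma store_spec (x : Reg) (a : Arr) (i : Reg) (o : ℕ) (h : Repr c σ)
    (hr : ∀ r, (σ.reg r).size ≤ w) :
    Repr (runL tapes ω ((Stmt.store a i x).code o) c) (σ.setA a (σ.reg i) (σ.reg x)) ∧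
      costL tapes ω ((Stmt.store a i x).code o) c ≤ 5 * (2 * w + 12) ^ 2 := by
  have hadr : 32 * σ.reg i + (3 + a.num) = a.adr (σ.reg i) := rfl
  refine ⟨h.setA rfl fun p hp => ?_, ?_⟩
  · have h0 : p ≠ 0 := by omega
    have h1 : p ≠ 1 := by omega
    simp [h.2.1, h0, h1, hadr]
  · obtain ⟨s3, h1, h2⟩ := a.size_adr_le i (hr i)
    have s32 : Nat.size 32 ≤ 6 := by decide
    have e1 := mul_cost_le (w := w) (s32.trans (by omega)) ((hr i).trans (by omega))
    have e2 := add_cost_le (w := w) (h1.trans (by omega)) (s3.trans (by omega))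
    have e3 := add_cost_le (w := w) (h2.trans (by omega)) ((hr x).trans (by omega))
    have e4 := add_cost_le (w := w) (s32.trans (by omega)) (s3.trans (by omega))
    have e5 := add_cost_le (w := w) (s3.trans (by omega)) (s3.trans (by omega))
    simp [hadr, h.2.1]
    omega

/-- What correctness of the code of `s` from the state `σ` means: placed anywhere in a program it
leads to the denoted state, at a cost of at most `(2 w + 12) ^ 2` for each instruction, and the
values have grown by at most `κ` for each instruction. Here `2 ^ w` bounds all the values. -/
def CodeSpec (κ w : ℕ) (s : Stmt) (σ : State) : Prop :=
  ∀ (V : Program) (c : Config) (p B : ℕ), c.pc = p → CodeAt V p (s.code p) → Repr c σ → σ.Bd B →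
    B + κ * s.tb tapes ω σ < 2 ^ w →
    ∃ c', Reach V tapes ω c c' (s.tb tapes ω σ * (2 * w + 12) ^ 2) ∧
      c'.pc = p + (s.code p).length ∧ Repr c' (s.den tapes ω σ) ∧
      (s.den tapes ω σ).Bd (B + κ * s.tb tapes ω σ)

variable {tapes ω}

lemma CodeSpec.of_straight {κ : ℕ} {s : Stmt} (htb : s.tb tapes ω σ = 5)
    (hκ : 1 ≤ κ) (hs : ∀ o, (s.code o).all straight = true)
    (hB : ∀ B, σ.Bd B → (s.den tapes ω σ).Bd (B + 2 + κ))
    (hR : ∀ o c, Repr c σ → (∀ r, (σ.reg r).size ≤ w) → (∀ a i, (σ.arr a i).size ≤ w) →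
      κ.size ≤ w → Repr (runL tapes ω (s.code o) c) (s.den tapes ω σ) ∧
        costL tapes ω (s.code o) c ≤ 5 * (2 * w + 12) ^ 2) : CodeSpec tapes ω κ w s σ := by
  intro V c p B hp hV hr hb hw
  rw [htb] at hw ⊢
  obtain ⟨h1, h2⟩ := Reach.straightLine hp hV (hs _)
  obtain ⟨h3, h4⟩ := hR p c hr
    (fun r => size_le_of_lt (by have := hb.1 r; omega))
    (fun a i => size_le_of_lt (by have := hb.2 a i; omega)) (size_le_of_lt (by omega))
  exact ⟨_, h1.mono h4, h2, h3, (hB B hb).mono (by omega)⟩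

lemma tapeSymbol_le (l : List Bool) (i : ℕ) : tapeSymbol l i ≤ 2 := by
  unfold tapeSymbol
  cases l[i]? with
  | none => simp
  | some b => cases b <;> simp

/-- At the head of a loop, the index is compared with the bound. -/
lemma reach_head {V : Program} {i x : Reg} {p l : ℕ} (hp : c.pc = p)
    (h : V[p]? = some (.sub 0 x.adr i.adr)) (h' : V[p + 1]? = some (.jumpZero 0 l)) (hr : Repr c σ)
    (hw : ∀ r, (σ.reg r).size ≤ w) : ∃ c', Reach V tapes ω c c' (2 * (2 * w + 12) ^ 2) ∧
      c'.pc = (if σ.reg x - σ.reg i = 0 then l else p + 2) ∧ Repr c' σ := by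
  have s1 := Reach.step (tapes := tapes) (ω := ω) (hp ▸ h) rfl
  have s2 := Reach.jump (tapes := tapes) (ω := ω) (c := Instr.next tapes ω c (.sub 0 x.adr i.adr))
    (p := p + 1) (by simp [hp]) h'
  refine ⟨_, (s1.trans s2).mono ?_, by simp [hr.2.1], hr.congr rfl fun q hq => ?_⟩
  · have := hw x
    have := hw i
    have := (Nat.size_le_size (Nat.sub_le (σ.reg x) (σ.reg i))).trans (hw x)
    simp [hr.2.1]
    nlinarith
  · have : q ≠ 0 := by omega
    simp [this]

/-- Correctness of the compiler. -/
lemma Stmt.code_spec {κ : ℕ} (hκ : 1 ≤ κ) (s : Stmt) (hs : s.wf = true) (hk : s.kb ≤ κ)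
    (σ : State) : CodeSpec tapes ω κ w s σ := by
  have hone : 1 ≤ (2 * w + 12) ^ 2 := Nat.one_le_pow _ _ (by omega)
  induction s generalizing σ with
  | skip =>
    intro V c p B hp _ hr hb _
    exact ⟨c, (Reach.refl c).mono (Nat.zero_le _), hp, hr, hb.mono (by omega)⟩
  | op x o =>
    exact .of_straight rfl hκ (fun _ => by cases o <;> rfl)
      (fun B hB => (hB.mono (by omega)).setR ((Op.eval_le hB.1 o hk hκ).trans (by omega)))
      fun _ c hc hr _ hw => Op.code_spec tapes ω o x hc hr ((Nat.size_le_size hk).trans hw)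
  | load x a i =>
    exact .of_straight rfl hκ (fun _ => rfl)
      (fun B hB => (hB.mono (by omega)).setR ((hB.2 _ _).trans (by omega)))
      fun _ c hc hr ha _ => load_spec tapes ω x a i _ hc hr (ha a)
  | store a i x =>
    exact .of_straight rfl hκ (fun _ => rfl)
      (fun B hB => (hB.mono (by omega)).setA ((hB.1 _).trans (by omega)))
      fun _ c hc hr _ _ => store_spec tapes ω x a i _ hc hr
  | read x τ i =>
    refine .of_straight rfl hκ (fun _ => rfl)
      (fun B hB => (hB.mono (by omega)).setR ((tapeSymbol_le _ _).trans (by omega)))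
      fun _ c hc hr _ _ => ⟨hc.setR rfl fun p _ => by simp [hc.2.1], ?_⟩
    have := hr i
    simp [hc.2.1]
    nlinarith
  | toss x =>
    refine .of_straight rfl hκ (fun _ => rfl)
      (fun B hB => (hB.mono (by omega)).setR ((Bool.toNat_le _).trans (by omega)))
      fun _ c hc _ _ _ => ⟨?_, by simp; omega⟩
    have : Repr (c.write x.adr (ω c.tossed).toNat) (σ.setR x (ω σ.tossed).toNat) :=
      hc.setR rfl fun p _ => by simp [hc.1]
    exact ⟨by simp [den, hc.1], this.2.1, this.2.2⟩
  | seq a b iha ihb =>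
    simp only [wf, Bool.and_eq_true, kb, max_le_iff] at hs hk
    intro V c p B hp hV hr hb hw
    simp only [code, tb, den, codeAt_append, mul_add] at hV hw ⊢
    obtain ⟨c₁, h1, h2, h3, h4⟩ := iha hs.1 hk.1 σ V c p B hp hV.1 hr hb (by omega)
    obtain ⟨c₂, g1, g2, g3, g4⟩ := ihb hs.2 hk.2 _ V c₁ _ _ h2 hV.2 h3 h4 (by omega)
    exact ⟨c₂, (h1.trans g1).mono (by rw [add_mul]), by rw [g2, List.length_append, add_assoc], g3,
      g4.mono (by omega)⟩
  | ifz x a b iha ihb =>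
    simp only [wf, Bool.and_eq_true, kb, max_le_iff] at hs hk
    intro V c p B hp hV hr hb hw
    simp only [code, tb, den, codeAt_append, CodeAt, mul_add] at hV hw ⊢
    obtain ⟨v1, v2, v3, v4, v5⟩ := hV
    have hx : (σ.reg x).size ≤ w := size_le_of_lt (by have := hb.1 x; omega)
    have s1 := Reach.jump (tapes := tapes) (ω := ω) hp v1
    rw [hr.2.1] at s1
    by_cases h0 : σ.reg x = 0
    · rw [if_pos h0] at s1 ⊢
      obtain ⟨c₁, h1, h2, h3, h4⟩ := iha hs.1 hk.1 σ V { c with pc := _ } _ B rfl v5 (hr.congr rfl fun _ _ => rfl) hb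
        (by omega)
      refine ⟨c₁, (s1.trans h1).mono (by nlinarith), ?_, h3, h4.mono (by omega)⟩
      simp [h2]; omega
    · rw [if_neg h0] at s1 ⊢
      obtain ⟨c₁, h1, h2, h3, h4⟩ := ihb hs.2 hk.2 σ V { c with pc := _ } _ B rfl v2 (hr.congr rfl fun _ _ => rfl) hb
        (by omega)
      have s2 := Reach.step (tapes := tapes) (ω := ω) (h2 ▸ v3) rfl
      have s3 := Reach.jump (tapes := tapes) (ω := ω) (c := Instr.next tapes ω c₁ (.const 0 0))
        (by simp [h2]) v4
      refine ⟨_, (((s1.trans h1).trans s2).trans s3).mono ?_, ?_, h3.congr rfl fun q hq => ?_,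
        h4.mono (by omega)⟩
      · simp; nlinarith
      · simp; omega
      · have : q ≠ 0 := by omega
        simp [this]
  | loop i x s ih =>
    simp only [wf, Bool.and_eq_true, kb, Bool.not_eq_true', decide_eq_false_iff_not] at hs hk
    obtain ⟨⟨⟨hs, hi⟩, hx⟩, hxi⟩ := hs
    intro V c p B hp hV hr hb hw
    simp only [code, tb, den, codeAt_append, CodeAt, mul_add] at hV hw ⊢
    obtain ⟨v1, v2, v3, v4, v5, v6, v7, v8, -⟩ := hV
    set τ := fun k => loopN (s.den tapes ω) i k σ with hτ
    set T : ℕ → ℕ := fun k => ∑ k ∈ range k, (7 + s.tb tapes ω (τ k)) with hT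
    set U := (2 * w + 12) ^ 2 with hU
    change _ + (_ + κ * T (σ.reg x)) < _ at hw
    change ∃ c', Reach V tapes ω c c' ((3 + T (σ.reg x)) * U) ∧ _ ∧ Repr c' (τ (σ.reg x)) ∧
      (τ (σ.reg x)).Bd (B + (κ * 3 + κ * T (σ.reg x)))
    have hTle : ∀ k ≤ σ.reg x, κ * T k ≤ κ * T (σ.reg x) := fun k hk =>
      Nat.mul_le_mul_left _ (sum_le_sum_of_subset (range_subset_range.2 hk))
    have hreg : ∀ k, (τ k).reg x = σ.reg x := fun k => loopN_reg hx hxi k σ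
    have hregi : ∀ k, (τ k).reg i = k := fun k => loopN_reg_index _ _ _ _
    have hsize : ∀ k ≤ σ.reg x, (τ k).Bd (B + κ * T k) → ∀ r, ((τ k).reg r).size ≤ w :=
      fun k hk h r => size_le_of_lt (by have := h.1 r; have := hTle k hk; omega)
    -- the configuration at the head of the loop after `k` rounds
    have key : ∀ k ≤ σ.reg x, ∃ c', Reach V tapes ω c c' ((1 + T k) * U) ∧ c'.pc = p + 1 ∧
        Repr c' (τ k) ∧ (τ k).Bd (B + κ * T k) := by
      intro k
      induction k with
      | zero =>
        intro _
        exact ⟨_, (Reach.step (hp ▸ v1) rfl).mono (by simp; nlinarith), by simp [hp],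
          hr.setR rfl fun p _ => by simp, (hb.mono (by omega)).setR (Nat.zero_le _)⟩
      | succ k ihk =>
        intro hkN
        obtain ⟨c₁, h1, h2, h3, h4⟩ := ihk (by omega)
        have hTk : T (k + 1) = T k + (7 + s.tb tapes ω (τ k)) := sum_range_succ _ _
        have hw' := hTle (k + 1) hkN
        rw [hTk, mul_add, mul_add] at hw'
        have hks : k.size ≤ w := size_le_of_lt (by have := hb.1 x; omega)
        obtain ⟨c₂, e1, e2, e3⟩ := reach_head h2 v2 v3 h3
          (hsize k (by omega) h4)
        rw [hreg, hregi, if_neg (by omega)] at e2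
        obtain ⟨c₃, g1, g2, g3, g4⟩ := ih hs hk (τ k) V c₂ _ _ e2 v4 e3 h4 (by omega)
        obtain ⟨t1, t2⟩ := Reach.straightLine
          (l := [.const 0 1, .add i.adr i.adr 0, .const 0 0]) g2 ⟨v5, v6, v7, trivial⟩ rfl
        have s3 := Reach.jump (tapes := tapes) (ω := ω) t2 v8
        have hi3 : c₃.mem i.adr = k := by rw [g3.2.1, den_reg hi, hregi]
        refine ⟨_, ((((h1.trans e1).trans g1).trans t1).trans s3).mono ?_, ?_,
          Repr.setR (r := i) (v := k + 1) g3 rfl fun q hq => ?_, ?_⟩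
        · rw [hTk, show (1 + (T k + (7 + s.tb tapes ω (τ k)))) * U =
            (1 + T k) * U + 2 * U + s.tb tapes ω (τ k) * U + 5 * U by ring]
          simp [hi3]
          nlinarith
        · simp
        · have : q ≠ 0 := by omega
          simp [this, hi3]
        · rw [hTk, mul_add, mul_add]
          exact (g4.mono (by omega)).setR (by have := hb.1 x; omega)
    obtain ⟨c₁, h1, h2, h3, h4⟩ := key _ le_rfl
    obtain ⟨c₂, e1, e2, e3⟩ := reach_head h2 v2 v3 h3 (hsize _ le_rfl h4)
    rw [hreg, hregi, Nat.sub_self, if_pos rfl] at e2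
    refine ⟨c₂, (h1.trans e1).mono (by rw [← hU, add_mul, add_mul]; omega), by simp [e2]; omega, e3, h4.mono (by omega)⟩

end

end RAM
set_option linter.constructorNameAsVariable false

/-! ### Tokens of a tape -/

namespace RAM

open Finset

lemma tapeSymbol_of_le {w : List Bool} {i : ℕ} (h : w.length ≤ i) : tapeSymbol w i = 2 := by
  simp [tapeSymbol, List.getElem?_eq_none h]

lemma exists_tapeSymbol_ne (w : List Bool) (p : ℕ) : ∃ c, tapeSymbol w (p + 2 * c) ≠ 1 :=
  ⟨w.length, by rw [tapeSymbol_of_le (by omega)]; decide⟩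

/-- The number of digits of the self-delimiting code that starts at position `p`. Any bit string is
taken as code; beyond its end there are codes of `0` only. -/
def dcount (w : List Bool) (p : ℕ) : ℕ := Nat.find (exists_tapeSymbol_ne w p)

/-- The `k`-th digit of the code that starts at position `p`. -/
def tbit (w : List Bool) (p k : ℕ) : ℕ := tapeSymbol w (p + 2 * k + 1) % 2

/-- The natural number whose code starts at position `p`. -/
def dval (w : List Bool) (p : ℕ) : ℕ := ∑ k ∈ range (dcount w p), 2 ^ k * tbit w p k

/-- The positions at which the digits of consecutive integers start, the first one being `p₀`. -/
def tpos (w : List Bool) (p₀ : ℕ) : ℕ → ℕ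
  | 0 => p₀
  | i + 1 => tpos w p₀ i + 2 * dcount w (tpos w p₀ i) + 2

/-- The sign bit of the `i`-th integer; the first one is given. -/
def tsg (w : List Bool) (p₀ s₀ i : ℕ) : ℕ :=
  if i = 0 then s₀ else tapeSymbol w (tpos w p₀ i - 1) % 2

/-- The `i`-th integer. -/
def tval (w : List Bool) (p₀ s₀ i : ℕ) : ℤ := (-1) ^ tsg w p₀ s₀ i * dval w (tpos w p₀ i)

lemma dcount_spec (w : List Bool) (p c : ℕ) (h : c < dcount w p) : tapeSymbol w (p + 2 * c) = 1 :=
  not_not.1 (Nat.find_min (exists_tapeSymbol_ne w p) h)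

lemma dcount_spec' (w : List Bool) (p : ℕ) : tapeSymbol w (p + 2 * dcount w p) ≠ 1 :=
  Nat.find_spec (exists_tapeSymbol_ne w p)

lemma dcount_eq {w : List Bool} {p d : ℕ} (h : ∀ c < d, tapeSymbol w (p + 2 * c) = 1)
    (h' : tapeSymbol w (p + 2 * d) ≠ 1) : dcount w p = d := by
  rw [dcount, Nat.find_eq_iff]
  exact ⟨h', fun c hc => by simp [h c hc]⟩

lemma tbit_lt (w : List Bool) (p k : ℕ) : tbit w p k < 2 := Nat.mod_lt _ two_pos

lemma sum_bits_lt (f : ℕ → ℕ) (hf : ∀ k, f k < 2) (c : ℕ) :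
    ∑ k ∈ range c, 2 ^ k * f k < 2 ^ c := by
  induction c with
  | zero => simp
  | succ c ih =>
    rw [sum_range_succ, pow_succ]
    have := hf c
    have : 2 ^ c * f c ≤ 2 ^ c * 1 := Nat.mul_le_mul_left _ (by omega)
    omega

lemma dval_lt (w : List Bool) (p : ℕ) : dval w p < 2 ^ dcount w p :=
  sum_bits_lt _ (tbit_lt w p) _

lemma size_dval_le (w : List Bool) (p : ℕ) : (dval w p).size ≤ dcount w p :=
  Nat.size_le.2 (dval_lt w p)

/-- A code is canonical, that is, it has no leading zeros, iff its last digit is not `0`. -/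
lemma dcount_eq_size_iff (w : List Bool) (p : ℕ) :
    dcount w p = (dval w p).size ↔ dcount w p = 0 ∨ tbit w p (dcount w p - 1) = 1 := by
  rcases Nat.eq_zero_or_pos (dcount w p) with h0 | h0
  · have := size_dval_le w p
    simp only [h0, true_or, iff_true]; omega
  · obtain ⟨d, hd⟩ : ∃ d, dcount w p = d + 1 := ⟨dcount w p - 1, by omega⟩
    have hs : dval w p = ∑ k ∈ range d, 2 ^ k * tbit w p k + 2 ^ d * tbit w p d := by
      rw [dval, hd, sum_range_succ]
    have h1 := sum_bits_lt _ (tbit_lt w p) d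
    have h2 := tbit_lt w p d
    have h3 := size_dval_le w p
    rw [hd] at *
    simp only [Nat.add_sub_cancel, Nat.add_eq_zero_iff, one_ne_zero, and_false, false_or]
    constructor
    · intro h
      have : 2 ^ d ≤ dval w p := Nat.lt_size.1 (by omega)
      by_contra hb
      have : tbit w p d = 0 := by omega
      rw [this] at hs; omega
    · intro h
      rw [h] at hs
      have : d < (dval w p).size := Nat.lt_size.2 (by omega)
      omega

lemma tpos_succ' (w : List Bool) (p₀ i : ℕ) : tpos w p₀ (i + 1) = tpos w (tpos w p₀ 1) i := by
  induction i with
  | zero => rfl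
  | succ i ih => rw [tpos, ih]; rfl

lemma add_dcount_le (w : List Bool) (p : ℕ) : p + 2 * dcount w p ≤ max p (w.length + 1) := by
  rcases Nat.eq_zero_or_pos (dcount w p) with h0 | h0
  · simp [h0]
  · have h := dcount_spec w p (dcount w p - 1) (by omega)
    have : p + 2 * (dcount w p - 1) < w.length := by
      by_contra hlt
      rw [tapeSymbol_of_le (by omega)] at h
      exact absurd h (by decide)
    omega

lemma tpos_le (w : List Bool) (p₀ i : ℕ) : tpos w p₀ i ≤ max p₀ (w.length + 1) + 2 * i := by
  induction i with
  | zero => simp [tpos]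
  | succ i ih => have := add_dcount_le w (tpos w p₀ i); simp only [tpos]; omega

lemma tpos_eq_sum (w : List Bool) (p₀ i : ℕ) :
    tpos w p₀ i = p₀ + 2 * ∑ k ∈ range i, (dcount w (tpos w p₀ k) + 1) := by
  induction i with
  | zero => simp [tpos]
  | succ i ih => rw [sum_range_succ, mul_add, ← add_assoc, ← ih, tpos]; ring

lemma sum_dcount_le (w : List Bool) (i : ℕ) :
    ∑ k ∈ range i, dcount w (tpos w 1 k) ≤ w.length := by
  have h1 := tpos_eq_sum w 1 i
  have h2 := tpos_le w 1 i
  rw [sum_add_distrib] at h1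
  simp only [sum_const, card_range, smul_eq_mul, mul_one] at h1
  omega

lemma dcount_le (w : List Bool) (i : ℕ) : dcount w (tpos w 1 i) ≤ w.length :=
  (single_le_sum (f := fun k => dcount w (tpos w 1 k)) (fun _ _ => Nat.zero_le _)
    (self_mem_range_succ i)).trans (sum_dcount_le w (i + 1))

lemma natAbs_tval (w : List Bool) (p₀ s₀ i : ℕ) :
    (tval w p₀ s₀ i).natAbs = dval w (tpos w p₀ i) := by
  rw [tval, Int.natAbs_mul, Int.natAbs_pow]; simp

/-! ### Decoding what was encoded -/

lemma flatMap_getElem?_even (bs : List Bool) (t : List Bool) (c : ℕ) (hc : c < bs.length) :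
    ((bs.flatMap fun b => [true, b]) ++ t)[2 * c]? = some true ∧
      ((bs.flatMap fun b => [true, b]) ++ t)[2 * c + 1]? = some (bs[c]) := by
  induction bs generalizing c with
  | nil => simp at hc
  | cons b bs ih =>
    cases c with
    | zero => simp
    | succ c =>
      have := ih c (by simpa using hc)
      simpa [mul_add] using this

lemma length_flatMap_bits (bs : List Bool) : (bs.flatMap fun b => [true, b]).length =
    2 * bs.length := by
  induction bs with
  | nil => rfl
  | cons b bs ih => simp [ih]; ring

lemma length_encodeNat (k : ℕ) : (encodeNat k).length = 2 * k.size + 1 := by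
  rw [encodeNat, List.length_append, length_flatMap_bits, Nat.size_eq_bits_len]; rfl

lemma length_encodeInt (z : ℤ) : (encodeInt z).length = 2 * z.natAbs.size + 2 := by
  rw [encodeInt, List.length_cons, length_encodeNat]

lemma tapeSymbol_append_right (l t : List Bool) (i : ℕ) :
    tapeSymbol (l ++ t) (l.length + i) = tapeSymbol t i := by
  simp only [tapeSymbol]
  rw [List.getElem?_append_right (by omega), Nat.add_sub_cancel_left]

lemma sum_bits (k : ℕ) : ∑ j ∈ range k.bits.length, 2 ^ j * (k.bits.getD j false).toNat
    = k := by
  have key : ∀ bs : List Bool, ∑ j ∈ range bs.length, 2 ^ j * (bs.getD j false).toNat =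
      Nat.ofDigits 2 (bs.map fun b => cond b 1 0) := by
    intro bs
    induction bs with
    | nil => simp
    | cons b bs ih =>
      rw [List.length_cons, sum_range_succ', List.map_cons, Nat.ofDigits_cons, ← ih,
        mul_sum]
      simp only [pow_succ, List.getD_cons_succ, List.getD_cons_zero, pow_zero, one_mul]
      rw [add_comm]
      refine congr_arg₂ _ (by cases b <;> rfl) (sum_congr rfl fun _ _ => by ring)
  rw [key, ← Nat.digits_two_eq_bits, Nat.ofDigits_digits]

lemma decode_nat (l r : List Bool) (k : ℕ) :
    dcount (l ++ encodeNat k ++ r) l.length = k.size ∧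
      dval (l ++ encodeNat k ++ r) l.length = k := by
  have hs : ∀ i, tapeSymbol (l ++ encodeNat k ++ r) (l.length + i) =
      tapeSymbol ((k.bits.flatMap fun b => [true, b]) ++ ([false] ++ r)) i := by
    intro i
    rw [List.append_assoc, tapeSymbol_append_right, encodeNat, List.append_assoc]
  have h1 : dcount (l ++ encodeNat k ++ r) l.length = k.size := by
    rw [← Nat.size_eq_bits_len]
    refine dcount_eq (fun c hc => ?_) ?_
    · rw [hs, tapeSymbol, (flatMap_getElem?_even _ _ c hc).1]; rfl
    · rw [hs, ← length_flatMap_bits]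
      have := tapeSymbol_append_right (k.bits.flatMap fun b => [true, b]) ([false] ++ r) 0
      rw [add_zero] at this
      rw [this]; simp [tapeSymbol]
  refine ⟨h1, ?_⟩
  rw [dval, h1, ← Nat.size_eq_bits_len]
  conv_rhs => rw [← sum_bits k]
  refine sum_congr rfl fun c hc => ?_
  have hc' := mem_range.1 hc
  rw [tbit, add_assoc, hs, tapeSymbol, (flatMap_getElem?_even _ _ c hc').2,
    List.getD_eq_getElem _ _ hc']
  cases k.bits[c] <;> simp

lemma tpos_stream (l r : List Bool) (zs : List ℤ) (i : ℕ) (hi : i < zs.length) :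
    tpos (l ++ zs.flatMap encodeInt ++ r) (l.length + 1) i =
        (l ++ (zs.take i).flatMap encodeInt).length + 1 ∧
      dcount (l ++ zs.flatMap encodeInt ++ r) (tpos (l ++ zs.flatMap encodeInt ++ r) (l.length + 1) i)
        = (zs[i]).natAbs.size ∧
      dval (l ++ zs.flatMap encodeInt ++ r) (tpos (l ++ zs.flatMap encodeInt ++ r) (l.length + 1) i)
        = (zs[i]).natAbs ∧
      tapeSymbol (l ++ zs.flatMap encodeInt ++ r)
        (tpos (l ++ zs.flatMap encodeInt ++ r) (l.length + 1) i - 1) =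
        (decide (zs[i] < 0)).toNat := by
  have key : ∀ i (hi : i < zs.length), l ++ zs.flatMap encodeInt ++ r =
      (l ++ (zs.take i).flatMap encodeInt ++ [decide (zs[i] < 0)]) ++ encodeNat (zs[i]).natAbs ++
        ((zs.drop (i + 1)).flatMap encodeInt ++ r) := by
    intro i hi
    have e : zs.flatMap encodeInt = (zs.take i).flatMap encodeInt ++
        (encodeInt zs[i] ++ (zs.drop (i + 1)).flatMap encodeInt) := by
      conv_lhs => rw [← List.take_append_drop i zs, List.drop_eq_getElem_cons hi]
      rw [List.flatMap_append, List.flatMap_cons]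
    rw [e]; simp [encodeInt]
  have hp : tpos (l ++ zs.flatMap encodeInt ++ r) (l.length + 1) i =
      (l ++ (zs.take i).flatMap encodeInt).length + 1 := by
    induction i with
    | zero => simp [tpos]
    | succ i ih =>
      have ih := ih (by omega)
      have hd := decode_nat (l ++ (zs.take i).flatMap encodeInt ++ [decide (zs[i] < 0)])
        ((zs.drop (i + 1)).flatMap encodeInt ++ r) (zs[i]).natAbs
      rw [← key i (by omega), List.length_append, List.length_singleton] at hd
      rw [tpos, ih, hd.1, List.take_add_one, List.getElem?_eq_getElem (by omega)]
      simp only [List.flatMap_append, List.length_append, Option.toList_some, List.flatMap_cons,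
        List.flatMap_nil, List.append_nil, length_encodeInt]
      ring
  have hd := decode_nat (l ++ (zs.take i).flatMap encodeInt ++ [decide (zs[i] < 0)])
    ((zs.drop (i + 1)).flatMap encodeInt ++ r) (zs[i]).natAbs
  rw [← key i hi, List.length_append, List.length_singleton] at hd
  refine ⟨hp, by rw [hp]; exact hd.1, by rw [hp]; exact hd.2, ?_⟩
  rw [hp, Nat.add_sub_cancel, key i hi, List.append_assoc, List.append_assoc (_ ++ _)]
  have := tapeSymbol_append_right (l ++ (zs.take i).flatMap encodeInt)
    ([decide (zs[i] < 0)] ++ (encodeNat (zs[i]).natAbs ++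
        ((zs.drop (i + 1)).flatMap encodeInt ++ r))) 0
  rw [add_zero] at this
  rw [this]; simp [tapeSymbol]

lemma sign_mul_natAbs (z : ℤ) : (-1) ^ (decide (z < 0)).toNat * (z.natAbs : ℤ) = z := by
  by_cases h : z < 0
  · simp [h, abs_of_neg h]
  · simp [h, abs_of_nonneg (not_lt.1 h)]

/-- Integers that follow the code of a natural number. -/
lemma decode_header (k : ℕ) (zs : List ℤ) :
    let w := encodeNat k ++ zs.flatMap encodeInt
    dcount w (tpos w 0 0) = k.size ∧ tval w 0 0 0 = k ∧
      ∀ i (hi : i < zs.length), dcount w (tpos w 0 (i + 1)) = (zs[i]).natAbs.size ∧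
        tval w 0 0 (i + 1) = zs[i] := by
  intro w
  have h0 := decode_nat [] (zs.flatMap encodeInt) k
  simp only [List.nil_append, List.length_nil] at h0
  refine ⟨h0.1, by simp [tval, tsg, tpos, w, h0.2], fun i hi => ?_⟩
  have h1 : tpos w 0 1 = (encodeNat k).length + 1 := by
    simp only [tpos, w, h0.1, length_encodeNat]; ring
  have h2 := tpos_stream (encodeNat k) [] zs i hi
  simp only [List.append_nil] at h2
  rw [tval, tsg, if_neg (by omega), tpos_succ', h1]
  refine ⟨h2.2.1, ?_⟩
  rw [h2.2.2.1, h2.2.2.2]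
  have : (decide (zs[i] < 0)).toNat % 2 = (decide (zs[i] < 0)).toNat :=
    Nat.mod_eq_of_lt (by cases decide (zs[i] < 0) <;> decide)
  rw [this, sign_mul_natAbs]

/-- The `i`-th integer of a bit string that consists of codes of integers. -/
def cval (w : List Bool) (i : ℕ) : ℤ := tval w 1 (tapeSymbol w 0 % 2) i

lemma cval_eq (w : List Bool) (i : ℕ) :
    cval w i = (-1) ^ (tapeSymbol w (tpos w 1 i - 1) % 2) * dval w (tpos w 1 i) := by
  rw [cval, tval, tsg]
  split_ifs with h
  · subst h; rfl
  · rfl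

lemma decode_ints (zs : List ℤ) (i : ℕ) (hi : i < zs.length) :
    dcount (zs.flatMap encodeInt) (tpos (zs.flatMap encodeInt) 1 i) = (zs[i]).natAbs.size ∧
      cval (zs.flatMap encodeInt) i = zs[i] := by
  have h2 := tpos_stream [] [] zs i hi
  simp only [List.append_nil, List.nil_append, List.length_nil, zero_add] at h2
  refine ⟨h2.2.1, ?_⟩
  rw [cval_eq, h2.2.2.1, h2.2.2.2]
  have : (decide (zs[i] < 0)).toNat % 2 = (decide (zs[i] < 0)).toNat :=
    Nat.mod_eq_of_lt (by cases decide (zs[i] < 0) <;> decide)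
  rw [this, sign_mul_natAbs]

lemma natAbs_cval_lt (w : List Bool) (i : ℕ) : (cval w i).natAbs < 2 ^ w.length := by
  rw [cval, natAbs_tval]
  exact (dval_lt _ _).trans_le (Nat.pow_le_pow_right two_pos (dcount_le w i))

lemma natAbs_cval_lt' (w : List Bool) (i : ℕ) :
    (cval w i).natAbs < 2 ^ dcount w (tpos w 1 i) := by
  rw [cval, natAbs_tval]
  exact dval_lt _ _

/-- The entries of a matrix, row by row. -/
def entries {n : ℕ} (A : IntMat n) : List ℤ :=
  List.ofFn fun k : Fin (n * n) => A k.divNat k.modNat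

lemma encodeMatrix_eq {n : ℕ} (A : IntMat n) :
    encodeMatrix A = encodeNat n ++ (entries A).flatMap encodeInt := by
  rw [encodeMatrix, entries, List.ofFn_mul]
  congr 1
  rw [List.ofFn_eq_map, List.flatMap_def (l := List.flatten _), List.map_flatten,
    List.flatten_flatten, List.map_map, List.map_map, List.flatMap_def]
  refine congr_arg _ (List.map_congr_left fun i _ => ?_)
  simp only [Function.comp, List.flatMap_def, List.ofFn_eq_map, List.map_map]
  refine congr_arg _ (List.map_congr_left fun j _ => ?_)
  simp only [Function.comp]
  congr 2
  · ext; simp only [Fin.divNat]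
    exact (Nat.div_eq_of_lt_le (by nlinarith [j.2]) (by nlinarith [j.2])).symm
  · ext; simp [Fin.modNat, Nat.mod_eq_of_lt j.2]

lemma decode_matrix {n : ℕ} (A : IntMat n) (i j : Fin n) :
    dcount (encodeMatrix A) (tpos (encodeMatrix A) 0 (i * n + j + 1)) = (A i j).natAbs.size ∧
      tval (encodeMatrix A) 0 0 (i * n + j + 1) = A i j := by
  have hlt : (i : ℕ) * n + j < n * n := by nlinarith [i.2, j.2]
  have h := (decode_header n (entries A)).2.2 (i * n + j) (by simpa [entries] using hlt)
  rw [← encodeMatrix_eq] at h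
  have e : (entries A)[(i : ℕ) * n + j]'(by simpa [entries] using hlt) = A i j := by
    simp only [entries, List.getElem_ofFn]
    congr 1
    · ext; simp only [Fin.divNat]
      exact Nat.div_eq_of_lt_le (by nlinarith [j.2]) (by nlinarith [j.2])
    · ext; simp [Fin.modNat, Nat.mod_eq_of_lt j.2]
  rw [e] at h
  exact h

lemma decode_poly (g : ℤ[X]) :
    dcount (encodePoly g) (tpos (encodePoly g) 0 0) = (g.natDegree + 1).size ∧
      tval (encodePoly g) 0 0 0 = (g.natDegree + 1 : ℕ) ∧
      ∀ i ≤ g.natDegree, dcount (encodePoly g) (tpos (encodePoly g) 0 (i + 1)) =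
        (g.coeff i).natAbs.size ∧ tval (encodePoly g) 0 0 (i + 1) = g.coeff i := by
  have h := decode_header (g.natDegree + 1) ((List.range (g.natDegree + 1)).map g.coeff)
  have e : encodeNat (g.natDegree + 1) ++
      ((List.range (g.natDegree + 1)).map g.coeff).flatMap encodeInt = encodePoly g := by
    rw [encodePoly, List.flatMap_map]
  simp only [e] at h
  refine ⟨h.1, h.2.1, fun i hi => ?_⟩
  have := h.2.2 i (by simp; omega)
  simpa using this

end RAM
set_option linter.constructorNameAsVariable false

/-! ### Building blocks of the verifier's program -/

namespace RAM

open Finset State Stmt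

variable {tapes : List (List Bool)} {ω : ℕ → Bool}

/-- Store a finished integer and go on to the next one. -/
def tokEnd (τ : Fin 5) : Stmt :=
  .store (.pos τ) .idx .ps ;; .store (.cnt τ) .idx .cnt ;; .store (.last τ) .idx .lb ;;
  .ifz .sg .skip (.op .val (.mam .q .val .zero .q)) ;; .store (.val τ) .idx .val ;;
  .op .idx (.addc .idx 1) ;; .op .cnt (.const 0) ;; .op .val (.const 0) ;; .op .pw (.const 1) ;;
  .op .lb (.const 1) ;; .op .pos (.addc .pos 1) ;; .read .s τ .pos ;; .op .sg (.addp .zero .s) ;;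
  .op .pos (.addc .pos 1) ;; .op .ps (.addc .pos 0)

/-- Take another digit into account. -/
def tokDigit (τ : Fin 5) : Stmt :=
  .op .pos (.addc .pos 1) ;; .read .s τ .pos ;; .op .b (.addp .zero .s) ;;
  .op .val (.mam .b .pw .val .q) ;; .op .pw (.mam .two .pw .zero .q) ;; .op .pos (.addc .pos 1) ;;
  .op .cnt (.addc .cnt 1) ;; .op .lb (.addc .b 0)

/-- One step of the tokenizer. -/
def tokBody (τ : Fin 5) : Stmt :=
  .read .s τ .pos ;; .op .t (.addp .zero .s) ;; .ifz .t (tokEnd τ) (tokDigit τ)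

/-- The tokenizer. It makes as many steps as register `x` says, each of them taking two bits of
tape `τ`, and stores positions, numbers of digits, last digits, and residues modulo `q + 1` of the
integers that it passes. -/
def tok (τ : Fin 5) (x : Reg) : Stmt :=
  .op .idx (.const 0) ;; .op .cnt (.const 0) ;; .op .val (.const 0) ;; .op .pw (.const 1) ;;
  .op .lb (.const 1) ;; .op .two (.const 2) ;; .op .ps (.addc .pos 0) ;; .loop .jT x (tokBody τ)

/-- The entries of the arrays that describe the `i`-th integer of a tape. -/
structure TokOk (w : List Bool) (p₀ s₀ Q : ℕ) (τ : Fin 5) (arr : Arr → ℕ → ℕ) (i : ℕ) : Prop where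
  pos : arr (.pos τ) i = tpos w p₀ i
  cnt : arr (.cnt τ) i = dcount w (tpos w p₀ i)
  last : arr (.last τ) i =
    if dcount w (tpos w p₀ i) = 0 then 1 else tbit w (tpos w p₀ i) (dcount w (tpos w p₀ i) - 1)
  val_le : arr (.val τ) i ≤ Q
  val : (arr (.val τ) i : ZMod (Q + 1)) = tval w p₀ s₀ i

lemma mod_succ_le (a Q : ℕ) : a % (Q + 1) ≤ Q := Nat.lt_succ_iff.1 (Nat.mod_lt _ (by omega))

lemma cast_mod_succ (a Q : ℕ) : ((a % (Q + 1) : ℕ) : ZMod (Q + 1)) = a :=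
  ZMod.natCast_mod a (Q + 1)

/-- State of the tokenizer while it is at digit `c` of integer `i`. -/
structure TokInv (w : List Bool) (p₀ s₀ Q : ℕ) (τ : Fin 5) (i c : ℕ) (σ : State) : Prop where
  le : c ≤ dcount w (tpos w p₀ i)
  idx : σ.reg .idx = i
  cnt : σ.reg .cnt = c
  pos : σ.reg .pos = tpos w p₀ i + 2 * c
  ps : σ.reg .ps = tpos w p₀ i
  sg : σ.reg .sg = tsg w p₀ s₀ i
  val_le : σ.reg .val ≤ Q
  val : (σ.reg .val : ZMod (Q + 1)) =
    ((∑ k ∈ range c, 2 ^ k * tbit w (tpos w p₀ i) k : ℕ) : ZMod (Q + 1))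
  pw : (σ.reg .pw : ZMod (Q + 1)) = 2 ^ c
  lb : σ.reg .lb = if c = 0 then 1 else tbit w (tpos w p₀ i) (c - 1)
  zero : σ.reg .zero = 0
  two : σ.reg .two = 2
  q : σ.reg .q = Q
  ok : ∀ i' < i, TokOk w p₀ s₀ Q τ σ.arr i'

lemma TokInv.setR_jT {w : List Bool} {p₀ s₀ Q : ℕ} {τ : Fin 5} {i c : ℕ} {σ : State}
    (h : TokInv w p₀ s₀ Q τ i c σ) (v : ℕ) : TokInv w p₀ s₀ Q τ i c (σ.setR .jT v) :=
  ⟨h.le, h.idx, h.cnt, h.pos, h.ps, h.sg, h.val_le, h.val, h.pw, h.lb, h.zero, h.two, h.q, h.ok⟩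

lemma TokInv.digit {w : List Bool} {p₀ s₀ Q : ℕ} {τ : Fin 5} {i c : ℕ} {σ : State}
    (h : TokInv w p₀ s₀ Q τ i c σ) (hw : tapes.getD τ [] = w)
    (hs : tapeSymbol w (σ.reg .pos) = 1) :
    TokInv w p₀ s₀ Q τ i (c + 1) ((tokBody τ).den tapes ω σ) := by
  have hlt : c < dcount w (tpos w p₀ i) := by
    refine lt_of_le_of_ne h.le fun he => ?_
    rw [h.pos, he] at hs
    exact dcount_spec' w _ hs
  rw [List.getD_eq_getElem?_getD] at hw
  have e : (tokBody τ).den tapes ω σ = (tokDigit τ).den tapes ω ((σ.setR .s 1).setR .t 1) := by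
    simp [tokBody, den, hw, hs, Op.eval, h.zero]
  have hb : tapeSymbol w (tpos w p₀ i + 2 * c + 1) % 2 = tbit w (tpos w p₀ i) c := rfl
  rw [e]
  constructor <;> simp [tokDigit, den, Op.eval, h.zero, h.two, hw, hb, h.q, h.cnt, h.pos, h.idx,
    h.ps, h.sg]
  · exact hlt
  · ring
  · exact mod_succ_le _ _
  · rw [sum_range_succ, h.val, h.pw]; push_cast; ring
  · rw [h.pw]; ring
  · intro i' hi'
    obtain ⟨h1, h2, h3, h4, h5⟩ := h.ok i' hi'
    exact ⟨h1, h2, h3, h4, h5⟩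

lemma tsg_succ (w : List Bool) (p₀ s₀ i : ℕ) :
    tsg w p₀ s₀ (i + 1) = tapeSymbol w (tpos w p₀ i + 2 * dcount w (tpos w p₀ i) + 1) % 2 := by
  simp [tsg, tpos]

lemma tsg_lt (w : List Bool) (p₀ s₀ i : ℕ) (h : s₀ < 2) : tsg w p₀ s₀ i < 2 := by
  unfold tsg; split_ifs
  · exact h
  · exact Nat.mod_lt _ two_pos

lemma TokInv.next {w : List Bool} {p₀ s₀ Q : ℕ} {τ : Fin 5} {i c : ℕ} {σ : State}
    (h : TokInv w p₀ s₀ Q τ i c σ) (hs₀ : s₀ < 2) (hw : tapes.getD τ [] = w)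
    (hs : tapeSymbol w (σ.reg .pos) ≠ 1) :
    c = dcount w (tpos w p₀ i) ∧ TokInv w p₀ s₀ Q τ (i + 1) 0 ((tokBody τ).den tapes ω σ) := by
  rw [List.getD_eq_getElem?_getD] at hw
  have hc : c = dcount w (tpos w p₀ i) := by
    by_contra hne
    exact hs (by rw [h.pos]; exact dcount_spec w _ _ (lt_of_le_of_ne h.le hne))
  refine ⟨hc, ?_⟩
  have hs2 : tapeSymbol w (σ.reg .pos) % 2 = 0 := by
    have := tapeSymbol_le w (σ.reg .pos); omega
  have e : (tokBody τ).den tapes ω σ =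
      (tokEnd τ).den tapes ω ((σ.setR .s (tapeSymbol w (σ.reg .pos))).setR .t 0) := by
    simp only [tokBody, den, List.getD_eq_getElem?_getD, hw, Op.eval, setR_reg, h.zero, zero_add]
    simp [hs2]
  have hn : tapeSymbol w (σ.reg .pos + 1) % 2 = tsg w p₀ s₀ (i + 1) := by
    rw [h.pos, hc, tsg_succ]
  -- the residue that is stored
  set v : ℕ := if σ.reg .sg = 0 then σ.reg .val else (Q * σ.reg .val) % (Q + 1) with hv
  have hv1 : v ≤ Q := by rw [hv]; split_ifs; exacts [h.val_le, mod_succ_le _ _]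
  have hv2 : (v : ZMod (Q + 1)) = tval w p₀ s₀ i := by
    have hQ : (Q : ZMod (Q + 1)) = -1 := by
      have := ZMod.natCast_self (Q + 1); push_cast at this; linear_combination this
    have hd : (σ.reg .val : ZMod (Q + 1)) = dval w (tpos w p₀ i) := by rw [h.val, hc]; rfl
    have h2 := tsg_lt w p₀ s₀ i hs₀
    rw [hv, tval, h.sg]
    split_ifs with h0
    · rw [hd, h0]; push_cast; ring
    · rw [show tsg w p₀ s₀ i = 1 by omega, cast_mod_succ]; push_cast [hd, hQ]; ring
  have hreg : ∀ r, ((tokBody τ).den tapes ω σ).reg r = if r = .idx then i + 1 else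
      if r = .cnt then 0 else if r = .val then 0 else if r = .pw then 1 else if r = .lb then 1 else
      if r = .pos then σ.reg .pos + 2 else if r = .ps then σ.reg .pos + 2 else
      if r = .sg then tsg w p₀ s₀ (i + 1) else if r = .s then tapeSymbol w (σ.reg .pos + 1) else
      if r = .t then 0 else σ.reg r := by
    intro r
    rw [e]
    by_cases h0 : σ.reg .sg = 0 <;>
    · simp [tokEnd, den, Op.eval, h.zero, hw, hn, h.idx, h0]
      cases r <;> simp
  have harr : ∀ a k, ((tokBody τ).den tapes ω σ).arr a k =
      if a = .val τ ∧ k = i then v else if a = .last τ ∧ k = i then σ.reg .lb else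
      if a = .cnt τ ∧ k = i then c else if a = .pos τ ∧ k = i then tpos w p₀ i else σ.arr a k := by
    intro a k
    rw [e]
    by_cases h0 : σ.reg .sg = 0 <;>
    · simp [tokEnd, den, Op.eval, h.zero, hw, h.idx, h0, h.q, hv, h.ps, h.cnt]
  constructor
  any_goals simp [hreg, tpos, h.pos, hc, h.zero, h.two, h.q]
  · intro i' hi'
    rcases Nat.lt_succ_iff_lt_or_eq.1 (Nat.lt_succ_of_le hi') with hlt | rfl
    · obtain ⟨h1, h2, h3, h4, h5⟩ := h.ok i' hlt
      have : i' ≠ i := hlt.ne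
      constructor <;> simp [harr, this, h1, h2, h3, h4, h5]
    · constructor
      · simp [harr]
      · simp [harr, hc]
      · simp [harr, h.lb, hc]
      · simp [harr, hv1]
      · simp only [harr, true_and, if_true]; exact hv2

lemma tpos_strictMono (w : List Bool) (p₀ : ℕ) : StrictMono (tpos w p₀) :=
  strictMono_nat_of_lt_succ fun i => by simp only [tpos]; omega

/-- The tokenizer completes as many integers as fit into the bits that it looks at, and describes
each of them correctly. -/
lemma tok_spec (τ : Fin 5) (x : Reg) {w : List Bool} (hw : tapes.getD τ [] = w) (σ : State)
    (hx : (tok τ x).wr x = false) (hz : σ.reg .zero = 0) (hs : σ.reg .sg < 2) (i : ℕ) :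
    (i < ((tok τ x).den tapes ω σ).reg .idx ↔
      tpos w (σ.reg .pos) (i + 1) ≤ σ.reg .pos + 2 * σ.reg x) ∧
    (i < ((tok τ x).den tapes ω σ).reg .idx →
      TokOk w (σ.reg .pos) (σ.reg .sg) (σ.reg .q) τ ((tok τ x).den tapes ω σ).arr i) := by
  simp only [tok, den, wr, Bool.or_eq_false_iff, decide_eq_false_iff_not] at hx ⊢
  set σ₁ := ((((((σ.setR .idx _).setR .cnt _).setR .val _).setR .pw _).setR .lb _).setR .two _).setR
    .ps _ with hσ₁
  have hx1 : σ₁.reg x = σ.reg x := by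
    simp only [hσ₁, setR_reg]; simp only [hx, if_false]
  obtain ⟨j, c, h1, h2⟩ := loop_induction (i := .jT) (x := x)
    (s := tokBody τ)
    (fun t σ' => ∃ j c, TokInv w (σ.reg .pos) (σ.reg .sg) (σ.reg .q) τ j c σ' ∧
      σ'.reg .pos = σ.reg .pos + 2 * t) σ₁
    ⟨0, 0, by constructor <;> simp [hσ₁, Op.eval, tpos, tsg, hz], by simp [hσ₁]⟩
    (by
      rintro t - σ' - ⟨j, c, h1, h2⟩
      by_cases hsym : tapeSymbol w (σ'.reg .pos) = 1
      · have h3 := h1.digit (ω := ω) hw hsym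
        refine ⟨j, c + 1, h3.setR_jT _, ?_⟩
        · rw [setR_reg, if_neg (by decide), h3.pos]
          have := h1.pos; omega
      · obtain ⟨hc, h3⟩ := h1.next (ω := ω) hs hw hsym
        refine ⟨j + 1, 0, h3.setR_jT _, ?_⟩
        · rw [setR_reg, if_neg (by decide), h3.pos, tpos]
          have := h1.pos; omega)
  simp only [den] at h1 h2
  have hpos := h1.pos
  rw [h2, hx1] at hpos
  rw [h1.idx]
  have hle := h1.le
  refine ⟨⟨fun hi => ?_, fun hi => ?_⟩, fun hi => h1.ok i hi⟩
  · have := (tpos_strictMono w (σ.reg .pos)).monotone (show i + 1 ≤ j by omega)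
    omega
  · have h3 : tpos w (σ.reg .pos) (j + 1) =
      tpos w (σ.reg .pos) j + 2 * dcount w (tpos w (σ.reg .pos) j) + 2 := rfl
    have := (tpos_strictMono w (σ.reg .pos)).lt_iff_lt (a := i + 1) (b := j + 1)
    have := this.1 (by omega)
    omega

end RAM
set_option linter.constructorNameAsVariable false

/-! ### Linear algebra modulo a register, and bit-serial arithmetic -/

namespace RAM

open Finset State Stmt

variable {tapes : List (List Bool)} {ω : ℕ → Bool}

/-- Induction over the rounds of a loop, with what the body leaves alone at hand. -/
lemma loop_induction' {i x : Reg} {s : Stmt} (P : ℕ → State → Prop) (σ : State)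
    (h0 : P 0 (σ.setR i 0))
    (hs : ∀ k < σ.reg x, ∀ τ, τ.reg i = k → (∀ r, s.wr r = false → r ≠ i → τ.reg r = σ.reg r) →
      (∀ a, s.wa a = false → τ.arr a = σ.arr a) → P k τ →
      P (k + 1) ((s.den tapes ω τ).setR i (k + 1))) :
    P (σ.reg x) ((loop i x s).den tapes ω σ) := by
  refine (loop_induction (i := i) (x := x) (s := s)
    (fun k τ => ((∀ r, s.wr r = false → r ≠ i → τ.reg r = σ.reg r) ∧
      ∀ a, s.wa a = false → τ.arr a = σ.arr a) ∧ P k τ) σ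
    ⟨⟨fun r _ hr => by simp [hr], fun a _ => rfl⟩, h0⟩ ?_).2
  rintro k hk τ hi ⟨⟨h1, h2⟩, h3⟩
  refine ⟨⟨fun r hr hne => ?_, fun a ha => ?_⟩, hs k hk τ hi h1 h2 h3⟩
  · simp [hne, den_reg hr, h1 r hr hne]
  · simp [den_arr ha, h2 a ha]

/-! #### Comparisons -/

/-- Set register `bad` unless `a` and `b` agree. -/
def neq (a b : Reg) : Stmt :=
  .op .u (.sub a b) ;; .op .vv (.sub b a) ;;
    .ifz .u (.ifz .vv .skip (.op .bad (.const 1))) (.op .bad (.const 1))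

/-- Set register `bad` unless `a` is at most `b`. -/
def leq (a b : Reg) : Stmt :=
  .op .u (.sub a b) ;; .ifz .u .skip (.op .bad (.const 1))

lemma neq_spec (a b : Reg) (ha : a ≠ .u) (hb : b ≠ .u) (σ : State) :
    ((neq a b).den tapes ω σ).reg .bad = 0 ↔ σ.reg .bad = 0 ∧ σ.reg a = σ.reg b := by
  simp only [neq, den, Op.eval, setR_reg, if_neg ha, if_neg hb, if_true, reduceCtorEq,
    if_false]
  split_ifs with h1 h2
  · simp; omega
  · simp; omega
  · simp; omega

lemma leq_spec (a b : Reg) (σ : State) :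
    ((leq a b).den tapes ω σ).reg .bad = 0 ↔ σ.reg .bad = 0 ∧ σ.reg a ≤ σ.reg b := by
  simp only [leq, den, Op.eval, setR_reg, if_true]
  split_ifs with h1
  · simp; omega
  · simp; omega

lemma neq_reg (a b : Reg) {r : Reg} (h : r ≠ .bad) (hu : r ≠ .u) (hv : r ≠ .vv) (σ : State) :
    ((neq a b).den tapes ω σ).reg r = σ.reg r :=
  den_reg (by simp [neq, wr, h, hu, hv]) σ

lemma neq_arr (a b : Reg) (σ : State) : ((neq a b).den tapes ω σ).arr = σ.arr :=
  funext fun _ => den_arr rfl σ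

lemma leq_reg (a b : Reg) {r : Reg} (h : r ≠ .bad) (hu : r ≠ .u) (σ : State) :
    ((leq a b).den tapes ω σ).reg r = σ.reg r := den_reg (by simp [leq, wr, h, hu]) σ

lemma leq_arr (a b : Reg) (σ : State) : ((leq a b).den tapes ω σ).arr = σ.arr :=
  funext fun _ => den_arr rfl σ

/-! #### Matrices times vectors -/

/-- The `i`-th entry of the product of the `m × m`-matrix that is stored in `E` from position `o`
on, row by row, with the vector `y`. -/
def mv {R : Type*} [CommRing R] (m : ℕ) (E : ℕ → R) (o : ℕ) (y : ℕ → R) (i : ℕ) : R :=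
  ∑ j ∈ range m, E (o + i * m + j) * y j

/-- Multiply the row of numbers from `idx` on with a vector. -/
def dot (src : Arr) : Stmt :=
  .op .acc (.const 0) ;; .loop .jM .m (.load .e (.val 4) .idx ;; .load .y src .jM ;;
    .op .acc (.mam .e .y .acc .q) ;; .op .idx (.addc .idx 1))

/-- Multiply the matrix of numbers from `idx` on with a vector. -/
def matvec (dst src : Arr) : Stmt := .loop .iM .m (dot src ;; .store dst .iM .acc)

lemma dot_spec (src : Arr) (σ : State) :
    let σ' := (dot src).den tapes ω σ
    σ'.reg .idx = σ.reg .idx + σ.reg .m ∧ σ'.reg .acc ≤ σ.reg .q ∧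
      (σ'.reg .acc : ZMod (σ.reg .q + 1)) = ∑ j ∈ range (σ.reg .m),
        (σ.arr (.val 4) (σ.reg .idx + j) : ZMod (σ.reg .q + 1)) * σ.arr src j := by
  intro σ'
  refine loop_induction' (i := .jM) (x := .m) (s := _)
    (fun k τ => τ.reg .idx = σ.reg .idx + k ∧ τ.reg .acc ≤ σ.reg .q ∧
      (τ.reg .acc : ZMod (σ.reg .q + 1)) = ∑ j ∈ range k,
        (σ.arr (.val 4) (σ.reg .idx + j) : ZMod (σ.reg .q + 1)) * σ.arr src j)
    (σ.setR .acc 0) (by simp) ?_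
  rintro k - τ hi hr ha ⟨h1, h2, h3⟩
  have hq := hr .q rfl (by decide)
  have ha1 := ha (.val 4) rfl
  have ha2 := ha src rfl
  simp only [setR_reg, reduceCtorEq, if_false, setR_arr] at hq ha1 ha2
  simp [den, Op.eval, hi, h1, ha1, ha2, hq]
  refine ⟨by ring, mod_succ_le _ _, ?_⟩
  rw [h3, sum_range_succ]; ring

lemma matvec_spec (dst src : Arr) (hds : dst ≠ src) (hd : dst ≠ .val 4) (σ : State) :
    let σ' := (matvec dst src).den tapes ω σ
    σ'.reg .idx = σ.reg .idx + σ.reg .m * σ.reg .m ∧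
      ∀ i < σ.reg .m, σ'.arr dst i ≤ σ.reg .q ∧ (σ'.arr dst i : ZMod (σ.reg .q + 1)) =
        mv (σ.reg .m) (fun k => (σ.arr (.val 4) k : ZMod (σ.reg .q + 1))) (σ.reg .idx)
          (fun j => σ.arr src j) i := by
  refine loop_induction' (tapes := tapes) (ω := ω) (i := .iM) (x := .m) (s := _)
    (fun k τ => τ.reg .idx = σ.reg .idx + k * σ.reg .m ∧
      ∀ i < k, τ.arr dst i ≤ σ.reg .q ∧ (τ.arr dst i : ZMod (σ.reg .q + 1)) =
        mv (σ.reg .m) (fun k => (σ.arr (.val 4) k : ZMod (σ.reg .q + 1))) (σ.reg .idx)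
          (fun j => σ.arr src j) i) σ (by simp) ?_
  rintro k - τ hi hr ha ⟨h1, h2⟩
  have hq := hr .q rfl (by decide)
  have hm := hr .m rfl (by decide)
  have ha1 := ha (.val 4) (by simp [wa, dot, hd.symm])
  have ha2 := ha src (by simp [wa, dot, hds.symm])
  obtain ⟨d1, d2, d3⟩ := dot_spec (tapes := tapes) (ω := ω) src τ
  rw [hm] at d1 d3
  rw [hq] at d2 d3
  have hiM : ((dot src).den tapes ω τ).reg .iM = k := (den_reg rfl τ).trans hi
  have hsrc : ((dot src).den tapes ω τ).arr dst = τ.arr dst := den_arr rfl τ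
  simp only [den, State.setR_reg, State.setR_arr, State.setA_reg, State.setA_arr, hiM, d1, h1,
    reduceCtorEq, if_false, true_and]
  refine ⟨by ring, fun i hik => ?_⟩
  split_ifs with hik'
  · subst hik'
    refine ⟨d2, ?_⟩
    rw [d3, ha1, ha2, h1]; rfl
  · rw [hsrc]
    exact h2 i (by omega)

/-- Set register `bad` unless `y = w + X r` holds in all entries. -/
def chk (y w r : Arr) (X : Reg) : Stmt :=
  .loop .iC .m (.load .e y .iC ;; .load .y w .iC ;; .load .d1 r .iC ;;
    .op .y (.mam X .d1 .y .q) ;; neq .e .y)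

lemma natCast_inj_of_le {Q a b : ℕ} (ha : a ≤ Q) (hb : b ≤ Q) :
    (a : ZMod (Q + 1)) = b ↔ a = b := by
  rw [ZMod.natCast_eq_natCast_iff]
  exact ⟨fun h => Nat.ModEq.eq_of_lt_of_lt h (by omega) (by omega), fun h => h ▸ rfl⟩

lemma chk_spec (y w r : Arr) (X : Reg)
    (hX : (chk y w r X).wr X = false) (σ : State) (hy : ∀ i < σ.reg .m, σ.arr y i ≤ σ.reg .q) :
    ((chk y w r X).den tapes ω σ).reg .bad = 0 ↔ σ.reg .bad = 0 ∧ ∀ i < σ.reg .m,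
      (σ.arr y i : ZMod (σ.reg .q + 1)) = σ.arr w i + σ.reg X * σ.arr r i := by
  refine loop_induction' (i := .iC) (x := .m) (s := _)
    (fun k τ => τ.reg .bad = 0 ↔ σ.reg .bad = 0 ∧ ∀ i < k,
      (σ.arr y i : ZMod (σ.reg .q + 1)) = σ.arr w i + σ.reg X * σ.arr r i) σ (by simp) ?_
  rintro k hk τ hi hr ha h1
  have hq := hr .q rfl (by decide)
  simp only [chk, wr, Bool.or_eq_false_iff, decide_eq_false_iff_not] at hX
  have hX' := hr X (by simp only [wr, Bool.or_eq_false_iff, decide_eq_false_iff_not]; exact hX.2)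
    hX.1
  simp only [setR_reg, den, reduceCtorEq, if_false]
  rw [neq_spec _ _ (by decide) (by decide)]
  simp only [setR_reg, den, reduceCtorEq, if_false, if_true, Op.eval, hi, h1,
    setR_arr, hq, ha y rfl, ha w rfl, ha r rfl, if_neg hX.2.1, if_neg hX.2.2.1,
    if_neg hX.2.2.2.1, hX']
  rw [← natCast_inj_of_le (hy k hk) (mod_succ_le _ _), cast_mod_succ, Nat.forall_lt_succ_right,
    and_assoc]
  push_cast
  rw [add_comm (_ * _)]

/-! #### Bit-serial arithmetic

An integer is represented modulo `2 ^ S` by `S` binary digits in the array `acc`. -/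

/-- Look up the position of the `x`-th integer of tape `τ` and its sign, which is inverted if `flip`
is odd. A number is negated by inverting its digits and adding `1`, which is put into the carry. -/
def accumInit (τ : Fin 5) (x flip : Reg) : Stmt :=
  .load .ps (.pos τ) x ;; .load .cnt (.cnt τ) x ;; .op .t (.addc .ps 0) ;; .op .d1 (.const 1) ;;
  .op .t (.sub .t .d1) ;; .read .s τ .t ;; .op .sg (.addp flip .s) ;; .op .sg (.addp .zero .sg) ;;
  .op .carry (.addc .sg 0) ;; .op .pw (.addc .ps 1)

/-- Add the digit of the integer to the carry. -/
def accumBit (τ : Fin 5) : Stmt :=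
  .op .u (.sub .cnt .lB) ;; .ifz .u (.op .b (.const 0)) (.read .b τ .pw) ;;
    .op .b (.addp .sg .b) ;; .op .carry (.addp .carry .b)

/-- Compute a digit of the result. -/
def accumDigit (mult : Reg) : Stmt :=
  .load .e .acc .lB ;; .op .b (.mal .e mult .carry) ;; .op .carry (.mah .e mult .carry) ;;
    .store .acc .lB .b ;; .op .pw (.addc .pw 2)

/-- Multiply the number in `acc` by `mult` and add the `x`-th integer of tape `τ`, or subtract it if
`flip` is odd. -/
def accum (τ : Fin 5) (x mult flip S : Reg) : Stmt :=
  accumInit τ x flip ;; .loop .lB S (accumBit τ ;; accumDigit mult)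

/-- In two's complement, a number is negated by flipping its digits and adding one. -/
lemma sum_flip_bits (f : ℕ → ℕ) (hf : ∀ k, f k < 2) (g S : ℕ) (hg : g < 2) :
    ((∑ k ∈ range S, 2 ^ k * ((g + f k) % 2) + g : ℕ) : ℤ) ≡
      (-1) ^ g * ∑ k ∈ range S, 2 ^ k * (f k : ℤ) [ZMOD 2 ^ S] := by
  interval_cases g
  · simp only [zero_add, add_zero, pow_zero, one_mul]
    rw [sum_congr rfl fun k _ => by rw [Nat.mod_eq_of_lt (hf k)]]
    push_cast
    rfl
  · have h : ∀ S, ∑ k ∈ range S, 2 ^ k * ((1 + f k) % 2) + 1 +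
        ∑ k ∈ range S, 2 ^ k * f k = 2 ^ S := by
      intro S
      induction S with
      | zero => simp
      | succ S ih =>
        rw [sum_range_succ, sum_range_succ, pow_succ]
        have h2 : (1 + f S) % 2 + f S = 1 := by have := hf S; omega
        have h3 : 2 ^ S * ((1 + f S) % 2) + 2 ^ S * f S = 2 ^ S := by rw [← mul_add, h2, mul_one]
        omega
    have h := h S
    rw [Int.modEq_iff_dvd]
    zify at h
    push_cast
    exact ⟨-1, by linear_combination -h⟩

/-- Only the digits up to a fixed bound are computed, so the result is correct modulo a power of
two; negative numbers appear in two's complement. -/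
lemma accum_spec (τ : Fin 5) (x mult flip S : Reg) {w : List Bool} (hw : tapes.getD τ [] = w)
    (σ : State) (hx : x ∉ [Reg.ps])
    (hm : (accum τ x mult flip S).wr mult = false) (hf : (accum τ x mult flip S).wr flip = false)
    (hS : (accum τ x mult flip S).wr S = false) (hfl : σ.reg flip < 2) (hz : σ.reg .zero = 0)
    {p : ℕ} (hp : σ.arr (.pos τ) (σ.reg x) = p) (hc : σ.arr (.cnt τ) (σ.reg x) = dcount w p) :
    let σ' := (accum τ x mult flip S).den tapes ω σ
    (∀ j < σ.reg S, σ'.arr .acc j < 2) ∧ (dcount w p ≤ σ.reg S →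
      (∑ j ∈ range (σ.reg S), 2 ^ j * (σ'.arr .acc j : ℤ)) ≡ σ.reg mult *
        ∑ j ∈ range (σ.reg S), 2 ^ j * ((σ.arr .acc j % 2 : ℕ) : ℤ) +
        (-1) ^ (σ.reg flip + tapeSymbol w (p - 1)) * dval w p [ZMOD 2 ^ σ.reg S]) := by
  intro σ'
  rw [List.getD_eq_getElem?_getD] at hw
  simp only [accum, wr, Bool.or_eq_false_iff, decide_eq_false_iff_not] at hm hf hS
  set g := (σ.reg flip + tapeSymbol w (p - 1)) % 2 with hg
  -- the digits that are added
  set f : ℕ → ℕ := fun k => if k < dcount w p then tbit w p k else 0 with hfdef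
  have hf2 : ∀ k, f k < 2 := fun k => by
    simp only [hfdef]; split_ifs
    · exact tbit_lt _ _ _
    · omega
  have hxps : x ≠ .ps := by simpa using hx
  have hfl' : flip ≠ .ps ∧ flip ≠ .cnt ∧ flip ≠ .t ∧ flip ≠ .d1 ∧ flip ≠ .s := by
    have := hf.1
    simp only [accumInit, wr, Bool.or_eq_false_iff, decide_eq_false_iff_not] at this
    tauto
  have hme : mult ≠ .e ∧ mult ≠ .b ∧ mult ≠ .carry := by
    have := hm.2.2.2
    simp only [accumDigit, wr, Bool.or_eq_false_iff, decide_eq_false_iff_not] at this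
    tauto
  obtain ⟨σ₁, hσ₁⟩ : ∃ s, s = (accumInit τ x flip).den tapes ω σ := ⟨_, rfl⟩
  have h1 : σ₁.reg S = σ.reg S := hσ₁ ▸ den_reg hS.1 σ
  have h2 : σ₁.reg mult = σ.reg mult := hσ₁ ▸ den_reg hm.1 σ
  have h3 : σ₁.arr .acc = σ.arr .acc := hσ₁ ▸ den_arr rfl σ
  have h4 : σ₁.reg .cnt = dcount w p := by rw [hσ₁]; simp [accumInit, den, Op.eval, hc, hxps]
  have h5 : σ₁.reg .sg = g := by rw [hσ₁]; simp [accumInit, den, Op.eval, hp, hw, hfl', hz, hg]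
  have h6 : σ₁.reg .carry = g := by rw [hσ₁]; simp [accumInit, den, Op.eval, hp, hw, hfl', hz, hg]
  have h7 : σ₁.reg .pw = p + 1 := by rw [hσ₁]; simp [accumInit, den, Op.eval, hp]
  have main := loop_induction' (tapes := tapes) (ω := ω) (i := .lB) (x := S)
    (s := accumBit τ ;; accumDigit mult)
    (fun k τ' => τ'.reg .pw = p + 1 + 2 * k ∧ (∀ j ≥ k, τ'.arr .acc j = σ.arr .acc j) ∧
      (∀ j < k, τ'.arr .acc j < 2) ∧
      (∑ j ∈ range k, 2 ^ j * τ'.arr .acc j) + 2 ^ k * τ'.reg .carry =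
      σ.reg mult * (∑ j ∈ range k, 2 ^ j * (σ.arr .acc j % 2)) +
      (∑ j ∈ range k, 2 ^ j * ((g + f j) % 2) + g)) σ₁
    (by simp [h7, h6, h3]) ?_
  swap
  · rintro k hk τ' hi hr ha ⟨i1, i2, i3, i4⟩
    have hcnt := (hr .cnt rfl (by decide)).trans h4
    have hsg := (hr .sg rfl (by decide)).trans h5
    have hmult : τ'.reg mult = σ.reg mult :=
      (hr mult (by simp [wr, hm.2.2]) (by tauto)).trans h2
    obtain ⟨τ'', hτ''⟩ : ∃ s, s = (accumBit τ).den tapes ω τ' := ⟨_, rfl⟩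
    have hcarry : τ''.reg .carry = τ'.reg .carry + (g + f k) % 2 := by
      simp only [hτ'', accumBit, den, Op.eval, setR_reg, reduceCtorEq, if_false, if_true, hcnt, hi,
        hfdef, List.getD_eq_getElem?_getD, hw, i1]
      by_cases hlt : k < dcount w p
      · rw [if_neg (by omega), if_pos hlt]
        simp only [den, List.getD_eq_getElem?_getD, hw, setR_reg, if_true, i1, reduceCtorEq,
          if_false, hsg, tbit]
        rw [show p + 1 + 2 * k = p + 2 * k + 1 by ring]
      · rw [if_pos (by omega), if_neg hlt]
        simp [den, Op.eval, hsg]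
    have hmult' : τ''.reg mult = σ.reg mult := by rw [hτ'', den_reg hm.2.2.1, hmult]
    have hacc : τ''.arr .acc = τ'.arr .acc := by rw [hτ'', den_arr rfl τ']
    have hlB : τ''.reg .lB = k := by rw [hτ'', den_reg rfl τ', hi]
    have hpw : τ''.reg .pw = p + 1 + 2 * k := by rw [hτ'', den_reg rfl τ', i1]
    simp only [den]
    rw [← hτ'']
    simp only [accumDigit, den, Op.eval, setR_reg, setR_arr, setA_reg, setA_arr, hlB, hacc, hpw,
      hcarry, hmult', if_true, reduceCtorEq, if_false, if_neg hme.1, if_neg hme.2.1, i2 k le_rfl,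
      true_and]
    refine ⟨by ring, fun j hj => ?_, fun j hj => ?_, ?_⟩
    · rw [if_neg (by omega)]; exact i2 j (by omega)
    · split_ifs with hjk
      · exact Nat.mod_lt _ two_pos
      · exact i3 j (by omega)
    · rw [sum_range_succ, sum_range_succ, sum_range_succ, if_pos rfl,
        sum_congr rfl fun j hj => by rw [if_neg (mem_range.1 hj).ne], pow_succ]
      have hdm := Nat.mod_add_div ((σ.arr .acc k % 2) * σ.reg mult +
        (τ'.reg .carry + (g + f k) % 2)) 2
      zify at i4 hdm ⊢
      linear_combination i4 + 2 ^ k * hdm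
  have e : σ' = (Stmt.loop .lB S (accumBit τ ;; accumDigit mult)).den tapes ω σ₁ := hσ₁ ▸ rfl
  rw [h1, ← e] at main
  obtain ⟨-, -, r1, r2⟩ := main
  refine ⟨r1, fun hle => ?_⟩
  have h3 := sum_flip_bits f hf2 g (σ.reg S) (Nat.mod_lt _ two_pos)
  have h4 : (∑ k ∈ range (σ.reg S), 2 ^ k * (f k : ℤ)) = dval w p := by
    rw [dval]
    push_cast
    rw [← sum_subset (range_subset_range.2 hle)]
    · refine sum_congr rfl fun k hk => ?_
      simp [hfdef, mem_range.1 hk]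
    · intro k _ hk
      simp only [mem_range] at hk
      simp [hfdef, hk]
  have h5 : ((-1) ^ g : ℤ) = (-1) ^ (σ.reg flip + tapeSymbol w (p - 1)) := by
    rw [hg, ← neg_one_pow_eq_pow_mod_two]
  rw [h4, h5] at h3
  zify at r2
  have h6 : (∑ j ∈ range (σ.reg S), 2 ^ j * (σ'.arr .acc j : ℤ)) ≡
      (∑ j ∈ range (σ.reg S), 2 ^ j * (σ'.arr .acc j : ℤ)) +
        2 ^ σ.reg S * σ'.reg .carry [ZMOD 2 ^ σ.reg S] := by
    rw [Int.modEq_iff_dvd]; exact ⟨σ'.reg .carry, by ring⟩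
  refine h6.trans ?_
  rw [r2]
  refine Int.ModEq.add (by push_cast; rfl) ?_
  push_cast at h3 ⊢
  exact h3

/-- Set register `bad` unless all digits of the number in `acc` are zero. -/
def zeroTest (S : Reg) : Stmt :=
  .loop .lB S (.load .e .acc .lB ;; .ifz .e .skip (.op .bad (.const 1)))

lemma zeroTest_spec (S : Reg) (σ : State) (V : ℤ) (hb : ∀ j < σ.reg S, σ.arr .acc j < 2)
    (hV : (∑ j ∈ range (σ.reg S), 2 ^ j * (σ.arr .acc j : ℤ)) ≡ V [ZMOD 2 ^ σ.reg S])
    (hlt : V.natAbs < 2 ^ σ.reg S) :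
    ((zeroTest S).den tapes ω σ).reg .bad = 0 ↔ σ.reg .bad = 0 ∧ V = 0 := by
  have h1 : ((zeroTest S).den tapes ω σ).reg .bad = 0 ↔
      σ.reg .bad = 0 ∧ ∀ j < σ.reg S, σ.arr .acc j = 0 := by
    refine loop_induction' (i := .lB) (x := S) (s := _)
      (fun k τ => τ.reg .bad = 0 ↔ σ.reg .bad = 0 ∧ ∀ j < k, σ.arr .acc j = 0) σ (by simp) ?_
    rintro k - τ hi hr ha h1
    simp only [den, setR_reg, if_true, ha .acc rfl, hi, Nat.forall_lt_succ_right, reduceCtorEq,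
      if_false]
    by_cases h : σ.arr .acc k = 0
    · simp [h, h1]
    · simp [h, Op.eval]
  rw [h1]
  refine and_congr_right fun _ => ⟨fun h => ?_, fun h => ?_⟩
  · rw [sum_eq_zero fun j hj => by rw [h j (mem_range.1 hj)]; simp] at hV
    have := Int.modEq_zero_iff_dvd.1 hV.symm
    exact Int.eq_zero_of_abs_lt_dvd this (by rw [Int.abs_eq_natAbs]; exact_mod_cast hlt)
  · subst h
    intro j hj
    have h2 : (∑ j ∈ range (σ.reg S), 2 ^ j * (σ.arr .acc j % 2)) < 2 ^ σ.reg S :=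
      sum_bits_lt _ (fun k => Nat.mod_lt _ two_pos) _
    have h3 : (∑ j ∈ range (σ.reg S), 2 ^ j * (σ.arr .acc j % 2)) =
        ∑ j ∈ range (σ.reg S), 2 ^ j * σ.arr .acc j :=
      sum_congr rfl fun j hj => by rw [Nat.mod_eq_of_lt (hb j (mem_range.1 hj))]
    have h4 := Int.modEq_zero_iff_dvd.1 hV
    have h5 : 2 ^ σ.reg S ∣ ∑ j ∈ range (σ.reg S), 2 ^ j * σ.arr .acc j := by
      exact_mod_cast h4
    have h6 := Nat.eq_zero_of_dvd_of_lt h5 (h3 ▸ h2)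
    have := (sum_eq_zero_iff.1 h6) j (mem_range.2 hj)
    simpa using this

/-- Count the binary digits of `y` in `x` steps; `y` is destroyed. -/
def sizeLoop (c y x : Reg) : Stmt :=
  .op c (.const 0) ;; .loop .jB x (.ifz y .skip (.op y (.half y) ;; .op c (.addc c 1)))

lemma sizeLoop_spec (c y x : Reg) (hcy : c ≠ y) (hy : y ≠ .jB) (hc : c ≠ .jB) (hcx : c ≠ x)
    (σ : State) (hx : (σ.reg y).size ≤ σ.reg x) :
    ((sizeLoop c y x).den tapes ω σ).reg c = (σ.reg y).size := by
  have h := loop_induction' (tapes := tapes) (ω := ω) (i := .jB) (x := x)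
    (s := .ifz y .skip (.op y (.half y) ;; .op c (.addc c 1)))
    (fun k τ => τ.reg y = σ.reg y / 2 ^ k ∧ τ.reg c = min k (σ.reg y).size) (σ.setR c 0)
    (by simp [hcy.symm, hy, hc]) ?_
  · rw [State.setR_reg, if_neg hcx.symm] at h
    rw [min_eq_right hx] at h
    exact h.2
  · rintro k - τ hi hr ha ⟨h1, h2⟩
    simp only [den, Op.eval]
    have hk : σ.reg y / 2 ^ k = 0 ↔ (σ.reg y).size ≤ k := by
      rw [Nat.div_eq_zero_iff_lt (by positivity), Nat.size_le]
    split_ifs with h0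
    · simp only [den, State.setR_reg, if_neg hy, if_neg hc, h1, h2]
      rw [h1] at h0
      have := hk.1 h0
      refine ⟨?_, by omega⟩
      rw [pow_succ, ← Nat.div_div_eq_div_mul, h0]
    · simp only [den, State.setR_reg, if_neg hy, if_neg hc, h1, h2, if_true, if_neg hcy,
        if_neg hcy.symm]
      rw [h1, hk] at h0
      refine ⟨?_, by omega⟩
      rw [pow_succ, ← Nat.div_div_eq_div_mul]

end RAM

/-! ### The identities behind the determinant certificate -/

namespace DetCert

open Finset RAM Matrix

/-- The position of the `j`-th matrix in a certificate. The integers of a certificate are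
`X`, the `n` entries of a diagonal matrix `D`, and the following `2n × 2n`-matrices, row by row:
`N = [M T; Q Y]`, `[W 0; 0 0]`, `R₀, P₀, R₁, P₁, …, R_K`, `A₀, A₁, A₂, A₃`, `Z`. -/
def off (n j : ℕ) : ℕ := n + 1 + j * ((n + n) * (n + n))

/-- The number of squaring steps. -/
def depth (n : ℕ) : ℕ := n.size + 4

/-- The first `n` entries of a vector, followed by zeros. -/
def trunc {R : Type*} [CommRing R] (n : ℕ) (y : ℕ → R) (i : ℕ) : R := if i < n then y i else 0

section

variable {R S : Type*} [CommRing R] [CommRing S]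

/-- The product of the `j`-th matrix of a certificate with a vector. -/
def mat (n : ℕ) (c : ℕ → R) (j : ℕ) (y : ℕ → R) : ℕ → R := mv (n + n) c (off n j) y

/-- The product of all the matrices that show that `det N` is a square modulo `3`. -/
def squares (n : ℕ) (c : ℕ → R) (y : ℕ → R) : ℕ → R :=
  let f := fun l y => mat n c (3 + 2 * depth n + l) (mat n c (3 + 2 * depth n + l) y)
  f 3 (f 2 (f 1 (f 0 y)))

/-- The linear identities of a certificate, applied to a vector `v`. The first one is
`[W D] N = [0 1]`. The others, which involve the multiple `d v` of `v` only and so are void if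
`d = 0`, are `R₀ = 1`, `R_k ^ 2 = N P_k + X R_{k+1}`, `R_K = 0`,
and `N A₃² A₂² A₁² A₀² = 1 + 3 Z`. -/
structure LinCheck (n : ℕ) (c : ℕ → R) (d : R) (v : ℕ → R) : Prop where
  diag : ∀ i < n, mat n c 1 (trunc n (mat n c 0 v)) i + c (1 + i) * mat n c 0 v (n + i) = v (n + i)
  init : ∀ i < n + n, mat n c 2 (fun j => d * v j) i = d * v i
  step : ∀ k < depth n, ∀ i < n + n,
    mat n c (2 + 2 * k) (mat n c (2 + 2 * k) fun j => d * v j) i =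
      mat n c 0 (mat n c (3 + 2 * k) fun j => d * v j) i +
        c 0 * mat n c (4 + 2 * k) (fun j => d * v j) i
  last : ∀ i < n + n, mat n c (2 + 2 * depth n) (fun j => d * v j) i = 0
  square : ∀ i < n + n, mat n c 0 (squares n c fun j => d * v j) i =
    d * v i + 3 * mat n c (7 + 2 * depth n) (fun j => d * v j) i

/-- All the identities of a certificate, applied to a vector `v`. -/
structure RoundCheck (n : ℕ) (c : ℕ → R) (d : R) (v : ℕ → R) : Prop extends LinCheck n c d v where
  prod : ∏ i ∈ range n, c (1 + i) = d

lemma mat_congr (n : ℕ) (c : ℕ → R) (j : ℕ) {y y' : ℕ → R} (h : ∀ i < n + n, y i = y' i)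
    (i : ℕ) : mat n c j y i = mat n c j y' i := by
  simp only [mat, mv]
  exact sum_congr rfl fun l hl => by rw [h l (mem_range.1 hl)]

lemma mat_sub (n : ℕ) (c : ℕ → R) (j : ℕ) (y y' : ℕ → R) :
    (mat n c j fun i => y i - y' i) = fun i => mat n c j y i - mat n c j y' i := by
  funext i
  simp [mat, mv, mul_sub]

lemma mat_smul (n : ℕ) (c : ℕ → R) (j : ℕ) (a : R) (y : ℕ → R) :
    (mat n c j fun i => a * y i) = fun i => a * mat n c j y i := by
  funext i
  simp only [mat, mv, mul_sum]
  exact sum_congr rfl fun _ _ => by ring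

lemma squares_sub (n : ℕ) (c : ℕ → R) (y y' : ℕ → R) :
    (squares n c fun i => y i - y' i) = fun i => squares n c y i - squares n c y' i := by
  simp only [squares, mat_sub]

lemma squares_smul (n : ℕ) (c : ℕ → R) (a : R) (y : ℕ → R) :
    (squares n c fun i => a * y i) = fun i => a * squares n c y i := by
  simp only [squares, mat_smul]

lemma trunc_sub (n : ℕ) (y y' : ℕ → R) :
    (trunc n fun i => y i - y' i) = fun i => trunc n y i - trunc n y' i := by
  funext i; simp only [trunc]; split_ifs <;> simp

/-- The vectors that satisfy the identities form a subspace. -/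
lemma LinCheck.sub {n : ℕ} {c : ℕ → R} {d : R} {v v' : ℕ → R} (h : LinCheck n c d v)
    (h' : LinCheck n c d v') : LinCheck n c d fun j => v j - v' j := by
  have e : (fun j => d * (v j - v' j)) = fun j => d * v j - d * v' j := by funext j; ring
  constructor
  · intro i hi
    rw [mat_sub, trunc_sub, mat_sub]
    linear_combination h.diag i hi - h'.diag i hi
  · intro i hi
    rw [e, mat_sub]
    linear_combination h.init i hi - h'.init i hi
  · intro k hk i hi
    simp only [e, mat_sub]
    linear_combination h.step k hk i hi - h'.step k hk i hi
  · intro i hi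
    simp only [e, mat_sub]
    linear_combination h.last i hi - h'.last i hi
  · intro i hi
    simp only [e, squares_sub, mat_sub]
    linear_combination h.square i hi - h'.square i hi

lemma LinCheck.congr {n : ℕ} {c : ℕ → R} {d : R} {v v' : ℕ → R} (h : LinCheck n c d v)
    (hv : ∀ i < n + n, v i = v' i) : LinCheck n c d v' := by
  have e : ∀ j, mat n c j v' = mat n c j v := fun j => funext fun i =>
    (mat_congr n c j hv i).symm
  have e' : ∀ j, (mat n c j fun i => d * v' i) = mat n c j fun i => d * v i := fun j =>
    funext fun i => (mat_congr n c j (fun i hi => by rw [hv i hi]) i).symm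
  constructor
  · intro i hi
    rw [e, h.diag i hi, hv _ (by omega)]
  · intro i hi
    rw [e', h.init i hi, hv _ hi]
  · intro k hk i hi
    simp only [e']
    exact h.step k hk i hi
  · intro i hi
    rw [e', h.last i hi]
  · intro i hi
    have := h.square i hi
    simp only [squares, e', ← hv i hi] at this ⊢
    exact this

lemma map_mat (f : R →+* S) (n : ℕ) (c : ℕ → R) (j : ℕ) (y : ℕ → R) :
    (mat n (fun k => f (c k)) j fun i => f (y i)) = fun i => f (mat n c j y i) := by
  funext i
  simp [mat, mv, map_sum]

lemma map_trunc (f : R →+* S) (n : ℕ) (y : ℕ → R) :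
    (trunc n fun i => f (y i)) = fun i => f (trunc n y i) := by
  funext i; simp only [trunc]; split_ifs <;> simp

lemma map_squares (f : R →+* S) (n : ℕ) (c : ℕ → R) (y : ℕ → R) :
    (squares n (fun k => f (c k)) fun i => f (y i)) = fun i => f (squares n c y i) := by
  simp only [squares, map_mat]

/-- The identities, with all terms on one side. -/
inductive defect (n : ℕ) (c : ℕ → R) (d : R) (v : ℕ → R) : R → Prop
  | diag (i : ℕ) (hi : i < n) : defect n c d v
      (mat n c 1 (trunc n (mat n c 0 v)) i + c (1 + i) * mat n c 0 v (n + i) - v (n + i))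
  | init (i : ℕ) (hi : i < n + n) : defect n c d v (mat n c 2 (fun j => d * v j) i - d * v i)
  | step (k : ℕ) (hk : k < depth n) (i : ℕ) (hi : i < n + n) : defect n c d v
      (mat n c (2 + 2 * k) (mat n c (2 + 2 * k) fun j => d * v j) i -
      (mat n c 0 (mat n c (3 + 2 * k) fun j => d * v j) i +
        c 0 * mat n c (4 + 2 * k) (fun j => d * v j) i))
  | last (i : ℕ) (hi : i < n + n) : defect n c d v (mat n c (2 + 2 * depth n) (fun j => d * v j) i)
  | square (i : ℕ) (hi : i < n + n) : defect n c d v (mat n c 0 (squares n c fun j => d * v j) i -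
      (d * v i + 3 * mat n c (7 + 2 * depth n) (fun j => d * v j) i))

lemma linCheck_iff (n : ℕ) (c : ℕ → R) (d : R) (v : ℕ → R) :
    LinCheck n c d v ↔ ∀ z, defect n c d v z → z = 0 := by
  constructor
  · rintro h z (⟨i, hi⟩ | ⟨i, hi⟩ | ⟨k, hk, i, hi⟩ | ⟨i, hi⟩ | ⟨i, hi⟩)
    · exact sub_eq_zero.2 (h.diag i hi)
    · exact sub_eq_zero.2 (h.init i hi)
    · exact sub_eq_zero.2 (h.step k hk i hi)
    · exact h.last i hi
    · exact sub_eq_zero.2 (h.square i hi)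
  · intro h
    exact ⟨fun i hi => sub_eq_zero.1 (h _ (.diag i hi)), fun i hi => sub_eq_zero.1 (h _ (.init i hi)),
      fun k hk i hi => sub_eq_zero.1 (h _ (.step k hk i hi)), fun i hi => h _ (.last i hi),
      fun i hi => sub_eq_zero.1 (h _ (.square i hi))⟩

lemma defect.map (f : R →+* S) {n : ℕ} {c : ℕ → R} {d : R} {v : ℕ → R} {z : R}
    (h : defect n c d v z) : defect n (fun k => f (c k)) (f d) (fun k => f (v k)) (f z) := by
  have e : (fun j => f d * f (v j)) = fun j => f (d * v j) := by funext j; simp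
  cases h with
  | diag i hi =>
    have := defect.diag (c := fun k => f (c k)) (d := f d) (v := fun k => f (v k)) i hi
    simp only [map_mat, map_trunc] at this
    simpa using this
  | init i hi =>
    have := defect.init (c := fun k => f (c k)) (d := f d) (v := fun k => f (v k)) i hi
    simp only [e, map_mat] at this
    simpa using this
  | step k hk i hi =>
    have := defect.step (c := fun k => f (c k)) (d := f d) (v := fun k => f (v k)) k hk i hi
    simp only [e, map_mat] at this
    simpa using this
  | last i hi =>
    have := defect.last (c := fun k => f (c k)) (d := f d) (v := fun k => f (v k)) i hi
    simp only [e, map_mat] at this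
    simpa using this
  | square i hi =>
    have := defect.square (c := fun k => f (c k)) (d := f d) (v := fun k => f (v k)) i hi
    simp only [e, map_mat, map_squares] at this
    simpa [map_ofNat] using this

lemma RoundCheck.map (f : R →+* S) {n : ℕ} {c : ℕ → R} {d : R} {v : ℕ → R}
    (h : RoundCheck n c d v) : RoundCheck n (fun k => f (c k)) (f d) fun k => f (v k) := by
  have e : (fun j => f d * f (v j)) = fun j => f (d * v j) := by funext j; simp
  refine ⟨⟨fun i hi => ?_, fun i hi => ?_, fun k hk i hi => ?_, fun i hi => ?_, fun i hi => ?_⟩, ?_⟩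
  · have := congr_arg f (h.diag i hi)
    simp only [map_mat, map_trunc]
    simpa using this
  · have := congr_arg f (h.init i hi)
    simp only [e, map_mat]
    simpa using this
  · have := congr_arg f (h.step k hk i hi)
    simp only [e, map_mat]
    simpa using this
  · have := congr_arg f (h.last i hi)
    simp only [e, map_mat]
    simpa using this
  · have := congr_arg f (h.square i hi)
    simp only [e, map_mat, map_squares]
    simpa [map_ofNat] using this
  · have := congr_arg f h.prod
    simpa using this

end

/-! #### Integer identities determine the determinant -/

/-- If `1 = N C` can be reached by squaring from `R₀ = 1`, then `N` is invertible. -/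
lemma exists_mul_eq_one {m : Type*} [Fintype m] [DecidableEq m] (N : Matrix m m ℤ) (X : ℤ)
    (R P : ℕ → Matrix m m ℤ) (K : ℕ) (h0 : R 0 = 1)
    (hs : ∀ k < K, R k * R k = N * P k + X • R (k + 1)) (hK : R K = 0) : ∃ C, N * C = 1 := by
  have H : ∀ k ≤ K, ∃ (C : Matrix m m ℤ) (a : ℤ), 1 = N * C + a • R k := by
    intro k
    induction k with
    | zero => exact fun _ => ⟨0, 1, by simp [h0]⟩
    | succ k ih =>
      intro hk
      obtain ⟨C, a, h⟩ := ih (by omega)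
      refine ⟨C + C - C * (N * C) + (a * a) • P k, a * a * X, ?_⟩
      have e1 : a • R k = 1 - N * C := by rw [eq_sub_iff_add_eq, add_comm]; exact h.symm
      have e2 : (a * a) • (R k * R k) = (1 - N * C) * (1 - N * C) := by
        rw [← e1, smul_mul_smul_comm]
      rw [hs k (by omega), smul_add, smul_smul] at e2
      have e3 : (a * a * X) • R (k + 1) =
          (1 - N * C) * (1 - N * C) - (a * a) • (N * P k) := by
        rw [← e2]; abel
      rw [e3]
      simp only [mul_add, mul_sub, sub_mul, one_mul, mul_one, Matrix.mul_smul, Matrix.mul_assoc]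
      abel
  obtain ⟨C, a, h⟩ := H K le_rfl
  exact ⟨C, by rw [h, hK]; simp⟩

/-- A matrix over `ℤ` with determinant `± 1` whose product with squares is `1` modulo `3` has
determinant `1`. -/
lemma det_eq_one_of_squares {m : Type*} [Fintype m] [DecidableEq m] (N A Z : Matrix m m ℤ)
    (hu : ∃ C, N * C = 1) (a : ℤ) (hA : A.det = a * a) (h : N * A = 1 + (3 : ℤ) • Z) :
    N.det = 1 := by
  obtain ⟨C, hC⟩ := hu
  have h1 : IsUnit N.det := IsUnit.of_mul_eq_one C.det (by rw [← det_mul, hC, det_one])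
  have h2 : ((N * A).det : ZMod 3) = 1 := by
    rw [h]
    have := RingHom.map_det (Int.castRingHom (ZMod 3)) (1 + (3 : ℤ) • Z)
    rw [eq_intCast] at this
    rw [this]
    have e : (Int.castRingHom (ZMod 3)).mapMatrix (1 + (3 : ℤ) • Z) = 1 := by
      rw [map_add, map_one, map_zsmul]
      have : (3 : ℤ) • ((Int.castRingHom (ZMod 3)).mapMatrix Z) = 0 := by
        ext i j
        simp only [Matrix.smul_apply, zsmul_eq_mul, Matrix.zero_apply]
        rw [show (((3 : ℤ)) : ZMod 3) = 0 from rfl, zero_mul]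
      rw [this, add_zero]
    rw [e, det_one]
  rcases Int.isUnit_iff.1 h1 with h3 | h3
  · exact h3
  · rw [det_mul, hA, h3] at h2
    push_cast at h2
    generalize (a : ZMod 3) = x at h2
    have : ∀ x : ZMod 3, -1 * (x * x) ≠ 1 := by decide
    exact absurd h2 (this x)

/-- The matrix that is stored in a sequence of integers from position `o` on. -/
def blk (n : ℕ) (c : ℕ → ℤ) (j : ℕ) : IntMat (n + n) :=
  .of fun i l => c (off n j + i * (n + n) + l)

lemma mat_eq_mulVec (n : ℕ) (c : ℕ → ℤ) (j : ℕ) (y : ℕ → ℤ) (i : Fin (n + n)) :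
    mat n c j y i = (blk n c j *ᵥ fun l => y l) i := by
  simp [mat, mv, mulVec, dotProduct, sum_range, blk]

/-- The unit vectors. -/
def unitVec (j i : ℕ) : ℤ := if i = j then 1 else 0

lemma mulVec_unitVec {n : ℕ} (A : IntMat (n + n)) (a : ℤ)
    (i j : Fin (n + n)) : (A *ᵥ fun l => a * unitVec j l) i = a * A i j := by
  simp [mulVec, dotProduct, unitVec, Fin.val_inj, mul_comm]

/-- The identities, for a nonzero determinant `d`, in terms of matrices. -/
lemma det_eq_one_of_linCheck {n : ℕ} {c : ℕ → ℤ} {d : ℤ} (hd : d ≠ 0)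
    (h : ∀ j < n + n, LinCheck n c d (unitVec j)) : (blk n c 0).det = 1 := by
  have e : ∀ k (y : ℕ → ℤ), (fun i : Fin (n + n) => mat n c k y i) = blk n c k *ᵥ fun l => y l :=
    fun k y => funext (mat_eq_mulVec n c k y)
  have e2 : ∀ (A B : IntMat (n + n)), (∀ i j : Fin (n + n),
      (A *ᵥ fun l => d * unitVec j l) i = (B *ᵥ fun l => d * unitVec j l) i) → A = B := by
    intro A B hAB
    ext i j
    have := hAB i j
    rw [mulVec_unitVec, mulVec_unitVec] at this
    exact mul_left_cancel₀ hd this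
  set v : ℕ → ℕ → ℤ := fun j l => d * unitVec j l with hv
  have h0 : blk n c 2 = 1 := by
    refine e2 _ _ fun i j => ?_
    rw [← mat_eq_mulVec n c 2 (v j), one_mulVec]
    exact (h j j.2).init i i.2
  have hs : ∀ k < depth n, blk n c (2 + 2 * k) * blk n c (2 + 2 * k) =
      blk n c 0 * blk n c (3 + 2 * k) + c 0 • blk n c (2 + 2 * (k + 1)) := by
    intro k hk
    refine e2 _ _ fun i j => ?_
    have := (h j j.2).step k hk i i.2
    rw [mat_eq_mulVec, mat_eq_mulVec, mat_eq_mulVec, e, e] at this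
    rw [← mulVec_mulVec, add_mulVec, ← mulVec_mulVec, smul_mulVec,
      show 2 + 2 * (k + 1) = 4 + 2 * k by ring]
    exact this
  have hK : blk n c (2 + 2 * depth n) = 0 := by
    refine e2 _ _ fun i j => ?_
    rw [← mat_eq_mulVec n c _ (v j), zero_mulVec]
    exact (h j j.2).last i i.2
  have hu := exists_mul_eq_one (blk n c 0) (c 0) (fun k => blk n c (2 + 2 * k))
    (fun k => blk n c (3 + 2 * k)) (depth n) h0 hs hK
  set A : ℕ → IntMat (n + n) := fun l => blk n c (3 + 2 * depth n + l)
  refine det_eq_one_of_squares (blk n c 0)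
    (A 3 * (A 3 * (A 2 * (A 2 * (A 1 * (A 1 * (A 0 * A 0)))))))
    (blk n c (7 + 2 * depth n)) hu ((A 3).det * (A 2).det * (A 1).det * (A 0).det)
    (by simp only [det_mul]; ring) ?_
  refine e2 _ _ fun i j => ?_
  have := (h j j.2).square i i.2
  simp only [squares] at this
  rw [mat_eq_mulVec, mat_eq_mulVec, e, e, e, e, e, e, e, e] at this
  rw [add_mulVec, one_mulVec, smul_mulVec]
  simp only [← mulVec_mulVec]
  exact this

/-- Integers that satisfy all the identities certify a determinant. -/
lemma det_eq_of_roundCheck {n : ℕ} {c : ℕ → ℤ} {d : ℤ} (M : IntMat n)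
    (hM : ∀ i j : Fin n, c (1 + n + i * (n + n) + j) = M i j)
    (hp : ∏ i ∈ range n, c (1 + i) = d)
    (h : ∀ j < n + n, LinCheck n c d (unitVec j)) : M.det = d := by
  set D : IntMat n := diagonal fun i => c (1 + i) with hD
  set N : Matrix (Fin n ⊕ Fin n) (Fin n ⊕ Fin n) ℤ :=
    (blk n c 0).submatrix finSumFinEquiv finSumFinEquiv with hN
  set W : IntMat n := (blk n c 1).submatrix (Fin.castAdd n) (Fin.castAdd n) with hW
  have hdN : N.det = (blk n c 0).det := det_submatrix_equiv_self _ _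
  have hM' : N.toBlocks₁₁ = M := by
    ext i j
    rw [← hM i j]
    simp [hN, toBlocks₁₁, blk, off, add_comm 1 n]
  have hdD : D.det = d := by rw [hD, det_diagonal, ← hp, prod_range]
  have key : ∀ j i, (W * N.toBlocks₁₁ + D * N.toBlocks₂₁) i j = 0 ∧
      (W * N.toBlocks₁₂ + D * N.toBlocks₂₂) i j = (1 : IntMat n) i j := by
    have aux : ∀ (j : Fin (n + n)) (i : Fin n), ∑ k : Fin n, W i k * blk n c 0 (Fin.castAdd n k) j +
        c (1 + i) * blk n c 0 (Fin.natAdd n i) j = if (n + i : ℕ) = j then 1 else 0 := by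
      intro j i
      have h1 := (h j j.2).diag i i.2
      have h2 : ∀ k : Fin (n + n), mat n c 0 (unitVec j) k = blk n c 0 k j := by
        intro k
        rw [mat_eq_mulVec]
        have := mulVec_unitVec (blk n c 0) 1 k j
        simpa only [one_mul] using this
      have h3 : mat n c 0 (unitVec j) (n + i) = blk n c 0 (Fin.natAdd n i) j :=
        h2 (Fin.natAdd n i)
      rw [h3, show ((i : ℕ)) = ((Fin.castAdd n i : Fin (n + n)) : ℕ) from rfl, mat_eq_mulVec] at h1
      rw [mulVec, dotProduct, Fin.sum_univ_add] at h1
      simp only [trunc, Fin.val_castAdd, Fin.val_natAdd, Fin.is_lt, if_true] at h1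
      rw [sum_eq_zero (s := univ) (f := fun x : Fin n => _ * if n + (x : ℕ) < n then _
        else _) (fun x _ => by simp), add_zero] at h1
      rw [← show unitVec j (n + i) = if (n + i : ℕ) = j then 1 else 0 from rfl, ← h1]
      congr 1
      exact sum_congr rfl fun k _ => by rw [← h2]; rfl
    intro j i
    constructor
    · have := aux (Fin.castAdd n j) i
      rw [if_neg (by simp; omega)] at this
      rw [← this]
      simp [mul_apply, hN, toBlocks₁₁, toBlocks₂₁, hD, diagonal_apply]
    · have := aux (Fin.natAdd n j) i
      rw [one_apply]
      simp only [Fin.val_natAdd, add_right_inj, Fin.val_inj] at this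
      rw [← this]
      simp [mul_apply, hN, toBlocks₁₂, toBlocks₂₂, hD, diagonal_apply]
  have h1 : W * N.toBlocks₁₁ + D * N.toBlocks₂₁ = 0 := by ext i j; exact (key j i).1
  have h2 : W * N.toBlocks₁₂ + D * N.toBlocks₂₂ = 1 := by ext i j; exact (key j i).2
  have h3 : fromBlocks 1 0 W D * N = fromBlocks M N.toBlocks₁₂ 0 1 := by
    conv_lhs => rw [← fromBlocks_toBlocks N, fromBlocks_multiply]
    rw [h1, h2, hM']
    simp
  have h4 := congr_arg det h3
  rw [det_mul, det_fromBlocks_zero₁₂, det_fromBlocks_zero₂₁, det_one, one_mul, mul_one, hdD,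
    hdN] at h4
  by_cases hd : d = 0
  · rw [← h4, hd, zero_mul]
  · rw [← h4, det_eq_one_of_linCheck hd h, mul_one]

end DetCert

/-! ### The certificate of invertibility -/

namespace DetCert

open Finset RAM Matrix

/-- The quotient for division of all entries with remainders of least absolute value. -/
def mdiv {m : Type*} (H : ℤ) (A : Matrix m m ℤ) : Matrix m m ℤ := .of fun i j => (A i j + H) / (2 * H)

/-- The remainders of least absolute value. -/
def mrem {m : Type*} (H : ℤ) (A : Matrix m m ℤ) : Matrix m m ℤ := .of fun i j => (A i j + H) % (2 * H) - H

lemma mrem_add {m : Type*} (H : ℤ) (A : Matrix m m ℤ) : A = mrem H A + (2 * H) • mdiv H A := by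
  ext i j
  have := Int.emod_add_mul_ediv (A i j + H) (2 * H)
  simp only [mrem, mdiv, Matrix.add_apply, Matrix.smul_apply, of_apply, smul_eq_mul]
  linarith

lemma abs_mrem_le {m : Type*} {H : ℤ} (hH : 0 < H) (A : Matrix m m ℤ) (i j : m) : |mrem H A i j| ≤ H := by
  have h1 := Int.emod_nonneg (A i j + H) (show 2 * H ≠ 0 by omega)
  have h2 := Int.emod_lt_of_pos (A i j + H) (show 0 < 2 * H by omega)
  rw [abs_le]
  simp only [mrem, of_apply]
  constructor <;> linarith

section

variable {m : Type*} [Fintype m] [DecidableEq m]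

lemma abs_mul_apply_le {l : Type*} [Fintype l] {p q : Type*} (A : Matrix p l ℤ) (B : Matrix l q ℤ)
    (a b : ℤ) (i : p) (j : q) (hA : ∀ k, |A i k| ≤ a) (hB : ∀ k, |B k j| ≤ b) :
    |(A * B) i j| ≤ Fintype.card l * (a * b) := by
  rw [mul_apply]
  refine (abs_sum_le_sum_abs _ _).trans ?_
  refine (sum_le_card_nsmul _ _ (a * b) fun k _ => ?_).trans (by simp)
  rw [abs_mul]
  exact mul_le_mul (hA k) (hB k) (abs_nonneg _) ((abs_nonneg _).trans (hA k))

lemma abs_det_le (A : Matrix m m ℤ) (b : ℤ) (hA : ∀ i j, |A i j| ≤ b) :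
    |A.det| ≤ (Fintype.card m * b) ^ Fintype.card m := by
  have h := det_le (R := ℤ) (S := ℤ) (A := A) (abv := AbsoluteValue.abs) (x := b) hA
  simp only [AbsoluteValue.abs_apply, nsmul_eq_mul] at h
  refine h.trans ?_
  rcases Nat.eq_zero_or_pos (Fintype.card m) with h0 | h0
  · simp [h0]
  · haveI : Nonempty m := Fintype.card_pos_iff.1 h0
    have hb : 0 ≤ b := (abs_nonneg _).trans (hA (Classical.arbitrary m) (Classical.arbitrary m))
    rw [mul_pow]
    refine mul_le_mul_of_nonneg_right ?_ (by positivity)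
    exact_mod_cast Nat.factorial_le_pow _

/-- The inverse of an integer matrix of determinant `± 1` is not too large. -/
lemma abs_inv_le (N Ni : Matrix m m ℤ) (hN : N * Ni = 1) (b : ℤ) (hb : 1 ≤ b)
    (h : ∀ i j, |N i j| ≤ b) (i j : m) : |Ni i j| ≤ (Fintype.card m * b) ^ Fintype.card m := by
  have h1 : N.adjugate = N.det • Ni := by
    calc N.adjugate = N.adjugate * (N * Ni) := by rw [hN, mul_one]
      _ = N.det • Ni := by rw [← mul_assoc, adjugate_mul, smul_mul, one_mul]
  have h2 : IsUnit N.det := IsUnit.of_mul_eq_one Ni.det (by rw [← det_mul, hN, det_one])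
  have h3 : |Ni i j| = |N.adjugate i j| := by
    rw [h1, Matrix.smul_apply, smul_eq_mul, abs_mul]
    rcases Int.isUnit_iff.1 h2 with h3 | h3 <;> simp [h3]
  rw [h3, adjugate_apply]
  refine abs_det_le _ b fun k l => ?_
  rw [updateRow_apply]
  split_ifs
  · rw [Pi.single_apply]; split_ifs <;> simp <;> omega
  · exact h k l

/-- The residues that occur when `N⁻¹` is expanded in powers of `2 H` by repeated squaring. -/
def residue (N Ni : Matrix m m ℤ) (H : ℤ) : ℕ → Matrix m m ℤ
  | 0 => 1
  | k + 1 => N * mdiv H (Ni * (residue N Ni H k * residue N Ni H k))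

/-- A matrix `N` of determinant `± 1` has a short certificate of invertibility: the expansion of
`N⁻¹` in powers of a number `X` that is larger than the entries of `N`, which terminates after
logarithmically many squaring steps as `N⁻¹` is integral. -/
lemma exists_chain (N Ni : Matrix m m ℤ) (hN : N * Ni = 1) (b : ℤ) (hb : 1 ≤ b)
    (h : ∀ i j, |N i j| ≤ b) (K : ℕ) (hK : Fintype.card m < 2 ^ K) :
    ∃ R P : ℕ → Matrix m m ℤ, R 0 = 1 ∧
      (∀ k, R k * R k = N * P k + (8 * (Fintype.card m : ℤ) ^ 2 * b) • R (k + 1)) ∧ R K = 0 ∧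
      ∀ k i j, |R k i j| ≤ 8 * (Fintype.card m : ℤ) ^ 2 * b ∧
        |P k i j| ≤ 8 * (Fintype.card m : ℤ) ^ 2 * b := by
  rcases isEmpty_or_nonempty m with he | hne
  · exact ⟨fun _ => 1, fun _ => 0, rfl, fun k => Subsingleton.elim _ _, Subsingleton.elim _ _,
      fun k i => isEmptyElim i⟩
  set d : ℕ := Fintype.card m with hd
  have hd1 : (1 : ℤ) ≤ d := by exact_mod_cast Fintype.card_pos
  set H : ℤ := 4 * (d : ℤ) ^ 2 * b with hH
  have hX : 8 * (d : ℤ) ^ 2 * b = 2 * H := by rw [hH]; ring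
  have hH1 : 1 ≤ H := by rw [hH]; nlinarith [mul_le_mul hd1 hd1 (by omega) (by omega)]
  rw [hX]
  have hNi : Ni * N = 1 := mul_eq_one_comm.1 hN
  set R := residue N Ni H with hR
  set P : ℕ → Matrix m m ℤ := fun k => mrem H (Ni * (R k * R k)) with hP
  have hs : ∀ k, R k * R k = N * P k + (2 * H) • R (k + 1) := by
    intro k
    calc R k * R k = N * (Ni * (R k * R k)) := by rw [← Matrix.mul_assoc, hN, one_mul]
      _ = N * (P k + (2 * H) • mdiv H (Ni * (R k * R k))) := by rw [hP, ← mrem_add]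
      _ = _ := by rw [Matrix.mul_add, Matrix.mul_smul]; rfl
  have hPb : ∀ k i j, |P k i j| ≤ H := fun k i j => abs_mrem_le (by omega) _ i j
  -- division by `2 H` compensates for the growth of the entries by squaring
  have hRb : ∀ k i j, |R k i j| ≤ d * b := by
    intro k
    induction k with
    | zero =>
      intro i j
      have : (1 : ℤ) ≤ d * b := by nlinarith
      simp only [hR, residue, Matrix.one_apply]
      split_ifs <;> simp <;> omega
    | succ k ih =>
      intro i j
      have h1 : 2 * H * |R (k + 1) i j| ≤ 2 * H * (d * b) := by
        have e : 2 * H * R (k + 1) i j = (R k * R k) i j - (N * P k) i j := by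
          rw [hs k]; simp only [Matrix.add_apply, Matrix.smul_apply, smul_eq_mul]; ring
        rw [← abs_of_pos (show 0 < 2 * H by omega), ← abs_mul, e,
          abs_of_pos (show 0 < 2 * H by omega)]
        have e1 := abs_mul_apply_le (R k) (R k) _ _ i j (ih i) fun k => ih k j
        have e2 := abs_mul_apply_le N (P k) _ _ i j (h i) fun l => hPb k l j
        have e3 := abs_sub ((R k * R k) i j) ((N * P k) i j)
        have e4 : (d : ℤ) * (d * b * (d * b)) + d * (b * H) ≤ 2 * H * (d * b) := by
          have : 0 ≤ (d : ℤ) ^ 3 * b ^ 2 := by positivity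
          rw [hH]; nlinarith
        linarith
      exact le_of_mul_le_mul_left h1 (by omega)
  -- the partial sums of the expansion
  set a : ℕ → ℤ := fun k => (2 * H) ^ (2 ^ k - 1) with ha
  have ha1 : ∀ k, 1 ≤ a k := fun k => one_le_pow₀ (by omega)
  have has : ∀ k, a (k + 1) = a k * a k * (2 * H) := by
    intro k
    simp only [ha]
    rw [← pow_add, ← pow_succ]
    congr 1
    have := Nat.one_le_two_pow (n := k)
    rw [pow_succ]; omega
  have hC : ∀ k, ∃ C : Matrix m m ℤ, Ni = C + a k • (Ni * R k) ∧
      ∀ i j, 3 * |C i j| ≤ 2 * a k := by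
    intro k
    induction k with
    | zero => exact ⟨0, by simp [ha, hR, residue], fun i j => by simp [ha]⟩
    | succ k ih =>
      obtain ⟨C, h1, h2⟩ := ih
      refine ⟨C + a k • (C * R k) + (a k * a k) • P k, ?_, fun i j => ?_⟩
      · have e : (a k * a k) • (Ni * (R k * R k)) =
            (a k * a k) • P k + a (k + 1) • (Ni * R (k + 1)) := by
          rw [hs k, Matrix.mul_add, ← Matrix.mul_assoc, hNi, one_mul, smul_add, has,
            Matrix.mul_smul, smul_smul]
        have e2 : C + a k • (C * R k) + (a k * a k) • (Ni * (R k * R k)) = Ni := by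
          have : a k • (C * R k) + (a k * a k) • (Ni * (R k * R k)) = a k • (Ni * R k) := by
            conv_rhs => rw [h1, Matrix.add_mul, smul_add, Matrix.smul_mul, smul_smul,
              Matrix.mul_assoc]
          rw [add_assoc, this, ← h1]
        rw [e] at e2
        rw [add_assoc, e2]
      · simp only [Matrix.add_apply, Matrix.smul_apply, smul_eq_mul]
        have e1 : 3 * |(C * R k) i j| ≤ d * (2 * a k * (d * b)) := by
          have := abs_mul_apply_le ((3 : ℤ) • C) (R k) (2 * a k) (d * b) i j
            (fun l => by
              rw [Matrix.smul_apply, smul_eq_mul, abs_mul, abs_of_pos (by norm_num : (0 : ℤ) < 3)]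
              exact h2 i l) fun l => hRb k l j
          rwa [Matrix.smul_mul, Matrix.smul_apply, smul_eq_mul, abs_mul,
            abs_of_pos (by norm_num : (0 : ℤ) < 3)] at this
        have e2 := h2 i j
        have e3 := hPb k i j
        have e4 : |C i j + a k * (C * R k) i j + a k * a k * P k i j| ≤
            |C i j| + a k * |(C * R k) i j| + a k * a k * |P k i j| := by
          refine (abs_add_le _ _).trans (add_le_add ((abs_add_le _ _).trans (add_le_add le_rfl ?_))
            ?_)
          · rw [abs_mul, abs_of_pos (by linarith [ha1 k])]
          · rw [abs_mul, abs_of_pos (mul_pos (by linarith [ha1 k]) (by linarith [ha1 k]))]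
        have e5 : a k * (3 * |(C * R k) i j|) ≤ a k * (d * (2 * a k * (d * b))) :=
          mul_le_mul_of_nonneg_left e1 (by linarith [ha1 k])
        have e6 : a k * a k * |P k i j| ≤ a k * a k * H :=
          mul_le_mul_of_nonneg_left e3 (by nlinarith [ha1 k])
        have e7 : a k ≤ a k * a k * (d ^ 2 * b) := by
          have h1 : (1 : ℤ) ≤ d ^ 2 * b := by nlinarith [mul_le_mul hd1 hd1 (by omega) (by omega)]
          have h2 : a k * 1 ≤ a k * a k := mul_le_mul_of_nonneg_left (ha1 k) (by linarith [ha1 k])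
          have h3 : a k * a k * 1 ≤ a k * a k * (d ^ 2 * b) :=
            mul_le_mul_of_nonneg_left h1 (by nlinarith [ha1 k])
          linarith
        rw [has]
        have e8 : a k * a k * (2 * H) = 8 * (a k * a k * (d ^ 2 * b)) := by rw [hH]; ring
        have e9 : a k * a k * H = 4 * (a k * a k * (d ^ 2 * b)) := by rw [hH]; ring
        have e10 : a k * (d * (2 * a k * (d * b))) = 2 * (a k * a k * (d ^ 2 * b)) := by ring
        linarith
  refine ⟨R, P, rfl, hs, ?_, fun k i j => ⟨(hRb k i j).trans ?_, (hPb k i j).trans (by omega)⟩⟩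
  · have hz : Ni * R K = 0 := by
      obtain ⟨C, h1, h2⟩ := hC K
      ext i j
      have e1 := abs_inv_le N Ni hN b hb h i j
      rw [← hd] at e1
      have e2 : 3 * ((d : ℤ) * b) ^ d < a K := by
        have f1 : (0 : ℤ) < (d * b) ^ d := by positivity
        have f2 : (8 * (d * b) : ℤ) ^ d ≤ (2 * H) ^ d := by
          refine pow_le_pow_left₀ (by positivity) ?_ d
          rw [hH]
          nlinarith [mul_le_mul hd1 hd1 (by omega) (by omega)]
        have f3 : (2 * H) ^ d ≤ a K := pow_le_pow_right₀ (by omega) (by omega)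
        have f4 : (8 : ℤ) ^ 1 ≤ 8 ^ d := pow_le_pow_right₀ (by norm_num) (by exact_mod_cast hd1)
        rw [mul_pow] at f2
        nlinarith
      have e3 : a K * (Ni * R K) i j = Ni i j - C i j := by
        have := congr_fun (congr_fun h1 i) j
        simp only [Matrix.add_apply, Matrix.smul_apply, smul_eq_mul] at this
        linarith
      have e4 : a K * |(Ni * R K) i j| ≤ |Ni i j| + |C i j| := by
        rw [← abs_of_pos (show 0 < a K by linarith [ha1 K]), ← abs_mul, e3]
        exact abs_sub _ _
      have e5 := h2 i j
      have e6 : |(Ni * R K) i j| < 1 := by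
        by_contra hcon
        have := mul_le_mul_of_nonneg_left (not_lt.1 hcon) (show 0 ≤ a K by linarith [ha1 K])
        linarith
      simpa using e6
    calc R K = N * (Ni * R K) := by rw [← Matrix.mul_assoc, hN, one_mul]
      _ = 0 := by rw [hz, Matrix.mul_zero]
  · rw [hH]
    nlinarith [mul_le_mul hd1 hd1 (by omega) (by omega)]

end

end DetCert

/-! ### Matrices of determinant one as products of squares modulo three -/

namespace DetCert

open Finset RAM Matrix

section

variable {F : Type*} [Field F]

lemma isNilpotent_upper {n : ℕ} (x : Matrix (Fin 1) (Fin n) F) {U : Matrix (Fin n) (Fin n) F}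
    (h : IsNilpotent (U - 1)) : IsNilpotent (fromBlocks (1 : Matrix (Fin 1) (Fin 1) F) x 0 U - 1) := by
  obtain ⟨k, hk⟩ := h
  have e : fromBlocks 1 x 0 U - 1 =
      fromBlocks (0 : Matrix (Fin 1) (Fin 1) F) x 0 (U - 1) := by
    rw [sub_eq_iff_eq_add, ← fromBlocks_one, fromBlocks_add]; simp
  have e2 : ∀ l, (fromBlocks (0 : Matrix (Fin 1) (Fin 1) F) x 0 (U - 1)) ^ (l + 1) =
      fromBlocks 0 (x * (U - 1) ^ l) 0 ((U - 1) ^ (l + 1)) := by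
    intro l
    induction l with
    | zero => simp
    | succ l ih =>
      rw [pow_succ, ih, fromBlocks_multiply, pow_succ _ (l + 1), pow_succ _ l]
      simp [Matrix.mul_assoc]
  refine ⟨k + 1, ?_⟩
  rw [e, e2, pow_succ, hk]
  simp

lemma isNilpotent_lower {n : ℕ} (y : Matrix (Fin n) (Fin 1) F) {L : Matrix (Fin n) (Fin n) F}
    (h : IsNilpotent (L - 1)) : IsNilpotent (fromBlocks (1 : Matrix (Fin 1) (Fin 1) F) 0 y L - 1) := by
  obtain ⟨k, hk⟩ := h
  have e : fromBlocks 1 0 y L - 1 =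
      fromBlocks (0 : Matrix (Fin 1) (Fin 1) F) 0 y (L - 1) := by
    rw [sub_eq_iff_eq_add, ← fromBlocks_one, fromBlocks_add]; simp
  have e2 : ∀ l, (fromBlocks (0 : Matrix (Fin 1) (Fin 1) F) 0 y (L - 1)) ^ (l + 1) =
      fromBlocks 0 0 ((L - 1) ^ l * y) ((L - 1) ^ (l + 1)) := by
    intro l
    induction l with
    | zero => simp
    | succ l ih =>
      rw [pow_succ', ih, fromBlocks_multiply, pow_succ' _ (l + 1), pow_succ' _ l]
      simp [Matrix.mul_assoc]
  refine ⟨k + 1, ?_⟩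
  rw [e, e2, pow_succ', hk]
  simp

lemma exists_inv_of_isNilpotent {n : ℕ} {U : Matrix (Fin n) (Fin n) F} (h : IsNilpotent (U - 1)) :
    ∃ V, U * V = 1 ∧ V * U = 1 := by
  have h1 := h.isUnit_one_add
  rw [add_sub_cancel] at h1
  obtain ⟨u, rfl⟩ := h1
  exact ⟨↑u⁻¹, u.mul_inv, u.inv_mul⟩

/-- Adding a multiple of the other columns to the first column, and then a multiple of the other
rows to the first row, makes the corner of a matrix of determinant `1` equal to `1`. -/
lemma exists_corner_eq_one {n : ℕ} (a : Matrix (Fin 1) (Fin 1) F) (b : Matrix (Fin 1) (Fin n) F)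
    (c : Matrix (Fin n) (Fin 1) F) (D : Matrix (Fin n) (Fin n) F)
    (h : (fromBlocks a b c D).det = 1) :
    ∃ (x : Matrix (Fin 1) (Fin n) F) (z : Matrix (Fin n) (Fin 1) F),
      a + b * z + x * (c + D * z) = 1 := by
  have key : ∀ z : Matrix (Fin n) (Fin 1) F, (∃ k, (c + D * z) k 0 ≠ 0) →
      ∃ x : Matrix (Fin 1) (Fin n) F, a + b * z + x * (c + D * z) = 1 := by
    rintro z ⟨k, hk⟩
    refine ⟨.of fun _ j => if j = k then (1 - (a + b * z) 0 0) / (c + D * z) k 0 else 0, ?_⟩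
    ext i j
    rw [Subsingleton.elim i 0, Subsingleton.elim j 0, Matrix.add_apply, Matrix.mul_apply]
    simp only [of_apply, ite_mul, zero_mul, sum_ite_eq', mem_univ, if_true]
    rw [div_mul_cancel₀ _ hk]
    simp
  by_cases hc : ∃ k, c k 0 ≠ 0
  · obtain ⟨x, hx⟩ := key 0 (by simpa using hc)
    exact ⟨x, 0, hx⟩
  · push Not at hc
    have hc0 : c = 0 := by ext i j; rw [Subsingleton.elim j 0, hc i]; rfl
    subst hc0
    rw [det_fromBlocks_zero₂₁] at h
    rcases n with _ | n
    · refine ⟨0, 0, ?_⟩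
      rw [det_isEmpty (A := D), mul_one, det_fin_one] at h
      ext i j
      rw [Subsingleton.elim i 0, Subsingleton.elim j 0]
      simpa using h
    · have hD : D.det ≠ 0 := right_ne_zero_of_mul (h ▸ one_ne_zero)
      obtain ⟨x, hx⟩ := key
        (D.adjugate * (.of fun i _ => if i = 0 then 1 else 0 : Matrix (Fin (n + 1)) (Fin 1) F)) ⟨0, by
        rw [← Matrix.mul_assoc, mul_adjugate]
        simpa using hD⟩
      exact ⟨x, _, hx⟩

/-- A matrix of determinant `1` over a field is a product of four unipotent matrices. -/
lemma exists_unipotent (n : ℕ) (g : Matrix (Fin n) (Fin n) F) (h : g.det = 1) :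
    ∃ u : Fin 4 → Matrix (Fin n) (Fin n) F, (∀ i, IsNilpotent (u i - 1)) ∧
      g = u 0 * u 1 * u 2 * u 3 := by
  induction n with
  | zero => exact ⟨fun _ => 1, fun _ => by simp, Subsingleton.elim _ _⟩
  | succ n ih =>
    -- the statement does not depend on how the rows and columns are named
    suffices H : ∀ g : Matrix (Fin 1 ⊕ Fin n) (Fin 1 ⊕ Fin n) F, g.det = 1 →
        ∃ u : Fin 4 → Matrix (Fin 1 ⊕ Fin n) (Fin 1 ⊕ Fin n) F, (∀ i, IsNilpotent (u i - 1)) ∧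
        g = u 0 * u 1 * u 2 * u 3 by
      set e : Fin 1 ⊕ Fin n ≃ Fin (n + 1) := finSumFinEquiv.trans (finCongr (add_comm 1 n))
      set f := reindexAlgEquiv F F e
      obtain ⟨u, h1, h2⟩ := H (f.symm g) (by
        rw [show f.symm g = reindexAlgEquiv F F e.symm g from rfl, det_reindexAlgEquiv, h])
      refine ⟨fun i => f (u i), fun i => ?_, ?_⟩
      · have := (h1 i).map f
        rwa [map_sub, map_one] at this
      · rw [← map_mul, ← map_mul, ← map_mul, ← h2, AlgEquiv.apply_symm_apply]
    intro g hg
    obtain ⟨a, b, c, D, rfl⟩ : ∃ a b c D, g = fromBlocks a b c D :=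
      ⟨_, _, _, _, (fromBlocks_toBlocks g).symm⟩
    -- unipotent factors make the corner `1` and then clear its row and column
    obtain ⟨x, z, hxz⟩ := exists_corner_eq_one a b c D hg
    set c' := c + D * z with hc'
    set b' := b + x * D with hb'
    have hdet : (D - c' * b').det = 1 := by
      have e : fromBlocks 1 x 0 1 * fromBlocks a b c D * fromBlocks 1 0 z 1 =
          fromBlocks 1 b' c' D := by
        simp only [fromBlocks_multiply, Matrix.one_mul, Matrix.zero_mul, Matrix.mul_one,
          Matrix.mul_zero, zero_add, add_zero]
        refine congr_arg₂ (fun s t => fromBlocks s t c' D) ?_ rfl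
        rw [← hxz, hc', Matrix.add_mul, Matrix.mul_add, Matrix.mul_assoc]
        abel
      have := congr_arg det e
      rw [det_mul, det_mul, det_fromBlocks_zero₂₁, det_fromBlocks_zero₁₂, hg,
        det_fromBlocks_one₁₁] at this
      simpa using this.symm
    obtain ⟨u, hu, hD⟩ := ih _ hdet
    obtain ⟨V, hV, -⟩ := exists_inv_of_isNilpotent (hu 0)
    obtain ⟨V', -, hV'⟩ := exists_inv_of_isNilpotent (hu 3)
    refine ⟨![fromBlocks 1 (-(x * u 0)) 0 (u 0), fromBlocks 1 0 (V * c') (u 1),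
      fromBlocks 1 (b' * V') 0 (u 2), fromBlocks 1 0 (-(u 3 * z)) (u 3)], ?_, ?_⟩
    · intro i
      fin_cases i
      · exact isNilpotent_upper _ (hu 0)
      · exact isNilpotent_lower _ (hu 1)
      · exact isNilpotent_upper _ (hu 2)
      · exact isNilpotent_lower _ (hu 3)
    · have e1 : u 0 * (V * c') = c' := by rw [← Matrix.mul_assoc, hV, Matrix.one_mul]
      have e2 : b' * V' * u 3 = b' := by rw [Matrix.mul_assoc, hV', Matrix.mul_one]
      have e3 : u 0 * u 1 * (u 2 * u 3) = D - c' * b' := by rw [hD]; simp only [Matrix.mul_assoc]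
      have f1 : fromBlocks 1 (-(x * u 0)) 0 (u 0) * fromBlocks 1 0 (V * c') (u 1) =
          fromBlocks (1 - x * c') (-(x * (u 0 * u 1))) c' (u 0 * u 1) := by
        rw [fromBlocks_multiply]
        simp only [Matrix.one_mul, Matrix.zero_mul, Matrix.mul_zero, zero_add, Matrix.neg_mul,
          Matrix.mul_assoc, e1]
        simp [sub_eq_add_neg]
      have f2 : fromBlocks 1 (b' * V') 0 (u 2) * fromBlocks 1 0 (-(u 3 * z)) (u 3) =
          fromBlocks (1 - b' * z) b' (-(u 2 * u 3 * z)) (u 2 * u 3) := by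
        rw [fromBlocks_multiply]
        simp only [Matrix.one_mul, Matrix.zero_mul, Matrix.mul_zero, zero_add, Matrix.mul_neg,
          e2, ← Matrix.mul_assoc]
        simp [sub_eq_add_neg]
      simp only [Matrix.cons_val]
      rw [Matrix.mul_assoc, f1, f2, fromBlocks_multiply]
      refine fromBlocks_inj.2 ⟨?_, ?_, ?_, ?_⟩
      · have ha : a = 1 - b * z - x * c' := by rw [← hxz]; abel
        have : -(x * (u 0 * u 1)) * -(u 2 * u 3 * z) = x * ((D - c' * b') * z) := by
          rw [Matrix.neg_mul, Matrix.mul_neg, neg_neg, ← e3]; simp only [Matrix.mul_assoc]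
        simp only [this]
        rw [ha, hb']
        simp only [Matrix.mul_sub, Matrix.sub_mul, Matrix.mul_add, Matrix.add_mul, Matrix.one_mul,
          Matrix.mul_one, Matrix.mul_assoc]
        abel
      · have : -(x * (u 0 * u 1)) * (u 2 * u 3) = -(x * (D - c' * b')) := by
          rw [Matrix.neg_mul, ← e3]; simp only [Matrix.mul_assoc]
        simp only [this]
        rw [hb']
        simp only [Matrix.mul_sub, Matrix.sub_mul, Matrix.mul_add, Matrix.one_mul,
          Matrix.mul_assoc]
        abel
      · have : u 0 * u 1 * -(u 2 * u 3 * z) = -((D - c' * b') * z) := by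
          rw [Matrix.mul_neg, ← e3]; simp only [Matrix.mul_assoc]
        simp only [this]
        rw [hc']
        simp only [Matrix.mul_sub, Matrix.sub_mul, Matrix.mul_one, Matrix.mul_assoc]
        abel
      · simp only [e3]
        abel

end

/-- In characteristic three, unipotent elements are squares, as their order is odd. -/
lemma exists_mul_self_of_isNilpotent {R : Type*} [Ring R] [CharP R 3] {u : R}
    (h : IsNilpotent (u - 1)) : ∃ v, u = v * v := by
  obtain ⟨k, hk⟩ := h
  haveI : Fact (Nat.Prime 3) := ⟨Nat.prime_three⟩
  have h1 : u ^ 3 ^ k = 1 := by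
    have := add_pow_char_pow_of_commute (p := 3) (n := k) (Commute.one_right (u - 1))
    rw [sub_add_cancel, one_pow] at this
    have hle : k ≤ 3 ^ k := (Nat.lt_pow_self (by norm_num)).le
    rw [this, pow_eq_zero_of_le hle hk, zero_add]
  have hodd : Odd (3 ^ k) := Odd.pow (by decide)
  obtain ⟨l, hl⟩ := hodd
  refine ⟨u ^ (l + 1), ?_⟩
  rw [← pow_add, show l + 1 + (l + 1) = 3 ^ k + 1 by omega, pow_succ, h1, one_mul]

/-- The determinant of an integer matrix is shown to be a square modulo three by small matrices. -/
lemma exists_squares {n : ℕ} (hn : 0 < n) (N : IntMat n) (hN : N.det = 1) (b : ℤ)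
    (hb : ∀ i j, |N i j| ≤ b) :
    ∃ (A : Fin 4 → IntMat n) (Z : IntMat n),
      N * (A 3 * (A 3 * (A 2 * (A 2 * (A 1 * (A 1 * (A 0 * A 0))))))) = 1 + (3 : ℤ) • Z ∧
      (∀ k i j, |A k i j| ≤ 2) ∧ ∀ i j, |Z i j| ≤ 256 * n ^ 8 * b + 1 := by
  haveI : Nonempty (Fin n) := ⟨⟨0, hn⟩⟩
  haveI : Fact (Nat.Prime 3) := ⟨Nat.prime_three⟩
  set f := (Int.castRingHom (ZMod 3)).mapMatrix (m := Fin n) with hf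
  have hdet : (f N.adjugate).det = 1 := by
    rw [hf, ← RingHom.map_det, det_adjugate, hN]; simp
  obtain ⟨u, hu, hprod⟩ := exists_unipotent n (f N.adjugate) hdet
  choose v hv using fun i => exists_mul_self_of_isNilpotent (hu i)
  -- the factors are lifted to integers from `0` to `2`
  set A : Fin 4 → IntMat n := fun k => .of fun i j => ((v (3 - k) i j).val : ℤ)
    with hA
  have hfA : ∀ k, f (A k) = v (3 - k) := by
    intro k; ext i j
    simp [hf, hA]
  have hAb : ∀ k i j, |A k i j| ≤ 2 := by
    intro k i j
    have := ZMod.val_lt (v (3 - k) i j)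
    simp only [hA, of_apply, abs_le]
    omega
  set T := A 3 * (A 3 * (A 2 * (A 2 * (A 1 * (A 1 * (A 0 * A 0)))))) with hT
  have hfT : f (N * T) = 1 := by
    have : f T = f N.adjugate := by
      rw [hprod, hT]
      simp only [map_mul, hfA, hv, mul_assoc]
      rfl
    rw [map_mul, this, ← map_mul, mul_adjugate, hN, one_smul, map_one]
  have hdvd : ∀ i j, (3 : ℤ) ∣ (N * T - 1) i j := by
    intro i j
    have h2 : f (N * T - 1) i j = 0 := by rw [map_sub, map_one, hfT, sub_self]; rfl
    exact_mod_cast (ZMod.intCast_zmod_eq_zero_iff_dvd _ 3).1 h2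
  refine ⟨A, .of fun i j => (N * T - 1) i j / 3, ?_, hAb, fun i j => ?_⟩
  · ext i j
    rw [Matrix.add_apply, Matrix.smul_apply, of_apply, smul_eq_mul, Int.mul_ediv_cancel' (hdvd i j),
      Matrix.sub_apply]
    ring
  · have s1 := fun i j => abs_mul_apply_le (A 0) (A 0) 2 2 i j (hAb 0 i) fun l => hAb 0 l j
    have s2 := fun i j => abs_mul_apply_le (A 1) _ 2 _ i j (hAb 1 i) fun l => s1 l j
    have s3 := fun i j => abs_mul_apply_le (A 1) _ 2 _ i j (hAb 1 i) fun l => s2 l j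
    have s4 := fun i j => abs_mul_apply_le (A 2) _ 2 _ i j (hAb 2 i) fun l => s3 l j
    have s5 := fun i j => abs_mul_apply_le (A 2) _ 2 _ i j (hAb 2 i) fun l => s4 l j
    have s6 := fun i j => abs_mul_apply_le (A 3) _ 2 _ i j (hAb 3 i) fun l => s5 l j
    have s7 := fun i j => abs_mul_apply_le (A 3) _ 2 _ i j (hAb 3 i) fun l => s6 l j
    have s8 := abs_mul_apply_le N _ b _ i j (hb i) fun l => s7 l j
    rw [Fintype.card_fin] at s8
    have e : |(N * T - 1) i j| ≤ 256 * n ^ 8 * b + 1 := by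
      rw [Matrix.sub_apply]
      refine (abs_sub _ _).trans (add_le_add (s8.trans (le_of_eq ?_)) ?_)
      · ring
      · rw [one_apply]; split_ifs <;> simp
    rw [of_apply]
    obtain ⟨q, hq⟩ := hdvd i j
    rw [hq] at e ⊢
    rw [Int.mul_ediv_cancel_left _ (by norm_num)]
    rw [abs_mul, abs_of_pos (by norm_num : (0 : ℤ) < 3)] at e
    linarith [abs_nonneg q]

end DetCert

/-! ### Smith normal form and kernel vectors -/

namespace DetCert

open Finset RAM Matrix

/-- The Smith normal form of a nonsingular integer matrix; the signs are chosen so that the diagonal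
entries multiply to the determinant. -/
lemma exists_smith {n : ℕ} (M : IntMat n) (hM : M.det ≠ 0) :
    ∃ (U V Q : IntMat n) (s : Fin n → ℤ),
      U * V = 1 ∧ U * M = diagonal s * Q ∧ ∏ i, s i = M.det := by
  obtain ⟨U, V, Q, s, h1, h2, h3⟩ : ∃ (U V Q : IntMat n) (s : Fin n → ℤ),
      U * V = 1 ∧ U * M = diagonal s * Q ∧ IsUnit Q.det := by
    set f : (Fin n → ℤ) →ₗ[ℤ] (Fin n → ℤ) := M.mulVecLin with hf
    have hinj : Function.Injective f := by
      intro x y hxy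
      have h : M *ᵥ (x - y) = 0 := by rw [mulVec_sub]; exact sub_eq_zero.2 hxy
      exact sub_eq_zero.1 (eq_zero_of_mulVec_eq_zero hM h)
    have hrank : Module.finrank ℤ (LinearMap.range f) = Module.finrank ℤ (Fin n → ℤ) :=
      LinearMap.finrank_range_of_inj hinj
    obtain ⟨b, a, b', hb⟩ := Submodule.exists_smith_normal_form_of_rank_eq
      (Pi.basisFun ℤ (Fin n)) hrank
    -- `B` is the matrix whose columns form the basis of the lattice of all integer vectors
    set B : IntMat n := .of fun i j => b j i with hB
    set Bi : IntMat n := .of fun i j => b.repr (Pi.single j 1) i with hBi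
    have hBB : B * Bi = 1 := by
      ext i j
      have := congr_fun (b.sum_repr (Pi.single j 1)) i
      rw [Finset.sum_apply] at this
      rw [mul_apply, one_apply]
      simp only [hB, hBi, of_apply]
      rw [Pi.single_apply] at this
      rw [← this]
      exact sum_congr rfl fun k _ => by simp [mul_comm]
    have hcol : ∀ j, (fun i => M i j) ∈ LinearMap.range f := fun j =>
      ⟨Pi.single j 1, by ext i; simp [hf]⟩
    set Q : IntMat n := .of fun i j => b'.repr ⟨fun i => M i j, hcol j⟩ i with hQ
    have hM1 : M = B * (diagonal a * Q) := by
      ext i j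
      have := congr_arg Subtype.val (b'.sum_repr ⟨fun i => M i j, hcol j⟩)
      have := congr_fun this i
      simp only [AddSubmonoidClass.coe_finset_sum, Submodule.coe_smul, hb, Finset.sum_apply,
        Pi.smul_apply, smul_eq_mul] at this
      rw [← this, mul_apply]
      refine Finset.sum_congr rfl fun k _ => ?_
      rw [diagonal_mul]
      simp only [hB, hQ, of_apply]
      ring
    have hpre : ∀ j, ∃ y, f y = a j • b j := fun j => by rw [← hb j]; exact (b' j).2
    choose y hy using hpre
    have hM2 : B * diagonal a = M * .of fun i j => y j i := by
      ext i j
      have := congr_fun (hy j) i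
      rw [mul_diagonal]
      simp only [hB, of_apply]
      rw [mul_comm]
      exact this.symm
    have hQ1 : (.of fun i j => y j i : IntMat n) * Q = 1 := by
      have h : M * ((.of fun i j => y j i : IntMat n) * Q) = M * 1 := by
        rw [← mul_assoc, ← hM2, mul_assoc, ← hM1, mul_one]
      have h2 := congr_arg (M.adjugate * ·) h
      simp only [← mul_assoc, adjugate_mul, smul_mul, one_mul, mul_one] at h2
      exact smul_right_injective _ hM h2
    refine ⟨Bi, B, Q, a, mul_eq_one_comm.1 hBB, ?_, ?_⟩
    · conv_lhs => rw [hM1]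
      rw [← mul_assoc, mul_eq_one_comm.1 hBB, one_mul]
    · refine IsUnit.of_mul_eq_one (det (.of fun i j => y j i)) ?_
      rw [mul_comm, ← det_mul, hQ1, det_one]
  -- adjust the sign of one diagonal entry
  have hU : IsUnit U.det := IsUnit.of_mul_eq_one V.det (by rw [← det_mul, h1, det_one])
  have hdet : U.det * M.det = (∏ i, s i) * Q.det := by
    have := congr_arg det h2
    rwa [det_mul, det_mul, det_diagonal] at this
  have hcase : ∏ i, s i = M.det ∨ ∏ i, s i = -M.det := by
    rcases Int.isUnit_iff.1 hU with h4 | h4 <;> rcases Int.isUnit_iff.1 h3 with h5 | h5 <;>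
      rw [h4, h5] at hdet <;> [left; right; right; left] <;> linarith
  rcases hcase with h | h
  · exact ⟨U, V, Q, s, h1, h2, h⟩
  · rcases n with _ | n
    · rw [det_isEmpty] at h; simp at h
    · refine ⟨U, V, diagonal (Function.update 1 0 (-1)) * Q, Function.update s 0 (-s 0), h1, ?_, ?_⟩
      · rw [h2, ← mul_assoc, diagonal_mul_diagonal]
        congr 2
        funext i
        by_cases hi : i = 0 <;> simp [hi]
      · rw [prod_update_of_mem (mem_univ _)]
        rw [← mul_prod_erase _ _ (mem_univ (0 : Fin (n + 1)))] at h
        rw [sdiff_singleton_eq_erase]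
        linarith

/-- A singular integer matrix has a short covector in its kernel. -/
lemma exists_short_covector {n : ℕ} (M : IntMat n) (hM : M.det = 0) (b : ℕ)
    (hb1 : 1 ≤ b) (hb : ∀ i j, |M i j| ≤ b) :
    ∃ w : Fin n → ℤ, w ≠ 0 ∧ w ᵥ* M = 0 ∧ ∀ i, |w i| ≤ (n * b) ^ n := by
  obtain ⟨u, hu, hMu⟩ := exists_mulVec_eq_zero_iff.2 hM
  obtain ⟨j₀, hj⟩ := Function.ne_iff.1 hu
  have hn : 0 < n := j₀.pos
  -- the equation for column `j₀` follows from the other ones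
  have key : ∀ w : Fin n → ℤ, (∀ j ≠ j₀, (w ᵥ* M) j = 0) → w ᵥ* M = 0 := by
    intro w hw
    have h1 : (w ᵥ* M) ⬝ᵥ u = 0 := by rw [← dotProduct_mulVec, hMu, dotProduct_zero]
    rw [dotProduct, sum_eq_single j₀ (fun j _ hne => by rw [hw j hne, zero_mul])
      (by simp)] at h1
    have h2 := (mul_eq_zero.1 h1).resolve_right hj
    funext j
    by_cases h : j = j₀
    · rw [h, h2]; rfl
    · rw [hw j h]; rfl
  have hnb : (1 : ℤ) ≤ n * b := by exact_mod_cast Nat.one_le_iff_ne_zero.2 (by positivity)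
  rcases Nat.lt_or_ge n 2 with h2 | h2
  · have hn1 : n = 1 := by omega
    subst hn1
    refine ⟨fun _ => 1, fun h => one_ne_zero (congr_fun h 0), key _ fun j hne =>
      absurd (Subsingleton.elim j j₀) hne, fun i => by simpa using hnb⟩
  · letI := Matrix.seminormedAddCommGroup (m := {j : Fin n // j ≠ j₀}) (n := Fin n) (α := ℤ)
    set A : Matrix {j : Fin n // j ≠ j₀} (Fin n) ℤ := .of fun j i => M i j with hA
    have hcard : Fintype.card {j : Fin n // j ≠ j₀} = n - 1 := by simp
    obtain ⟨t, h3, h4, h5⟩ := Int.Matrix.exists_ne_zero_int_vec_norm_le A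
      (by rw [hcard, Fintype.card_fin]; omega) (by rw [hcard]; omega)
    refine ⟨t, h3, key t fun j hne => ?_, fun i => ?_⟩
    · have := congr_fun h4 ⟨j, hne⟩
      rw [Pi.zero_apply, mulVec, dotProduct] at this
      rw [vecMul, dotProduct, ← this]
      exact sum_congr rfl fun k _ => mul_comm _ _
    · have hAb : max 1 ‖A‖ ≤ b := by
        refine max_le (by exact_mod_cast hb1) ?_
        rw [norm_le_iff (by positivity)]
        intro j i
        rw [Int.norm_eq_abs]
        exact_mod_cast hb i j
      rw [hcard, Fintype.card_fin] at h5
      have he : ((n - 1 : ℕ) : ℝ) / (n - (n - 1 : ℕ)) = (n - 1 : ℕ) := by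
        rw [Nat.cast_sub (by omega)]; push_cast; rw [sub_sub_cancel, div_one]
      rw [he, Real.rpow_natCast] at h5
      have h6 : ‖t i‖ ≤ (n * b : ℝ) ^ (n - 1) := (norm_le_pi_norm t i).trans (h5.trans (by gcongr))
      have h7 : (n * b : ℝ) ^ (n - 1) ≤ (n * b : ℝ) ^ n :=
        pow_le_pow_right₀ (by exact_mod_cast hnb) (by omega)
      have h8 := h6.trans h7
      rw [Int.norm_eq_abs] at h8
      exact_mod_cast h8

/-- A singular integer matrix has a short primitive covector in its kernel, and its primitivity has
a short proof. -/
lemma exists_primitive_covector {n : ℕ} (M : IntMat n) (hM : M.det = 0) (b : ℕ)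
    (hb1 : 1 ≤ b) (hb : ∀ i j, |M i j| ≤ b) :
    ∃ w x : Fin n → ℤ, w ⬝ᵥ x = 1 ∧ w ᵥ* M = 0 ∧ (∀ i, |w i| ≤ (n * b) ^ n) ∧
      ∀ i, |x i| ≤ n * (n * b) ^ n + 1 := by
  obtain ⟨w₀, hw0, hw1, hw2⟩ := exists_short_covector M hM b hb1 hb
  set g := univ.gcd w₀ with hg
  have hg0 : g ≠ 0 := by
    intro h
    rw [hg, Finset.gcd_eq_zero_iff] at h
    exact hw0 (funext fun i => h i (mem_univ i))
  obtain ⟨w, hw, hgw⟩ := extract_gcd w₀ (s := univ)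
    (by obtain ⟨i, -⟩ := Function.ne_iff.1 hw0; exact ⟨i, mem_univ i⟩)
  have hgg : w₀ = g • w := funext fun i => by simpa using hw i (mem_univ i)
  have hwM : w ᵥ* M = 0 := by
    rw [hgg, smul_vecMul] at hw1
    exact (smul_eq_zero.1 hw1).resolve_left hg0
  have hwb : ∀ i, |w i| ≤ (n * b) ^ n := by
    intro i
    refine le_trans ?_ (hw2 i)
    rw [hgg, Pi.smul_apply, smul_eq_mul, abs_mul]
    exact le_mul_of_one_le_left (abs_nonneg _) (Int.one_le_abs hg0)
  obtain ⟨y, hy⟩ : ∃ y : Fin n → ℤ, ∑ i, w i * y i = 1 := by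
    have := gcd_eq_sum_mul (s := univ) w
    obtain ⟨y, hy⟩ := this
    exact ⟨y, by rw [← hgw, ← hy]⟩
  obtain ⟨k, hk⟩ : ∃ k, w k ≠ 0 := by
    by_contra hcon
    push Not at hcon
    simp [hcon] at hy
  -- reduce all coefficients but one modulo `w k`
  set x : Fin n → ℤ := fun i => if i = k then
    y k + ∑ j ∈ univ.erase k, w j * (y j / w k) else y i % w k with hx
  have hx1 : ∑ i, w i * x i = 1 := by
    rw [← add_sum_erase _ _ (mem_univ k)] at hy ⊢
    have hxk : x k = y k + ∑ j ∈ univ.erase k, w j * (y j / w k) := by simp [hx]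
    have hxj : ∀ j ∈ univ.erase k, w j * x j = w j * (y j % w k) := fun j hj => by
      simp [hx, ne_of_mem_erase hj]
    rw [sum_congr rfl hxj, hxk, mul_add, mul_sum, add_assoc,
      ← sum_add_distrib, ← hy]
    congr 1
    refine sum_congr rfl fun j _ => ?_
    have := Int.emod_add_mul_ediv (y j) (w k)
    linear_combination w j * this
  have hxb : ∀ i ≠ k, |x i| ≤ |w k| := by
    intro i hi
    simp only [hx, if_neg hi]
    rw [abs_of_nonneg (Int.emod_nonneg _ hk)]
    exact (Int.emod_lt_abs _ hk).le
  refine ⟨w, x, hx1, hwM, hwb, fun i => ?_⟩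
  have hN : (0 : ℤ) ≤ (n * b) ^ n := by positivity
  have hn1 : (1 : ℤ) ≤ n := by exact_mod_cast k.pos
  by_cases hi : i = k
  · subst hi
    have h1 : |w i| * |x i| ≤ |w i| * (n * (n * b) ^ n + 1) := by
      rw [← abs_mul]
      have e : w i * x i = 1 - ∑ j ∈ univ.erase i, w j * x j := by
        rw [← hx1, ← add_sum_erase _ _ (mem_univ i)]; ring
      rw [e]
      refine (abs_sub _ _).trans ?_
      have h2 : |∑ j ∈ univ.erase i, w j * x j| ≤ n * ((n * b) ^ n * |w i|) := by
        refine (abs_sum_le_sum_abs _ _).trans ((sum_le_card_nsmul _ _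
          ((n * b) ^ n * |w i|) fun j hj => ?_).trans ?_)
        · rw [abs_mul]
          exact mul_le_mul (hwb j) (hxb j (ne_of_mem_erase hj)) (abs_nonneg _) hN
        · rw [nsmul_eq_mul]
          refine mul_le_mul_of_nonneg_right ?_ (mul_nonneg hN (abs_nonneg _))
          have := card_le_univ (univ.erase i)
          rw [Fintype.card_fin] at this
          exact_mod_cast this
      have h3 := Int.one_le_abs hk
      rw [abs_one]
      nlinarith
    exact le_of_mul_le_mul_left h1 (abs_pos.2 hk)
  · refine (hxb i hi).trans ((hwb k).trans ?_)
    nlinarith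

end DetCert

/-! ### Existence of short certificates -/

namespace DetCert

open Finset RAM Matrix

lemma size_natAbs_le {z : ℤ} {B : ℕ} (h : |z| ≤ B) : z.natAbs.size ≤ B.size :=
  Nat.size_le_size (by rw [Int.abs_eq_natAbs] at h; exact_mod_cast h)

lemma size_add_size_le {a b : ℕ} (ha : 0 < a) (hb : 0 < b) :
    a.size + b.size ≤ (a * b).size + 1 := by
  have h1 := Nat.size_pos.2 ha
  have h2 := Nat.size_pos.2 hb
  have h3 : 2 ^ (a.size - 1) ≤ a := Nat.lt_size.1 (by omega)
  have h4 : 2 ^ (b.size - 1) ≤ b := Nat.lt_size.1 (by omega)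
  have h5 : 2 ^ (a.size - 1 + (b.size - 1)) ≤ a * b := by rw [pow_add]; exact Nat.mul_le_mul h3 h4
  have := Nat.lt_size.2 h5
  omega

lemma sum_size_le {ι : Type*} (s : Finset ι) (f : ι → ℤ) (hf : ∀ i ∈ s, f i ≠ 0) :
    ∑ i ∈ s, (f i).natAbs.size ≤ (∏ i ∈ s, f i).natAbs.size + s.card := by
  classical
  induction s using Finset.induction_on with
  | empty => simp
  | insert a s ha ih =>
    rw [sum_insert ha, prod_insert ha, card_insert_of_notMem ha,
      Int.natAbs_mul]
    have h1 := ih fun i hi => hf i (mem_insert_of_mem hi)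
    have h2 := size_add_size_le (Int.natAbs_pos.2 (hf a (mem_insert_self a s)))
      (Int.natAbs_pos.2 (prod_ne_zero_iff.2 fun i hi => hf i (mem_insert_of_mem hi)))
    omega

lemma size_pow_le (a k : ℕ) : (a ^ k).size ≤ k * a.size + 1 := by
  rw [Nat.size_le]
  calc a ^ k ≤ (2 ^ a.size) ^ k := Nat.pow_le_pow_left (Nat.lt_size_self a).le k
    _ = 2 ^ (k * a.size) := by rw [← pow_mul, mul_comm]
    _ < 2 ^ (k * a.size + 1) := Nat.pow_lt_pow_right (by norm_num) (by omega)

/-- A bound for the digits of the entries of a kernel covector, and for the digits of all entries of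
a Smith normal form together. -/
def longBits (n b : ℕ) : ℕ := n * (n.size + b.size) + n.size + n + 2

/-- A bound for the other entries. -/
def shortBits (n b : ℕ) : ℕ := (2 ^ 18 * n ^ 10 * b).size

/-- The matrices that relate `M` to a diagonal matrix. -/
structure DiagData {n : ℕ} (M : IntMat n) (b : ℕ) where
  D : Fin n → ℤ
  W : IntMat n
  T : IntMat n
  Q : IntMat n
  Y : IntMat n
  left : W * M + diagonal D * Q = 0
  right : W * T + diagonal D * Y = 1
  prod : ∏ i, D i = M.det
  sum_D : ∑ i, (D i).natAbs.size ≤ longBits n b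
  sum_W : ∑ i, ∑ j, (W i j).natAbs.size ≤ n * longBits n b
  sum_T : ∑ i, ∑ j, (T i j).natAbs.size ≤ n * n * shortBits n b + n * longBits n b
  Q_le : ∀ i j, |Q i j| ≤ n ^ 2 * b + 1
  Y_le : ∀ i j, |Y i j| ≤ n ^ 2 * b + 1
  T_le : M.det ≠ 0 → ∀ i j, |T i j| ≤ n ^ 2 * b + 1

lemma small_le {n b : ℕ} (hn : 0 < n) (hb : 1 ≤ b) :
    256 * (n + n) ^ 8 * (n ^ 2 * b + 1) + 1 ≤ 2 ^ 18 * n ^ 10 * b := by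
  have h1 : 1 ≤ n ^ 2 * b := Nat.one_le_iff_ne_zero.2 (by positivity)
  have h2 : 1 ≤ n ^ 8 := Nat.one_le_iff_ne_zero.2 (by positivity)
  have h3 : n ^ 8 * 1 ≤ n ^ 8 * (n ^ 2 * b) := Nat.mul_le_mul_left _ h1
  have e1 : 2 ^ 18 * n ^ 10 * b = 262144 * (n ^ 8 * (n ^ 2 * b)) := by ring
  have e2 : 256 * (n + n) ^ 8 * (n ^ 2 * b + 1) + 1 =
      65536 * (n ^ 8 * (n ^ 2 * b)) + 65536 * n ^ 8 + 1 := by ring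
  omega

lemma medium_le {n b : ℕ} (hn : 0 < n) (hb : 1 ≤ b) :
    8 * (n + n) ^ 2 * (n ^ 2 * b + 1) ≤ 2 ^ 18 * n ^ 10 * b := by
  refine le_trans ?_ (small_le hn hb)
  have h2 : (n + n) ^ 2 ≤ (n + n) ^ 8 := Nat.pow_le_pow_right (by omega) (by norm_num)
  have : 8 * (n + n) ^ 2 * (n ^ 2 * b + 1) ≤ 256 * (n + n) ^ 8 * (n ^ 2 * b + 1) :=
    Nat.mul_le_mul_right _ (Nat.mul_le_mul (by norm_num) h2)
  omega

lemma tiny_le {n b : ℕ} (hn : 0 < n) (hb : 1 ≤ b) : n ^ 2 * b + 1 ≤ 2 ^ 18 * n ^ 10 * b := by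
  refine le_trans ?_ (medium_le hn hb)
  have h2 : 1 ≤ (n + n) ^ 2 := Nat.one_le_iff_ne_zero.2 (by positivity)
  nlinarith [Nat.zero_le (n ^ 2 * b)]

lemma size_small_le {n b : ℕ} (hn : 0 < n) (hb : 1 ≤ b) {z : ℤ}
    (h : |z| ≤ (n : ℤ) ^ 2 * b + 1) : z.natAbs.size ≤ shortBits n b :=
  (size_natAbs_le (B := n ^ 2 * b + 1) (by exact_mod_cast h)).trans
    (Nat.size_le_size (tiny_le hn hb))

/-- For a nonsingular matrix, the Smith normal form yields the data; the rows of the transformation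
are reduced modulo the diagonal entries, and the columns of its inverse modulo the lattice that the
columns of `M` span. -/
lemma nonempty_diagData_of_ne {n : ℕ} (hn : 0 < n) (M : IntMat n) (b : ℕ)
    (hb1 : 1 ≤ b) (hb : ∀ i j, |M i j| ≤ b) (hM : M.det ≠ 0) : Nonempty (DiagData M b) := by
  obtain ⟨U, V, Q₀, s, hUV, hUM, hs⟩ := exists_smith M hM
  have hVU : V * U = 1 := mul_eq_one_comm.1 hUV
  have hs0 : ∀ i, s i ≠ 0 := fun i => by
    have := prod_ne_zero_iff.1 (hs ▸ hM); exact this i (mem_univ i)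
  -- row `i` of `U` is reduced modulo `s i`
  set E : IntMat n := .of fun i j => U i j / s i with hE
  set W : IntMat n := .of fun i j => U i j % s i with hW
  have hWE : W = U - diagonal s * E := by
    ext i j
    rw [Matrix.sub_apply, diagonal_mul]
    simp only [hW, hE, of_apply]
    have := Int.emod_add_mul_ediv (U i j) (s i)
    linarith
  -- `V` is reduced modulo the columns of `M`; as `M⁻¹ V = G / det M`, this leaves `M ρ / det M`
  set G := M.adjugate * V with hG
  set F : IntMat n := .of fun i j => G i j / M.det with hF
  set ρ : IntMat n := .of fun i j => G i j % M.det with hρ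
  have hGF : G = ρ + M.det • F := by
    ext i j
    simp only [hF, hρ, Matrix.add_apply, Matrix.smul_apply, of_apply, smul_eq_mul]
    exact (Int.emod_add_mul_ediv _ _).symm
  set T := V - M * F with hT
  have hMG : M * G = M.det • V := by rw [hG, ← mul_assoc, mul_adjugate, smul_mul, one_mul]
  have hMT : M.det • T = M * ρ := by
    have h1 : M * G = M * ρ + M.det • (M * F) := by rw [hGF, Matrix.mul_add, Matrix.mul_smul]
    rw [hT, smul_sub, ← hMG, h1]; abel
  set Y := Q₀ * F + E * T with hY
  have hright : W * T + diagonal s * Y = 1 := by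
    have h1 : U * T = 1 - diagonal s * (Q₀ * F) := by
      rw [hT, mul_sub, hUV, ← mul_assoc, hUM, mul_assoc]
    rw [hWE, hY, sub_mul, mul_add, h1, mul_assoc]; abel
  have hleft : W * M + diagonal s * (E * M - Q₀) = 0 := by
    rw [hWE, sub_mul, mul_sub, hUM, mul_assoc]; abel
  have hWb : ∀ i j, |W i j| ≤ |s i| := fun i j => by
    simp only [hW, of_apply]
    rw [abs_of_nonneg (Int.emod_nonneg _ (hs0 i))]
    exact (Int.emod_lt_abs _ (hs0 i)).le
  have hTb : ∀ i j, |T i j| ≤ n * b := by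
    intro i j
    have h1 : |M.det| * |T i j| ≤ |M.det| * (n * b) := by
      rw [← abs_mul]
      have e := congr_fun (congr_fun hMT i) j
      rw [Matrix.smul_apply, smul_eq_mul] at e
      rw [e]
      have := abs_mul_apply_le M ρ b |M.det| i j (hb i) fun k => by
        simp only [hρ, of_apply]
        rw [abs_of_nonneg (Int.emod_nonneg _ hM)]
        exact (Int.emod_lt_abs _ hM).le
      rw [Fintype.card_fin] at this
      linarith
    exact le_of_mul_le_mul_left h1 (abs_pos.2 hM)
  have hn1 : (1 : ℤ) ≤ n := by exact_mod_cast hn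
  have hb1' : (1 : ℤ) ≤ b := by exact_mod_cast hb1
  have hnb : (n : ℤ) * b ≤ n ^ 2 * b + 1 := by nlinarith [mul_le_mul hn1 hb1' zero_le_one (by omega)]
  have hQb : ∀ i j, |(E * M - Q₀) i j| ≤ n * b := by
    intro i j
    have h1 : |s i| * |(E * M - Q₀) i j| ≤ |s i| * (n * b) := by
      rw [← abs_mul]
      have e := congr_fun (congr_fun hleft i) j
      rw [Matrix.add_apply, diagonal_mul, Matrix.zero_apply] at e
      rw [show s i * (E * M - Q₀) i j = -(W * M) i j by linarith, abs_neg]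
      have := abs_mul_apply_le W M |s i| b i j (hWb i) fun k => hb k j
      rw [Fintype.card_fin] at this
      linarith
    exact le_of_mul_le_mul_left h1 (abs_pos.2 (hs0 i))
  have hYb : ∀ i j, |Y i j| ≤ n ^ 2 * b + 1 := by
    intro i j
    have h1 : |s i| * |Y i j| ≤ |s i| * (n ^ 2 * b + 1) := by
      rw [← abs_mul]
      have e := congr_fun (congr_fun hright i) j
      rw [Matrix.add_apply, diagonal_mul] at e
      rw [show s i * Y i j = (1 : IntMat n) i j - (W * T) i j by linarith]
      have h2 := abs_mul_apply_le W T |s i| (n * b) i j (hWb i) fun k => hTb k j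
      rw [Fintype.card_fin] at h2
      have h3 : |(1 : IntMat n) i j| ≤ |s i| := by
        have := Int.one_le_abs (hs0 i)
        rw [one_apply]; split_ifs <;> simp <;> omega
      have := abs_sub ((1 : IntMat n) i j) ((W * T) i j)
      nlinarith
    exact le_of_mul_le_mul_left h1 (abs_pos.2 (hs0 i))
  have hsum : ∑ i, (s i).natAbs.size ≤ longBits n b := by
    refine (sum_size_le _ s fun i _ => hs0 i).trans ?_
    rw [hs, card_univ, Fintype.card_fin]
    have h1 := abs_det_le M b hb
    rw [Fintype.card_fin] at h1
    have h2 := size_natAbs_le (B := (n * b) ^ n) (by exact_mod_cast h1)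
    have h3 := size_pow_le (n * b) n
    have h4 := Nat.mul_le_mul_left n (size_mul_le (a := n) (b := b) le_rfl le_rfl)
    simp only [longBits]
    omega
  refine ⟨⟨s, W, T, E * M - Q₀, Y, hleft, hright, hs, hsum, ?_, ?_, fun i j => (hQb i j).trans hnb,
    hYb, fun _ i j => (hTb i j).trans hnb⟩⟩
  · calc ∑ i, ∑ j, (W i j).natAbs.size ≤ ∑ i : Fin n, ∑ _j : Fin n, (s i).natAbs.size :=
          sum_le_sum fun i _ => sum_le_sum fun j _ => Nat.size_le_size (by
            have := hWb i j; rw [Int.abs_eq_natAbs, Int.abs_eq_natAbs] at this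
            exact_mod_cast this)
      _ = n * ∑ i, (s i).natAbs.size := by simp [mul_sum]
      _ ≤ _ := Nat.mul_le_mul_left _ hsum
  · calc ∑ i, ∑ j, (T i j).natAbs.size ≤ ∑ _i : Fin n, ∑ _j : Fin n, shortBits n b :=
          sum_le_sum fun i _ => sum_le_sum fun j _ =>
            size_small_le hn hb1 ((hTb i j).trans hnb)
      _ = n * n * shortBits n b := by simp [mul_assoc]
      _ ≤ _ := Nat.le_add_right _ _

/-- For a singular matrix, a primitive kernel covector yields the data. -/
lemma nonempty_diagData_of_eq {n : ℕ} (hn : 0 < n) (M : IntMat n) (b : ℕ)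
    (hb1 : 1 ≤ b) (hb : ∀ i j, |M i j| ≤ b) (hM : M.det = 0) : Nonempty (DiagData M b) := by
  obtain ⟨w, x, hwx, hwM, hw, hx⟩ := exists_primitive_covector M hM b hb1 hb
  set l : Fin n := ⟨0, hn⟩
  have hnb : (1 : ℤ) ≤ (n : ℤ) ^ 2 * b + 1 := by
    have : (0 : ℤ) ≤ (n : ℤ) ^ 2 * b := by positivity
    omega
  have hwb : ∀ i, (w i).natAbs.size ≤ longBits n b := by
    intro i
    have h2 := size_natAbs_le (B := (n * b) ^ n) (by exact_mod_cast hw i)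
    have h3 := size_pow_le (n * b) n
    have h4 := Nat.mul_le_mul_left n (size_mul_le (a := n) (b := b) le_rfl le_rfl)
    simp only [longBits]
    omega
  have hxb : ∀ i, (x i).natAbs.size ≤ longBits n b := by
    intro i
    have h2 := size_natAbs_le (B := n * (n * b) ^ n + 1) (by exact_mod_cast hx i)
    have h3 := size_pow_le (n * b) n
    have h4 := Nat.mul_le_mul_left n (size_mul_le (a := n) (b := b) le_rfl le_rfl)
    have h5 := size_mul_le (a := n) (b := (n * b) ^ n) le_rfl le_rfl
    have h6 : (n * (n * b) ^ n + 1).size ≤ (n * (n * b) ^ n).size + 1 := by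
      rw [Nat.size_le, pow_succ]
      have := Nat.lt_size_self (n * (n * b) ^ n)
      omega
    simp only [longBits]
    omega
  refine ⟨⟨fun i => if i = l then 0 else 1, .of fun i j => if i = l then w j else 0,
    .of fun i j => if j = l then x i else 0, 0, diagonal fun i => if i = l then 0 else 1,
    ?_, ?_, ?_, ?_, ?_, ?_, ?_, ?_, fun h => absurd hM h⟩⟩
  · ext i j
    have := congr_fun hwM j
    rw [vecMul, dotProduct] at this
    by_cases hi : i = l <;> simp [mul_apply, hi, this]
  · ext i j
    rw [dotProduct] at hwx
    rw [diagonal_mul_diagonal]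
    by_cases hi : i = l <;> by_cases hj : j = l
    · subst hi; subst hj; simp [mul_apply, hwx]
    · have : l ≠ j := fun h => hj h.symm
      simp [mul_apply, hi, hj, this]
    · simp [mul_apply, hi, hj]
    · simp [mul_apply, hi, diagonal_apply, one_apply]
  · rw [hM]; exact prod_eq_zero (mem_univ l) (if_pos rfl)
  · calc ∑ i : Fin n, ((if i = l then 0 else 1 : ℤ)).natAbs.size ≤ ∑ _i : Fin n, 1 :=
        sum_le_sum fun i _ => by split_ifs <;> simp
      _ ≤ _ := by simp [longBits]; omega
  · calc _ = ∑ j, (w j).natAbs.size := by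
          rw [sum_eq_single l (fun i _ hi => by simp [hi]) (by simp)]; simp
      _ ≤ ∑ _j : Fin n, longBits n b := sum_le_sum fun j _ => hwb j
      _ = _ := by simp
  · calc _ = ∑ i, (x i).natAbs.size := by
          refine sum_congr rfl fun i _ => ?_
          rw [sum_eq_single l (fun j _ hj => by simp [hj]) (by simp)]; simp
      _ ≤ ∑ _j : Fin n, longBits n b := sum_le_sum fun j _ => hxb j
      _ = n * longBits n b := by simp
      _ ≤ _ := Nat.le_add_left _ _
  · intro i j; simp; positivity
  · intro i j
    rw [diagonal_apply]; split_ifs <;> simp <;> positivity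

lemma nonempty_diagData {n : ℕ} (hn : 0 < n) (M : IntMat n) (b : ℕ)
    (hb1 : 1 ≤ b) (hb : ∀ i j, |M i j| ≤ b) : Nonempty (DiagData M b) := by
  by_cases h : M.det = 0
  · exact nonempty_diagData_of_eq hn M b hb1 hb h
  · exact nonempty_diagData_of_ne hn M b hb1 hb h

end DetCert

/-! ### Certificates as sequences of integers -/

namespace DetCert

open Finset RAM Matrix

/-- The entries of a matrix, with natural numbers as indices. -/
def ent {m : ℕ} (A : Matrix (Fin m) (Fin m) ℤ) (i j : ℕ) : ℤ :=
  if h : i < m ∧ j < m then A ⟨i, h.1⟩ ⟨j, h.2⟩ else 0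

/-- The sequence of integers that consists of `X`, `D` and a sequence of matrices. -/
def flat (n : ℕ) (X : ℤ) (D : ℕ → ℤ) (A : ℕ → IntMat (n + n)) (k : ℕ) : ℤ :=
  if k = 0 then X else if k ≤ n then D (k - 1) else
    ent (A ((k - (n + 1)) / ((n + n) * (n + n)))) ((k - (n + 1)) % ((n + n) * (n + n)) / (n + n))
      ((k - (n + 1)) % (n + n))

lemma div_mod_row_major {m i l : ℕ} (hi : i < m) (hl : l < m) (o j : ℕ) :
    (o + j * (m * m) + i * m + l - o) / (m * m) = j ∧
      (o + j * (m * m) + i * m + l - o) % (m * m) / m = i ∧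
      (o + j * (m * m) + i * m + l - o) % m = l := by
  have hm : 0 < m := by omega
  have h1 : i * m + l < m * m := by nlinarith
  have e0 : o + j * (m * m) + i * m + l - o = i * m + l + m * m * j := by
    rw [mul_comm (m * m)]; omega
  rw [e0, Nat.add_mul_div_left _ _ (by positivity), Nat.div_eq_of_lt h1, Nat.add_mul_mod_self_left,
    Nat.mod_eq_of_lt h1, zero_add, mul_comm i m, Nat.mul_add_div hm, Nat.div_eq_of_lt hl, add_zero,
    mul_assoc m m j, add_right_comm, ← mul_add, Nat.mul_add_mod, Nat.mod_eq_of_lt hl]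
  exact ⟨rfl, rfl, rfl⟩

lemma blk_flat (n : ℕ) (X : ℤ) (D : ℕ → ℤ) (A : ℕ → IntMat (n + n))
    (j : ℕ) : blk n (flat n X D A) j = A j := by
  ext i l
  obtain ⟨h1, h2, h3⟩ := div_mod_row_major i.2 l.2 (n + 1) j
  change flat n X D A (n + 1 + j * ((n + n) * (n + n)) + i * (n + n) + l) = A j i l
  rw [flat, if_neg (by omega), if_neg (by omega), h1, h2, h3]
  simp [ent]

lemma vec_mat (n : ℕ) (c : ℕ → ℤ) (j : ℕ) (y : ℕ → ℤ) :
    (fun i : Fin (n + n) => mat n c j y i) = blk n c j *ᵥ fun l => y l :=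
  funext (mat_eq_mulVec n c j y)

/-- Matrices with the right relations pass all linear checks. -/
lemma linCheck_of_blk {n : ℕ} {c : ℕ → ℤ} {d : ℤ}
    (hdiag : ∀ (i : Fin n) (j : Fin (n + n)),
      ∑ k : Fin n, blk n c 1 (Fin.castAdd n i) (Fin.castAdd n k) * blk n c 0 (Fin.castAdd n k) j +
        c (1 + i) * blk n c 0 (Fin.natAdd n i) j = if (j : ℕ) = n + i then 1 else 0)
    (hd : d ≠ 0 → blk n c 2 = 1 ∧ (∀ k < depth n, blk n c (2 + 2 * k) * blk n c (2 + 2 * k) =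
      blk n c 0 * blk n c (3 + 2 * k) + c 0 • blk n c (4 + 2 * k)) ∧
      blk n c (2 + 2 * depth n) = 0 ∧ ∃ A : ℕ → IntMat (n + n),
      (∀ l < 4, blk n c (3 + 2 * depth n + l) = A l) ∧
      blk n c 0 * (A 3 * (A 3 * (A 2 * (A 2 * (A 1 * (A 1 * (A 0 * A 0))))))) =
        1 + (3 : ℤ) • blk n c (7 + 2 * depth n)) (v : ℕ → ℤ) : LinCheck n c d v := by
  have hfirst : ∀ i < n, mat n c 1 (trunc n (mat n c 0 v)) i + c (1 + i) * mat n c 0 v (n + i) =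
      v (n + i) := by
    intro i hi
    have h1 := mat_eq_mulVec n c 1 (trunc n (mat n c 0 v)) (Fin.castAdd n ⟨i, hi⟩)
    have h2 := mat_eq_mulVec n c 0 v (Fin.natAdd n ⟨i, hi⟩)
    simp only [Fin.val_castAdd, Fin.val_natAdd] at h1 h2
    rw [h1, h2, mulVec, dotProduct, Fin.sum_univ_add]
    simp only [trunc, Fin.val_castAdd, Fin.val_natAdd, Fin.is_lt, if_true]
    rw [sum_eq_zero (s := univ) (f := fun x : Fin n => _ * if n + (x : ℕ) < n then _
        else _) (fun x _ => by simp), add_zero]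
    have h3 : ∀ x : Fin n, mat n c 0 v x = (blk n c 0 *ᵥ fun l => v l) (Fin.castAdd n x) :=
      fun x => mat_eq_mulVec n c 0 v (Fin.castAdd n x)
    simp only [h3, mulVec, dotProduct, mul_sum]
    rw [sum_comm, ← sum_add_distrib]
    rw [sum_eq_single (Fin.natAdd n ⟨i, hi⟩)]
    · have := (hdiag ⟨i, hi⟩ (Fin.natAdd n ⟨i, hi⟩)).trans (if_pos rfl)
      simp only [← mul_assoc, ← sum_mul]
      rw [← add_mul, this, one_mul]; rfl
    · intro j _ hj
      have := (hdiag ⟨i, hi⟩ j).trans (if_neg fun h => hj (Fin.ext h))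
      simp only [← mul_assoc, ← sum_mul]
      rw [← add_mul, this, zero_mul]
    · simp
  by_cases hd0 : d = 0
  · subst hd0
    have e : ∀ j, (mat n c j fun l => 0 * v l) = fun i => 0 * mat n c j v i := fun j =>
      mat_smul n c j 0 v
    constructor
    · exact hfirst
    · intro i _; rw [e]; ring
    · intro k _ i _; simp only [e, mat_smul]; ring
    · intro i _; rw [e]; ring
    · intro i _; simp only [e, squares_smul, mat_smul]; ring
  · obtain ⟨h0, hs, hK, A, hA, hN⟩ := hd hd0
    have key : ∀ (j : ℕ) (y : ℕ → ℤ) (i : ℕ) (hi : i < n + n), mat n c j y i =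
        (blk n c j *ᵥ fun l => y l) ⟨i, hi⟩ := fun j y i hi => mat_eq_mulVec n c j y ⟨i, hi⟩
    constructor
    · exact hfirst
    · intro i hi; rw [key _ _ _ hi, h0, one_mulVec]
    · intro k hk i hi
      rw [key _ _ _ hi, key _ _ _ hi, key _ _ _ hi, vec_mat, vec_mat, mulVec_mulVec, hs k hk,
        add_mulVec, ← mulVec_mulVec, smul_mulVec]
      rfl
    · intro i hi; rw [key _ _ _ hi, hK, zero_mulVec]; rfl
    · intro i hi
      simp only [squares]
      have hA0 := hA 0 (by norm_num)
      have hA1 := hA 1 (by norm_num)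
      have hA2 := hA 2 (by norm_num)
      have hA3 := hA 3 (by norm_num)
      rw [key _ _ _ hi, key _ _ _ hi]
      simp only [vec_mat, hA0, hA1, hA2, hA3]
      simp only [mulVec_mulVec, mul_assoc, hN]
      rw [add_mulVec, one_mulVec, smul_mulVec]
      rfl

lemma sum_range_mul {α : Type*} [AddCommMonoid α] (f : ℕ → α) (a b : ℕ) :
    ∑ k ∈ range (a * b), f k = ∑ i ∈ range a, ∑ j ∈ range b, f (i * b + j) := by
  induction a with
  | zero => simp
  | succ a ih => rw [Nat.succ_mul, sum_range_add, ih, sum_range_succ]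

/-- The number of integers of a certificate. -/
def numTokens (n : ℕ) : ℕ := off n (8 + 2 * depth n)

lemma sum_off {α : Type*} [AddCommMonoid α] (f : ℤ → α) (n J : ℕ) (c : ℕ → ℤ) :
    ∑ k ∈ range (off n J), f (c k) = f (c 0) + ∑ i : Fin n, f (c (1 + i)) +
      ∑ j ∈ range J, ∑ i, ∑ l, f (blk n c j i l) := by
  rw [off, add_comm n 1, sum_range_add, sum_range_add, sum_range_one,
    sum_range fun i => f (c (1 + i)), sum_range_mul]
  congr 1
  refine sum_congr rfl fun j _ => ?_
  rw [sum_range_mul, sum_range]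
  refine sum_congr rfl fun i _ => ?_
  rw [sum_range]
  refine sum_congr rfl fun l _ => ?_
  simp only [blk, of_apply, off]
  congr 2; ring

/-- The digits of all integers of an honest certificate together. -/
def digitBound (n b : ℕ) : ℕ :=
  shortBits n b + (2 * n + 1) * longBits n b + (7 + 2 * depth n) * ((n + n) * (n + n)) * shortBits n b

lemma sum_sum_le {n : ℕ} (A : IntMat (n + n)) (E : ℕ)
    (h : ∀ i j, (A i j).natAbs.size ≤ E) :
    ∑ i, ∑ j, (A i j).natAbs.size ≤ (n + n) * (n + n) * E := by
  calc _ ≤ ∑ _i : Fin (n + n), ∑ _j : Fin (n + n), E :=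
      sum_le_sum fun i _ => sum_le_sum fun j _ => h i j
    _ = _ := by simp [mul_assoc]

/-- Every integer matrix has a short certificate for its determinant. -/
lemma exists_certificate {n : ℕ} (M : IntMat n) (b : ℕ) (hb1 : 1 ≤ b)
    (hb : ∀ i j, |M i j| ≤ b) :
    ∃ c : ℕ → ℤ, (∀ i j : Fin n, c (1 + n + i * (n + n) + j) = M i j) ∧
      (∀ v, RoundCheck n c M.det v) ∧
      ∑ k ∈ range (numTokens n), (c k).natAbs.size ≤ digitBound n b := by
  rcases Nat.eq_zero_or_pos n with hn | hn
  · subst hn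
    refine ⟨fun _ => 0, fun i => i.elim0, fun v => ⟨⟨?_, ?_, ?_, ?_, ?_⟩, by simp⟩, by simp⟩ <;>
      intros <;> omega
  obtain ⟨D, W, T, Q, Y, hl, hr, hp, sD, sW, sT, bQ, bY, bT⟩ := nonempty_diagData hn M b hb1 hb
  set N' : Matrix (Fin n ⊕ Fin n) (Fin n ⊕ Fin n) ℤ := fromBlocks M T Q Y with hN'
  set N : IntMat (n + n) :=
    N'.submatrix finSumFinEquiv.symm finSumFinEquiv.symm with hN
  set W' : IntMat (n + n) :=
    (fromBlocks W 0 0 0).submatrix finSumFinEquiv.symm finSumFinEquiv.symm with hW'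
  have hMb : ∀ i j, |M i j| ≤ (n : ℤ) ^ 2 * b + 1 := fun i j => (hb i j).trans (by
    have : (1 : ℤ) ≤ n := by exact_mod_cast hn
    have : (b : ℤ) * 1 ≤ b * (n * n) := mul_le_mul_of_nonneg_left (by nlinarith) (by positivity)
    nlinarith)
  -- the part of the certificate that is needed in the nonsingular case only
  obtain ⟨X, R, P, A, Z, hrest, bX, bR, bP, bA, bZ⟩ : ∃ (X : ℤ)
      (R P : ℕ → IntMat (n + n))
      (A : ℕ → IntMat (n + n)) (Z : IntMat (n + n)),
      (M.det ≠ 0 → R 0 = 1 ∧ (∀ k, R k * R k = N * P k + X • R (k + 1)) ∧ R (depth n) = 0 ∧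
        N * (A 3 * (A 3 * (A 2 * (A 2 * (A 1 * (A 1 * (A 0 * A 0))))))) = 1 + (3 : ℤ) • Z) ∧
      X.natAbs.size ≤ shortBits n b ∧ (∀ k i j, (R k i j).natAbs.size ≤ shortBits n b) ∧
      (∀ k i j, (P k i j).natAbs.size ≤ shortBits n b) ∧
      (∀ k i j, (A k i j).natAbs.size ≤ shortBits n b) ∧
      ∀ i j, (Z i j).natAbs.size ≤ shortBits n b := by
    by_cases hM : M.det = 0
    · exact ⟨0, 0, 0, 0, 0, fun h => absurd hM h, by simp, by simp, by simp, by simp, by simp⟩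
    · have hNb : ∀ i j, |N i j| ≤ (n ^ 2 * b + 1 : ℕ) := by
        intro i j
        push_cast
        simp only [hN, hN', submatrix_apply]
        rcases finSumFinEquiv.symm i with i | i <;> rcases finSumFinEquiv.symm j with j | j
        · exact hMb i j
        · exact bT hM i j
        · exact bQ i j
        · exact bY i j
      have hdet : N.det = 1 := by
        have h3 : fromBlocks 1 0 W (diagonal D) * N' = fromBlocks M T 0 1 := by
          rw [hN', fromBlocks_multiply, hl, hr]; simp
        have h4 := congr_arg det h3
        rw [det_mul, det_fromBlocks_zero₁₂, det_fromBlocks_zero₂₁, det_one, one_mul, mul_one,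
          det_diagonal, hp] at h4
        rw [hN, det_submatrix_equiv_self]
        exact mul_left_cancel₀ hM (h4.trans (mul_one _).symm)
      obtain ⟨R, P, h1, h2, h3, h4⟩ := exists_chain N N.adjugate
        (by rw [mul_adjugate, hdet, one_smul]) _ (by push_cast; nlinarith [sq_nonneg (n : ℤ), (by exact_mod_cast hb1 : (1 : ℤ) ≤ b)]) hNb (depth n) (by
          rw [Fintype.card_fin, depth, pow_add]
          have := Nat.lt_size_self n
          omega)
      obtain ⟨A, Z, h5, h6, h7⟩ := exists_squares (show 0 < n + n by omega) N hdet _ hNb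
      rw [Fintype.card_fin] at h2 h4
      have hmed : ∀ z : ℤ, |z| ≤ 8 * ((n + n : ℕ) : ℤ) ^ 2 * ((n ^ 2 * b + 1 : ℕ) : ℤ) →
          z.natAbs.size ≤ shortBits n b := fun z hz =>
        (size_natAbs_le (B := 8 * (n + n) ^ 2 * (n ^ 2 * b + 1)) (by exact_mod_cast hz)).trans
          (Nat.size_le_size (medium_le hn hb1))
      refine ⟨_, R, P, fun k => A (Fin.ofNat 4 k), Z, fun _ => ⟨h1, h2, h3, h5⟩, hmed _ ?_, fun k i j => hmed _ (h4 k i j).1,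
        fun k i j => hmed _ (h4 k i j).2, fun k i j => ?_, fun i j => ?_⟩
      · rw [abs_of_nonneg (by positivity)]
      · refine size_small_le hn hb1 ((h6 _ i j).trans ?_)
        have : (1 : ℤ) ≤ (n : ℤ) ^ 2 * b := by
          exact_mod_cast Nat.one_le_iff_ne_zero.2 (by positivity)
        omega
      · exact (size_natAbs_le (B := 256 * (n + n) ^ 8 * (n ^ 2 * b + 1) + 1)
          (by exact_mod_cast h7 i j)).trans (Nat.size_le_size (small_le hn hb1))
  set K := depth n with hK
  set mats : ℕ → IntMat (n + n) := fun j =>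
    if j = 0 then N else if j = 1 then W' else if j ≤ 2 + 2 * K then
      (if j % 2 = 0 then R ((j - 2) / 2) else P ((j - 3) / 2))
    else if j < 7 + 2 * K then A (j - (3 + 2 * K)) else Z with hmats
  set c := flat n X (fun i => if h : i < n then D ⟨i, h⟩ else 0) mats with hc
  have hblk : ∀ j, blk n c j = mats j := blk_flat n X _ mats
  have hc0 : c 0 = X := rfl
  have hcD : ∀ i : Fin n, c (1 + i) = D i := fun i => by simp [hc, flat, add_comm 1]
  have m0 : mats 0 = N := rfl
  have m1 : mats 1 = W' := rfl
  have mR : ∀ k ≤ K, mats (2 + 2 * k) = R k := fun k hk => by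
    simp only [hmats]; split_ifs <;> first | omega | (congr 1; omega)
  have mP : ∀ k < K, mats (3 + 2 * k) = P k := fun k hk => by
    simp only [hmats]; split_ifs <;> first | omega | (congr 1; omega)
  have mA : ∀ l < 4, mats (3 + 2 * K + l) = A l := fun l hl => by
    simp only [hmats]; split_ifs <;> first | omega | (congr 1; omega)
  have mZ : mats (7 + 2 * K) = Z := by
    simp only [hmats]; split_ifs <;> first | omega | rfl
  refine ⟨c, fun i j => ?_, fun v => ⟨linCheck_of_blk (fun i j => ?_) (fun hd => ?_) v, ?_⟩, ?_⟩
  · have : blk n c 0 (Fin.castAdd n i) (Fin.castAdd n j) = M i j := by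
      rw [hblk, m0]; simp [hN, hN']
    rw [← this]
    simp [blk, off, add_comm 1 n]
  · rw [hblk, hblk, m0, m1, hcD]
    refine Fin.addCases (fun j => ?_) (fun j => ?_) j
    · have := congr_fun (congr_fun hl i) j
      rw [if_neg (by simp; omega)]
      rw [Matrix.add_apply, Matrix.mul_apply, diagonal_mul, Matrix.zero_apply] at this
      rw [← this]
      simp [hN, hN', hW', -Fin.natAdd_eq_addNat]
    · have := congr_fun (congr_fun hr i) j
      rw [Matrix.add_apply, Matrix.mul_apply, diagonal_mul, Matrix.one_apply] at this
      simp only [Fin.val_natAdd, add_right_inj, Fin.val_inj, eq_comm (a := j)]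
      rw [← this]
      simp [hN, hN', hW', -Fin.natAdd_eq_addNat]
  · obtain ⟨h1, h2, h3, h4⟩ := hrest hd
    refine ⟨?_, fun k hk => ?_, ?_, A, fun l hl => ?_, ?_⟩
    · rw [hblk, ← h1, ← mR 0 (by omega)]
    · rw [hblk, hblk, hblk, hblk, m0, hc0, mR k (by omega), mP k (by omega),
        show 4 + 2 * k = 2 + 2 * (k + 1) by ring, mR (k + 1) (by omega), h2]
    · rw [hblk, mR K le_rfl, h3]
    · rw [hblk, mA l hl]
    · rw [hblk, hblk, m0, mZ]; exact h4
  · rw [prod_range, ← hp]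
    exact prod_congr rfl fun i _ => hcD i
  · rw [numTokens, sum_off (fun z => z.natAbs.size), hc0]
    simp only [hcD, hblk]
    rw [← hK, show 8 + 2 * K = 6 + 2 * K + 1 + 1 by ring, sum_range_succ',
      sum_range_succ']
    have hrestb : ∑ k ∈ range (6 + 2 * K), ∑ i, ∑ l, (mats (k + 1 + 1) i l).natAbs.size ≤
        (6 + 2 * K) * ((n + n) * (n + n) * shortBits n b) := by
      refine (sum_le_card_nsmul _ _ ((n + n) * (n + n) * shortBits n b) fun j hj =>
        sum_sum_le _ _ fun i l => ?_).trans (by simp)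
      simp only [hmats]
      rw [if_neg (by omega), if_neg (by omega)]
      split_ifs
      exacts [bR _ _ _, bP _ _ _, bA _ _ _, bZ _ _]
    have hW'b : ∑ i, ∑ l, (mats (0 + 1) i l).natAbs.size ≤ n * longBits n b := by
      rw [zero_add, m1, hW']
      simp only [submatrix_apply]
      rw [Equiv.sum_comp finSumFinEquiv.symm (fun i => ∑ l, (fromBlocks W 0 0 0 i
        (finSumFinEquiv.symm l)).natAbs.size)]
      simpa [Fin.sum_univ_add, -Fin.natAdd_eq_addNat] using sW
    have hNb : ∑ i, ∑ l, (mats 0 i l).natAbs.size ≤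
        (n + n) * (n + n) * shortBits n b + n * longBits n b := by
      rw [m0, hN]
      simp only [submatrix_apply]
      rw [Equiv.sum_comp finSumFinEquiv.symm (fun i => ∑ l, (N' i
        (finSumFinEquiv.symm l)).natAbs.size)]
      simp only [Fintype.sum_sum_type, Fin.sum_univ_add, hN', finSumFinEquiv_symm_apply_castAdd,
        finSumFinEquiv_symm_apply_natAdd, fromBlocks_apply₁₁, fromBlocks_apply₁₂,
        fromBlocks_apply₂₁, fromBlocks_apply₂₂, sum_add_distrib]
      have q : ∀ B : IntMat n, (∀ i j, |B i j| ≤ (n : ℤ) ^ 2 * b + 1) →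
          ∑ i, ∑ j, (B i j).natAbs.size ≤ n * n * shortBits n b := by
        intro B hB
        calc _ ≤ ∑ _i : Fin n, ∑ _j : Fin n, shortBits n b :=
            sum_le_sum fun i _ => sum_le_sum fun j _ => size_small_le hn hb1 (hB i j)
          _ = _ := by simp [mul_assoc]
      have q1 := q M hMb
      have q2 := q Q bQ
      have q3 := q Y bY
      have e : (n + n) * (n + n) * shortBits n b = 4 * (n * n * shortBits n b) := by ring
      omega
    rw [digitBound, ← hK]
    have e : (7 + 2 * K) * ((n + n) * (n + n)) * shortBits n b =
        (6 + 2 * K) * ((n + n) * (n + n) * shortBits n b) + (n + n) * (n + n) * shortBits n b := by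
      ring
    have e2 : (2 * n + 1) * longBits n b = n * longBits n b + n * longBits n b + longBits n b := by
      ring
    omega

end DetCert

/-! ### Random primes -/

namespace DetCert

open Finset RAM

/-- Chebyshev's lower bound for the number of primes. -/
lemma two_pow_le_mul_primes (b : ℕ) (hb : 0 < b) :
    2 ^ b ≤ b * (((range (2 ^ b + 1)).filter Nat.Prime).card + 1) := by
  obtain ⟨k, hk⟩ : ∃ k, 2 ^ b = 2 * k := ⟨2 ^ (b - 1), by rw [← pow_succ', Nat.sub_add_cancel hb]⟩
  have hk0 : 0 < k := by have := Nat.two_pow_pos b; omega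
  have h1 := Nat.four_pow_le_two_mul_self_mul_centralBinom k hk0
  have h2 : k.centralBinom ≤ (2 * k) ^ ((range (2 * k + 1)).filter Nat.Prime).card := by
    conv_lhs => rw [← Nat.prod_pow_factorization_centralBinom]
    rw [← prod_const, prod_filter]
    refine prod_le_prod' fun p _ => ?_
    split_ifs with hp
    · exact Nat.pow_factorization_choose_le (by omega)
    · rw [Nat.factorization_eq_zero_of_not_prime _ hp, pow_zero]
  rw [← hk] at h2 h1
  have h3 : 2 ^ (2 ^ b) ≤ 2 ^ (b * (((range (2 ^ b + 1)).filter Nat.Prime).card + 1)) := by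
    rw [pow_mul 2 b, pow_succ' (2 ^ b)]
    refine le_trans ?_ (Nat.mul_le_mul_left _ h2)
    calc 2 ^ (2 ^ b) = 4 ^ k := by rw [hk, pow_mul]; norm_num
      _ ≤ _ := h1
  exact (Nat.pow_le_pow_iff_right (by norm_num)).1 h3

lemma card_primeFactors_le {z : ℤ} (hz : z ≠ 0) {H : ℕ} (h : z.natAbs ≤ 2 ^ H) :
    z.natAbs.primeFactors.card ≤ H := by
  have h1 : 2 ^ z.natAbs.primeFactors.card ≤ ∏ p ∈ z.natAbs.primeFactors, p := by
    rw [← prod_const]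
    exact prod_le_prod' fun p hp => (Nat.prime_of_mem_primeFactors hp).two_le
  have h2 := Nat.le_of_dvd (Int.natAbs_pos.2 hz) (Nat.prod_primeFactors_dvd z.natAbs)
  exact (Nat.pow_le_pow_iff_right (by norm_num)).1 (h1.trans (h2.trans h))

/-- The number with the given binary digits, highest first. -/
def coinNum (f : ℕ → Bool) : ℕ → ℕ
  | 0 => 0
  | k + 1 => 2 * coinNum f k + (f k).toNat

lemma coinNum_congr {f g : ℕ → Bool} {b : ℕ} (h : ∀ k < b, f k = g k) :
    coinNum f b = coinNum g b := by
  induction b with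
  | zero => rfl
  | succ b ih => rw [coinNum, coinNum, ih fun k hk => h k (by omega), h b (by omega)]

lemma coinNum_lt (f : ℕ → Bool) (b : ℕ) : coinNum f b < 2 ^ b := by
  induction b with
  | zero => simp [coinNum]
  | succ b ih =>
    rw [coinNum, pow_succ]
    have : (f b).toNat ≤ 1 := Bool.toNat_le _
    omega

lemma exists_coinNum (b q : ℕ) (h : q < 2 ^ b) : ∃ f, coinNum f b = q := by
  induction b generalizing q with
  | zero => exact ⟨fun _ => false, by simp [coinNum] at *; omega⟩
  | succ b ih =>
    rw [pow_succ] at h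
    obtain ⟨f, hf⟩ := ih (q / 2) (by omega)
    refine ⟨Function.update f b (decide (q % 2 = 1)), ?_⟩
    have h1 : coinNum (Function.update f b (decide (q % 2 = 1))) b = coinNum f b :=
      coinNum_congr fun k hk => by rw [Function.update_of_ne hk.ne]
    rw [coinNum, h1, hf, Function.update_self]
    rcases Nat.mod_two_eq_zero_or_one q with h2 | h2 <;> simp [h2] <;> omega

/-- Extend a finite sequence of coins. -/
def ext {β : ℕ} (s : Fin β → Bool) (k : ℕ) : Bool := if h : k < β then s ⟨k, h⟩ else false

/-! #### Rounds of coin tosses -/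

lemma fairCoins_prefix (T : ℕ) (s : ℕ → Bool) :
    fairCoins {ω | ∀ k < T, ω k = s k} = (2⁻¹ : ENNReal) ^ T := by
  have e : {ω : ℕ → Bool | ∀ k < T, ω k = s k} =
      Set.pi (range T : Set ℕ) fun k => {s k} := by ext ω; simp [Set.mem_pi]
  rw [e, fairCoins, Measure.infinitePi_pi _ (fun _ _ => MeasurableSet.singleton _)]
  rw [prod_congr rfl fun k _ => by
    rw [PMF.toMeasure_apply_singleton _ _ (MeasurableSet.singleton _),
      PMF.uniformOfFintype_apply]]
  simp

/-- If each round is passed by the coins in a finite set only, all rounds are passed with the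
probability of that set to the power of the number of rounds, at most. -/
lemma fairCoins_rounds_le (β r : ℕ) (G : Finset (Fin β → Bool)) :
    fairCoins {ω | ∀ t < r, (fun i : Fin β => ω (t * β + i)) ∈ G} ≤
      (G.card * (2⁻¹ : ENNReal) ^ β) ^ r := by
  classical
  rcases Nat.eq_zero_or_pos β with h0 | h0
  · subst h0
    rcases Nat.eq_zero_or_pos r with hr | hr
    · subst hr
      haveI : IsProbabilityMeasure fairCoins := by unfold fairCoins; infer_instance
      simpa using prob_le_one
    · rcases G.eq_empty_or_nonempty with hG | hG
      · subst hG
        have : {ω : ℕ → Bool | ∀ t < r, (fun i : Fin 0 => ω (t * 0 + i)) ∈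
            (∅ : Finset (Fin 0 → Bool))} = ∅ := by
          ext ω; simp; exact ⟨0, hr⟩
        rw [this]; simp
      · haveI : IsProbabilityMeasure fairCoins := by unfold fairCoins; infer_instance
        refine prob_le_one.trans ?_
        have : (1 : ENNReal) ≤ G.card := by exact_mod_cast hG.card_pos
        simpa using one_le_pow₀ this
  set S : Finset (Fin r → Fin β → Bool) := Fintype.piFinset fun _ => G
  set glue : (Fin r → Fin β → Bool) → ℕ → Bool := fun s k =>
    if h : k / β < r then s ⟨k / β, h⟩ ⟨k % β, Nat.mod_lt _ h0⟩ else false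
  have hsub : {ω : ℕ → Bool | ∀ t < r, (fun i : Fin β => ω (t * β + i)) ∈ G} ⊆
      ⋃ s ∈ S, {ω | ∀ k < r * β, ω k = glue s k} := by
    intro ω hω
    simp only [Set.mem_iUnion]
    refine ⟨fun t i => ω (t * β + i), Fintype.mem_piFinset.2 fun t => hω t t.2, fun k hk => ?_⟩
    have h1 : k / β < r := (Nat.div_lt_iff_lt_mul h0).2 hk
    simp only [glue, h1, dif_pos]
    rw [Nat.div_add_mod']
  refine (measure_mono hsub).trans ((measure_biUnion_finset_le _ _).trans ?_)
  simp only [fairCoins_prefix]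
  rw [sum_const, nsmul_eq_mul, Fintype.card_piFinset_const, mul_pow, ← pow_mul, mul_comm r β]
  push_cast
  exact le_rfl

/-! #### Detection of a wrong certificate -/

/-- The certificate `C` for the value `δ` passes a round with modulus `Q + 1` and test vector `v`. -/
def Passes (n : ℕ) (C : List Bool) (δ : ℤ) (Q : ℕ) (v : ℕ → ℕ) : Prop :=
  RoundCheck n (fun k => (cval C k : ZMod (Q + 1))) (δ : ZMod (Q + 1)) fun j => (v j : ZMod (Q + 1))

lemma Passes.congr {n : ℕ} {C : List Bool} {δ : ℤ} {Q : ℕ} {v v' : ℕ → ℕ}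
    (h : Passes n C δ Q v) (hv : ∀ j < n + n, v j = v' j) : Passes n C δ Q v' :=
  ⟨h.toLinCheck.congr fun j hj => by rw [hv j hj], h.prod⟩

/-- Modulo any number that does not divide the defect of an identity, at least half of all test
vectors reveal it: flipping the right coordinate turns a vector that does not into one that does. -/
lemma card_passes_le {n : ℕ} {C : List Bool} {δ z : ℤ} {Q : ℕ}
    (hz : ((z : ℤ) : ZMod (Q + 1)) ≠ 0)
    (h : z = ∏ i ∈ range n, cval C (1 + i) - δ ∨
      ∃ j < n + n, defect n (cval C) δ (unitVec j) z) [DecidablePred fun s : Fin (n + n) → Bool =>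
        Passes n C δ Q fun j => (ext s j).toNat] :
    2 * (univ.filter fun s : Fin (n + n) → Bool =>
      Passes n C δ Q fun j => (ext s j).toNat).card ≤ 2 ^ (n + n) := by
  classical
  rcases h with h | ⟨j, hj, h⟩
  · rw [filter_false_of_mem]
    · simp
    · intro s _ hs
      apply hz
      rw [h]
      have := hs.prod
      push_cast
      rw [this, sub_self]
  · set G := univ.filter fun s : Fin (n + n) → Bool =>
      Passes n C δ Q fun j => (ext s j).toNat with hG
    set flip : (Fin (n + n) → Bool) → (Fin (n + n) → Bool) := fun s =>
      Function.update s ⟨j, hj⟩ (!s ⟨j, hj⟩) with hflip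
    have hinv : Function.Involutive flip := by
      intro s
      simp [hflip]
    have hmaps : ∀ s ∈ G, flip s ∈ Gᶜ := by
      intro s hs
      rw [mem_compl]
      intro hs'
      have h1 := ((mem_filter.1 hs).2).toLinCheck
      have h2 := ((mem_filter.1 hs').2).toLinCheck
      have key : ∀ σ : Fin (n + n) → Bool, σ ⟨j, hj⟩ = true →
          LinCheck n (fun k => (cval C k : ZMod (Q + 1))) (δ : ZMod (Q + 1))
            (fun i => ((ext σ i).toNat : ZMod (Q + 1))) →
          LinCheck n (fun k => (cval C k : ZMod (Q + 1))) (δ : ZMod (Q + 1))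
            (fun i => ((ext (flip σ) i).toNat : ZMod (Q + 1))) → False := by
        intro σ hσ l1 l2
        have l3 := (l1.sub l2).congr (v' := fun i => ((unitVec j i : ℤ) : ZMod (Q + 1)))
          fun i hi => by
            simp only [ext, hi, dif_pos, hflip, Function.update_apply, unitVec]
            by_cases hij : i = j
            · subst hij; simp [hσ]
            · simp [hij]
        exact hz ((linCheck_iff _ _ _ _).1 l3 _ (h.map (Int.castRingHom (ZMod (Q + 1)))))
      cases hb : s ⟨j, hj⟩
      · refine key (flip s) (by simp [hflip, hb]) h2 ?_
        rw [hinv s]; exact h1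
      · exact key s hb h1 h2
    have h1 := card_le_card_of_injOn flip hmaps hinv.injective.injOn
    have h2 := card_compl_add_card G
    rw [Fintype.card_fun, Fintype.card_bool, Fintype.card_fin] at h2
    omega

/-- In one round, a wrong certificate fails for a proportion of at least `1 / (4 b)` of the coins: at
least `1 / (2 b)` of the moduli are primes that do not divide the defect `z`, and half of the vectors
reveal it for each of them. -/
lemma card_good_le {n : ℕ} {C : List Bool} {δ z : ℤ} (hz : z ≠ 0) {H b : ℕ} (hb : 0 < b)
    (hzH : z.natAbs ≤ 2 ^ H) (hH : 2 * b * (H + 1) ≤ 2 ^ b)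
    (h : z = ∏ i ∈ range n, cval C (1 + i) - δ ∨
      ∃ j < n + n, defect n (cval C) δ (unitVec j) z)
    [DecidablePred fun s : Fin (b + (n + n)) → Bool =>
        Passes n C δ (coinNum (ext s) b) fun j => (ext s (b + j)).toNat] :
    4 * b * (univ.filter fun s : Fin (b + (n + n)) → Bool =>
      Passes n C δ (coinNum (ext s) b) fun j => (ext s (b + j)).toNat).card + 2 ^ (b + (n + n)) ≤
      4 * b * 2 ^ (b + (n + n)) := by
  set G := univ.filter fun s : Fin (b + (n + n)) → Bool =>
      Passes n C δ (coinNum (ext s) b) fun j => (ext s (b + j)).toNat with hG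
  classical
  set A : (Fin b → Bool) → Finset (Fin (n + n) → Bool) := fun a => univ.filter fun v =>
    Passes n C δ (coinNum (ext a) b) fun j => (ext v j).toNat with hA
  -- split the coins into those for the modulus and those for the test vector
  have hcard : G.card ≤ ∑ a, (A a).card := by
    have : G.card ≤ ((univ : Finset (Fin b → Bool)).sigma A).card := by
      refine card_le_card_of_injOn
        (fun s => ⟨fun i => s (Fin.castAdd (n + n) i), fun i => s (Fin.natAdd b i)⟩) (fun s hs => ?_) ?_
      · rw [mem_coe, mem_sigma]
        refine ⟨mem_univ _, ?_⟩
        simp only [hA, mem_filter, mem_univ, true_and]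
        have hs := (mem_filter.1 hs).2
        have e : coinNum (ext fun i => s (Fin.castAdd (n + n) i)) b = coinNum (ext s) b :=
          coinNum_congr fun k hk => by
            simp only [ext, hk, dif_pos, show k < b + (n + n) by omega]; rfl
        rw [e]
        refine hs.congr fun j hj => ?_
        simp only [ext, show j < (n + n) from hj, dif_pos, show b + j < b + (n + n) by omega]; rfl
      · intro s _ s' _ hss
        simp only [Sigma.mk.injEq, heq_eq_eq] at hss
        funext i
        refine Fin.addCases (fun i => congr_fun hss.1 i) (fun i => congr_fun hss.2 i) i
    rwa [card_sigma] at this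
  set P : Finset (Fin b → Bool) := univ.filter fun a =>
    ((z : ℤ) : ZMod (coinNum (ext a) b + 1)) ≠ 0 with hP
  have hAle : ∀ a, 2 * (A a).card ≤ if a ∈ P then 2 ^ (n + n) else 2 * 2 ^ (n + n) := by
    intro a
    split_ifs with ha
    · exact card_passes_le (mem_filter.1 ha).2 h
    · have := card_le_univ (A a)
      rw [Fintype.card_fun, Fintype.card_bool, Fintype.card_fin] at this
      omega
  have hsum : 2 * G.card + P.card * 2 ^ (n + n) ≤ 2 * (2 ^ b * 2 ^ (n + n)) := by
    have h1 : 2 * G.card ≤ ∑ a : Fin b → Bool, if a ∈ P then 2 ^ (n + n) else 2 * 2 ^ (n + n) := by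
      refine (Nat.mul_le_mul_left 2 hcard).trans ?_
      rw [mul_sum]
      exact sum_le_sum fun a _ => hAle a
    have h2 : (∑ a : Fin b → Bool, if a ∈ P then 2 ^ (n + n) else 2 * 2 ^ (n + n)) + P.card * 2 ^ (n + n) =
        2 * (2 ^ b * 2 ^ (n + n)) := by
      have e : P.card * 2 ^ (n + n) = ∑ a : Fin b → Bool, if a ∈ P then 2 ^ (n + n) else 0 := by
        rw [sum_ite_mem, univ_inter, sum_const, smul_eq_mul]
      rw [e, ← sum_add_distrib]
      rw [sum_congr rfl (g := fun _ => 2 * 2 ^ (n + n)) fun a _ => by split_ifs <;> ring]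
      simp; ring
    omega
  -- there are many primes that do not divide `z`
  have hPcard : 2 ^ b ≤ 2 * b * P.card := by
    choose f hf using exists_coinNum b
    set primes := (range (2 ^ b + 1)).filter Nat.Prime with hprimes
    have h1 := two_pow_le_mul_primes b hb
    have h2 : (primes \ z.natAbs.primeFactors).card ≤ P.card := by
      refine card_le_card_of_injOn (fun p => if h : p - 1 < 2 ^ b then
        fun i : Fin b => f (p - 1) h i else fun _ => false) (fun p hp => ?_) ?_
      · simp only [hprimes, coe_sdiff, Set.mem_diff, mem_coe, mem_filter,
          mem_range] at hp
        obtain ⟨⟨hp1, hp2⟩, hp3⟩ := hp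
        have hp4 : p - 1 < 2 ^ b := by have := hp2.one_lt; omega
        simp only [hP, coe_filter, mem_univ, true_and, Set.mem_setOf_eq, hp4, dif_pos]
        have e : coinNum (ext fun i : Fin b => f (p - 1) hp4 i) b = p - 1 := by
          refine (coinNum_congr fun k hk => ?_).trans (hf (p - 1) hp4)
          simp [ext, hk]
        rw [e, Nat.sub_add_cancel hp2.one_lt.le]
        intro h0
        apply hp3
        rw [ZMod.intCast_zmod_eq_zero_iff_dvd] at h0
        exact Nat.mem_primeFactors.2 ⟨hp2, Int.natCast_dvd.1 h0, Int.natAbs_ne_zero.2 hz⟩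
      · intro p hp p' hp' heq
        simp only [hprimes, coe_sdiff, Set.mem_diff, mem_coe, mem_filter,
          mem_range] at hp hp'
        have hp4 : p - 1 < 2 ^ b := by have := hp.1.2.one_lt; omega
        have hp4' : p' - 1 < 2 ^ b := by have := hp'.1.2.one_lt; omega
        simp only [hp4, hp4', dif_pos] at heq
        have : coinNum (f (p - 1) hp4) b = coinNum (f (p' - 1) hp4') b :=
          coinNum_congr fun k hk => congr_fun heq ⟨k, hk⟩
        rw [hf, hf] at this
        have := hp.1.2.one_lt
        have := hp'.1.2.one_lt
        omega
    have h3 := le_card_sdiff z.natAbs.primeFactors primes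
    have h4 := card_primeFactors_le hz hzH
    have h5 : primes.card + 1 ≤ P.card + (H + 1) := by omega
    have h6 : 2 ^ b ≤ b * (P.card + (H + 1)) := h1.trans (Nat.mul_le_mul_left b h5)
    nlinarith
  have h7 : 2 ^ b * 2 ^ (n + n) ≤ 2 * b * P.card * 2 ^ (n + n) := Nat.mul_le_mul_right _ hPcard
  have h8 := Nat.mul_le_mul_left (2 * b) hsum
  rw [pow_add]
  clear_value P
  have e : 2 * b * (2 * G.card + P.card * 2 ^ (n + n)) =
      4 * b * G.card + 2 * b * P.card * 2 ^ (n + n) := by ring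
  have e' : 2 * b * (2 * (2 ^ b * 2 ^ (n + n))) = 4 * b * (2 ^ b * 2 ^ (n + n)) := by ring
  omega

end DetCert

/-! ### The determinant certificate -/

namespace DetCert

open Finset RAM Matrix

/-! #### The size of the defects -/

lemma two_mul_le_two_pow (n : ℕ) : n + n ≤ 2 ^ n := by
  induction n with
  | zero => simp
  | succ n ih =>
    rw [pow_succ]
    rcases Nat.eq_zero_or_pos n with h | h
    · subst h; norm_num
    · omega

lemma abs_mat_le {n l : ℕ} {c : ℕ → ℤ} (hc : ∀ k, |c k| ≤ 2 ^ l) (j k : ℕ) {y : ℕ → ℤ}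
    (hy : ∀ i, |y i| ≤ 2 ^ (k * (l + n + 1))) (i : ℕ) :
    |mat n c j y i| ≤ 2 ^ ((k + 1) * (l + n + 1)) := by
  have h1 : ((n + n : ℕ) : ℤ) ≤ 2 ^ n := by exact_mod_cast two_mul_le_two_pow n
  calc |mat n c j y i| ≤ ∑ t ∈ range (n + n), |c (off n j + i * (n + n) + t) * y t| := by
        rw [mat, mv]; exact abs_sum_le_sum_abs _ _
    _ ≤ ∑ _t ∈ range (n + n), 2 ^ l * 2 ^ (k * (l + n + 1)) :=
        sum_le_sum fun t _ => by
          rw [abs_mul]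
          exact mul_le_mul (hc _) (hy _) (abs_nonneg _) (by positivity)
    _ = ((n + n : ℕ) : ℤ) * (2 ^ l * 2 ^ (k * (l + n + 1))) := by simp
    _ ≤ 2 ^ n * (2 ^ l * 2 ^ (k * (l + n + 1))) := mul_le_mul_of_nonneg_right h1 (by positivity)
    _ = 2 ^ ((k * (l + n + 1)) + (l + n)) := by ring
    _ ≤ _ := pow_le_pow_right₀ (by norm_num) (by rw [add_mul]; omega)

lemma abs_defect_le {n l : ℕ} {c : ℕ → ℤ} (hc : ∀ k, |c k| ≤ 2 ^ l) {d : ℤ} (hd : |d| ≤ 2 ^ l)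
    {v : ℕ → ℤ} (hv : ∀ j, |v j| ≤ 1) {z : ℤ} (hz : defect n c d v z) :
    |z| ≤ 2 ^ (20 * (l + n + 1)) := by
  set x := l + n + 1 with hx
  have h1 : (2 : ℤ) ≤ 2 ^ x := by
    calc (2 : ℤ) = 2 ^ 1 := by norm_num
      _ ≤ 2 ^ x := pow_le_pow_right₀ (by norm_num) (by omega)
  have hlx : (2 : ℤ) ^ l ≤ 2 ^ x := pow_le_pow_right₀ (by norm_num) (by omega)
  have hv0 : ∀ j, |v j| ≤ 2 ^ (0 * x) := by simpa using hv
  have hdv : ∀ j, |d * v j| ≤ 2 ^ (1 * x) := by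
    intro j
    rw [abs_mul, one_mul]
    calc |d| * |v j| ≤ 2 ^ l * 1 := mul_le_mul hd (hv j) (abs_nonneg _) (by positivity)
      _ ≤ 2 ^ x := by rwa [mul_one]
  have htr : ∀ (k : ℕ) (y : ℕ → ℤ), (∀ i, |y i| ≤ 2 ^ (k * x)) →
      ∀ i, |trunc n y i| ≤ 2 ^ (k * x) := by
    intro k y hy i
    rw [trunc]; split_ifs
    · exact hy i
    · simp
  have hmat := fun j k (y : ℕ → ℤ) hy i => abs_mat_le (n := n) (y := y) hc j k hy i
  rw [← hx] at hmat
  have hmono : ∀ k ≤ 18, (2 : ℤ) ^ (k * x) ≤ 2 ^ (18 * x) := fun k hk =>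
    pow_le_pow_right₀ (by norm_num) (Nat.mul_le_mul_right x hk)
  have hc' : ∀ (k : ℕ) (i : ℕ) (t : ℤ), |t| ≤ 2 ^ (k * x) → |c i * t| ≤ 2 ^ ((k + 1) * x) := by
    intro k i t ht
    rw [abs_mul, add_mul, one_mul, pow_add, mul_comm]
    exact mul_le_mul ht ((hc i).trans hlx) (abs_nonneg _) (by positivity)
  have h4 : (8 : ℤ) * 2 ^ (18 * x) ≤ 2 ^ (20 * x) * 2 := by
    have : (2 : ℤ) ^ (20 * x) = 2 ^ (18 * x) * (2 ^ x * 2 ^ x) := by ring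
    rw [this]
    have : (4 : ℤ) ≤ 2 ^ x * 2 ^ x := by nlinarith
    have h0 : (0 : ℤ) < 2 ^ (18 * x) := by positivity
    nlinarith
  have h5 : ∀ t : ℤ, ∀ k ≤ 17, |t| ≤ 2 ^ (k * x) → |t| * 2 ≤ 2 ^ (18 * x) := by
    intro t k hk ht
    calc |t| * 2 ≤ 2 ^ (k * x) * 2 ^ x := mul_le_mul ht h1 (by norm_num) (by positivity)
      _ = 2 ^ ((k + 1) * x) := by ring
      _ ≤ _ := hmono _ (by omega)
  have h0 : (0 : ℤ) < 2 ^ (18 * x) := by positivity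
  rcases hz with ⟨i, hi⟩ | ⟨i, hi⟩ | ⟨k, hk, i, hi⟩ | ⟨i, hi⟩ | ⟨i, hi⟩
  · have a1 := h5 _ 2 (by norm_num) (hmat 1 1 _ (htr 1 _ (hmat 0 0 v hv0)) i)
    have a2 := h5 _ 2 (by norm_num) (hc' 1 (1 + i) _ (hmat 0 0 v hv0 (n + i)))
    have a3 := h5 _ 0 (by norm_num) (hv0 (n + i))
    refine (abs_sub _ _).trans ((add_le_add_left (abs_add_le _ _) _).trans ?_)
    linarith
  · have a1 := h5 _ 2 (by norm_num) (hmat 2 1 _ hdv i)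
    have a2 := h5 _ 1 (by norm_num) (hdv i)
    refine (abs_sub _ _).trans ?_
    linarith
  · have a1 := h5 _ 3 (by norm_num) (hmat (2 + 2 * k) 2 _ (hmat (2 + 2 * k) 1 _ hdv) i)
    have a2 := h5 _ 3 (by norm_num) (hmat 0 2 _ (hmat (3 + 2 * k) 1 _ hdv) i)
    have a3 := h5 _ 3 (by norm_num) (hc' 2 0 _ (hmat (4 + 2 * k) 1 _ hdv i))
    refine (abs_sub _ _).trans ((add_le_add_right (abs_add_le _ _) _).trans ?_)
    linarith
  · have a1 := h5 _ 2 (by norm_num) (hmat (2 + 2 * depth n) 1 _ hdv i)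
    linarith
  · have hsq : ∀ i, |squares n c (fun j => d * v j) i| ≤ 2 ^ (9 * x) :=
      hmat _ 8 _ (hmat _ 7 _ (hmat _ 6 _ (hmat _ 5 _ (hmat _ 4 _ (hmat _ 3 _ (hmat _ 2 _
        (hmat _ 1 _ hdv)))))))
    have a1 := h5 _ 10 (by norm_num) (hmat 0 9 _ hsq i)
    have a2 := h5 _ 1 (by norm_num) (hdv i)
    have a3 := h5 _ 2 (by norm_num) (hmat (7 + 2 * depth n) 1 _ hdv i)
    refine (abs_sub _ _).trans ((add_le_add_right (abs_add_le _ _) _).trans ?_)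
    rw [abs_mul 3, abs_of_pos (show (0 : ℤ) < 3 by norm_num)]
    linarith

lemma abs_cval_le (C : List Bool) (k : ℕ) : |cval C k| ≤ 2 ^ C.length := by
  have := (natAbs_cval_lt C k).le
  rw [Int.abs_eq_natAbs]; exact_mod_cast this

lemma abs_prod_cval_le (n : ℕ) (C : List Bool) :
    |∏ i ∈ range n, cval C (1 + i)| ≤ 2 ^ C.length := by
  rw [abs_prod]
  calc ∏ i ∈ range n, |cval C (1 + i)|
      ≤ ∏ i ∈ range n, 2 ^ dcount C (tpos C 1 (1 + i)) :=
        prod_le_prod (fun _ _ => abs_nonneg _) fun i _ => by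
          have := (natAbs_cval_lt' C (1 + i)).le
          rw [Int.abs_eq_natAbs]; exact_mod_cast this
    _ = 2 ^ ∑ i ∈ range n, dcount C (tpos C 1 (1 + i)) := prod_pow_eq_pow_sum _ _ _
    _ ≤ _ := pow_le_pow_right₀ (by norm_num) (by
        refine le_trans ?_ (sum_dcount_le C (n + 1))
        rw [sum_range_succ']
        simp only [add_comm 1]
        omega)

/-! #### The certificate and its test -/

/-- The number of bits of the random moduli, for certificates of length `l`. It exceeds the
logarithm of the bit size of any defect sufficiently for a random prime to reveal the defect. -/
def modBits (n l : ℕ) : ℕ := (512 * ((l + n + 1).size * (l + n + 1))).size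

lemma modBits_pos (n l : ℕ) : 0 < modBits n l := by
  have : 0 < (l + n + 1).size := Nat.size_pos.2 (by omega)
  exact Nat.size_pos.2 (by positivity)

lemma two_pow_modBits_le (n l : ℕ) :
    2 ^ modBits n l ≤ 1024 * ((l + n + 1).size * (l + n + 1)) := by
  obtain ⟨b, hb⟩ : ∃ b, modBits n l = b + 1 := ⟨modBits n l - 1, by have := modBits_pos n l; omega⟩
  have : 2 ^ b ≤ 512 * ((l + n + 1).size * (l + n + 1)) := Nat.lt_size.1 (by
    have : modBits n l = (512 * ((l + n + 1).size * (l + n + 1))).size := rfl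
    omega)
  rw [hb, pow_succ]; omega

lemma modBits_spec (n l : ℕ) :
    2 * modBits n l * (20 * (l + n + 1) + 1) ≤ 2 ^ modBits n l := by
  have h0 : 512 * ((l + n + 1).size * (l + n + 1)) < 2 ^ modBits n l := Nat.lt_size_self _
  set x := l + n + 1 with hx
  have h1 : 0 < x.size := Nat.size_pos.2 (by omega)
  have h2 : modBits n l ≤ 11 * x.size := by
    have : modBits n l ≤ 9 + 2 * x.size := by
      refine Nat.size_le.2 ?_
      have e1 : x < 2 ^ x.size := Nat.lt_size_self x
      have e2 : x.size < 2 ^ x.size := Nat.lt_two_pow_self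
      calc 512 * (x.size * x) < 512 * (2 ^ x.size * 2 ^ x.size) := by
            refine Nat.mul_lt_mul_of_pos_left ?_ (by norm_num)
            exact Nat.mul_lt_mul'' e2 e1
        _ = 2 ^ (9 + 2 * x.size) := by ring
    omega
  have h3 : 2 * modBits n l * (20 * x + 1) ≤ 2 * (11 * x.size) * (21 * x) :=
    Nat.mul_le_mul (Nat.mul_le_mul_left 2 h2) (by omega)
  nlinarith

/-- The test of a certificate, with `ρ * modBits` rounds. The copy of the matrix in the certificate
must be exact and have no leading zeros; this makes its comparison with the matrix cheap. In each
round, the identities are tested modulo a random number for a random vector of zeros and ones. -/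
def detAccepts (ρ : ℕ) {n : ℕ} (M : IntMat n) (δ : ℤ) (C : List Bool)
    (ω : ℕ → Bool) : Prop :=
  (∀ i j : Fin n, cval C (1 + n + i * (n + n) + j) = M i j ∧
    dcount C (tpos C 1 (1 + n + i * (n + n) + j)) = (M i j).natAbs.size) ∧
  δ.natAbs.size ≤ C.length ∧
  ∀ t < ρ * modBits n C.length, Passes n C δ
    (coinNum (fun i => ω (t * (modBits n C.length + (n + n)) + i)) (modBits n C.length))
    fun j => (ω (t * (modBits n C.length + (n + n)) + (modBits n C.length + j))).toNat

lemma mul_inv_le_exp {g b N : ℝ} (hb : 0 < b) (hN : 0 < N) (h : 4 * b * g + N ≤ 4 * b * N) :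
    g * N⁻¹ ≤ Real.exp (-(1 / (4 * b))) := by
  have h3 : g * N⁻¹ ≤ 1 - 1 / (4 * b) := by
    rw [← div_eq_mul_inv, div_le_iff₀ hN, ← sub_nonneg]
    have : (1 - 1 / (4 * b)) * N - g = (4 * b * N - (4 * b * g + N)) / (4 * b) := by
      field_simp
      ring
    rw [this]
    exact div_nonneg (by linarith) (by positivity)
  have := Real.add_one_le_exp (-(1 / (4 * b)))
  linarith

lemma natCast_mul_inv_pow (g N : ℕ) :
    (g : ENNReal) * 2⁻¹ ^ N = ENNReal.ofReal ((g : ℝ) * 2⁻¹ ^ N) := by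
  have h : (2⁻¹ : ENNReal) = ENNReal.ofReal 2⁻¹ := by
    rw [ENNReal.ofReal_inv_of_pos two_pos]
    norm_num
  have h2 : (0 : ℝ) ≤ 2⁻¹ := by norm_num
  rw [ENNReal.ofReal_mul (Nat.cast_nonneg g), ENNReal.ofReal_natCast, ENNReal.ofReal_pow h2, h]

open Classical in
/-- A wrong certificate passes with exponentially small probability. -/
lemma detAccepts_le (ρ : ℕ) {n : ℕ} (M : IntMat n) (δ : ℤ) (hδ : δ ≠ M.det)
    (C : List Bool) :
    fairCoins {ω | detAccepts ρ M δ C ω} ≤ ENNReal.ofReal (Real.exp (-(ρ / 4))) := by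
  by_cases hM : ∀ i j : Fin n, cval C (1 + n + i * (n + n) + j) = M i j
  swap
  · have : {ω | detAccepts ρ M δ C ω} = ∅ := by
      ext ω
      simp only [Set.mem_setOf_eq, Set.mem_empty_iff_false, iff_false]
      exact fun h => hM fun i j => (h.1 i j).1
    rw [this]; simp
  by_cases hs : δ.natAbs.size ≤ C.length
  swap
  · have : {ω | detAccepts ρ M δ C ω} = ∅ := by
      ext ω
      simp only [Set.mem_setOf_eq, Set.mem_empty_iff_false, iff_false]
      exact fun h => hs h.2.1
    rw [this]; simp
  have hd : |δ| ≤ 2 ^ C.length := by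
    have := (Nat.size_le.1 hs).le
    rw [Int.abs_eq_natAbs]; exact_mod_cast this
  have hC := abs_cval_le C
  set b := modBits n C.length with hb
  have hb0 : 0 < b := modBits_pos n _
  -- some identity fails for a unit vector; its defect is not too large
  obtain ⟨z, hz, hzb, h⟩ : ∃ z : ℤ, z ≠ 0 ∧ |z| ≤ 2 ^ (20 * (C.length + n + 1)) ∧
      (z = ∏ i ∈ range n, cval C (1 + i) - δ ∨
        ∃ j < n + n, defect n (cval C) δ (unitVec j) z) := by
    by_cases hp : ∏ i ∈ range n, cval C (1 + i) = δ
    · have : ¬ ∀ j < n + n, LinCheck n (cval C) δ (unitVec j) := fun h =>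
        hδ (det_eq_of_roundCheck M hM hp h).symm
      push Not at this
      obtain ⟨j, hj, hl⟩ := this
      rw [linCheck_iff] at hl
      push Not at hl
      obtain ⟨z, hz, hz0⟩ := hl
      refine ⟨z, hz0, abs_defect_le hC hd (fun i => ?_) hz, .inr ⟨j, hj, hz⟩⟩
      rw [unitVec]; split_ifs <;> simp
    · refine ⟨_, sub_ne_zero.2 hp, ?_, .inl rfl⟩
      refine (abs_sub _ _).trans ((add_le_add (abs_prod_cval_le n C) hd).trans ?_)
      rw [← two_mul, ← pow_succ']
      exact pow_le_pow_right₀ (by norm_num) (by omega)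
  have hzb' : z.natAbs ≤ 2 ^ (20 * (C.length + n + 1)) := by
    rw [Int.abs_eq_natAbs] at hzb; exact_mod_cast hzb
  have key := card_good_le hz hb0 hzb' (modBits_spec n C.length) h
  set G := univ.filter fun s : Fin (b + (n + n)) → Bool =>
      Passes n C δ (coinNum (ext s) b) fun j => (ext s (b + j)).toNat with hG
  -- the rounds use disjoint blocks of coins
  have hsub : {ω | detAccepts ρ M δ C ω} ⊆
      {ω | ∀ t < ρ * b, (fun i : Fin (b + (n + n)) => ω (t * (b + (n + n)) + i)) ∈ G} := by
    intro ω hω t ht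
    have h1 := hω.2.2 t ht
    rw [← hb] at h1
    rw [hG, mem_filter]
    refine ⟨mem_univ _, ?_⟩
    have e : coinNum (ext fun i : Fin (b + (n + n)) => ω (t * (b + (n + n)) + i)) b =
        coinNum (fun i => ω (t * (b + (n + n)) + i)) b :=
      coinNum_congr fun k hk => by simp only [ext, show k < b + (n + n) by omega, dif_pos]
    rw [e]
    exact h1.congr fun j hj => by simp only [ext, show b + j < b + (n + n) by omega, dif_pos]
  refine (measure_mono hsub).trans ((fairCoins_rounds_le _ _ G).trans ?_)
  clear_value G b
  have hbR : (0 : ℝ) < b := by exact_mod_cast hb0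
  have hkey : (G.card : ℝ) * 2⁻¹ ^ (b + (n + n)) ≤ Real.exp (-(1 / (4 * b))) := by
    rw [inv_pow]
    exact mul_inv_le_exp hbR (pow_pos two_pos _) (by exact_mod_cast key)
  have h0 : (0 : ℝ) ≤ (G.card : ℝ) * 2⁻¹ ^ (b + (n + n)) :=
    mul_nonneg (Nat.cast_nonneg _) (pow_nonneg (inv_nonneg.2 zero_le_two) _)
  rw [natCast_mul_inv_pow, ← ENNReal.ofReal_pow h0]
  generalize (G.card : ℝ) * 2⁻¹ ^ (b + (n + n)) = y at h0 hkey ⊢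
  refine ENNReal.ofReal_le_ofReal ((pow_le_pow_left₀ h0 hkey _).trans_eq ?_)
  rw [← Real.exp_nat_mul]
  congr 1
  push_cast
  field_simp

lemma exists_bits {n : ℕ} (M : IntMat n) : ∃ c : ℕ → ℤ,
    (∀ i j : Fin n, c (1 + n + i * (n + n) + j) = M i j) ∧ (∀ v, RoundCheck n c M.det v) ∧
    ∑ k ∈ range (numTokens n), (c k).natAbs.size ≤ digitBound n (2 ^ entryBits M) := by
  refine exists_certificate M (2 ^ entryBits M) Nat.one_le_two_pow fun i j => ?_
  have h1 : (M i j).natAbs.size ≤ entryBits M := by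
    refine le_trans ?_ (le_max_right _ _)
    exact le_sup (f := fun p : Fin n × Fin n => (M p.1 p.2).natAbs.size)
      (mem_univ (i, j))
  have := (Nat.size_le.1 h1).le
  rw [Int.abs_eq_natAbs]; exact_mod_cast this

/-- The certificate of the honest prover. -/
noncomputable def detProve {n : ℕ} (M : IntMat n) : List Bool :=
  ((List.range (numTokens n)).map (exists_bits M).choose).flatMap encodeInt

lemma length_flatMap_encodeInt (zs : List ℤ) :
    (zs.flatMap encodeInt).length = 2 * (zs.map fun z => z.natAbs.size).sum + 2 * zs.length := by
  induction zs with
  | nil => rfl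
  | cons z zs ih => simp [ih, length_encodeInt]; ring

lemma length_detProve {n : ℕ} (M : IntMat n) : (detProve M).length =
    2 * ∑ k ∈ range (numTokens n), ((exists_bits M).choose k).natAbs.size +
      2 * numTokens n := by
  rw [detProve, length_flatMap_encodeInt, List.map_map, List.length_map, List.length_range,
    sum_range]
  congr 2
  rw [← List.sum_ofFn, List.ofFn_eq_map, ← List.map_coe_finRange_eq_range, List.map_map]
  rfl

lemma length_detProve_le {n : ℕ} (M : IntMat n) : (detProve M).length ≤
    2 * digitBound n (2 ^ entryBits M) + 2 * numTokens n := by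
  rw [length_detProve]
  have := (exists_bits M).choose_spec.2.2
  omega

lemma detProve_spec {n : ℕ} (M : IntMat n) (k : ℕ) (hk : k < numTokens n) :
    dcount (detProve M) (tpos (detProve M) 1 k) = ((exists_bits M).choose k).natAbs.size ∧
      cval (detProve M) k = (exists_bits M).choose k := by
  have := decode_ints ((List.range (numTokens n)).map (exists_bits M).choose) k (by simpa using hk)
  rw [List.getElem_map, List.getElem_range] at this
  exact this

lemma off_le_numTokens {n j : ℕ} (hj : j < 8 + 2 * depth n) {i k : ℕ} (hi : i < n + n)
    (hk : k < n + n) : off n j + i * (n + n) + k < numTokens n := by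
  rw [numTokens, off, off]
  have h1 : (j + 1) * ((n + n) * (n + n)) ≤ (8 + 2 * depth n) * ((n + n) * (n + n)) :=
    Nat.mul_le_mul_right _ (by omega)
  have h2 : (i + 1) * (n + n) ≤ (n + n) * (n + n) := Nat.mul_le_mul_right _ (by omega)
  rw [add_mul, one_mul] at h1 h2
  omega

/-- The identities only involve the integers of a certificate. -/
lemma RoundCheck.congr_left {R : Type*} [CommRing R] {n : ℕ} {c c' : ℕ → R} {d : R} {v : ℕ → R}
    (h : RoundCheck n c d v) (hc : ∀ k < numTokens n, c k = c' k) : RoundCheck n c' d v := by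
  have e : ∀ {j : ℕ}, j < 8 + 2 * depth n → ∀ {y y' : ℕ → R}, (∀ i < n + n, y i = y' i) →
      ∀ i < n + n, mat n c' j y i = mat n c j y' i := fun hj _ _ hy i hi => by
    rw [← mat_congr n c _ hy i, mat, mat, mv, mv]
    exact sum_congr rfl fun t ht => by rw [hc _ (off_le_numTokens hj hi (mem_range.1 ht))]
  have r : ∀ {y : ℕ → R}, ∀ i < n + n, y i = y i := fun _ _ => rfl
  have hd : 1 + n ≤ numTokens n := by rw [numTokens, off]; omega
  constructor
  · constructor
    · intro i hi
      rw [← h.diag i hi, ← hc _ (by omega), e (j := 0) (by omega) r _ (by omega),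
        e (j := 1) (by omega) (fun i hi => ?_) i (by omega)]
      rw [trunc, trunc, e (j := 0) (by omega) r i hi]
    · exact fun i hi => (e (by omega) r i hi).trans (h.init i hi)
    · intro k hk i hi
      rw [e (j := 2 + 2 * k) (by omega) (e (by omega) r) i hi, e (j := 0) (by omega)
        (e (j := 3 + 2 * k) (by omega) r) i hi, e (j := 4 + 2 * k) (by omega) r i hi, ← hc 0 (by omega), h.step k hk i hi]
    · exact fun i hi => (e (by omega) r i hi).trans (h.last i hi)
    · intro i hi
      rw [e (j := 7 + 2 * depth n) (by omega) r i hi, ← h.square i hi]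
      simp only [squares]
      iterate 8 refine e (by omega) ?_ i hi; clear hi i; intro i hi
      exact e (by omega) r i hi
  · rw [← h.prod]
    exact prod_congr rfl fun i hi => (hc _ (by have := mem_range.1 hi; omega)).symm

/-- The honest certificate passes. -/
lemma detAccepts_detProve (ρ : ℕ) {n : ℕ} (M : IntMat n) (ω : ℕ → Bool) :
    detAccepts ρ M M.det (detProve M) ω := by
  have hc := (exists_bits M).choose_spec
  refine ⟨fun i j => ?_, ?_, fun t _ => ?_⟩
  · have hlt : 1 + n + i * (n + n) + j < numTokens n := by
      have := off_le_numTokens (n := n) (j := 0) (by omega) (i := i) (k := j) (by omega) (by omega)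
      rw [off] at this; omega
    have := detProve_spec M _ hlt
    rw [hc.1 i j] at this
    exact ⟨this.2, this.1⟩
  · have hp := (hc.2.1 0).prod
    have h1 : ∀ k ≤ n, (∏ i ∈ range k, (exists_bits M).choose (1 + i)).natAbs ≤
        2 ^ ∑ i ∈ range k, ((exists_bits M).choose (1 + i)).natAbs.size := by
      intro k hk
      induction k with
      | zero => simp
      | succ k ih =>
        rw [prod_range_succ, sum_range_succ, Int.natAbs_mul, pow_add]
        exact Nat.mul_le_mul (ih (by omega)) (Nat.lt_size_self _).le
    have h2 : ∑ i ∈ range n, ((exists_bits M).choose (1 + i)).natAbs.size ≤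
        ∑ k ∈ range (numTokens n), ((exists_bits M).choose k).natAbs.size := by
      have hd : n + 1 ≤ numTokens n := by rw [numTokens, off]; omega
      refine le_trans ?_ (sum_le_sum_of_subset (range_mono hd))
      rw [sum_range_succ']
      simp only [add_comm 1]
      omega
    have h3 := h1 n le_rfl
    rw [hp] at h3
    have h4 : 0 < numTokens n := by rw [numTokens, off]; omega
    rw [length_detProve]
    refine Nat.size_le.2 (lt_of_le_of_lt h3 (Nat.pow_lt_pow_right (by norm_num) ?_))
    omega
  · have h := (hc.2.1 fun j => ((ω (t * (modBits n (detProve M).length + (n + n)) +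
      (modBits n (detProve M).length + j))).toNat : ℤ)).map (Int.castRingHom (ZMod (coinNum
      (fun i => ω (t * (modBits n (detProve M).length + (n + n)) + i))
      (modBits n (detProve M).length) + 1)))
    have h' := h.congr_left (c' := fun k => ((cval (detProve M) k : ℤ) : ZMod _)) fun k hk => by
      rw [(detProve_spec M k hk).2]; rfl
    simpa [Passes] using h'

end DetCert

/-! ### The protocol -/

namespace DetCert

open Finset RAM Matrix

/-! #### Soundness -/

lemma uniformOn_range_singleton {N a : ℕ} (ha : a < N) :
    uniformOn (Finset.range N : Set ℕ) {a} = (N : ENNReal)⁻¹ := by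
  rw [uniformOn, cond_apply (Finset.measurableSet _),
    Set.inter_eq_right.2 (Set.singleton_subset_iff.2 (by simpa using ha)), Measure.count_singleton,
    mul_one, Measure.count_apply_finset, card_range]

/-- If a prover can pass with the challenge `q` and with probability at most `e q` over the coins,
then all `k` repetitions are passed with at most the `k`-th power of the mean value of `e`. -/
lemma acceptsAll_le {X Y R : Type} (P : InteractiveCertificate X Y ℕ R) (x : X) (y : Y) {N : ℕ}
    (hN : 0 < N) (hx : P.challenges x = range N) (e : ℕ → ENNReal)
    (he : ∀ q < N, ∀ r, fairCoins {ω | P.accepts x y q r ω} ≤ e q) (k : ℕ) (prover : List ℕ → R) :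
    Measure.pi (fun _ : Fin k => (uniformOn (P.challenges x : Set ℕ)).prod fairCoins)
      (P.acceptsAll x y prover k) ≤ (∑ q ∈ range N, (N : ENNReal)⁻¹ * e q) ^ k := by
  haveI : IsProbabilityMeasure fairCoins := by unfold fairCoins; infer_instance
  rw [hx]
  haveI : IsProbabilityMeasure (uniformOn (range N : Set ℕ)) :=
    isProbabilityMeasure_uniformOn (finite_toSet _) ⟨0, by simpa using hN⟩
  set μ := Measure.pi (fun _ : Fin k => (uniformOn (range N : Set ℕ)).prod fairCoins)
  set E : (Fin k → ℕ) → Fin k → Set (ℕ → Bool) := fun t i =>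
    {ω | P.accepts x y (t i) (prover ((List.ofFn t).take (i + 1))) ω} with hE
  set T : Finset (Fin k → ℕ) := Fintype.piFinset fun _ => range N with hT
  -- the event splits according to the challenges drawn
  have hsub : P.acceptsAll x y prover k ⊆
      (⋃ t ∈ T, Set.univ.pi fun i => ({t i} : Set ℕ) ×ˢ E t i) ∪
        ⋃ i, Function.eval i ⁻¹' (((range N : Set ℕ)ᶜ) ×ˢ Set.univ) := by
    intro s hs
    by_cases h : ∀ i, (s i).1 < N
    · left
      simp only [Set.mem_iUnion]
      refine ⟨fun i => (s i).1, Fintype.mem_piFinset.2 fun i => mem_range.2 (h i), ?_⟩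
      intro i _
      exact ⟨rfl, hs i⟩
    · right
      push Not at h
      obtain ⟨i, hi⟩ := h
      exact Set.mem_iUnion.2 ⟨i, by simpa using hi⟩
  -- other challenges than those in the range are never drawn
  have hnull : μ (⋃ i, Function.eval i ⁻¹' (((range N : Set ℕ)ᶜ) ×ˢ Set.univ)) = 0 := by
    rw [measure_iUnion_null_iff]
    intro i
    refine Measure.pi_eval_preimage_null _ ?_
    rw [Measure.prod_prod, (uniformOn_eq_zero_iff (finite_toSet _)).2
      (Set.inter_compl_self _), zero_mul]
  refine (measure_mono hsub).trans ((measure_union_le _ _).trans ?_)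
  rw [hnull, add_zero]
  refine (measure_biUnion_finset_le _ _).trans ?_
  have hle : ∀ t ∈ T, μ (Set.univ.pi fun i => ({t i} : Set ℕ) ×ˢ E t i) ≤
      ∏ i, ((N : ENNReal)⁻¹ * e (t i)) := by
    intro t ht
    rw [Measure.pi_pi]
    refine prod_le_prod' fun i _ => ?_
    have hti : t i < N := mem_range.1 (Fintype.mem_piFinset.1 ht i)
    rw [Measure.prod_prod, uniformOn_range_singleton hti]
    gcongr
    exact he _ hti _
  refine (sum_le_sum hle).trans_eq ?_
  rw [hT, ← prod_univ_sum (fun _ => range N) fun _ q => (N : ENNReal)⁻¹ * e q]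
  simp

lemma eval_charpoly' {n : ℕ} (A : IntMat n) (a : ℤ) :
    A.charpoly.eval a = (a • (1 : IntMat n) - A).det := by
  rw [eval_charpoly, scalar_apply, ← smul_one_eq_diagonal]

/-- A wrong polynomial of degree `n` agrees with the characteristic polynomial in at most `n`
points; at any other point, the prover has to certify a wrong determinant. -/
lemma soundWithError (K : DetCertificate) (F : SizeLimits) {η : ℝ} (hη : 0 < η)
    (hK : K.SoundWithError η) {c n : ℕ} (hc : 0 < c) (hn : 0 < n) :
    (charpolyCertificate K F c n).SoundWithError (1 / c + η) := by
  classical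
  intro A g hg k prover
  have hcn : 0 < c * n := Nat.mul_pos hc hn
  set bad := (range (c * n)).filter fun q : ℕ => g.eval (q : ℤ) = A.charpoly.eval (q : ℤ)
    with hbad
  have hcard : g.degree = n → bad.card ≤ n := by
    intro hdeg
    have h0 : g - A.charpoly ≠ 0 := sub_ne_zero.2 hg
    have h1 : bad.card ≤ (g - A.charpoly).roots.toFinset.card := by
      refine card_le_card_of_injOn (fun q : ℕ => (q : ℤ)) (fun q hq => ?_) ?_
      · simp only [coe_sort_coe, mem_coe, Multiset.mem_toFinset]
        rw [mem_roots h0, IsRoot, eval_sub, (mem_filter.1 hq).2, sub_self]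
      · exact fun _ _ _ _ h => Nat.cast_injective (R := ℤ) h
    refine h1.trans ((Multiset.toFinset_card_le _).trans ((card_roots' _).trans ?_))
    refine (natDegree_sub_le _ _).trans ?_
    rw [charpoly_natDegree_eq_dim, Fintype.card_fin, natDegree_eq_of_degree_eq_some hdeg, max_self]
  set e : ℕ → ENNReal := fun q => if g.degree = n then
    (if q ∈ bad then 1 else ENNReal.ofReal η) else 0 with he
  have h := acceptsAll_le (charpolyCertificate K F c n) A g hcn rfl e (fun q hq r => ?_) k prover
  swap
  · haveI : IsProbabilityMeasure fairCoins := by unfold fairCoins; infer_instance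
    simp only [he]
    split_ifs with hdeg hq'
    · exact prob_le_one
    · by_cases hr : r.1 = ((q : ℤ) • (1 : IntMat n) - A).det
      · have : {ω | (charpolyCertificate K F c n).accepts A g q r ω} = ∅ := by
          ext ω
          simp only [Set.mem_setOf_eq, Set.mem_empty_iff_false, iff_false]
          rintro ⟨-, -, h, -⟩
          refine hq' (mem_filter.2 ⟨mem_range.2 hq, ?_⟩)
          rw [eval_charpoly', ← hr, h]
        rw [this]; simp
      · exact (measure_mono fun ω hω => hω.2.2.2).trans (hK n _ r.1 hr r.2)
    · have : {ω | (charpolyCertificate K F c n).accepts A g q r ω} = ∅ := by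
        ext ω
        simp only [Set.mem_setOf_eq, Set.mem_empty_iff_false, iff_false]
        exact fun h => hdeg h.2.1
      rw [this]; simp
  refine h.trans ?_
  rw [ENNReal.ofReal_pow (by positivity)]
  gcongr
  rw [← mul_sum]
  by_cases hdeg : g.degree = n
  swap
  · simp [he, hdeg]
  have hsum : ∑ q ∈ range (c * n), e q ≤ n + (c * n : ℕ) * ENNReal.ofReal η := by
    calc ∑ q ∈ range (c * n), e q
        ≤ ∑ q ∈ range (c * n), ((if q ∈ bad then 1 else 0) + ENNReal.ofReal η) := by
          refine sum_le_sum fun q _ => ?_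
          simp only [he, hdeg, if_true]
          split_ifs <;> simp
      _ = bad.card + (c * n : ℕ) * ENNReal.ofReal η := by
          rw [sum_add_distrib, sum_const, card_range, nsmul_eq_mul,
            sum_ite_mem, inter_eq_right.2 (filter_subset _ _), sum_const,
            nsmul_eq_mul, mul_one]
      _ ≤ _ := by gcongr; exact hcard hdeg
  refine (mul_le_mul_right hsum _).trans_eq ?_
  have hN : ((c * n : ℕ) : ENNReal) = ENNReal.ofReal ((c * n : ℕ) : ℝ) :=
    (ENNReal.ofReal_natCast _).symm
  have hn' : ((n : ℕ) : ENNReal) = ENNReal.ofReal (n : ℝ) := (ENNReal.ofReal_natCast _).symm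
  have hpos : (0 : ℝ) < (c * n : ℕ) := by exact_mod_cast hcn
  rw [hN, hn', ← ENNReal.ofReal_inv_of_pos hpos, ← ENNReal.ofReal_mul (by positivity),
    ← ENNReal.ofReal_add (by positivity) (by positivity), ← ENNReal.ofReal_mul (by positivity)]
  congr 1
  have : (0 : ℝ) < n := by exact_mod_cast hn
  have : (0 : ℝ) < c := by exact_mod_cast hc
  push_cast
  field_simp

/-! #### Sizes of honest messages -/

/-- `q` bounds the absolute values of the coefficients of `p`. -/
def Majorizes (q p : ℤ[X]) : Prop := ∀ i, |p.coeff i| ≤ q.coeff i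

lemma Majorizes.mul {p q p' q' : ℤ[X]} (h : Majorizes q p) (h' : Majorizes q' p') :
    Majorizes (q * q') (p * p') := by
  intro i
  rw [coeff_mul, coeff_mul]
  refine (abs_sum_le_sum_abs _ _).trans (sum_le_sum fun x _ => ?_)
  rw [abs_mul]
  exact mul_le_mul (h _) (h' _) (abs_nonneg _) ((abs_nonneg _).trans (h _))

lemma Majorizes.sum {ι : Type*} (s : Finset ι) {p q : ι → ℤ[X]} (h : ∀ i ∈ s, Majorizes (q i) (p i)) :
    Majorizes (∑ i ∈ s, q i) (∑ i ∈ s, p i) := by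
  intro k
  rw [finsetSum_coeff, finsetSum_coeff]
  exact (abs_sum_le_sum_abs _ _).trans (sum_le_sum fun i hi => h i hi k)

lemma Majorizes.prod {ι : Type*} (s : Finset ι) {p q : ι → ℤ[X]}
    (h : ∀ i ∈ s, Majorizes (q i) (p i)) : Majorizes (∏ i ∈ s, q i) (∏ i ∈ s, p i) := by
  classical
  induction s using Finset.induction_on with
  | empty =>
    intro k
    simp only [prod_empty, coeff_one]
    split_ifs <;> simp
  | insert a s ha ih =>
    rw [prod_insert ha, prod_insert ha]
    exact (h a (mem_insert_self _ _)).mul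
      (ih fun i hi => h i (mem_insert_of_mem hi))

lemma abs_coeff_charpoly_le {n : ℕ} (A : IntMat n) {b : ℕ}
    (hA : ∀ i j, |A i j| ≤ b) (k : ℕ) : |A.charpoly.coeff k| ≤ (n.factorial * (b + 1) ^ n : ℕ) := by
  have hent : ∀ i j, Majorizes (X + C (b : ℤ)) (A.charmatrix i j) := by
    intro i j k
    have h0 : (0 : ℤ) ≤ (X : ℤ[X]).coeff k := by rw [coeff_X]; split_ifs <;> norm_num
    rw [charmatrix_apply, coeff_add, coeff_sub, diagonal_apply]
    refine (abs_sub _ _).trans (add_le_add ?_ ?_)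
    · split_ifs
      · rw [abs_of_nonneg h0]
      · simpa using h0
    · rw [coeff_C, coeff_C]
      split_ifs
      · exact hA i j
      · simp
  have hmaj : Majorizes (∑ _σ : Equiv.Perm (Fin n), ∏ _i : Fin n, (X + C (b : ℤ))) A.charpoly := by
    rw [charpoly, det_apply]
    refine Majorizes.sum _ fun σ _ k => ?_
    have := Majorizes.prod univ (fun i _ => hent (σ i) i) k
    rcases Int.units_eq_one_or (Equiv.Perm.sign σ) with h | h <;> simpa [h] using this
  have hcoef : ∀ p : ℤ[X], (∀ i, 0 ≤ p.coeff i) → p.coeff k ≤ p.eval 1 := by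
    intro p hp
    rw [eval_eq_sum_range]
    simp only [one_pow, mul_one]
    by_cases hk : k ≤ p.natDegree
    · exact single_le_sum (f := fun i => p.coeff i) (fun i _ => hp i)
        (mem_range.2 (by omega))
    · rw [coeff_eq_zero_of_natDegree_lt (by omega)]
      exact sum_nonneg fun i _ => hp i
  refine (hmaj k).trans ((hcoef _ fun i => (abs_nonneg _).trans (hmaj i)).trans_eq ?_)
  simp only [prod_const, sum_const, card_univ, Fintype.card_perm,
    Fintype.card_fin]
  simp [eval_finsetSum, add_comm]

lemma natAbs_size_le_entryBits {n : ℕ} (A : IntMat n) (i j : Fin n) :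
    (A i j).natAbs.size ≤ entryBits A := by
  refine le_trans ?_ (le_max_right _ _)
  exact le_sup (f := fun p : Fin n × Fin n => (A p.1 p.2).natAbs.size)
    (mem_univ (i, j))

lemma abs_le_of_natAbs_size_le {z : ℤ} {k : ℕ} (h : z.natAbs.size ≤ k) : |z| ≤ (2 ^ k : ℕ) := by
  have := (Nat.size_le.1 h).le
  rw [Int.abs_eq_natAbs]; exact_mod_cast this

lemma one_le_entryBits {n : ℕ} (A : IntMat n) : 1 ≤ entryBits A :=
  le_max_left _ _

lemma size_coeff_charpoly_le {n : ℕ} (hn : 0 < n) (A : IntMat n) (k : ℕ) :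
    (A.charpoly.coeff k).natAbs.size ≤ 4 * (n * n.size * entryBits A) := by
  have h1 := abs_coeff_charpoly_le A (fun i j => abs_le_of_natAbs_size_le
    (natAbs_size_le_entryBits A i j)) k
  have hL := one_le_entryBits A
  set L := entryBits A
  have hs : 1 ≤ n.size := Nat.size_pos.2 hn
  have h2 : n.factorial * (2 ^ L + 1) ^ n < 2 ^ (n * n.size + n * (L + 1) + 1) := by
    have a1 : n.factorial ≤ 2 ^ (n * n.size) := by
      rw [mul_comm n, pow_mul]
      exact (Nat.factorial_le_pow n).trans (Nat.pow_le_pow_left (Nat.lt_size_self n).le n)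
    have a2 : (2 ^ L + 1) ^ n ≤ 2 ^ (n * (L + 1)) := by
      rw [mul_comm n, pow_mul]
      refine Nat.pow_le_pow_left ?_ n
      rw [pow_succ]
      have := Nat.one_le_two_pow (n := L)
      omega
    rw [pow_succ, pow_add]
    have : 0 < 2 ^ (n * n.size) * 2 ^ (n * (L + 1)) := by positivity
    have := Nat.mul_le_mul a1 a2
    omega
  refine (size_natAbs_le h1).trans ((Nat.size_le.2 h2).trans ?_)
  have b1 : n * n.size * 1 ≤ n * n.size * L := Nat.mul_le_mul_left _ hL
  have b2 : n * L * 1 ≤ n * L * n.size := Nat.mul_le_mul_left _ hs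
  have b3 : n * 1 ≤ n * L := Nat.mul_le_mul_left _ hL
  have b4 : n * L * n.size = n * n.size * L := by ring
  have b5 : 1 ≤ n * n.size := Nat.mul_pos hn hs
  rw [mul_add]
  nlinarith

lemma entryBits_sub_le {n : ℕ} (A : IntMat n) {c lam : ℕ} (hlam : lam < c * n) :
    entryBits ((lam : ℤ) • (1 : IntMat n) - A) ≤
      entryBits A + c.size + n.size + 1 := by
  refine max_le (by omega) (Finset.sup_le fun p _ => ?_)
  have h1 := abs_le_of_natAbs_size_le (natAbs_size_le_entryBits A p.1 p.2)
  set L := entryBits A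
  have h2 : (lam : ℤ) ≤ (2 ^ (c.size + n.size) : ℕ) := by
    have : c * n ≤ 2 ^ c.size * 2 ^ n.size :=
      Nat.mul_le_mul (Nat.lt_size_self c).le (Nat.lt_size_self n).le
    rw [pow_add]; exact_mod_cast hlam.le.trans this
  have h3 : |((lam : ℤ) • (1 : IntMat n) - A) p.1 p.2| ≤
      (2 ^ (c.size + n.size) + 2 ^ L : ℕ) := by
    rw [Matrix.sub_apply, Matrix.smul_apply, Matrix.one_apply]
    push_cast at h1 h2 ⊢
    refine (abs_sub _ _).trans (add_le_add ?_ h1)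
    split_ifs
    · simpa using h2
    · simp
  refine (size_natAbs_le h3).trans (Nat.size_le.2 ?_)
  have e1 : 2 ^ (c.size + n.size) ≤ 2 ^ (L + c.size + n.size) :=
    Nat.pow_le_pow_right (by norm_num) (by omega)
  have e2 : 2 ^ L < 2 ^ (L + c.size + n.size) ∨ c.size + n.size = 0 := by
    rcases Nat.eq_zero_or_pos (c.size + n.size) with h | h
    · exact .inr h
    · exact .inl (Nat.pow_lt_pow_right (by norm_num) (by omega))
  have hc : 0 < c.size := Nat.size_pos.2 (Nat.pos_of_ne_zero (by rintro rfl; simp at hlam))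
  rw [pow_succ]
  omega

/-- The constant of the bounds for the size of a determinant. -/
def detConst (c : ℕ) : ℕ := 2 * (c.size + 6)

lemma size_det_le {n : ℕ} (hn : 0 < n) (A : IntMat n) {c lam : ℕ}
    (hlam : lam < c * n) :
    ((lam : ℤ) • (1 : IntMat n) - A).det.natAbs.size ≤
      detConst c * (n * n.size * entryBits A) := by
  have hL := one_le_entryBits A
  have h0 := entryBits_sub_le A hlam
  set M := (lam : ℤ) • (1 : IntMat n) - A with hM
  set L := entryBits A
  set L' := entryBits M
  have h1 := abs_det_le M (2 ^ L' : ℕ) fun i j =>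
    abs_le_of_natAbs_size_le (natAbs_size_le_entryBits M i j)
  rw [Fintype.card_fin] at h1
  have h2 := size_natAbs_le (B := (n * 2 ^ L') ^ n) (by exact_mod_cast h1)
  refine h2.trans ((size_pow_le _ _).trans ?_)
  have h3 : (n * 2 ^ L').size ≤ n.size + L' := by
    refine Nat.size_le.2 ?_
    rw [pow_add]
    exact Nat.mul_lt_mul_of_pos_right (Nat.lt_size_self n) (by positivity)
  have hs : 1 ≤ n.size := Nat.size_pos.2 hn
  have h4 : n.size + L' + 1 ≤ (c.size + 6) * (n.size * L) := by
    have : n.size * 1 ≤ n.size * L := Nat.mul_le_mul_left _ hL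
    have : 1 * L ≤ n.size * L := Nat.mul_le_mul_right _ hs
    have : c.size * 1 ≤ c.size * (n.size * L) := Nat.mul_le_mul_left _ (by omega)
    rw [add_mul]
    omega
  have h5 : n * (n * 2 ^ L').size + 1 ≤ n * ((c.size + 6) * (n.size * L)) := by
    calc n * (n * 2 ^ L').size + 1 ≤ n * (n.size + L') + n * 1 := by
          have := Nat.mul_le_mul_left n h3; omega
      _ = n * (n.size + L' + 1) := by ring
      _ ≤ _ := Nat.mul_le_mul_left n h4
  refine h5.trans ?_
  rw [detConst]
  have : n * ((c.size + 6) * (n.size * L)) = (c.size + 6) * (n * n.size * L) := by ring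
  rw [this]
  exact Nat.mul_le_mul_right _ (by omega)

/-- The constant of the bound for the length of a certificate. -/
def certConst (c : ℕ) : ℕ := 10000 * (c.size + 40)

lemma length_detProve_le' {n : ℕ} (hn : 0 < n) (A : IntMat n) {c lam : ℕ}
    (hlam : lam < c * n) :
    (detProve ((lam : ℤ) • (1 : IntMat n) - A)).length ≤
      certConst c * (n * n * (n.size * n.size) * entryBits A) := by
  have hL := one_le_entryBits A
  have h0 := entryBits_sub_le A hlam
  set M := (lam : ℤ) • (1 : IntMat n) - A with hM
  have h1 := length_detProve_le M
  set L := entryBits A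
  set L' := entryBits M
  set s := n.size with hs
  have hs1 : 1 ≤ s := Nat.size_pos.2 hn
  set u := s * L with hu
  have hu1 : 1 ≤ u := Nat.mul_pos hs1 hL
  have hsu : s ≤ u := Nat.le_mul_of_pos_right _ hL
  have hLu : L ≤ u := Nat.le_mul_of_pos_left _ hs1
  have hcu : c.size ≤ c.size * u := Nat.le_mul_of_pos_right _ hu1
  have hL' : L' ≤ (c.size + 3) * u := by rw [add_mul]; omega
  have hshort : shortBits n (2 ^ L') ≤ (c.size + 33) * u := by
    have : shortBits n (2 ^ L') ≤ 19 + 10 * s + L' := by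
      refine Nat.size_le.2 ?_
      have : n ^ 10 ≤ (2 ^ s) ^ 10 := Nat.pow_le_pow_left (Nat.lt_size_self n).le 10
      calc 2 ^ 18 * n ^ 10 * 2 ^ L' ≤ 2 ^ 18 * (2 ^ s) ^ 10 * 2 ^ L' :=
            Nat.mul_le_mul_right _ (Nat.mul_le_mul_left _ this)
        _ = 2 ^ (18 + 10 * s + L') := by ring
        _ < _ := Nat.pow_lt_pow_right (by norm_num) (by omega)
    have e1 : (c.size + 33) * u = (c.size + 3) * u + 30 * u := by ring
    omega
  have hlong : longBits n (2 ^ L') ≤ n * ((c.size + 9) * u) := by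
    rw [longBits, Nat.size_pow]
    calc n * (n.size + (L' + 1)) + n.size + n + 2 ≤ n * (n.size + (L' + 1)) + n * s + n + n * 2 := by
          have : 1 * s ≤ n * s := Nat.mul_le_mul_right _ hn
          omega
      _ = n * (s + (L' + 1) + s + 1 + 2) := by rw [← hs]; ring
      _ ≤ _ := Nat.mul_le_mul_left n (by
        have e1 : (c.size + 9) * u = (c.size + 3) * u + 6 * u := by ring
        omega)
  set w := (c.size + 40) * u with hw
  have hshort' : shortBits n (2 ^ L') ≤ w := hshort.trans (Nat.mul_le_mul_right _ (by omega))
  have hlong' : longBits n (2 ^ L') ≤ n * w :=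
    hlong.trans (Nat.mul_le_mul_left _ (Nat.mul_le_mul_right _ (by omega)))
  have hw1 : 1 ≤ w := Nat.mul_pos (by omega) hu1
  set t := n * n * s with ht
  have hn2 : n ≤ n * n := Nat.le_mul_of_pos_left _ hn
  have ht1 : n * n ≤ t := Nat.le_mul_of_pos_right _ hs1
  have h2 : digitBound n (2 ^ L') ≤ 100 * (t * w) := by
    rw [digitBound, depth, ← hs]
    have a1 : (2 * n + 1) * longBits n (2 ^ L') ≤ (3 * n) * (n * w) :=
      Nat.mul_le_mul (by omega) hlong'
    have a2 : (7 + 2 * (s + 4)) * ((n + n) * (n + n)) * shortBits n (2 ^ L') ≤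
        (17 * s) * ((n + n) * (n + n)) * w :=
      Nat.mul_le_mul (Nat.mul_le_mul_right _ (by omega)) hshort'
    have a3 : (3 * n) * (n * w) = 3 * (n * n * w) := by ring
    have a4 : (17 * s) * ((n + n) * (n + n)) * w = 68 * (t * w) := by rw [ht]; ring
    have a5 : n * n * w ≤ t * w := Nat.mul_le_mul_right _ ht1
    have a6 : 1 * w ≤ t * w := Nat.mul_le_mul_right _ (by omega)
    omega
  have h3 : numTokens n ≤ 200 * (t * w) := by
    rw [numTokens, off, depth, ← hs]
    have a2 : (8 + 2 * (s + 4)) * ((n + n) * (n + n)) ≤ (18 * s) * ((n + n) * (n + n)) :=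
      Nat.mul_le_mul_right _ (by omega)
    have a4 : (18 * s) * ((n + n) * (n + n)) = 72 * t := by rw [ht]; ring
    have a5 : t * 1 ≤ t * w := Nat.mul_le_mul_left _ hw1
    omega
  refine h1.trans ?_
  have e : certConst c * (n * n * (s * s) * L) = 10000 * (t * w) := by
    rw [certConst, hw, hu, ht]; ring
  rw [e]
  omega

/-- The size limits. -/
def limits (c : ℕ) : SizeLimits where
  numBits n L := detConst c * (n * n.size * L)
  certBits n L := certConst c * (n * n * (n.size * n.size) * L)

/-- The determinant certificate with test of `ρ * modBits` rounds. -/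
noncomputable def detCert (ρ : ℕ) : DetCertificate where
  prove M := detProve M
  accepts M δ C ω := detAccepts ρ M δ C ω

lemma detCert_perfectlyComplete (ρ : ℕ) : (detCert ρ).PerfectlyComplete :=
  fun _ M ω => detAccepts_detProve ρ M ω

lemma perfectlyComplete (ρ : ℕ) {c n : ℕ} (hn : 0 < n) :
    (charpolyCertificate (detCert ρ) (limits c) c n).PerfectlyComplete := by
  intro A g hg lam hlam ω
  have hg : g = A.charpoly := hg
  have hlam : lam < c * n := mem_range.1 hlam
  refine ⟨⟨fun i => ?_, size_det_le hn A hlam, length_detProve_le' hn A hlam⟩, ?_, ?_,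
    detAccepts_detProve ρ _ ω⟩
  · rw [hg]
    refine (size_coeff_charpoly_le hn A i).trans (Nat.mul_le_mul_right _ ?_)
    rw [detConst]; omega
  · rw [hg, charpoly_degree_eq_dim, Fintype.card_fin]
  · rw [hg, eval_charpoly']; rfl

lemma exists_detCert_soundWithError {η : ℝ} (hη : 0 < η) : ∃ ρ, (detCert ρ).SoundWithError η := by
  obtain ⟨ρ, hρ⟩ := exists_nat_gt (4 * -Real.log η)
  refine ⟨ρ, fun n M δ hδ C => (detAccepts_le ρ M δ hδ C).trans (ENNReal.ofReal_le_ofReal ?_)⟩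
  rw [← Real.le_log_iff_exp_le hη]
  linarith

end DetCert
set_option linter.constructorNameAsVariable false

/-! ### Triples with time bounds -/

namespace RAM

open State Stmt

variable {tapes : List (List Bool)} {ω : ℕ → Bool}

/-- The registers in a list have prescribed values. -/
def State.Agree (ρ : Reg → ℕ) (l : List Reg) (σ : State) : Prop := ∀ r ∈ l, σ.reg r = ρ r

namespace Stmt

/-- The registers that bound the loops of a program. -/
def bounds : Stmt → List Reg
  | seq a b => bounds a ++ bounds b
  | ifz _ a b => bounds a ++ bounds b
  | loop _ x s => x :: bounds s
  | _ => []

lemma mem_bounds {s : Stmt} {r : Reg} (h : s.isBound r = true) : r ∈ s.bounds := by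
  induction s with
  | seq a b iha ihb =>
    simp only [isBound, Bool.or_eq_true] at h
    exact List.mem_append.2 (h.imp iha ihb)
  | ifz x a b iha ihb =>
    simp only [isBound, Bool.or_eq_true] at h
    exact List.mem_append.2 (h.imp iha ihb)
  | loop i x s ih =>
    simp only [isBound, Bool.or_eq_true, decide_eq_true_eq] at h
    exact List.mem_cons.2 (h.imp id ih)
  | _ => simp [isBound] at h

/-- The program leaves the registers of the list alone. -/
def keeps (s : Stmt) (l : List Reg) : Bool := l.all fun r => !s.wr r

/-- The program leaves the arrays of the list alone. -/
def keepsA (s : Stmt) (l : List Arr) : Bool := l.all fun a => !s.wa a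

/-- The loop bounds are in the list and constant. -/
def bounded (s : Stmt) (l : List Reg) : Bool := s.bounds.all fun r => l.contains r && !s.wr r

lemma keeps_reg {s : Stmt} {l : List Reg} (h : s.keeps l = true) (σ : State) {r : Reg}
    (hr : r ∈ l) : (s.den tapes ω σ).reg r = σ.reg r :=
  den_reg (by simpa using List.all_eq_true.1 h r hr) σ

lemma keepsA_arr {s : Stmt} {l : List Arr} (h : s.keepsA l = true) (σ : State) {a : Arr}
    (ha : a ∈ l) : (s.den tapes ω σ).arr a = σ.arr a :=
  den_arr (by simpa using List.all_eq_true.1 h a ha) σ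

lemma agree_den {ρ : Reg → ℕ} {l : List Reg} {s : Stmt} {σ : State} (h : σ.Agree ρ l)
    (hs : s.keeps l = true) : (s.den tapes ω σ).Agree ρ l :=
  fun r hr => (keeps_reg hs σ hr).trans (h r hr)

lemma agree_of_loop {ρ : Reg → ℕ} {l : List Reg} {s : Stmt} {i : Reg} {σ τ : State}
    (h : σ.Agree ρ l) (hr : ∀ r, s.wr r = false → r ≠ i → τ.reg r = σ.reg r)
    (hs : s.keeps l = true) (hi : l.contains i = false) : τ.Agree ρ l := fun r hl =>
  (hr r (by simpa using List.all_eq_true.1 hs r hl) (by rintro rfl; simp [hl] at hi)).trans (h r hl)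

lemma tb_le_of_agree {ρ : Reg → ℕ} {l : List Reg} {s : Stmt} {σ : State} (h : σ.Agree ρ l)
    (hs : s.bounded l = true) : s.tb tapes ω σ ≤ s.stb ρ := by
  refine tb_le_stb s ρ σ fun r hr => ?_
  have := List.all_eq_true.1 hs r (mem_bounds hr)
  simp only [Bool.and_eq_true, List.contains_iff_mem, Bool.not_eq_true'] at this
  exact ⟨this.2, h r this.1⟩

/-- Register `bad` is never reset. -/
def sticky : Stmt → Bool
  | op x (.const k) => !decide (x = .bad) || decide (k = 1)
  | op x _ => !decide (x = .bad)
  | load x _ _ => !decide (x = .bad)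
  | read x _ _ => !decide (x = .bad)
  | toss x => !decide (x = .bad)
  | seq a b => sticky a && sticky b
  | ifz _ a b => sticky a && sticky b
  | loop i _ s => !decide (i = .bad) && sticky s
  | _ => true

lemma bad_den {s : Stmt} (h : s.sticky = true) (σ : State)
    (hb : (s.den tapes ω σ).reg .bad = 0) : σ.reg .bad = 0 := by
  induction s generalizing σ with
  | skip => exact hb
  | op x o =>
    by_cases hx : x = .bad
    · subst hx
      cases o with
      | const k =>
        simp only [sticky, decide_true, Bool.not_true, Bool.false_or, decide_eq_true_eq] at h
        simp [den, Op.eval, h] at hb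
      | _ => simp [sticky] at h
    · simpa [den, Ne.symm hx] using hb
  | seq a b iha ihb =>
    simp only [sticky, Bool.and_eq_true] at h
    exact iha h.1 _ (ihb h.2 _ hb)
  | ifz x a b iha ihb =>
    simp only [sticky, Bool.and_eq_true] at h
    simp only [den] at hb
    split_ifs at hb
    · exact iha h.1 _ hb
    · exact ihb h.2 _ hb
  | loop i x s ih =>
    simp only [sticky, Bool.and_eq_true, Bool.not_eq_true', decide_eq_false_iff_not] at h
    simp only [den] at hb
    generalize σ.reg x = N at hb
    induction N with
    | zero => simpa [loopN, Ne.symm h.1] using hb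
    | succ k ihk =>
      simp only [loopN, setR_reg, if_neg (Ne.symm h.1)] at hb
      exact ihk (ih h.2 _ hb)
  | store a i x => exact hb
  | _ =>
    simp only [sticky, Bool.not_eq_true', decide_eq_false_iff_not] at h
    simpa [den, Ne.symm h] using hb

end Stmt

/-- From states with property `P`, the program leads to states with property `Q`, in the time that
follows from the values `ρ` of the loop bounds. -/
def Triple (tapes : List (List Bool)) (ω : ℕ → Bool) (ρ : Reg → ℕ) (P : State → Prop) (s : Stmt)
    (Q : State → Prop) : Prop :=
  ∀ σ, P σ → Q (s.den tapes ω σ) ∧ s.tb tapes ω σ ≤ s.stb ρ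

lemma Triple.seq {ρ : Reg → ℕ} {P Q R : State → Prop} {a b : Stmt}
    (ha : Triple tapes ω ρ P a Q) (hb : Triple tapes ω ρ Q b R) : Triple tapes ω ρ P (a ;; b) R :=
  fun σ hσ => ⟨(hb _ (ha σ hσ).1).1, add_le_add (ha σ hσ).2 (hb _ (ha σ hσ).1).2⟩

/-! #### Arithmetic by counting -/

/-- `x := a + k y` for constants `a` and `k` -/
def lin (x : Reg) (a k : ℕ) (y : Reg) : Stmt :=
  .op x (.const a) ;; .loop .iB y (.op x (.addc x k))

/-- `x := k y z` for a constant `k` -/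
def mulc (x : Reg) (k : ℕ) (y z : Reg) : Stmt :=
  .op x (.const 0) ;; .loop .jB y (.loop .iB z (.op x (.addc x k)))

/-- `x := x + y` -/
def addr (x y : Reg) : Stmt := .loop .iB y (.op x (.addc x 1))

lemma loop_addc (x y : Reg) (k : ℕ) (hx : x ≠ .iB) (σ : State) :
    ((Stmt.loop .iB y (.op x (.addc x k))).den tapes ω σ).reg x = σ.reg x + k * σ.reg y := by
  refine loop_induction' (i := .iB) (x := y) (s := _)
    (fun t τ => τ.reg x = σ.reg x + k * t) σ (by simp [hx]) ?_
  rintro t - τ - - - h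
  simp only [den, Op.eval, setR_reg, if_neg hx, if_true, h]
  ring

lemma lin_spec (x : Reg) (a k : ℕ) (y : Reg) (hx : x ≠ .iB) (hxy : y ≠ x) (σ : State) :
    ((lin x a k y).den tapes ω σ).reg x = a + k * σ.reg y := by
  refine (loop_addc x y k hx (σ.setR x a)).trans ?_
  simp [hxy]

lemma addr_spec (x y : Reg) (hx : x ≠ .iB) (σ : State) :
    ((addr x y).den tapes ω σ).reg x = σ.reg x + σ.reg y := by
  rw [addr, loop_addc x y 1 hx, one_mul]

lemma mulc_spec (x : Reg) (k : ℕ) (y z : Reg) (hx : x ≠ .iB) (hx' : x ≠ .jB) (hxy : y ≠ x)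
    (hxz : z ≠ x) (hz : z ≠ .iB) (hz' : z ≠ .jB) (σ : State) :
    ((mulc x k y z).den tapes ω σ).reg x = k * (σ.reg y * σ.reg z) := by
  have h := loop_induction' (tapes := tapes) (ω := ω) (i := .jB) (x := y)
    (s := .loop .iB z (.op x (.addc x k)))
    (fun t τ => τ.reg x = k * (t * σ.reg z)) (σ.setR x 0) (by simp [hx']) ?_
  · rw [State.setR_reg, if_neg hxy] at h
    exact h
  · rintro t - τ - hr - h
    have hz1 := hr z (by simp [wr, hz, hxz]) hz'
    rw [setR_reg, if_neg hxz] at hz1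
    rw [setR_reg, if_neg hx', loop_addc x z k hx, h, hz1]
    ring

section

variable {ρ : Reg → ℕ} {l : List Reg} {E : State → Prop}

/-- A step that computes one more register. -/
lemma Triple.step {s : Stmt} {x : Reg} (hk : s.keeps l = true) (hb : s.bounded l = true)
    (hE : ∀ σ, E σ → E (s.den tapes ω σ))
    (hx : ∀ σ, E σ → (∀ r ∈ l, σ.reg r = ρ r) → (s.den tapes ω σ).reg x = ρ x) :
    Triple tapes ω ρ (fun σ => E σ ∧ σ.Agree ρ l) s (fun σ => E σ ∧ σ.Agree ρ (x :: l)) := by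
  rintro σ ⟨h1, h2⟩
  refine ⟨⟨hE σ h1, fun r hr => ?_⟩, tb_le_of_agree h2 hb⟩
  rcases List.mem_cons.1 hr with rfl | hr
  · exact hx σ h1 h2
  · exact agree_den h2 hk r hr

end

end RAM
set_option linter.constructorNameAsVariable false

/-! ### The parameters of the verification -/

namespace DetCert

open Finset RAM RAM.State Stmt

variable {tapes : List (List Bool)} {ω : ℕ → Bool}

/-- The values of the registers that are computed first. Here `r` is the number of rounds per bit
of the moduli, `n` and `L` are dimension and bit size of the input of length `len`, and `l` is the
length of the certificate of the determinant. -/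
def par (c r n L len l : ℕ) (x : Reg) : ℕ :=
  let k1 := n.size * L
  let k2 := n * k1
  let cb := certConst c * (n.size * (n * k2))
  let lenC := min (cb + 1) l
  let h := (lenC + n + 1).size
  match x with
  | .len => len
  | .oB => 2 * len
  | .n => n
  | .sz => n.size
  | .idx0 => n * n
  | .L => L
  | .m => n + n
  | .n1 => n + 1
  | .m4 => 4 * n
  | .cn => c * n
  | .one => 1
  | .two => 2
  | .three => 3
  | .K => depth n
  | .nm => 16 + 2 * n.size
  | .k1 => k1
  | .hd => (c.size + 3) * k1
  | .S1 => (c.size + 3) * k1 + 2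
  | .k2 => k2
  | .nb => detConst c * k2
  | .nb1 => detConst c * k2 + 1
  | .S => (detConst c + c.size + 4) * k2
  | .iR => n * k2
  | .d => n.size * (n * k2)
  | .cb => cb
  | .cb1 => cb + 1
  | .G => (n + 1) * (detConst c * k2 + 1) + n.size + 2
  | .prod => (n + n) * (n + n)
  | .nT => numTokens n
  | .lenC => lenC
  | .itC => lenC + 1 + numTokens n
  | .x => lenC + n + 1
  | .h => h
  | .big => 1024 * (h * (lenC + n + 1))
  | .bb => modBits n lenC
  | .rr => r * modBits n lenC
  | _ => 0

/-- The facts about arrays and the other registers that hold after tape `0` has been read. -/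
structure Ready (w : List Bool) (n : ℕ) (σ : State) : Prop where
  pos : ∀ k ≤ n * n, σ.arr (.pos 0) k = tpos w 0 k
  cnt : ∀ k ≤ n * n, σ.arr (.cnt 0) k = dcount w (tpos w 0 k)
  zeros : ∀ i, σ.arr .O i = 0
  tossed : σ.tossed = 0
  bad : σ.reg .bad = 0

lemma Ready.den {w : List Bool} {n : ℕ} {σ : State} (h : Ready w n σ) {s : Stmt}
    (ha : s.keepsA [.pos 0, .cnt 0, .O] = true) (ht : s.wt = false) (hb : s.wr .bad = false) :
    Ready w n (s.den tapes ω σ) := by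
  have h1 := keepsA_arr (tapes := tapes) (ω := ω) ha σ (a := .pos 0) (by simp)
  have h2 := keepsA_arr (tapes := tapes) (ω := ω) ha σ (a := .cnt 0) (by simp)
  have h3 := keepsA_arr (tapes := tapes) (ω := ω) ha σ (a := .O) (by simp)
  exact ⟨by rw [h1]; exact h.pos, by rw [h2]; exact h.cnt, by rw [h3]; exact h.zeros,
    (den_tossed ht σ).trans h.tossed, (den_reg hb σ).trans h.bad⟩

/-- The largest number of digits of the entries of the input, and at least `1`. -/
def maxDigits : Stmt :=
  .op .L (.const 1) ;; .loop .iB .idx0 (.op .y (.addc .iB 1) ;; .load .e (.cnt 0) .y ;;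
    .op .u (.sub .e .L) ;; .ifz .u .skip (.op .L (.addc .e 0)))

lemma maxDigits_spec (σ : State) : ((maxDigits).den tapes ω σ).reg .L =
    max 1 ((range (σ.reg .idx0)).sup fun k => σ.arr (.cnt 0) (k + 1)) := by
  refine loop_induction' (i := .iB) (x := .idx0) (s := _)
    (fun t τ => τ.reg .L = max 1 ((range t).sup fun k => σ.arr (.cnt 0) (k + 1)))
    (σ.setR .L 1) (by simp) ?_
  rintro t - τ hi - ha h
  have ha := ha (.cnt 0) rfl
  simp only [den, Op.eval, setR_reg, setR_arr, hi, ha, if_true, reduceCtorEq, if_false]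
  rw [range_add_one, sup_insert]
  generalize ((range t).sup fun k => σ.arr (.cnt 0) (k + 1)) = M at h ⊢
  have e : ∀ a, a ⊔ M = max a M := fun _ => rfl
  rw [e]
  split_ifs with h0
  · simp only [setR_reg, reduceCtorEq, if_false, h] at h0 ⊢
    omega
  · simp only [setR_reg, reduceCtorEq, if_false, if_true, h] at h0 ⊢
    omega

/-- The length of tape `4`, but at most the value of `cb1`. -/
def certLength : Stmt :=
  .op .lenC (.const 0) ;; .loop .iB .cb1 (.read .s 4 .lenC ;; .op .t (.half .s) ;;
    .ifz .t (.op .lenC (.addc .lenC 1)) .skip)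

lemma tapeSymbol_div_two (w : List Bool) (i : ℕ) : tapeSymbol w i / 2 = 0 ↔ i < w.length := by
  by_cases h : i < w.length
  · simp only [tapeSymbol, List.getElem?_eq_getElem h, h, iff_true]
    cases w[i] <;> rfl
  · simp [tapeSymbol_of_le (not_lt.1 h), h]

lemma certLength_spec {C : List Bool} (hC : tapes.getD 4 [] = C) (σ : State) :
    ((certLength).den tapes ω σ).reg .lenC = min (σ.reg .cb1) C.length := by
  refine loop_induction' (i := .iB) (x := .cb1) (s := _)
    (fun t τ => τ.reg .lenC = min t C.length) (σ.setR .lenC 0) (by simp) ?_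
  rintro t - τ hi - ha h
  simp only [den, Op.eval, setR_reg, if_true, reduceCtorEq, if_false, h]
  have := tapeSymbol_div_two C (min t C.length)
  rw [← hC] at this
  simp only [Fin.isValue, Fin.coe_ofNat_eq_mod, Nat.reduceMod]
  rw [hC] at this ⊢
  split_ifs with h0
  · rw [this] at h0
    simp [h]; omega
  · rw [this] at h0
    simp [h]; omega

/-- Read the input. -/
def readInput : Stmt :=
  lin .oB 0 2 .len ;; .op .q (.addc .len 0) ;; tok 0 .oB ;; .load .n (.val 0) .zero ;;
    .load .sz (.cnt 0) .zero

/-- Compute the parameters. -/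
def params (c r : ℕ) : Stmt :=
  mulc .idx0 1 .n .n ;; maxDigits ;; lin .m 0 2 .n ;; .op .n1 (.addc .n 1) ;; lin .m4 0 4 .n ;;
  lin .cn 0 c .n ;; .op .one (.const 1) ;; .op .two (.const 2) ;; .op .three (.const 3) ;;
  .op .K (.addc .sz 4) ;; lin .nm 16 2 .sz ;; mulc .k1 1 .sz .L ;; lin .hd 0 (c.size + 3) .k1 ;;
  .op .S1 (.addc .hd 2) ;; mulc .k2 1 .n .k1 ;; lin .nb 0 (detConst c) .k2 ;;
  .op .nb1 (.addc .nb 1) ;; lin .S 0 (detConst c + c.size + 4) .k2 ;; mulc .iR 1 .n .k2 ;;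
  mulc .d 1 .sz .iR ;; lin .cb 0 (certConst c) .d ;; .op .cb1 (.addc .cb 1) ;;
  (mulc .G 1 .n1 .nb1 ;; addr .G .sz ;; .op .G (.addc .G 2)) ;;
  mulc .prod 1 .m .m ;; (mulc .nT 1 .nm .prod ;; addr .nT .n1) ;;
  certLength ;; (.op .itC (.addc .lenC 1) ;; addr .itC .nT) ;;
  (.op .x (.addc .lenC 0) ;; addr .x .n ;; .op .x (.addc .x 1)) ;;
  (.op .u (.addc .x 0) ;; sizeLoop .h .u .x) ;; mulc .big 1024 .h .x ;;
  (mulc .y 512 .h .x ;; sizeLoop .bb .y .big) ;; lin .rr 0 r .bb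

lemma length_encodeMatrix {n : ℕ} (A : IntMat n) :
    (encodeMatrix A).length =
      2 * n.size + 1 + 2 * ((entries A).map fun z => z.natAbs.size).sum + 2 * (n * n) := by
  rw [encodeMatrix_eq, List.length_append, length_encodeNat, length_flatMap_encodeInt, entries,
    List.length_ofFn]
  ring

lemma entryBits_eq {n : ℕ} (A : IntMat n) :
    max 1 ((range (n * n)).sup fun k =>
      dcount (encodeMatrix A) (tpos (encodeMatrix A) 0 (k + 1))) = entryBits A := by
  rw [entryBits]
  congr 1
  refine le_antisymm (Finset.sup_le fun k hk => ?_) (Finset.sup_le fun p _ => ?_)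
  · have hk := mem_range.1 hk
    have hn : 0 < n := Nat.pos_of_ne_zero (by rintro rfl; simp at hk)
    have h1 : k / n < n := Nat.div_lt_of_lt_mul hk
    have h2 : k % n < n := Nat.mod_lt _ hn
    have := (decode_matrix A ⟨k / n, h1⟩ ⟨k % n, h2⟩).1
    simp only [Nat.div_add_mod'] at this
    rw [this]
    exact le_sup (f := fun p : Fin n × Fin n => (A p.1 p.2).natAbs.size)
      (mem_univ (_, _))
  · have := (decode_matrix A p.1 p.2).1
    rw [← this]
    exact le_sup (f := fun k => dcount (encodeMatrix A) (tpos (encodeMatrix A) 0 (k + 1)))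
      (mem_range.2 (by nlinarith [p.1.2, p.2.2]))

/-- The state in which the structured program starts: all is zero but the length of tape `0`. -/
def start (len : ℕ) : State where
  reg r := if r = .len then len else 0
  arr _ _ := 0
  tossed := 0

section

variable {c r n l : ℕ} {A : IntMat n}

lemma readInput_spec (hA : tapes.getD 0 [] = encodeMatrix A) {L : ℕ} :
    Triple tapes ω (par c r n L (encodeMatrix A).length l)
      (fun σ => σ = start (encodeMatrix A).length) readInput
      (fun σ => Ready (encodeMatrix A) n σ ∧
        σ.Agree (par c r n L (encodeMatrix A).length l) [.sz, .n, .oB, .zero]) := by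
  rintro _ rfl
  set w := encodeMatrix A with hw
  set ρ := par c r n L w.length l
  have hlen := length_encodeMatrix A
  rw [← hw] at hlen
  refine ⟨?_, add_le_add (tb_le_of_agree (l := [.len]) (by simp [State.Agree, start, ρ, par]) rfl)
    (tb_le_of_agree (l := [.oB]) (by simp [State.Agree, lin_spec, start, ρ, par]) rfl)⟩
  simp only [readInput, den]
  set σ₁ := (lin .oB 0 2 .len).den tapes ω (start w.length) with hσ₁
  have h1 : σ₁.reg .oB = 2 * w.length := by
    rw [hσ₁, lin_spec _ _ _ _ (by decide) (by decide)]; simp [start]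
  have hlen1 : σ₁.reg .len = w.length := by rw [hσ₁, den_reg rfl]; simp [start]
  have hz : ∀ r, (lin .oB 0 2 .len).wr r = false → r ≠ .len → σ₁.reg r = 0 := fun r hr hne => by
    rw [hσ₁, den_reg hr]; simp [start, hne]
  set σ₂ := σ₁.setR .q ((Op.addc .len 0).eval σ₁.reg) with hσ₂
  have q2 : σ₂.reg .q = w.length := by simp [hσ₂, Op.eval, hlen1]
  have p2 : σ₂.reg .pos = 0 := by simp [hσ₂, hz .pos rfl (by decide)]
  have s2 : σ₂.reg .sg = 0 := by simp [hσ₂, hz .sg rfl (by decide)]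
  have z2 : σ₂.reg .zero = 0 := by simp [hσ₂, hz .zero rfl (by decide)]
  have b2 : σ₂.reg .bad = 0 := by simp [hσ₂, hz .bad rfl (by decide)]
  have o2 : σ₂.reg .oB = 2 * w.length := by simp [hσ₂, h1]
  set σ₃ := (tok 0 .oB).den tapes ω σ₂ with hσ₃
  have htok : ∀ k ≤ n * n, TokOk w 0 0 w.length 0 σ₃.arr k := by
    intro k hk
    have h := tok_spec (ω := ω) 0 .oB hA σ₂ rfl z2 (by rw [s2]; decide) k
    rw [q2, p2, s2, o2, ← hσ₃] at h
    refine h.2 (h.1.2 ?_)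
    have := tpos_le w 0 (k + 1)
    omega
  have h0 := htok 0 (Nat.zero_le _)
  have hdec := decode_header n (entries A)
  rw [← encodeMatrix_eq, ← hw] at hdec
  have hnle : n ≤ w.length := by
    have := Nat.le_mul_self n
    omega
  have hn0 : σ₃.arr (.val 0) 0 = n := by
    have := h0.val
    rw [hdec.2.1] at this
    exact (natCast_inj_of_le h0.val_le hnle).1 (by exact_mod_cast this)
  have hs0 : σ₃.arr (.cnt 0) 0 = n.size := by rw [h0.cnt, hdec.1]
  have z3 : σ₃.reg .zero = 0 := by rw [hσ₃, den_reg rfl, z2]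
  have o3 : σ₃.reg .oB = 2 * w.length := by rw [hσ₃, den_reg rfl, o2]
  refine ⟨⟨fun k hk => (htok k hk).pos, fun k hk => (htok k hk).cnt, fun i => ?_, ?_, ?_⟩, ?_⟩
  · rw [setR_arr, setR_arr, hσ₃, den_arr rfl, hσ₂, setR_arr, hσ₁, den_arr rfl]; rfl
  · simp only [setR_tossed]
    rw [hσ₃, den_tossed rfl, hσ₂, setR_tossed, hσ₁, den_tossed rfl]; rfl
  · simp only [setR_reg, reduceCtorEq, if_false]
    rw [hσ₃, den_reg rfl, b2]
  · simp [State.Agree, z3, hs0, hn0, o3, ρ, par]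

/-- The registers that `params` computes. -/
def paramRegs : List Reg :=
  [.rr, .bb, .big, .h, .x, .itC, .lenC, .nT, .prod, .G, .cb1, .cb, .d, .iR, .S, .nb1, .nb, .k2,
    .S1, .hd, .k1, .nm, .K, .three, .two, .one, .cn, .m4, .n1, .m, .L, .idx0, .sz, .n, .oB, .zero]

lemma size_le_self (x : ℕ) : x.size ≤ x := Nat.size_le.2 Nat.lt_two_pow_self

/-- Compute one parameter after those in the list `l`, and go on with `t`. The side conditions on
the program are decided by evaluation. -/
lemma Ready.seq {w : List Bool} {ρ : Reg → ℕ} {l : List Reg} {s t : Stmt} {Q : State → Prop}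
    (x : Reg) (hx : ∀ σ, Ready w n σ → (∀ r ∈ l, σ.reg r = ρ r) → (s.den tapes ω σ).reg x = ρ x)
    (ht : Triple tapes ω ρ (fun σ => Ready w n σ ∧ σ.Agree ρ (x :: l)) t Q)
    (hs : (s.keeps l && s.bounded l && s.keepsA [.pos 0, .cnt 0, .O] && !s.wt && !s.wr .bad) = true
      := by rfl) : Triple tapes ω ρ (fun σ => Ready w n σ ∧ σ.Agree ρ l) (s ;; t) Q := by
  simp only [Bool.and_eq_true, Bool.not_eq_true'] at hs
  exact (Triple.step hs.1.1.1.1 hs.1.1.1.2 (fun σ h => h.den hs.1.1.2 hs.1.2 hs.2) hx).seq ht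

lemma params_spec (hC : (tapes.getD 4 []).length = l) :
    Triple tapes ω (par c r n (entryBits A) (encodeMatrix A).length l)
      (fun σ => Ready (encodeMatrix A) n σ ∧
        σ.Agree (par c r n (entryBits A) (encodeMatrix A).length l) [.sz, .n, .oB, .zero])
      (params c r)
      (fun σ => Ready (encodeMatrix A) n σ ∧
        σ.Agree (par c r n (entryBits A) (encodeMatrix A).length l) paramRegs) := by
  refine Ready.seq .idx0 ?_ <| Ready.seq .L ?_ <| Ready.seq .m ?_ <| Ready.seq .n1 ?_ <| Ready.seq .m4 ?_ <| Ready.seq .cn ?_ <|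
    Ready.seq .one ?_ <| Ready.seq .two ?_ <| Ready.seq .three ?_ <| Ready.seq .K ?_ <| Ready.seq .nm ?_ <| Ready.seq .k1 ?_ <|
    Ready.seq .hd ?_ <| Ready.seq .S1 ?_ <| Ready.seq .k2 ?_ <| Ready.seq .nb ?_ <| Ready.seq .nb1 ?_ <| Ready.seq .S ?_ <|
    Ready.seq .iR ?_ <| Ready.seq .d ?_ <| Ready.seq .cb ?_ <| Ready.seq .cb1 ?_ <| Ready.seq .G ?_ <| Ready.seq .prod ?_ <|
    Ready.seq .nT ?_ <| Ready.seq .lenC ?_ <| Ready.seq .itC ?_ <| Ready.seq .x ?_ <| Ready.seq .h ?_ <| Ready.seq .big ?_ <|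
    Ready.seq .bb ?_ <|
    Triple.step (x := .rr) rfl rfl (fun σ h => h.den rfl rfl rfl) fun σ _ h => ?_
  case refine_2 => 
    intro σ hE h
    rw [maxDigits_spec, h .idx0 (by simp)]
    refine Eq.trans ?_ (entryBits_eq A)
    congr 1
    exact sup_congr rfl fun k hk => hE.cnt _ (Nat.succ_le_of_lt (mem_range.1 hk))
  all_goals
    try intro σ _ h
  all_goals
    try simp [lin_spec, mulc_spec, addr_spec, den, Op.eval, h, par, depth, two_mul]; done
  · simp only [Stmt.den, setR_reg, if_true, Op.eval]
    rw [addr_spec _ _ (by decide), den_reg (r := .sz) rfl, mulc_spec] <;> try decide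
    simp [h, par]
  · simp only [Stmt.den]
    rw [addr_spec _ _ (by decide), den_reg (r := .n1) rfl, mulc_spec] <;> try decide
    rw [h .nm (by simp), h .prod (by simp), h .n1 (by simp)]
    simp only [par, numTokens, off, depth]; ring
  · rw [certLength_spec rfl, hC, h .cb1 (by simp)]; simp [par]
  · simp only [Stmt.den]
    rw [sizeLoop_spec] <;> simp [Op.eval, h, par, size_le_self]
  · have hy : ((mulc .y 512 .h .x).den tapes ω σ).reg .y = 512 * (σ.reg .h * σ.reg .x) := by
      rw [mulc_spec] <;> decide
    simp only [Stmt.den]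
    rw [sizeLoop_spec _ _ _ (by decide) (by decide) (by decide) (by decide), hy]
    · rw [h .h (by simp), h .x (by simp)]; rfl
    · rw [hy, den_reg rfl, h .h (by simp), h .x (by simp), h .big (by simp)]
      refine (size_le_self _).trans ?_
      simp only [par]; omega

end

end DetCert
set_option linter.constructorNameAsVariable false

/-! ### Reading the messages -/

namespace DetCert

open Finset RAM RAM.State Stmt

variable {tapes : List (List Bool)} {ω : ℕ → Bool}

/-- Read a tape that starts with a natural number. -/
def tokNat (τ : Fin 5) (x : Reg) : Stmt :=
  .op .pos (.const 0) ;; .op .sg (.const 0) ;; tok τ x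

/-- Read a tape that starts with the sign of an integer. -/
def tokInt (τ : Fin 5) (x : Reg) : Stmt :=
  .op .pos (.const 0) ;; .read .s τ .pos ;; .op .sg (.addp .zero .s) ;; .op .pos (.const 1) ;;
    tok τ x

lemma tokNat_spec (τ : Fin 5) (x : Reg) {w : List Bool} (hw : tapes.getD τ [] = w) (σ : State)
    (hx : (tokNat τ x).wr x = false) (hz : σ.reg .zero = 0) (i : ℕ) :
    (i < ((tokNat τ x).den tapes ω σ).reg .idx ↔ tpos w 0 (i + 1) ≤ 2 * σ.reg x) ∧
    (i < ((tokNat τ x).den tapes ω σ).reg .idx →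
      TokOk w 0 0 (σ.reg .q) τ ((tokNat τ x).den tapes ω σ).arr i) := by
  have hx' := hx
  simp only [tokNat, wr, Bool.or_eq_false_iff, decide_eq_false_iff_not] at hx
  have h := tok_spec (ω := ω) τ x hw ((σ.setR .pos 0).setR .sg 0) hx.2.2 (by simpa using hz)
    (by simp) i
  simp only [setR_reg, if_neg hx.1, if_neg hx.2.1, if_true, reduceCtorEq, if_false,
    zero_add] at h
  exact h

lemma tokInt_spec (τ : Fin 5) (x : Reg) {w : List Bool} (hw : tapes.getD τ [] = w) (σ : State)
    (hx : (tokInt τ x).wr x = false) (hz : σ.reg .zero = 0) (i : ℕ) :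
    (i < ((tokInt τ x).den tapes ω σ).reg .idx ↔ tpos w 1 (i + 1) ≤ 1 + 2 * σ.reg x) ∧
    (i < ((tokInt τ x).den tapes ω σ).reg .idx →
      TokOk w 1 (tapeSymbol w 0 % 2) (σ.reg .q) τ ((tokInt τ x).den tapes ω σ).arr i) := by
  have hx' := hx
  simp only [tokInt, wr, Bool.or_eq_false_iff, decide_eq_false_iff_not] at hx
  have h := tok_spec (ω := ω) τ x hw
    ((((σ.setR .pos 0).setR .s (tapeSymbol w 0)).setR .sg (tapeSymbol w 0 % 2)).setR .pos 1)
    hx.2.2.2.2 (by simpa using hz) (by rw [setR_reg, if_neg (by decide), setR_reg, if_pos rfl]; exact Nat.mod_lt _ two_pos) i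
  simp only [setR_reg, if_neg hx.1, if_neg hx.2.1, if_neg hx.2.2.1, if_true, reduceCtorEq,
    if_false] at h
  have e : (tokInt τ x).den tapes ω σ = (tok τ x).den tapes ω
      ((((σ.setR .pos 0).setR .s (tapeSymbol w 0)).setR .sg (tapeSymbol w 0 % 2)).setR .pos 1) := by
    simp only [tokInt, den, Op.eval, setR_reg, if_true, reduceCtorEq, if_false, hz, zero_add,
      hw]
  rw [e]
  exact h

/-- Read the challenge. -/
def readChallenge : Stmt :=
  .op .q (.addc .cn 0) ;; tokNat 2 .cn ;; .load .lam (.val 2) .zero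

/-- Check the degree of the polynomial and the sizes of its coefficients. -/
def polyTests : Stmt :=
  (.op .y (.addc .sz 1) ;; .load .e (.cnt 1) .zero ;; leq .e .y) ;;
    (.load .e (.val 1) .zero ;; neq .e .n1) ;;
    (.op .y (.addc .n1 1) ;; leq .y .idx) ;;
    .loop .iB .n1 (.op .y (.addc .iB 1) ;; .load .e (.cnt 1) .y ;; leq .e .nb)

/-- Read and check the polynomial. -/
def readPoly : Stmt :=
  .op .q (.addc .m4 0) ;; tokNat 1 .G ;; polyTests

/-- Check the size of the claimed determinant. -/
def valueTests : Stmt := leq .one .idx ;; .load .e (.cnt 3) .zero ;; leq .e .lenC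

/-- Read and check the claimed determinant. -/
def readValue : Stmt := .op .q (.const 0) ;; tokInt 3 .nb1 ;; valueTests

/-- Read all the messages. -/
def readMessages : Stmt :=
  leq .lenC .cb ;; readChallenge ;; readPoly ;; readValue ;; tokInt 4 .itC

lemma readPoly_bad (σ : State) (hz : σ.reg .zero = 0) :
    let σ' := (tokNat 1 .G).den tapes ω (σ.setR .q (σ.reg .m4))
    ((readPoly).den tapes ω σ).reg .bad = 0 ↔ σ.reg .bad = 0 ∧ σ'.arr (.cnt 1) 0 ≤ σ.reg .sz + 1 ∧
      σ'.arr (.val 1) 0 = σ.reg .n1 ∧ σ.reg .n1 + 1 ≤ σ'.reg .idx ∧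
      ∀ k < σ.reg .n1, σ'.arr (.cnt 1) (k + 1) ≤ σ.reg .nb := by
  intro σ'
  have hloop : ∀ τ : State, ((Stmt.loop .iB .n1 (.op .y (.addc .iB 1) ;; .load .e (.cnt 1) .y ;;
      leq .e .nb)).den tapes ω τ).reg .bad = 0 ↔ τ.reg .bad = 0 ∧
        ∀ k < τ.reg .n1, τ.arr (.cnt 1) (k + 1) ≤ τ.reg .nb := by
    intro τ
    refine loop_induction' (i := .iB) (x := .n1) (s := _)
      (fun t τ' => τ'.reg .bad = 0 ↔ τ.reg .bad = 0 ∧ ∀ k < t, τ.arr (.cnt 1) (k + 1) ≤ τ.reg .nb)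
      τ (by simp) ?_
    rintro t - τ' hi hr ha h
    simp only [Stmt.den, setR_reg, reduceCtorEq, if_false]
    rw [leq_spec]
    simp only [setR_reg, setR_arr, Op.eval, if_true, reduceCtorEq, if_false, h, hi,
      ha (.cnt 1) rfl, hr .nb rfl (by decide)]
    rw [Nat.forall_lt_succ_right, and_assoc]
  have hreg : ∀ r, (tokNat 1 .G).wr r = false → r ≠ .q → σ'.reg r = σ.reg r := fun r h1 h2 => by
    rw [den_reg h1, setR_reg, if_neg h2]
  have e : (readPoly).den tapes ω σ = polyTests.den tapes ω σ' := rfl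
  simp only [e, polyTests, Stmt.den]
  refine (hloop _).trans ?_
  simp [leq_spec, neq_spec, leq_reg, neq_reg, leq_arr, neq_arr, Op.eval, hz, and_assoc,
    hreg .bad rfl, hreg .sz rfl, hreg .zero rfl, hreg .n1 rfl, hreg .nb rfl]

/-- The registers that are needed after the computation of the parameters. -/
def keepRegs : List Reg :=
  [.rr, .bb, .big, .itC, .lenC, .G, .cb, .S, .nb1, .nb, .S1, .hd, .K, .three, .one, .cn, .m4, .n1,
    .m, .sz, .n, .zero]

/-- The parameters have their values. -/
abbrev HasParams (c r n L len l : ℕ) (σ : State) : Prop := σ.Agree (par c r n L len l) keepRegs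

lemma HasParams.get {c r n L len l : ℕ} {σ : State} (h : HasParams c r n L len l σ) (x : Reg)
    (hx : keepRegs.contains x = true := by rfl) : σ.reg x = par c r n L len l x :=
  h x (by simpa using hx)

/-- What the arrays hold after the messages have been read. -/
structure Facts (n : ℕ) (wA wg wl wd C : List Bool) (lam : ℕ) (σ : State) : Prop where
  pos0 : ∀ k ≤ n * n, σ.arr (.pos 0) k = tpos wA 0 k
  cnt0 : ∀ k ≤ n * n, σ.arr (.cnt 0) k = dcount wA (tpos wA 0 k)
  pos1 : ∀ k ≤ n + 1, σ.arr (.pos 1) k = tpos wg 0 k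
  cnt1 : ∀ k ≤ n + 1, σ.arr (.cnt 1) k = dcount wg (tpos wg 0 k)
  lam : σ.reg .lam = lam
  pos2 : σ.arr (.pos 2) 0 = 0
  cnt2 : σ.arr (.cnt 2) 0 = dcount wl 0
  pos3 : σ.arr (.pos 3) 0 = 1
  cnt3 : σ.arr (.cnt 3) 0 = dcount wd 1
  pos4 : ∀ k < numTokens n, σ.arr (.pos 4) k = tpos C 1 k
  cnt4 : ∀ k < numTokens n, σ.arr (.cnt 4) k = dcount C (tpos C 1 k)
  last4 : ∀ k < numTokens n, σ.arr (.last 4) k =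
    if dcount C (tpos C 1 k) = 0 then 1 else tbit C (tpos C 1 k) (dcount C (tpos C 1 k) - 1)

lemma size_succ_le (n : ℕ) : (n + 1).size ≤ n.size + 1 := by
  refine Nat.size_le.2 ?_
  have := Nat.lt_size_self n
  have : 0 < 2 ^ n.size := by positivity
  rw [pow_succ]; omega

lemma two_pow_size_le {n : ℕ} (hn : 0 < n) : 2 ^ n.size ≤ 2 * n := by
  obtain ⟨s, hs⟩ : ∃ s, n.size = s + 1 := ⟨n.size - 1, by have := Nat.size_pos.2 hn; omega⟩
  have : 2 ^ s ≤ n := Nat.lt_size.1 (by omega)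
  rw [hs, pow_succ]; omega

/-- The check of the polynomial. -/
lemma poly_iff {n nb G idx : ℕ} (hn : 0 < n) (g : ℤ[X]) (hG : G = (n + 1) * (nb + 1) + n.size + 2)
    (arr : Arr → ℕ → ℕ) (hidx : ∀ i, i < idx ↔ tpos (encodePoly g) 0 (i + 1) ≤ 2 * G)
    (htok : ∀ i < idx, TokOk (encodePoly g) 0 0 (4 * n) 1 arr i) :
    (arr (.cnt 1) 0 ≤ n.size + 1 ∧ arr (.val 1) 0 = n + 1 ∧ n + 1 + 1 ≤ idx ∧
      ∀ k < n + 1, arr (.cnt 1) (k + 1) ≤ nb) ↔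
    ((∀ i, (g.coeff i).natAbs.size ≤ nb) ∧ g.degree = n) := by
  obtain ⟨d1, d2, d3⟩ := decode_poly g
  have hdeg : g.degree = n ↔ g.natDegree = n := by
    rw [degree_eq_iff_natDegree_eq_of_pos hn]
  rw [hdeg]
  have hval : 0 < idx → (g.natDegree + 1).size ≤ n.size + 1 → arr (.val 1) 0 = g.natDegree + 1 := by
    intro h0 hs
    have h := htok 0 h0
    have h1 := h.val
    rw [d2] at h1
    refine (natCast_inj_of_le h.val_le ?_).1 (by exact_mod_cast h1)
    have := Nat.size_le.1 hs
    have := two_pow_size_le hn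
    rw [pow_succ] at *
    omega
  constructor
  · rintro ⟨h1, h2, h3, h4⟩
    have hcnt : ∀ i < n + 2, arr (.cnt 1) i = dcount (encodePoly g) (tpos (encodePoly g) 0 i) :=
      fun i hi => (htok i (by omega)).cnt
    rw [hcnt 0 (by omega), d1] at h1
    have hd : g.natDegree = n := by
      have := hval (by omega) h1
      omega
    refine ⟨fun i => ?_, hd⟩
    by_cases hi : i ≤ n
    · have := h4 i (by omega)
      rwa [hcnt _ (by omega), (d3 i (by omega)).1] at this
    · rw [coeff_eq_zero_of_natDegree_lt (by omega)]; simp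
  · rintro ⟨h1, h2⟩
    rw [h2] at d1 d3 hval
    have h3 : n + 2 ≤ idx := by
      have := (hidx (n + 1)).2 ?_
      · omega
      · rw [tpos_eq_sum, sum_range_succ', d1, zero_add]
        have hle : ∑ k ∈ range (n + 1), (dcount (encodePoly g)
            (tpos (encodePoly g) 0 (k + 1)) + 1) ≤ ∑ _k ∈ range (n + 1), (nb + 1) := by
          refine sum_le_sum fun k hk => ?_
          have hk := mem_range.1 hk
          rw [(d3 k (by omega)).1]
          have := h1 k
          omega
        rw [sum_const, card_range, smul_eq_mul] at hle
        have := size_succ_le n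
        omega
    refine ⟨?_, hval (by omega) (size_succ_le n), h3, fun k hk => ?_⟩
    · rw [(htok 0 (by omega)).cnt, d1]; exact size_succ_le n
    · rw [(htok (k + 1) (by omega)).cnt, (d3 k (by omega)).1]; exact h1 k

/-- After reading the messages, `bad` tells whether their sizes are admissible. -/
lemma readMessages_spec {c r n l L len : ℕ} (hn : 0 < n) {wA : List Bool} {g : ℤ[X]} {lam : ℕ}
    (hlam : lam < c * n) {δ : ℤ} {C : List Bool} (hg : tapes.getD 1 [] = encodePoly g)
    (hl : tapes.getD 2 [] = encodeNat lam) (hd : tapes.getD 3 [] = encodeInt δ)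
    (hC : tapes.getD 4 [] = C) (hlen : C.length = l) (σ : State) (h : Ready wA n σ)
    (ha : HasParams c r n L len l σ) :
    let σ' := (readMessages).den tapes ω σ
    let nb := (limits c).numBits n L
    (σ'.reg .bad = 0 ↔ l ≤ (limits c).certBits n L ∧
      ((∀ i, (g.coeff i).natAbs.size ≤ nb) ∧ g.degree = n) ∧ δ.natAbs.size ≤ nb ∧
        δ.natAbs.size ≤ l) ∧
    (σ'.reg .bad = 0 →
      Facts n wA (encodePoly g) (encodeNat lam) (encodeInt δ) C lam σ') := by
  intro σ' nb
  have enb : detConst c * (n * (n.size * L)) = nb := by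
    simp only [nb, limits]; ring
  have ecb : certConst c * (n.size * (n * (n * (n.size * L)))) = (limits c).certBits n L := by
    simp only [limits]; ring
  -- the states in between
  obtain ⟨σ₁, hσ₁⟩ : ∃ s, s = (leq .lenC .cb).den tapes ω σ := ⟨_, rfl⟩
  obtain ⟨σ₂, hσ₂⟩ : ∃ s, s = (readChallenge).den tapes ω σ₁ := ⟨_, rfl⟩
  obtain ⟨σ₃, hσ₃⟩ : ∃ s, s = (readPoly).den tapes ω σ₂ := ⟨_, rfl⟩
  obtain ⟨σ₄, hσ₄⟩ : ∃ s, s = (readValue).den tapes ω σ₃ := ⟨_, rfl⟩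
  have hσ' : σ' = (tokInt 4 .itC).den tapes ω σ₄ := by
    rw [hσ₄, hσ₃, hσ₂, hσ₁]; rfl
  clear_value σ' nb
  have g1 : HasParams c r n L len l σ₁ := hσ₁ ▸ agree_den ha rfl
  have g2 : HasParams c r n L len l σ₂ := hσ₂ ▸ agree_den g1 rfl
  have g3 : HasParams c r n L len l σ₃ := hσ₃ ▸ agree_den g2 rfl
  have g4 : HasParams c r n L len l σ₄ := hσ₄ ▸ agree_den g3 rfl
  -- size of the certificate
  have b1 : σ₁.reg .bad = 0 ↔ l ≤ (limits c).certBits n L := by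
    rw [hσ₁, leq_spec, ha.get .lenC, ha.get .cb, h.bad]
    simp only [par, ecb, true_and]
    omega
  -- the challenge
  have b2 : σ₂.reg .bad = σ₁.reg .bad := by rw [hσ₂]; exact den_reg rfl σ₁
  have t2 : σ₂.reg .lam = lam ∧ σ₂.arr (.pos 2) 0 = 0 ∧
      σ₂.arr (.cnt 2) 0 = dcount (encodeNat lam) 0 := by
    have h0 := decode_nat [] [] lam
    simp only [List.nil_append, List.append_nil, List.length_nil] at h0
    have hs := tokNat_spec (ω := ω) 2 .cn hl (σ₁.setR .q (σ₁.reg .cn)) rfl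
      (by simpa [par] using g1.get .zero) 0
    simp only [State.setR_reg, if_true, reduceCtorEq, if_false] at hs
    have hcn : σ₁.reg .cn = c * n := g1.get .cn
    have hok := hs.2 (hs.1.2 (by
      rw [hcn, tpos, tpos, h0.1]
      have := size_le_self lam
      omega))
    have hlam' : ((tokNat 2 .cn).den tapes ω (σ₁.setR .q (σ₁.reg .cn))).arr (.val 2) 0 = lam := by
      have hv := hok.val
      rw [tval, tsg, if_pos rfl, tpos, h0.2] at hv
      exact (natCast_inj_of_le hok.val_le (by omega)).1 (by simpa using hv)
    have hz : ((tokNat 2 .cn).den tapes ω (σ₁.setR .q (σ₁.reg .cn))).reg .zero = 0 := by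
      rw [den_reg rfl]; simpa [par] using g1.get .zero
    rw [hσ₂]
    simp only [readChallenge, den, Op.eval, add_zero, State.setR_reg, State.setR_arr, if_true, hz]
    exact ⟨hlam', hok.pos, hok.cnt⟩
  -- the polynomial
  obtain ⟨τ₂, hτ₂⟩ : ∃ s, s = (tokNat 1 .G).den tapes ω (σ₂.setR .q (σ₂.reg .m4)) := ⟨_, rfl⟩
  have ts2 := fun i => tokNat_spec (ω := ω) 1 .G hg (σ₂.setR .q (σ₂.reg .m4)) rfl
      (by simpa [par] using g2.get .zero) i
  simp only [State.setR_reg, if_true, reduceCtorEq, if_false, ← hτ₂] at ts2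
  have hm4 : σ₂.reg .m4 = 4 * n := g2.get .m4
  have hn1 : σ₂.reg .n1 = n + 1 := g2.get .n1
  have hGG : σ₂.reg .G = (n + 1) * (nb + 1) + n.size + 2 := by
    rw [g2.get .G]; simp only [par, enb]
  rw [hm4] at ts2
  have b3' := readPoly_bad (tapes := tapes) (ω := ω) σ₂ (g2.get .zero)
  simp only [← hτ₂, ← hσ₃] at b3'
  have b3 : σ₃.reg .bad = 0 ↔ σ₂.reg .bad = 0 ∧
      ((∀ i, (g.coeff i).natAbs.size ≤ nb) ∧ g.degree = n) := by
    rw [b3', hn1, g2.get .sz, g2.get .nb]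
    simp only [par, enb]
    rw [poly_iff hn g hGG τ₂.arr (fun i => (ts2 i).1) (fun i hi => (ts2 i).2 hi)]
  have arr3 : ∀ a, σ₃.arr a = τ₂.arr a := fun a => by
    rw [hσ₃, hτ₂]; exact den_arr (s := polyTests) rfl _
  have t3 : σ₃.reg .bad = 0 → ∀ k ≤ n + 1, σ₃.arr (.pos 1) k = tpos (encodePoly g) 0 k ∧
      σ₃.arr (.cnt 1) k = dcount (encodePoly g) (tpos (encodePoly g) 0 k) := by
    intro hb k hk
    have := (b3'.1 hb).2.2.2.1
    rw [hn1] at this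
    have hok := (ts2 k).2 (by omega)
    rw [arr3, arr3]
    exact ⟨hok.pos, hok.cnt⟩
  -- the value
  have hdd := decode_ints [δ] 0 (by simp)
  simp only [List.flatMap_cons, List.flatMap_nil, List.append_nil, List.getElem_cons_zero, tpos]
    at hdd
  obtain ⟨τ₃, hτ₃⟩ : ∃ s, s = (tokInt 3 .nb1).den tapes ω (σ₃.setR .q 0) := ⟨_, rfl⟩
  have ts3 := tokInt_spec (ω := ω) 3 .nb1 hd (σ₃.setR .q 0) rfl (by simpa [par] using g3.get .zero) 0
  simp only [State.setR_reg, if_true, reduceCtorEq, if_false, ← hτ₃] at ts3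
  have hnb1 : σ₃.reg .nb1 = nb + 1 := by rw [g3.get .nb1]; simp only [par, enb]
  have hidx3 : 0 < τ₃.reg .idx ↔ δ.natAbs.size ≤ nb := by
    rw [ts3.1, tpos, tpos, hdd.1, hnb1]; omega
  have k3 : ∀ r, (tokInt 3 .nb1).wr r = false → r ≠ .q → τ₃.reg r = σ₃.reg r := fun r h1 h2 => by
    rw [hτ₃, den_reg h1, State.setR_reg, if_neg h2]
  have b4 : σ₄.reg .bad = 0 ↔ (σ₃.reg .bad = 0 ∧ 0 < τ₃.reg .idx) ∧
      τ₃.arr (.cnt 3) 0 ≤ σ₃.reg .lenC := by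
    have e : σ₄ = valueTests.den tapes ω τ₃ := by rw [hσ₄, hτ₃]; rfl
    rw [e]
    simp [valueTests, Stmt.den, leq_spec, leq_reg, leq_arr, k3 .zero rfl, k3 .lenC rfl, k3 .bad rfl,
      k3 .one rfl, g3.get .zero, g3.get .one, par, Nat.succ_le_iff]
  have arr4 : ∀ a, σ₄.arr a = τ₃.arr a := fun a => by
    rw [hσ₄, hτ₃]; exact den_arr (s := valueTests) rfl _
  have hbad' : σ'.reg .bad = σ₄.reg .bad := by rw [hσ']; exact den_reg rfl σ₄
  have hfin : σ'.reg .bad = 0 ↔ l ≤ (limits c).certBits n L ∧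
      ((∀ i, (g.coeff i).natAbs.size ≤ nb) ∧ g.degree = n) ∧ δ.natAbs.size ≤ nb ∧
        δ.natAbs.size ≤ l := by
    rw [hbad', b4, b3, b2, b1, and_assoc, and_assoc]
    refine and_congr_right fun h1 => and_congr_right fun _ => ?_
    rw [hidx3]
    refine and_congr_right fun h2 => ?_
    rw [(ts3.2 (hidx3.2 h2)).cnt, tpos, hdd.1, g3.get .lenC]
    simp only [par, ecb]
    omega
  refine ⟨hfin, fun hb => ?_⟩
  obtain ⟨c1, c2, c3, c4⟩ := hfin.1 hb
  rw [hbad'] at hb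
  have t3 := t3 (b4.1 hb).1.1
  have hok3 := ts3.2 (hidx3.2 c3)
  -- the certificate
  have ts4 : ∀ k < numTokens n, TokOk C 1 (tapeSymbol C 0 % 2) (σ₄.reg .q) 4 σ'.arr k := by
    intro k hk
    have h := tokInt_spec (ω := ω) 4 .itC hC σ₄ rfl (g4.get .zero) k
    rw [← hσ'] at h
    refine h.2 (h.1.2 ?_)
    have := tpos_le C 1 (k + 1)
    rw [g4.get .itC]
    simp only [par, ecb]
    omega
  have e3 : σ' = (readValue ;; tokInt 4 .itC).den tapes ω σ₃ := by rw [hσ', hσ₄]; rfl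
  have e2 : σ' = (readPoly ;; readValue ;; tokInt 4 .itC).den tapes ω σ₂ := by rw [e3, hσ₃]; rfl
  have e1 : σ' = readMessages.den tapes ω σ := by rw [e2, hσ₂, hσ₁]; rfl
  refine ⟨?_, ?_, ?_, ?_, ?_, ?_, ?_, ?_, ?_, fun k hk => (ts4 k hk).pos,
    fun k hk => (ts4 k hk).cnt, fun k hk => (ts4 k hk).last⟩
  · rw [e1, den_arr rfl]; exact h.pos
  · rw [e1, den_arr rfl]; exact h.cnt
  · rw [e3, den_arr rfl]; exact fun k hk => (t3 k hk).1
  · rw [e3, den_arr rfl]; exact fun k hk => (t3 k hk).2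
  · rw [hσ', den_reg rfl, hσ₄, den_reg rfl, hσ₃, den_reg rfl]; exact t2.1
  · rw [e2, den_arr rfl]; exact t2.2.1
  · rw [e2, den_arr rfl]; exact t2.2.2
  · rw [hσ', den_arr rfl, arr4]; exact hok3.pos
  · rw [hσ', den_arr rfl, arr4]; exact hok3.cnt

end DetCert
set_option linter.constructorNameAsVariable false

/-! ### Exact checks by bit-serial arithmetic -/

namespace DetCert

open Finset Matrix RAM RAM.State Stmt

variable {tapes : List (List Bool)} {ω : ℕ → Bool}

/-- The arrays that describe the tapes. -/
def factArrs : List Arr :=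
  [.pos 0, .cnt 0, .pos 1, .cnt 1, .pos 2, .cnt 2, .pos 3, .cnt 3, .pos 4, .cnt 4, .last 4]

lemma Facts.of_eq {n : ℕ} {wA wg wl wd C : List Bool} {lam : ℕ} {σ σ' : State}
    (h : Facts n wA wg wl wd C lam σ) (ha : ∀ a ∈ factArrs, σ'.arr a = σ.arr a)
    (hb : σ'.reg .lam = σ.reg .lam) : Facts n wA wg wl wd C lam σ' := by
  cases h
  constructor <;> (first | rw [ha _ (by simp [factArrs])] | rw [hb]) <;> assumption

lemma Facts.den {n : ℕ} {wA wg wl wd C : List Bool} {lam : ℕ} {σ : State}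
    (h : Facts n wA wg wl wd C lam σ) {s : Stmt} (ha : s.keepsA factArrs = true)
    (hb : s.wr .lam = false) : Facts n wA wg wl wd C lam (s.den tapes ω σ) :=
  h.of_eq (fun _ h => keepsA_arr ha σ h) (den_reg hb σ)

/-- The number whose binary digits are in `acc`. -/
def digits (σ : State) (S : ℕ) : ℤ :=
  ∑ j ∈ range S, 2 ^ j * ((σ.arr .acc j % 2 : ℕ) : ℤ)

lemma accum_digits (τ : Fin 5) (x mult flip S : Reg) {w : List Bool} (hw : tapes.getD τ [] = w)
    (σ : State) (hx : x ∉ [Reg.ps])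
    (hm : (accum τ x mult flip S).wr mult = false) (hf : (accum τ x mult flip S).wr flip = false)
    (hS : (accum τ x mult flip S).wr S = false) (hfl : σ.reg flip < 2) (hz : σ.reg .zero = 0)
    {p : ℕ} (hp : σ.arr (.pos τ) (σ.reg x) = p) (hc : σ.arr (.cnt τ) (σ.reg x) = dcount w p)
    (hd : dcount w p ≤ σ.reg S) :
    (∀ j < σ.reg S, ((accum τ x mult flip S).den tapes ω σ).arr .acc j < 2) ∧
      digits ((accum τ x mult flip S).den tapes ω σ) (σ.reg S) ≡
        σ.reg mult * digits σ (σ.reg S) +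
          (-1) ^ (σ.reg flip + tapeSymbol w (p - 1)) * dval w p [ZMOD 2 ^ σ.reg S] := by
  obtain ⟨h1, h2⟩ := accum_spec (ω := ω) τ x mult flip S hw σ hx hm hf hS hfl hz hp hc
  refine ⟨h1, ?_⟩
  have h2 := h2 hd
  rw [digits, sum_congr rfl fun j hj => by
    rw [Nat.mod_eq_of_lt (h1 j (mem_range.1 hj))]]
  exact h2

lemma zeroTest_digits (S : Reg) (σ : State) (V : ℤ) (hb : ∀ j < σ.reg S, σ.arr .acc j < 2)
    (hV : digits σ (σ.reg S) ≡ V [ZMOD 2 ^ σ.reg S]) (hlt : V.natAbs < 2 ^ σ.reg S) :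
    ((zeroTest S).den tapes ω σ).reg .bad = 0 ↔ σ.reg .bad = 0 ∧ V = 0 := by
  refine zeroTest_spec S σ V hb ?_ hlt
  rwa [digits, sum_congr rfl fun j hj => by
    rw [Nat.mod_eq_of_lt (hb j (mem_range.1 hj))]] at hV

/-! #### The copy of the matrix in the certificate -/

/-- Subtract the challenge on the diagonal. The first bit of the code of a positive number, which is
`1`, acts as a negative sign here. -/
def copyDiag : Stmt :=
  .op .u (.sub .iX .jX) ;; .op .vv (.sub .jX .iX) ;;
    .ifz .u (.ifz .vv (accum 2 .zero .one .zero .S1) .skip) .skip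

/-- Compare one entry. -/
def copyStep : Stmt :=
  (.load .e (.cnt 4) .k1 ;; leq .e .hd) ;; (.load .e (.last 4) .k1 ;; neq .e .one) ;;
  accum 4 .k1 .zero .zero .S1 ;; accum 0 .k2 .one .zero .S1 ;; copyDiag ;; zeroTest .S1 ;;
  .op .k1 (.addc .k1 1) ;; .op .k2 (.addc .k2 1)

/-- Compare the copy of `λ - A` in the certificate with `A` and `λ`. -/
def copyCheck : Stmt :=
  .op .k1 (.addc .n1 0) ;; .op .k2 (.const 1) ;;
    .loop .iX .n (.loop .jX .n copyStep ;; addr .k1 .n)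

lemma neg_one_pow_zero_add (t : ℕ) : (-1 : ℤ) ^ (0 + t) = (-1) ^ (t % 2) := by
  rw [zero_add, ← neg_one_pow_eq_pow_mod_two]

lemma encodeNat_head (k : ℕ) :
    (-1 : ℤ) ^ (0 + tapeSymbol (encodeNat k) (0 - 1)) * dval (encodeNat k) 0 = -k := by
  have h0 := decode_nat [] [] k
  simp only [List.nil_append, List.append_nil, List.length_nil] at h0
  rw [h0.2]
  rcases Nat.eq_zero_or_pos k with hk | hk
  · subst hk; simp
  · have : tapeSymbol (encodeNat k) (0 - 1) = 1 := by
      have := dcount_spec (encodeNat k) 0 0 (by rw [h0.1]; exact Nat.size_pos.2 hk)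
      simpa using this
    rw [this]; ring

section

variable {c r n l L len : ℕ} {wA wg wd C : List Bool} {lam : ℕ}

lemma copyDiag_spec (hl : tapes.getD 2 [] = encodeNat lam) (σ : State)
    (hp : σ.arr (.pos 2) 0 = 0) (hc : σ.arr (.cnt 2) 0 = dcount (encodeNat lam) 0)
    (hz : σ.reg .zero = 0) (h1 : σ.reg .one = 1) (hs : lam.size ≤ σ.reg .S1) {V : ℤ}
    (hb : ∀ j < σ.reg .S1, σ.arr .acc j < 2)
    (hV : digits σ (σ.reg .S1) ≡ V [ZMOD 2 ^ σ.reg .S1]) :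
    (∀ j < σ.reg .S1, (copyDiag.den tapes ω σ).arr .acc j < 2) ∧
      digits (copyDiag.den tapes ω σ) (σ.reg .S1) ≡
        V - (if σ.reg .iX = σ.reg .jX then (lam : ℤ) else 0) [ZMOD 2 ^ σ.reg .S1] := by
  by_cases hij : σ.reg .iX = σ.reg .jX
  · obtain ⟨τ, hτ⟩ : ∃ s, s = (σ.setR .u 0).setR .vv 0 := ⟨_, rfl⟩
    have e5 : copyDiag.den tapes ω σ = (accum 2 .zero .one .zero .S1).den tapes ω τ := by
      rw [hτ]
      simp only [copyDiag, Stmt.den, Op.eval, setR_reg, if_true, reduceCtorEq, if_false,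
        hij, Nat.sub_self]
    have et : ∀ r, r ≠ .u → r ≠ .vv → τ.reg r = σ.reg r := fun r h1 h2 => by
      rw [hτ]; simp [h1, h2]
    have ez : τ.reg .zero = 0 := by rw [et _ (by decide) (by decide), hz]
    have eS : τ.reg .S1 = σ.reg .S1 := et _ (by decide) (by decide)
    have eo : τ.reg .one = 1 := by rw [et _ (by decide) (by decide), h1]
    have ea : τ.arr = σ.arr := by rw [hτ]; rfl
    have h0 := decode_nat [] [] lam
    simp only [List.nil_append, List.append_nil, List.length_nil] at h0
    have d := accum_digits (ω := ω) 2 .zero .one .zero .S1 hl τ (by decide) rfl rfl rfl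
      (by rw [ez]; decide) ez (p := 0) (by rw [ez, ea, hp])
      (by rw [ez, ea, hc]) (by rw [eS, h0.1]; exact hs)
    rw [e5, ← eS]
    rw [eo, ez, encodeNat_head, Nat.cast_one, one_mul] at d
    refine ⟨d.1, d.2.trans ?_⟩
    rw [if_pos hij, ← sub_eq_add_neg, eS]
    refine Int.ModEq.sub_right _ ?_
    rw [digits, ea]
    exact hV
  · have e5 : (copyDiag.den tapes ω σ).arr = σ.arr := by
      simp only [copyDiag, Stmt.den, Op.eval, setR_reg, if_true, reduceCtorEq, if_false]
      split_ifs with q1 q2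
      · omega
      · rfl
      · rfl
    rw [if_neg hij, sub_zero, e5, digits, e5]
    exact ⟨hb, hV⟩

lemma natAbs_add_sub_lt {a b d : ℤ} {S : ℕ} (ha : a.natAbs < 2 ^ S) (hb : b.natAbs < 2 ^ S)
    (hd : d.natAbs < 2 ^ S) : (a + b - d).natAbs < 2 ^ (S + 2) := by
  rw [pow_add]; omega

lemma le_entry_bound (c : ℕ) {n L : ℕ} (hn : 0 < n) (hL : 1 ≤ L) :
    L + c.size + n.size + 1 ≤ (c.size + 3) * (n.size * L) := by
  have hs : 1 ≤ n.size := Nat.size_pos.2 hn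
  have e1 : 1 * L ≤ n.size * L := Nat.mul_le_mul_right _ hs
  have e2 : n.size * 1 ≤ n.size * L := Nat.mul_le_mul_left _ hL
  have e3 : c.size * 1 ≤ c.size * (n.size * L) := Nat.mul_le_mul_left _ (by omega)
  rw [add_mul]; omega

set_option maxHeartbeats 1000000 in
lemma copyStep_spec (hn : 0 < n) (hA : tapes.getD 0 [] = wA) (hl : tapes.getD 2 [] = encodeNat lam)
    (hC : tapes.getD 4 [] = C) (σ : State) (h : Facts n wA wg (encodeNat lam) wd C lam σ)
    (ha : HasParams c r n L len l σ) (hlam : lam < c * n) {a b i j : ℕ}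
    (hk1 : σ.reg .k1 = a) (hk2 : σ.reg .k2 = b) (hi : σ.reg .iX = i) (hj : σ.reg .jX = j)
    (hb : b ≤ n * n) (hb0 : 0 < b) (hat : a < numTokens n)
    (hbL : dcount wA (tpos wA 0 b) ≤ L) (hL : 1 ≤ L) :
    ((copyStep.den tapes ω σ).reg .bad = 0 ↔ σ.reg .bad = 0 ∧
      cval C a = (if i = j then (lam : ℤ) else 0) - tval wA 0 0 b ∧
      dcount C (tpos C 1 a) = (cval C a).natAbs.size ∧
      dcount C (tpos C 1 a) ≤ (c.size + 3) * (n.size * L)) ∧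
    (copyStep.den tapes ω σ).reg .k1 = a + 1 ∧ (copyStep.den tapes ω σ).reg .k2 = b + 1 := by
  obtain ⟨S₀, hS₀⟩ : ∃ s, s = (c.size + 3) * (n.size * L) := ⟨_, rfl⟩
  have hLS := le_entry_bound c hn hL
  rw [← hS₀] at hLS
  have two : ∀ {s : ℕ}, s ≤ S₀ → 2 ^ s ≤ 2 ^ S₀ := Nat.pow_le_pow_right two_pos
  have hlS : lam < 2 ^ S₀ := by
    refine (hlam.trans_le ?_).trans_le (two (show c.size + n.size ≤ S₀ by omega))
    rw [pow_add]
    exact Nat.mul_le_mul (Nat.lt_size_self c).le (Nat.lt_size_self n).le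
  -- the two tests of the number of digits, the computation, and the test of its result
  obtain ⟨σ₁, hσ₁⟩ : ∃ s, s = (Stmt.load .e (.cnt 4) .k1 ;; leq .e .hd).den tapes ω σ := ⟨_, rfl⟩
  obtain ⟨σ₂, hσ₂⟩ : ∃ s, s = (Stmt.load .e (.last 4) .k1 ;; neq .e .one).den tapes ω σ₁ := ⟨_, rfl⟩
  obtain ⟨σ₃, hσ₃⟩ : ∃ s, s = (accum 4 .k1 .zero .zero .S1).den tapes ω σ₂ := ⟨_, rfl⟩
  obtain ⟨σ₄, hσ₄⟩ : ∃ s, s = (accum 0 .k2 .one .zero .S1).den tapes ω σ₃ := ⟨_, rfl⟩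
  obtain ⟨σ₅, hσ₅⟩ : ∃ s, s = copyDiag.den tapes ω σ₄ := ⟨_, rfl⟩
  obtain ⟨σ₆, hσ₆⟩ : ∃ s, s = (zeroTest .S1).den tapes ω σ₅ := ⟨_, rfl⟩
  have hσ' : copyStep.den tapes ω σ =
      (σ₆.setR .k1 (σ₆.reg .k1 + 1)).setR .k2 (σ₆.reg .k2 + 1) := by
    rw [hσ₆, hσ₅, hσ₄, hσ₃, hσ₂, hσ₁]; rfl
  -- what none of these steps changes
  obtain ⟨I, hI⟩ : ∃ I : State → Prop, ∀ τ, I τ ↔ Facts n wA wg (encodeNat lam) wd C lam τ ∧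
      τ.reg .k1 = a ∧ τ.reg .k2 = b ∧ τ.reg .zero = 0 ∧ τ.reg .one = 1 ∧ τ.reg .S1 = S₀ + 2 ∧
      τ.reg .iX = i ∧ τ.reg .jX = j := ⟨_, fun _ => Iff.rfl⟩
  have step : ∀ {s : Stmt} {τ : State}, I τ → s.keepsA factArrs = true → s.wr .lam = false →
      s.keeps [.k1, .k2, .zero, .one, .S1, .iX, .jX] = true → I (s.den tapes ω τ) := by
    intro s τ h ha hl hk
    have k := fun r hr => keeps_reg (tapes := tapes) (ω := ω) hk τ (r := r) hr
    rw [hI] at h ⊢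
    exact ⟨h.1.den ha hl, by simpa [k] using h.2⟩
  have i0 : I σ := (hI σ).2 ⟨h, hk1, hk2, ha.get .zero, ha.get .one,
    (ha.get .S1).trans (by rw [hS₀]; rfl), hi, hj⟩
  have vhd : σ.reg .hd = S₀ := (ha.get .hd).trans hS₀.symm
  have i1 : I σ₁ := hσ₁ ▸ step i0 rfl rfl rfl
  have i2 : I σ₂ := hσ₂ ▸ step i1 rfl rfl rfl
  have i3 : I σ₃ := hσ₃ ▸ step i2 rfl rfl rfl
  have i4 : I σ₄ := hσ₄ ▸ step i3 rfl rfl rfl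
  have i5 : I σ₅ := hσ₅ ▸ step i4 rfl rfl rfl
  have i6 : I σ₆ := hσ₆ ▸ step i5 rfl rfl rfl
  obtain ⟨f1, k1, -, -, o1, -⟩ := (hI σ₁).1 i1
  obtain ⟨f2, k2, -, z2, -, S2, -⟩ := (hI σ₂).1 i2
  obtain ⟨f3, -, l3, z3, o3, S3, -⟩ := (hI σ₃).1 i3
  obtain ⟨f4, -, -, z4, o4, S4, X4, Y4⟩ := (hI σ₄).1 i4
  obtain ⟨-, -, -, -, -, S5, -⟩ := (hI σ₅).1 i5
  obtain ⟨-, k6, l6, -⟩ := (hI σ₆).1 i6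
  refine ⟨?_, by rw [hσ']; simp [k6], by rw [hσ']; simp [l6]⟩
  have b1 : σ₁.reg .bad = 0 ↔ σ.reg .bad = 0 ∧ dcount C (tpos C 1 a) ≤ S₀ := by
    rw [hσ₁]
    simp [Stmt.den, leq_spec, hk1, h.cnt4 a hat, vhd]
  have b2 : σ₂.reg .bad = 0 ↔ σ₁.reg .bad = 0 ∧
      dcount C (tpos C 1 a) = (dval C (tpos C 1 a)).size := by
    rw [hσ₂, dcount_eq_size_iff]
    by_cases h0 : dcount C (tpos C 1 a) = 0 <;> simp [Stmt.den, neq_spec, k1, f1.last4 a hat, o1, h0]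
  rw [← hS₀]
  have b6 : (copyStep.den tapes ω σ).reg .bad = σ₆.reg .bad := by rw [hσ']; simp
  have bmid : σ₅.reg .bad = σ₂.reg .bad := by
    rw [hσ₅, den_reg rfl, hσ₄, den_reg rfl, hσ₃, den_reg rfl]
  have hcabs : (cval C a).natAbs = dval C (tpos C 1 a) := natAbs_tval _ _ _ _
  rw [b6]
  by_cases hd : dcount C (tpos C 1 a) ≤ S₀
  swap
  · have : σ₆.reg .bad ≠ 0 := by
      intro h6
      rw [hσ₆] at h6
      have h5 := bad_den rfl σ₅ h6
      rw [bmid, b2, b1] at h5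
      exact hd h5.1.2
    simp [this, hd]
  -- the digits
  have d3 := accum_digits (ω := ω) 4 .k1 .zero .zero .S1 hC σ₂ (by decide) rfl rfl rfl
    (by rw [z2]; decide) z2 (p := tpos C 1 a) (by rw [k2]; exact f2.pos4 a hat)
    (by rw [k2]; exact f2.cnt4 a hat) (by omega)
  rw [← hσ₃, S2, z2, neg_one_pow_zero_add, ← cval_eq, Nat.cast_zero, zero_mul, zero_add] at d3
  have d4 := accum_digits (ω := ω) 0 .k2 .one .zero .S1 hA σ₃ (by decide) rfl rfl rfl
    (by rw [z3]; decide) z3 (p := tpos wA 0 b) (by rw [l3]; exact f3.pos0 b hb)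
    (by rw [l3]; exact f3.cnt0 b hb) (by omega)
  have htv : tval wA 0 0 b = (-1) ^ (tapeSymbol wA (tpos wA 0 b - 1) % 2) * dval wA (tpos wA 0 b) := by
    rw [tval, tsg, if_neg (by omega)]
  rw [← hσ₄, S3, z3, o3, neg_one_pow_zero_add, ← htv, Nat.cast_one, one_mul] at d4
  have d5 := copyDiag_spec (ω := ω) hl σ₄ f4.pos2 f4.cnt2 z4 o4
    (by rw [S4]; exact (Nat.size_le.2 hlS).trans (by omega)) (V := cval C a + tval wA 0 0 b)
    (by rw [S4]; exact d4.1) (by rw [S4]; exact d4.2.trans (Int.ModEq.add_right _ d3.2))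
  rw [← hσ₅, S4, X4, Y4] at d5
  have b5 := zeroTest_digits (tapes := tapes) (ω := ω) .S1 σ₅
    (cval C a + tval wA 0 0 b - (if i = j then (lam : ℤ) else 0))
    (by rw [S5]; exact d5.1) (by rw [S5]; exact d5.2) (by
      rw [S5]
      refine natAbs_add_sub_lt ((natAbs_cval_lt' C a).trans_le (two hd)) ?_ ?_
      · rw [natAbs_tval]
        exact (dval_lt _ _).trans_le (two (by omega))
      · split_ifs <;> simp [hlS])
  rw [← hσ₆] at b5
  rw [b5, bmid, b2, b1, hcabs, sub_eq_zero, eq_sub_iff_add_eq]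
  exact ⟨fun ⟨⟨⟨p, q⟩, r⟩, s⟩ => ⟨p, s, r, q⟩, fun ⟨p, s, r, q⟩ => ⟨⟨⟨p, q⟩, r⟩, s⟩⟩

/-- The copy of `λ - A` is accepted if it is correct and has no leading zeros. -/
lemma copyCheck_spec (hn : 0 < n) {A : IntMat n}
    (hA : tapes.getD 0 [] = encodeMatrix A) (hl : tapes.getD 2 [] = encodeNat lam)
    (hC : tapes.getD 4 [] = C) (σ : State)
    (h : Facts n (encodeMatrix A) wg (encodeNat lam) wd C lam σ)
    (ha : HasParams c r n (entryBits A) len l σ) (hlam : lam < c * n) :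
    (copyCheck.den tapes ω σ).reg .bad = 0 ↔ σ.reg .bad = 0 ∧ ∀ i j : Fin n,
      cval C (1 + n + i * (n + n) + j) =
        ((lam : ℤ) • (1 : IntMat n) - A) i j ∧
      dcount C (tpos C 1 (1 + n + i * (n + n) + j)) =
        (((lam : ℤ) • (1 : IntMat n) - A) i j).natAbs.size := by
  set w := encodeMatrix A with hw
  set S₀ := (c.size + 3) * (n.size * entryBits A) with hS₀
  set cond : ℕ → ℕ → Prop := fun i j =>
    cval C (1 + n + i * (n + n) + j) = (if i = j then (lam : ℤ) else 0) - tval w 0 0 (i * n + j + 1) ∧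
    dcount C (tpos C 1 (1 + n + i * (n + n) + j)) = (cval C (1 + n + i * (n + n) + j)).natAbs.size ∧
    dcount C (tpos C 1 (1 + n + i * (n + n) + j)) ≤ S₀ with hcond
  have entry : ∀ i j : Fin n, ((lam : ℤ) • (1 : IntMat n) - A) i j =
      (if (i : ℕ) = j then (lam : ℤ) else 0) - tval w 0 0 (i * n + j + 1) := fun i j => by
    rw [hw, (decode_matrix A i j).2]
    simp only [Matrix.sub_apply, Matrix.smul_apply, Matrix.one_apply, Fin.ext_iff]
    split_ifs <;> simp
  have arrs : ∀ a ∈ factArrs, (Stmt.loop .jX .n copyStep ;; addr .k1 .n).wa a = false := by decide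
  obtain ⟨σ₀, hσ₀⟩ : ∃ s, s = (σ.setR .k1 (n + 1)).setR .k2 1 := ⟨_, rfl⟩
  have h0 : Facts n w wg (encodeNat lam) wd C lam σ₀ := hσ₀ ▸ h.of_eq (fun _ _ => rfl) (by simp)
  have ha0 : HasParams c r n (entryBits A) len l σ₀ := by
    have : (Stmt.op .k1 (.const (n + 1)) ;; .op .k2 (.const 1)).den tapes ω σ = σ₀ := hσ₀.symm
    exact this ▸ agree_den ha rfl
  have e : copyCheck.den tapes ω σ =
      (Stmt.loop .iX .n (.loop .jX .n copyStep ;; addr .k1 .n)).den tapes ω σ₀ := by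
    rw [hσ₀]
    simp only [copyCheck, Stmt.den, Op.eval, ha.get .n1, par, add_zero]
  have hn0 : σ₀.reg .n = n := ha0.get .n
  have key := loop_induction' (tapes := tapes) (ω := ω) (i := .iX) (x := .n)
    (s := .loop .jX .n copyStep ;; addr .k1 .n)
    (fun i τ => (τ.reg .bad = 0 ↔ σ₀.reg .bad = 0 ∧ ∀ i' < i, ∀ j < n, cond i' j) ∧
      τ.reg .k1 = 1 + n + i * (n + n) ∧ τ.reg .k2 = i * n + 1) σ₀ (by simp [hσ₀, add_comm]) ?_
  · rw [hn0] at key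
    rw [e, key.1, show σ₀.reg .bad = σ.reg .bad by simp [hσ₀]]
    refine and_congr_right fun _ => ⟨fun H i j => ?_, fun H i hi j hj => ?_⟩
    · obtain ⟨h1, h2, -⟩ := H i i.2 j j.2
      rw [entry, ← h1]
      exact ⟨rfl, h2⟩
    · obtain ⟨h1, h2⟩ := H ⟨i, hi⟩ ⟨j, hj⟩
      refine ⟨h1.trans (entry ⟨i, hi⟩ ⟨j, hj⟩), by rw [h1]; exact h2, ?_⟩
      rw [h2]
      refine (natAbs_size_le_entryBits _ ⟨i, hi⟩ ⟨j, hj⟩).trans ((entryBits_sub_le A hlam).trans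
        (le_entry_bound c hn (one_le_entryBits A)))
  · rintro i hi τ hiX hr har ⟨hbad, hk1, hk2⟩
    rw [hn0] at hi
    have aτ : HasParams c r n (entryBits A) len l τ := agree_of_loop ha0 hr rfl rfl
    have hτn : τ.reg .n = n := aτ.get .n
    have fτ : Facts n w wg (encodeNat lam) wd C lam τ :=
      h0.of_eq (fun a ha => har a (arrs a ha)) (hr .lam rfl (by decide))
    have inner := loop_induction' (tapes := tapes) (ω := ω) (i := .jX) (x := .n) (s := copyStep)
      (fun j τ' => (τ'.reg .bad = 0 ↔ τ.reg .bad = 0 ∧ ∀ j' < j, cond i j') ∧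
        τ'.reg .k1 = 1 + n + i * (n + n) + j ∧ τ'.reg .k2 = i * n + j + 1) τ
      (by simp [hk1, hk2]) ?_
    · rw [hτn] at inner
      obtain ⟨i1, i2, i3⟩ := inner
      generalize hτ' : (Stmt.loop .jX .n copyStep).den tapes ω τ = τ' at i1 i2 i3
      have hnn : τ'.reg .n = n := hτ' ▸ (den_reg rfl τ).trans hτn
      have e : (Stmt.loop .jX .n copyStep ;; addr .k1 .n).den tapes ω τ =
        (addr .k1 .n).den tapes ω τ' := hτ' ▸ rfl
      simp only [e, setR_reg, reduceCtorEq, if_false]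
      refine ⟨?_, ?_, ?_⟩
      · rw [den_reg rfl, i1, hbad, Nat.forall_lt_succ_right, and_assoc]
      · rw [addr_spec _ _ (by decide), i2, hnn]; ring
      · rw [den_reg rfl, i3]; ring
    · rintro j hj τ' hjX hr' har' ⟨hbad', hk1', hk2'⟩
      rw [hτn] at hj
      have fτ' : Facts n w wg (encodeNat lam) wd C lam τ' :=
        fτ.of_eq (fun a ha => har' a (by revert a; decide)) (hr' .lam rfl (by decide))
      have hb : i * n + j + 1 ≤ n * n := by nlinarith
      have hat : 1 + n + i * (n + n) + j < numTokens n := by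
        have := off_le_numTokens (n := n) (j := 0) (by omega) (i := i) (k := j) (by omega) (by omega)
        rw [off] at this; omega
      have hdL : dcount w (tpos w 0 (i * n + j + 1)) ≤ entryBits A :=
        (decode_matrix A ⟨i, hi⟩ ⟨j, hj⟩).1.trans_le (natAbs_size_le_entryBits A _ _)
      have st := copyStep_spec (ω := ω) hn hA hl hC τ' fτ' (agree_of_loop aτ hr' rfl rfl) hlam hk1'
        hk2' ((hr' .iX rfl (by decide)).trans hiX) hjX hb (by omega) hat hdL (one_le_entryBits A)
      simp only [setR_reg, reduceCtorEq, if_false]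
      refine ⟨?_, st.2.1, ?_⟩
      · rw [st.1, hbad', Nat.forall_lt_succ_right, and_assoc]
      · rw [st.2.2]; ring

end

end DetCert
set_option linter.constructorNameAsVariable false

namespace DetCert

open Finset RAM RAM.State Stmt

variable {tapes : List (List Bool)} {ω : ℕ → Bool}

/-! #### The value of the polynomial -/

/-- One step of Horner's rule. -/
def hornerStep : Stmt :=
  accum 1 .k1 .mult .zero .S ;; .op .k1 (.sub .k1 .one) ;; .op .mult (.addc .lam 0)

/-- Compare the value of the polynomial at the challenge with the claimed determinant. -/
def horner : Stmt :=
  (.op .k1 (.addc .n1 0) ;; .op .mult (.const 0)) ;; .loop .iX .n1 hornerStep ;;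
    accum 3 .zero .one .one .S ;; zeroTest .S

lemma natAbs_eval_le {g : ℤ[X]} {n nb X c lam : ℕ} (hn : 0 < n) (hdeg : g.natDegree = n)
    (hg : ∀ i, (g.coeff i).natAbs.size ≤ nb) (hlam : lam < c * n) (hX : n * n.size ≤ X) :
    (g.eval (lam : ℤ)).natAbs < 2 ^ (nb + (c.size + 3) * X) := by
  have hs : 1 ≤ n.size := Nat.size_pos.2 hn
  have h1 : (g.eval (lam : ℤ)).natAbs ≤ ∑ _i ∈ range (n + 1), 2 ^ nb * (c * n) ^ n := by
    rw [eval_eq_sum_range, hdeg]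
    refine (Int.natAbs_sum_le _ _).trans (sum_le_sum fun i hi => ?_)
    rw [Int.natAbs_mul, Int.natAbs_pow, Int.natAbs_natCast]
    refine Nat.mul_le_mul (Nat.size_le.1 (hg i)).le ((Nat.pow_le_pow_left hlam.le i).trans
      (Nat.pow_le_pow_right (by omega) (Nat.lt_succ_iff.1 (mem_range.1 hi))))
  rw [sum_const, card_range, smul_eq_mul] at h1
  have h2 : c * n ≤ 2 ^ (c.size + n.size) := by
    rw [pow_add]; exact Nat.mul_le_mul (Nat.lt_size_self c).le (Nat.lt_size_self n).le
  have h3 : n + 1 ≤ 2 ^ n.size := Nat.lt_size_self n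
  have h4 : (n + 1) * (2 ^ nb * (c * n) ^ n) ≤
      2 ^ n.size * (2 ^ nb * (2 ^ (c.size + n.size)) ^ n) := by gcongr
  refine (h1.trans h4).trans_lt ?_
  rw [← pow_mul, ← pow_add, ← pow_add]
  refine Nat.pow_lt_pow_right (by norm_num) ?_
  have e1 : n.size ≤ n * n.size := Nat.le_mul_of_pos_left _ hn
  have e2 : n ≤ n * n.size := Nat.le_mul_of_pos_right _ hs
  have e3 : c.size * n ≤ c.size * X := Nat.mul_le_mul_left _ (e2.trans hX)
  nlinarith

section

variable {c r n l L len : ℕ} {wA C : List Bool} {lam : ℕ}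

lemma hornerLoop_spec {g : ℤ[X]} {wl wd : List Bool} (hg : tapes.getD 1 [] = encodePoly g) (σ : State)
    (h : Facts n wA (encodePoly g) wl wd C lam σ) (hz : σ.reg .zero = 0) (h1 : σ.reg .one = 1)
    (hn1 : σ.reg .n1 = n + 1) (hdeg : g.natDegree = n)
    (hS : ∀ i, (g.coeff i).natAbs.size ≤ σ.reg .S) (hk : σ.reg .k1 = n + 1)
    (hm : σ.reg .mult = 0) :
    (∀ j < σ.reg .S, ((Stmt.loop .iX .n1 hornerStep).den tapes ω σ).arr .acc j < 2) ∧
      digits ((Stmt.loop .iX .n1 hornerStep).den tapes ω σ) (σ.reg .S) ≡ g.eval (lam : ℤ)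
        [ZMOD 2 ^ σ.reg .S] := by
  have key := loop_induction' (tapes := tapes) (ω := ω) (i := .iX) (x := .n1) (s := hornerStep)
    (fun t τ => τ.reg .k1 = n + 1 - t ∧ τ.reg .mult = (if t = 0 then 0 else lam) ∧
      (t ≠ 0 → (∀ j < σ.reg .S, τ.arr .acc j < 2) ∧ digits τ (σ.reg .S) ≡
        ∑ i ∈ Finset.range t, g.coeff (n + 1 - t + i) * (lam : ℤ) ^ i [ZMOD 2 ^ σ.reg .S])) σ
    (by simp [hk, hm]) ?_
  · rw [hn1] at key
    have := key.2.2 (by omega)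
    rw [eval_eq_sum_range, hdeg]
    simpa using this
  · rintro t ht τ hi hr ha ⟨k1, k2, k3⟩
    rw [hn1] at ht
    have a1 : ∀ a, a ∈ [Arr.pos 1, .cnt 1] → τ.arr a = σ.arr a := fun a h => ha a (by
      simp only [List.mem_cons, List.not_mem_nil, or_false] at h
      rcases h with rfl | rfl <;> rfl)
    have eS : τ.reg .S = σ.reg .S := hr .S rfl (by decide)
    have ez : τ.reg .zero = 0 := (hr .zero rfl (by decide)).trans hz
    have eo : τ.reg .one = 1 := (hr .one rfl (by decide)).trans h1
    have el : τ.reg .lam = lam := (hr .lam rfl (by decide)).trans h.lam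
    obtain ⟨d1, d2, d3⟩ := decode_poly g
    obtain ⟨e1, e2⟩ := d3 (n - t) (by omega)
    rw [show n - t + 1 = n + 1 - t by omega] at e1 e2
    have d := accum_digits (ω := ω) 1 .k1 .mult .zero .S hg τ (by decide) rfl rfl rfl
      (by rw [ez]; decide) ez (p := tpos (encodePoly g) 0 (n + 1 - t))
      (by rw [k1, a1 _ (by simp)]; exact h.pos1 _ (by omega))
      (by rw [k1, a1 _ (by simp)]; exact h.cnt1 _ (by omega))
      (by rw [e1, eS]; exact hS _)
    obtain ⟨τ', hτ'⟩ : ∃ s, s = (accum 1 .k1 .mult .zero .S).den tapes ω τ := ⟨_, rfl⟩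
    rw [← hτ', eS, k2, ez, neg_one_pow_zero_add] at d
    have htv := e2
    rw [tval, tsg, if_neg (by omega)] at htv
    rw [htv] at d
    have f1 : τ'.reg .k1 = n + 1 - t := by rw [hτ', den_reg rfl, k1]
    have f2 : τ'.reg .one = 1 := by rw [hτ', den_reg rfl, eo]
    have f3 : τ'.reg .lam = lam := by rw [hτ', den_reg rfl, el]
    have e : hornerStep.den tapes ω τ = (τ'.setR .k1 (n + 1 - (t + 1))).setR .mult lam := by
      rw [hornerStep, Stmt.den, ← hτ']
      simp only [Stmt.den, Op.eval, setR_reg, reduceCtorEq, if_false, f1, f2, f3, add_zero,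
        Nat.sub_sub]
    rw [e]
    refine ⟨by simp, by simp, fun _ => ⟨d.1, d.2.trans ?_⟩⟩
    rw [sum_range_succ', show n + 1 - (t + 1) = n - t by omega]
    simp only [add_zero, pow_zero, mul_one]
    refine Int.ModEq.add_right _ ?_
    by_cases h0 : t = 0
    · subst h0; simp
    · rw [if_neg h0]
      refine ((k3 h0).2.mul_left _).trans ?_
      rw [mul_sum]
      have es : ∀ i ∈ range t, (lam : ℤ) * (g.coeff (n + 1 - t + i) * (lam : ℤ) ^ i) =
          g.coeff (n - t + (i + 1)) * (lam : ℤ) ^ (i + 1) := fun i _ => by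
        rw [show n - t + (i + 1) = n + 1 - t + i by omega]; ring
      rw [sum_congr rfl es]

/-- The value of the polynomial is compared exactly. -/
lemma horner_spec (hn : 0 < n) {g : ℤ[X]} {wl : List Bool} {δ : ℤ} (hlam : lam < c * n)
    (hg : tapes.getD 1 [] = encodePoly g) (hd : tapes.getD 3 [] = encodeInt δ) (σ : State)
    (h : Facts n wA (encodePoly g) wl (encodeInt δ) C lam σ)
    (ha : HasParams c r n L len l σ) (hL : 1 ≤ L) (hdeg : g.natDegree = n)
    (hgs : ∀ i, (g.coeff i).natAbs.size ≤ (limits c).numBits n L)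
    (hδ : δ.natAbs.size ≤ (limits c).numBits n L) :
    (horner.den tapes ω σ).reg .bad = 0 ↔ σ.reg .bad = 0 ∧ δ = g.eval (lam : ℤ) := by
  obtain ⟨X, hX⟩ : ∃ X, X = n * (n.size * L) := ⟨_, rfl⟩
  have enb : (limits c).numBits n L = detConst c * X := by simp only [limits, hX]; ring
  rw [enb] at hgs hδ
  obtain ⟨σ₁, hσ₁⟩ : ∃ s, s = (Stmt.op .k1 (.addc .n1 0) ;; .op .mult (.const 0)).den tapes ω σ :=
    ⟨_, rfl⟩
  obtain ⟨σ₂, hσ₂⟩ : ∃ s, s = (Stmt.loop .iX .n1 hornerStep).den tapes ω σ₁ := ⟨_, rfl⟩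
  obtain ⟨σ₃, hσ₃⟩ : ∃ s, s = (accum 3 .zero .one .one .S).den tapes ω σ₂ := ⟨_, rfl⟩
  have e : horner.den tapes ω σ = (zeroTest .S).den tapes ω σ₃ := by
    rw [hσ₃, hσ₂, hσ₁]; rfl
  have a1 : HasParams c r n L len l σ₁ := hσ₁ ▸ agree_den ha rfl
  have a2 : HasParams c r n L len l σ₂ := hσ₂ ▸ agree_den a1 rfl
  have a3 : HasParams c r n L len l σ₃ := hσ₃ ▸ agree_den a2 rfl
  have f1 : Facts n wA (encodePoly g) wl (encodeInt δ) C lam σ₁ := hσ₁ ▸ h.den rfl rfl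
  have f2 : Facts n wA (encodePoly g) wl (encodeInt δ) C lam σ₂ := hσ₂ ▸ f1.den rfl rfl
  have vS : ∀ τ : State, HasParams c r n L len l τ →
      τ.reg .S = detConst c * X + (c.size + 4) * X := fun τ hτ => by
    rw [hτ.get .S]; simp only [par, ← hX]; ring
  have hk : σ₁.reg .k1 = n + 1 := by
    rw [hσ₁]; simp [Stmt.den, Op.eval, ha.get .n1, par]
  have hm : σ₁.reg .mult = 0 := by rw [hσ₁]; simp [Stmt.den, Op.eval]
  have d2 := hornerLoop_spec (ω := ω) hg σ₁ f1 (a1.get .zero)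
    (a1.get .one) (a1.get .n1) hdeg
    (fun i => (hgs i).trans (by rw [vS _ a1]; omega)) hk hm
  rw [← hσ₂, vS _ a1] at d2
  have hdd := decode_ints [δ] 0 (by simp)
  simp only [List.flatMap_cons, List.flatMap_nil, List.append_nil, List.getElem_cons_zero, tpos]
    at hdd
  have z2 : σ₂.reg .zero = 0 := a2.get .zero
  have o2 : σ₂.reg .one = 1 := a2.get .one
  have d3 := accum_digits (ω := ω) 3 .zero .one .one .S hd σ₂ (by decide) rfl rfl rfl
    (by rw [o2]; decide) z2 (p := 1)
    (by rw [z2]; exact f2.pos3) (by rw [z2]; exact f2.cnt3)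
    (by rw [hdd.1, vS _ a2]; omega)
  have hcv := hdd.2
  rw [cval_eq, tpos, ← neg_one_pow_eq_pow_mod_two] at hcv
  rw [← hσ₃, vS _ a2, o2, pow_add (-1 : ℤ) 1, pow_one, mul_assoc, hcv, Nat.cast_one, one_mul, neg_one_mul,
    ← sub_eq_add_neg] at d3
  have hlt : (g.eval (lam : ℤ) - δ).natAbs < 2 ^ (detConst c * X + (c.size + 4) * X) := by
    have hX1 : n * n.size ≤ X := by
      rw [hX, ← mul_assoc]; exact Nat.le_mul_of_pos_right _ hL
    have hX0 : 1 ≤ X := (Nat.mul_pos hn (Nat.size_pos.2 hn)).trans_le hX1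
    have q1 := natAbs_eval_le hn hdeg hgs hlam hX1
    have q2 : δ.natAbs < 2 ^ (detConst c * X + (c.size + 3) * X) :=
      (Nat.size_le.1 hδ).trans_le (Nat.pow_le_pow_right (by norm_num) (by omega))
    refine (Int.natAbs_sub_le _ _).trans_lt ((add_lt_add q1 q2).trans_le ?_)
    rw [← two_mul, ← pow_succ']
    exact Nat.pow_le_pow_right (by norm_num) (by nlinarith)
  have b := zeroTest_digits (tapes := tapes) (ω := ω) .S σ₃ (g.eval (lam : ℤ) - δ)
    (by rw [vS _ a3]; exact d3.1) (by rw [vS _ a3]; exact d3.2.trans (d2.2.sub_right _))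
    (by rw [vS _ a3]; exact hlt)
  have hbad : σ₃.reg .bad = σ.reg .bad := by
    rw [hσ₃, den_reg rfl, hσ₂, den_reg rfl, hσ₁, den_reg rfl]
  rw [e, b, hbad, sub_eq_zero, eq_comm (a := δ)]

end

end DetCert
set_option linter.constructorNameAsVariable false

/-! ### The randomized checks -/

namespace RAM

open Finset State

variable {tapes : List (List Bool)} {ω : ℕ → Bool}

/-- From states with property `P`, the program leads to states with property `Q`. -/
def Leads (tapes : List (List Bool)) (ω : ℕ → Bool) (P : State → Prop) (s : Stmt)
    (Q : State → Prop) : Prop := ∀ σ, P σ → Q (s.den tapes ω σ)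

lemma Leads.seq {P Q R : State → Prop} {a b : Stmt} (ha : Leads tapes ω P a Q)
    (hb : Leads tapes ω Q b R) : Leads tapes ω P (a ;; b) R := fun σ hσ => hb _ (ha σ hσ)

lemma Leads.exists {ι : Type*} {P : ι → State → Prop} {Q : State → Prop} {s : Stmt}
    (h : ∀ i, Leads tapes ω (P i) s Q) : Leads tapes ω (fun σ => ∃ i, P i σ) s Q :=
  fun σ ⟨i, hi⟩ => h i σ hi

end RAM

namespace DetCert

open RAM Stmt

variable {tapes : List (List Bool)} {ω : ℕ → Bool}

/-- The residues of the integers of a certificate. -/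
def res (Q : ℕ) (C : List Bool) (k : ℕ) : ZMod (Q + 1) := cval C k

/-- What all checks of a round rely on: modulus, constants, and the residues of the integers of the
certificate `C` and of the claimed determinant `δ`. -/
structure Env (n Q : ℕ) (C : List Bool) (δ : ℤ) (σ : State) : Prop where
  q : σ.reg .q = Q
  m : σ.reg .m = n + n
  dim : σ.reg .n = n
  n1 : σ.reg .n1 = n + 1
  zero : σ.reg .zero = 0
  one : σ.reg .one = 1
  three : σ.reg .three = 3
  K : σ.reg .K = depth n
  d_le : σ.reg .d ≤ Q
  d : (σ.reg .d : ZMod (Q + 1)) = δ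
  O : ∀ i, σ.arr .O i = 0
  val_le : ∀ k < numTokens n, σ.arr (.val 4) k ≤ Q
  val : ∀ k < numTokens n, (σ.arr (.val 4) k : ZMod (Q + 1)) = res Q C k

/-- In addition, the matrix to be read next is number `j`, number `jR` is marked, `bad` has been
kept from being set if and only if `B` holds, and the arrays in the list `vs` hold the given
vectors. -/
structure At (n Q : ℕ) (C : List Bool) (δ : ℤ) (j jR : ℕ) (B : Prop)
    (vs : List (Arr × (ℕ → ZMod (Q + 1)))) (σ : State) : Prop extends Env n Q C δ σ where
  idx : σ.reg .idx = off n j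
  iR : σ.reg .iR = off n jR
  bad : σ.reg .bad = 0 ↔ B
  vec : ∀ p ∈ vs, ∀ i < n + n, σ.arr p.1 i ≤ Q ∧ (σ.arr p.1 i : ZMod (Q + 1)) = p.2 i

section

variable {n Q : ℕ} {C : List Bool} {δ : ℤ} {j jR : ℕ} {B : Prop}
  {vs vs' : List (Arr × (ℕ → ZMod (Q + 1)))} {σ : State}

lemma Env.den (h : Env n Q C δ σ) {s : Stmt}
    (hr : s.keeps [.q, .m, .n, .n1, .zero, .one, .three, .K, .d] = true)
    (ha : s.keepsA [.val 4, .O] = true) : Env n Q C δ (s.den tapes ω σ) := by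
  have k : ∀ {r : Reg}, r ∈ [Reg.q, .m, .n, .n1, .zero, .one, .three, .K, .d] →
      (s.den tapes ω σ).reg r = σ.reg r := fun h => keeps_reg hr σ h
  have e1 := keepsA_arr (tapes := tapes) (ω := ω) ha σ (a := .val 4) (by simp)
  have e2 := keepsA_arr (tapes := tapes) (ω := ω) ha σ (a := .O) (by simp)
  constructor
  · rw [k (by simp), h.q]
  · rw [k (by simp), h.m]
  · rw [k (by simp), h.dim]
  · rw [k (by simp), h.n1]
  · rw [k (by simp), h.zero]
  · rw [k (by simp), h.one]
  · rw [k (by simp), h.three]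
  · rw [k (by simp), h.K]
  · rw [k (by simp)]; exact h.d_le
  · rw [k (by simp), h.d]
  · rw [e2]; exact h.O
  · rw [e1]; exact h.val_le
  · rw [e1]; exact h.val

lemma At.setIdx (h : At n Q C δ j jR B vs σ) {x : Reg} {J : ℕ} (hx : σ.reg x = off n J) :
    At n Q C δ J jR B vs ((Stmt.op .idx (.addc x 0)).den tapes ω σ) where
  toEnv := h.toEnv.den rfl rfl
  idx := by simp [Stmt.den, Op.eval, hx]
  iR := by simp [Stmt.den, h.iR]
  bad := by simp [Stmt.den, h.bad]
  vec := h.vec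

lemma leads_first : Leads tapes ω (At n Q C δ j jR B vs) (.op .idx (.addc .n1 0))
    (At n Q C δ 0 jR B vs) := fun σ h => h.setIdx (by rw [h.n1, off]; ring)

lemma leads_restore : Leads tapes ω (At n Q C δ j jR B vs) (.op .idx (.addc .iR 0))
    (At n Q C δ jR jR B vs) := fun σ h => h.setIdx h.iR

lemma leads_mark : Leads tapes ω (At n Q C δ j jR B vs) (.op .iR (.addc .idx 0))
    (At n Q C δ j j B vs) := fun σ h =>
  { toEnv := h.toEnv.den rfl rfl
    idx := by simp [Stmt.den, h.idx]
    iR := by simp [Stmt.den, Op.eval, h.idx]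
    bad := by simp [Stmt.den, h.bad]
    vec := h.vec }

lemma leads_matvec (dst src : Arr) (y : ℕ → ZMod (Q + 1)) (hj : j < 8 + 2 * depth n)
    (hd : dst ∉ [src, .val 4, .O]) (hs : (src, y) ∈ vs)
    (hv : ∀ p ∈ vs', p = (dst, mat n (res Q C) j y) ∨
      p ∈ vs ∧ p.1 ≠ dst) :
    Leads tapes ω (At n Q C δ j jR B vs) (matvec dst src) (At n Q C δ (j + 1) jR B vs') := by
  intro σ h
  simp only [List.mem_cons, List.not_mem_nil, or_false, not_or] at hd
  obtain ⟨h1, h2⟩ := matvec_spec dst src hd.1 hd.2.1 σ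
  have ka : ∀ a, a ≠ dst → ((matvec dst src).den tapes ω σ).arr a = σ.arr a := fun a ha =>
    den_arr (by simp [matvec, dot, wa, ha]) σ
  rw [h.m, h.q, h.idx] at h2
  rw [h.m, h.idx] at h1
  refine ⟨h.toEnv.den rfl ?_, h1.trans (by simp only [off]; ring), ?_, ?_, ?_⟩
  · simp [keepsA, matvec, dot, wa, Ne.symm hd.2.1, Ne.symm hd.2.2]
  · rw [den_reg rfl, h.iR]
  · rw [den_reg rfl, h.bad]
  · intro p hp i hi
    rcases hv p hp with rfl | ⟨hp, hne⟩
    · refine ⟨(h2 i hi).1, (h2 i hi).2.trans ?_⟩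
      refine Finset.sum_congr rfl fun k hk => ?_
      have hk := Finset.mem_range.1 hk
      beta_reduce
      rw [h.val _ (off_le_numTokens hj hi hk), (h.vec _ hs k hk).2]
    · rw [ka _ hne]; exact h.vec p hp i hi

lemma At.chk (h : At n Q C δ j jR B vs σ) (y w r : Arr) (X : Reg)
    {a b e : ℕ → ZMod (Q + 1)} {x : ZMod (Q + 1)} (hX : (chk y w r X).wr X = false)
    (hx : (σ.reg X : ZMod (Q + 1)) = x) (hy : (y, a) ∈ vs) (hw : (w, b) ∈ vs) (hr : (r, e) ∈ vs) :
    At n Q C δ j jR (B ∧ ∀ i < n + n, a i = b i + x * e i) vs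
      ((chk y w r X).den tapes ω σ) := by
  have h1 := chk_spec (tapes := tapes) (ω := ω) y w r X hX σ fun i hi => by
    rw [h.q]; exact (h.vec _ hy i (by rwa [h.m] at hi)).1
  rw [h.m, h.q, hx, h.bad] at h1
  refine ⟨h.toEnv.den rfl rfl, ?_, ?_, h1.trans (and_congr_right fun _ => ?_), ?_⟩
  · rw [den_reg rfl, h.idx]
  · rw [den_reg rfl, h.iR]
  · refine forall₂_congr fun i hi => ?_
    rw [(h.vec _ hy i hi).2, (h.vec _ hw i hi).2, (h.vec _ hr i hi).2]
  · intro p hp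
    rw [den_arr rfl]; exact h.vec p hp

lemma leads_chk (y w r : Arr) (X : Reg) {a b e : ℕ → ZMod (Q + 1)} {x : ZMod (Q + 1)}
    (hX : (chk y w r X).wr X = false) (hxe : ∀ σ, Env n Q C δ σ → (σ.reg X : ZMod (Q + 1)) = x)
    (hy : (y, a) ∈ vs) (hw : (w, b) ∈ vs) (hr : (r, e) ∈ vs) :
    Leads tapes ω (At n Q C δ j jR B vs) (chk y w r X)
      (At n Q C δ j jR (B ∧ ∀ i < n + n, a i = b i + x * e i) vs) :=
  fun σ h => h.chk y w r X hX (hxe σ h.toEnv) hy hw hr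

/-- As `leads_chk`, the factor being the first integer of the certificate. -/
lemma leads_chk_head (y w r : Arr) {a b e : ℕ → ZMod (Q + 1)}
    (hy : (y, a) ∈ vs) (hw : (w, b) ∈ vs) (hr : (r, e) ∈ vs) :
    Leads tapes ω (At n Q C δ j jR B vs) (.load .prod (.val 4) .zero ;; chk y w r .prod)
      (At n Q C δ j jR (B ∧ ∀ i < n + n, a i = b i + res Q C 0 * e i) vs) := by
  intro σ h
  have h' : At n Q C δ j jR B vs ((Stmt.load .prod (.val 4) .zero).den tapes ω σ) :=
    ⟨h.toEnv.den rfl rfl, by simp [Stmt.den, h.idx], by simp [Stmt.den, h.iR],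
      by simp [Stmt.den, h.bad], h.vec⟩
  refine h'.chk y w r .prod rfl ?_ hy hw hr
  simp only [Stmt.den, State.setR_reg, if_true]
  rw [h.zero, h.val 0 (by rw [numTokens, off]; omega)]

lemma At.weaken (h : At n Q C δ j jR B vs σ) {B' : Prop} (hB : B ↔ B')
    (hv : ∀ p ∈ vs', p ∈ vs ∨ p = (.O, fun _ => 0)) : At n Q C δ j jR B' vs' σ :=
  ⟨h.toEnv, h.idx, h.iR, h.bad.trans hB, fun p hp i hi => by
    rcases hv p hp with hp | rfl
    · exact h.vec p hp i hi
    · simp [h.O]⟩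

/-- The first matrix of the sequence `R` is `1`. -/
def checkInit : Stmt :=
  .op .iR (.addc .idx 0) ;; matvec .R .V ;; chk .R .V .O .zero

/-- The recursion for the sequence `R`. -/
def checkStep : Stmt :=
  .op .idx (.addc .iR 0) ;; matvec .R .V ;; .op .idx (.addc .iR 0) ;; matvec .Y .R ;;
    matvec .Z .V ;; .op .iR (.addc .idx 0) ;; matvec .R .V ;; .op .idx (.addc .n1 0) ;;
    matvec .W .Z ;; .load .prod (.val 4) .zero ;; chk .Y .W .R .prod

/-- The last matrix of the sequence `R` is `0`. -/
def checkLast : Stmt :=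
  .op .idx (.addc .iR 0) ;; matvec .R .V ;; chk .R .O .O .zero

/-- Multiply with the square of a matrix. -/
def applySquare (src : Arr) : Stmt :=
  .op .iR (.addc .idx 0) ;; matvec .Y src ;; .op .idx (.addc .iR 0) ;; matvec .Z .Y

/-- The determinant is a square modulo `3`. -/
def checkSquares : Stmt :=
  applySquare .V ;; applySquare .Z ;; applySquare .Z ;; applySquare .Z ;;
    .op .iR (.addc .idx 0) ;; .op .idx (.addc .n1 0) ;; matvec .Y .Z ;; .op .idx (.addc .iR 0) ;;
    matvec .W .V ;; chk .Y .V .W .three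

lemma leads_zero (σ : State) (h : Env n Q C δ σ) : (σ.reg .zero : ZMod (Q + 1)) = 0 := by
  rw [h.zero, Nat.cast_zero]

lemma leads_checkInit (y : ℕ → ZMod (Q + 1)) :
    Leads tapes ω (At n Q C δ 2 jR B [(.V, y)]) checkInit
      (At n Q C δ 3 2 (B ∧ ∀ i < n + n, mat n (res Q C) 2 y i = y i)
        [(.V, y)]) := by
  intro σ h
  have := (leads_mark (tapes := tapes) (ω := ω).seq ((leads_matvec .R .V y (by omega) (by decide)
    (by simp) (vs' := [(.V, y), (.R, mat n (res Q C) 2 y), (.O, fun _ => 0)])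
    (by simp)).seq (leads_chk .R .V .O .zero (a := mat n (res Q C) 2 y)
      (b := y) (e := fun _ => 0) rfl leads_zero (by simp) (by simp) (by simp)))) σ
    (h.weaken Iff.rfl (vs' := [(.V, y), (.O, fun _ => 0)]) (by simp))
  exact this.weaken (by simp) (by simp)

lemma leads_checkStep (y : ℕ → ZMod (Q + 1)) {k : ℕ} (hk : k < depth n) :
    Leads tapes ω (At n Q C δ j (2 + 2 * k) B [(.V, y)]) checkStep
      (At n Q C δ 1 (2 + 2 * (k + 1)) (B ∧ ∀ i < n + n,
        mat n (res Q C) (2 + 2 * k)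
          (mat n (res Q C) (2 + 2 * k) y) i =
        mat n (res Q C) 0
          (mat n (res Q C) (3 + 2 * k) y) i +
        res Q C 0 * mat n (res Q C) (4 + 2 * k) y i)
        [(.V, y)]) := by
  intro σ h
  obtain ⟨M, hM⟩ : ∃ M, M = mat n (res Q C) := ⟨_, rfl⟩
  rw [← hM]
  have hJ : 2 + 2 * k + 1 = 3 + 2 * k := by ring
  have hJ' : 3 + 2 * k + 1 = 4 + 2 * k := by ring
  have h1 := ((leads_restore (tapes := tapes) (ω := ω)).seq
    (leads_matvec .R .V y (by omega) (by decide) (by simp)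
      (vs' := [(.V, y), (.R, M (2 + 2 * k) y)]) (by simp [hM]))) σ h
  have h2 := ((leads_restore (tapes := tapes) (ω := ω)).seq
    (leads_matvec .Y .R (M (2 + 2 * k) y) (by omega) (by decide) (by simp)
      (vs' := [(.V, y), (.Y, M (2 + 2 * k) (M (2 + 2 * k) y))]) (by simp [hM]))) _ h1
  rw [hJ] at h2
  have h3 := ((leads_matvec (tapes := tapes) (ω := ω) .Z .V y (by omega) (by decide) (by simp)
      (vs' := [(.V, y), (.Y, M (2 + 2 * k) (M (2 + 2 * k) y)), (.Z, M (3 + 2 * k) y)])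
      (by simp [hM])).seq leads_mark) _ h2
  rw [hJ'] at h3
  have h4 := ((leads_matvec (tapes := tapes) (ω := ω) .R .V y (by omega) (by decide) (by simp)
      (vs' := [(.V, y), (.Y, M (2 + 2 * k) (M (2 + 2 * k) y)), (.Z, M (3 + 2 * k) y),
        (.R, M (4 + 2 * k) y)]) (by simp [hM])).seq leads_first) _ h3
  have h5 := ((leads_matvec (tapes := tapes) (ω := ω) .W .Z (M (3 + 2 * k) y) (by omega) (by decide)
      (by simp) (vs' := [(.V, y), (.Y, M (2 + 2 * k) (M (2 + 2 * k) y)),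
        (.R, M (4 + 2 * k) y), (.W, M 0 (M (3 + 2 * k) y))]) (by simp [hM])).seq
      (leads_chk_head .Y .W .R (a := M (2 + 2 * k) (M (2 + 2 * k) y))
        (b := M 0 (M (3 + 2 * k) y)) (e := M (4 + 2 * k) y) (by simp) (by simp) (by simp))) _ h4
  rw [show 2 + 2 * (k + 1) = 4 + 2 * k by ring]
  exact h5.weaken Iff.rfl (by simp)

lemma leads_checkLast (y : ℕ → ZMod (Q + 1)) :
    Leads tapes ω (At n Q C δ j (2 + 2 * depth n) B [(.V, y)]) checkLast
      (At n Q C δ (3 + 2 * depth n) (2 + 2 * depth n) (B ∧ ∀ i < n + n,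
        mat n (res Q C) (2 + 2 * depth n) y i = 0) [(.V, y)]) := by
  intro σ h
  have := (leads_restore (tapes := tapes) (ω := ω).seq ((leads_matvec .R .V y (by omega) (by decide)
    (by simp) (vs' := [(.V, y), (.R, mat n (res Q C) (2 + 2 * depth n) y),
      (.O, fun _ => 0)]) (by simp)).seq
    (leads_chk .R .O .O .zero (a := mat n (res Q C) (2 + 2 * depth n) y)
      (b := fun _ => 0) (e := fun _ => 0) rfl leads_zero (by simp) (by simp) (by simp)))) σ
    (h.weaken Iff.rfl (vs' := [(.V, y), (.O, fun _ => 0)]) (by simp))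
  rw [show 2 + 2 * depth n + 1 = 3 + 2 * depth n by ring] at this
  exact this.weaken (by simp) (by simp)

lemma leads_applySquare (src : Arr) (hs : src ∉ [.Y, .val 4, .O]) (y z : ℕ → ZMod (Q + 1))
    (hv : (src, z) ∈ vs) (hV : (.V, y) ∈ vs) (hj : j < 8 + 2 * depth n) :
    Leads tapes ω (At n Q C δ j jR B vs) (applySquare src)
      (At n Q C δ (j + 1) j B [(.V, y), (.Z, mat n (res Q C) j
        (mat n (res Q C) j z))]) := by
  simp only [List.mem_cons, List.not_mem_nil, or_false, not_or] at hs
  exact leads_mark.seq ((leads_matvec .Y src z hj (by simp [Ne.symm hs.1]) hv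
    (vs' := [(.V, y), (.Y, mat n (res Q C) j z)])
    (by simp [hV])).seq (leads_restore.seq (leads_matvec .Z .Y _ hj (by decide)
      (List.mem_cons_of_mem _ (List.mem_cons_self ..)) (by simp))))

lemma leads_checkSquares (y : ℕ → ZMod (Q + 1)) :
    Leads tapes ω (At n Q C δ (3 + 2 * depth n) jR B [(.V, y)]) checkSquares
      (fun σ => σ.reg .bad = 0 ↔ B ∧ ∀ i < n + n,
        mat n (res Q C) 0 (squares n (res Q C) y) i =
          y i + 3 * mat n (res Q C) (7 + 2 * depth n) y i) := by
  obtain ⟨M, hM⟩ : ∃ M, M = mat n (res Q C) := ⟨_, rfl⟩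
  have hz : ∃ z₀ z₁ z₂ z₃, z₀ = M (3 + 2 * depth n) (M (3 + 2 * depth n) y) ∧
      z₁ = M (4 + 2 * depth n) (M (4 + 2 * depth n) z₀) ∧
      z₂ = M (5 + 2 * depth n) (M (5 + 2 * depth n) z₁) ∧
      z₃ = M (6 + 2 * depth n) (M (6 + 2 * depth n) z₂) := ⟨_, _, _, _, rfl, rfl, rfl, rfl⟩
  obtain ⟨z₀, z₁, z₂, z₃, h0, h1, h2, h3⟩ := hz
  have hs : squares n (res Q C) y = z₃ := by
    rw [h3, h2, h1, h0, squares, ← hM]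
    simp only [add_right_comm _ (2 * depth n), Nat.reduceAdd]
  have sq : ∀ {j jR : ℕ} {src : Arr} {z z' : ℕ → ZMod (Q + 1)} {vs}, z' = M j (M j z) →
      src ∉ [Arr.Y, .val 4, .O] → (src, z) ∈ vs → (Arr.V, y) ∈ vs → j < 8 + 2 * depth n →
      Leads tapes ω (At n Q C δ j jR B vs) (applySquare src)
        (At n Q C δ (j + 1) j B [(.V, y), (.Z, z')]) := fun hz' h1 h2 h3 h4 => by
    rw [hz', hM]; exact leads_applySquare _ h1 y _ h2 h3 h4
  have e : ∀ k, k + 2 * depth n + 1 = k + 1 + 2 * depth n := fun k => by ring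
  have q0 := sq (jR := jR) (vs := [(.V, y)]) h0 (src := .V) (by decide) (by simp) (by simp) (by omega)
  have q1 := sq (jR := 3 + 2 * depth n) (vs := [(.V, y), (.Z, z₀)]) h1 (src := .Z) (by decide)
    (by simp) (by simp) (by omega)
  have q2 := sq (jR := 4 + 2 * depth n) (vs := [(.V, y), (.Z, z₁)]) h2 (src := .Z) (by decide)
    (by simp) (by simp) (by omega)
  have q3 := sq (jR := 5 + 2 * depth n) (vs := [(.V, y), (.Z, z₂)]) h3 (src := .Z) (by decide)
    (by simp) (by simp) (by omega)
  rw [e] at q0 q1 q2 q3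
  rw [hs, ← hM, checkSquares]
  refine q0.seq (q1.seq (q2.seq (q3.seq (leads_mark.seq (leads_first.seq
    ((leads_matvec .Y .Z z₃ (by omega) (by decide) (by simp) (vs' := [(.V, y), (.Y, M 0 z₃)])
      (by simp [hM])).seq (leads_restore.seq
    ((leads_matvec .W .V y (by omega) (by decide) (by simp)
      (vs' := [(.V, y), (.Y, M 0 z₃), (.W, M (7 + 2 * depth n) y)]) (by simp [hM])).seq
    fun σ h => (leads_chk .Y .V .W .three (a := M 0 z₃) (b := y) (e := M (7 + 2 * depth n) y)
      (x := 3) rfl (fun σ h => by rw [h.three]; norm_num) (by simp) (by simp) (by simp) σ h).bad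
    ))))))))

end

end DetCert
set_option linter.constructorNameAsVariable false

namespace DetCert

open Finset RAM RAM.State Stmt

variable {tapes : List (List Bool)} {ω : ℕ → Bool}

/-! #### The rounds -/

/-- Draw a random modulus. -/
def drawModulus : Stmt :=
  .op .two (.const 2) ;; .op .q (.const 0) ;;
    .loop .iB .bb (.toss .t ;; .op .q (.mam .two .q .t .big))

/-- Draw a random vector of zeros and ones. -/
def drawVector : Stmt :=
  .loop .iB .m (.toss .t ;; .op .t (.mam .one .t .zero .q) ;; .store .V .iB .t)

lemma drawModulus_spec (σ : State) (h : 2 ^ σ.reg .bb ≤ σ.reg .big) :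
    (drawModulus.den tapes ω σ).tossed = σ.tossed + σ.reg .bb ∧
      (drawModulus.den tapes ω σ).reg .q = coinNum (fun i => ω (σ.tossed + i)) (σ.reg .bb) := by
  refine loop_induction' (i := .iB) (x := .bb) (s := _)
    (fun t τ => τ.tossed = σ.tossed + t ∧ τ.reg .q = coinNum (fun i => ω (σ.tossed + i)) t)
    ((σ.setR .two 2).setR .q 0) (by simp [coinNum]) ?_
  rintro t ht τ hi hr - ⟨h1, h2⟩
  have e1 : τ.reg .two = 2 := hr .two rfl (by decide)
  have e2 : τ.reg .big = σ.reg .big := (hr .big rfl (by decide)).trans (by simp)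
  simp only [setR_reg, reduceCtorEq, if_false] at ht
  simp only [Stmt.den, Op.eval, setR_reg, setR_tossed, reduceCtorEq, if_false, if_true,
    e1, e2, h1, h2]
  refine ⟨by ring, Nat.mod_eq_of_lt (Nat.lt_succ_of_lt ?_)⟩
  exact (coinNum_lt (fun i => ω (σ.tossed + i)) (t + 1)).trans_le
    ((Nat.pow_le_pow_right (by norm_num) ht).trans h)

lemma drawVector_spec (σ : State) (h1 : σ.reg .one = 1) (hz : σ.reg .zero = 0) :
    (drawVector.den tapes ω σ).tossed = σ.tossed + σ.reg .m ∧
      ∀ i < σ.reg .m, (drawVector.den tapes ω σ).arr .V i ≤ σ.reg .q ∧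
        ((drawVector.den tapes ω σ).arr .V i : ZMod (σ.reg .q + 1)) =
          ((ω (σ.tossed + i)).toNat : ZMod (σ.reg .q + 1)) := by
  refine loop_induction' (i := .iB) (x := .m) (s := _)
    (fun t τ => τ.tossed = σ.tossed + t ∧ ∀ i < t, τ.arr .V i ≤ σ.reg .q ∧
      (τ.arr .V i : ZMod (σ.reg .q + 1)) = ((ω (σ.tossed + i)).toNat : ZMod (σ.reg .q + 1))) σ
    (by simp) ?_
  rintro t ht τ hi hr - ⟨h2, h3⟩
  have e1 : τ.reg .one = 1 := (hr .one rfl (by decide)).trans h1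
  have e2 : τ.reg .q = σ.reg .q := hr .q rfl (by decide)
  have e3 : τ.reg .zero = 0 := (hr .zero rfl (by decide)).trans hz
  simp only [Stmt.den, Op.eval, setR_reg, setR_tossed, setA_tossed,
    setR_arr, setA_arr, setA_reg, reduceCtorEq, if_false, if_true, e1, e2, e3, h2,
    hi, one_mul, add_zero, true_and]
  refine ⟨by ring, fun i hi => ?_⟩
  split_ifs with h
  · subst h; exact ⟨mod_succ_le _ _, cast_mod_succ _ _⟩
  · exact h3 i (by omega)

/-- The residues of the claimed determinant and of the certificate. -/
def loadResidues : Stmt :=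
  (tokInt 3 .nb1 ;; .load .d (.val 3) .zero) ;; tokInt 4 .itC ;; .op .idx (.addc .n1 0) ;;
    .op .iR (.addc .n1 0)

/-- The first `n` entries of `U`, followed by zeros. -/
def truncate : Stmt :=
  .loop .iB .m (.op .t (.const 0) ;; .op .u (.sub .n .iB) ;; .ifz .u .skip (.load .t .U .iB) ;;
    .store .U1 .iB .t)

/-- Compare the diagonal entries with the products of vectors, and their product with the claimed
determinant. -/
def diagLoop : Stmt :=
  .op .prod (.mam .one .one .zero .q) ;; .op .k2 (.addc .n 0) ;;
    .loop .iB .n (.op .y (.addc .iB 1) ;; .load .e (.val 4) .y ;;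
      .op .prod (.mam .prod .e .zero .q) ;; .load .t .Y .iB ;; .load .d1 .U .k2 ;;
      .op .t (.mam .e .d1 .t .q) ;; .load .d2 .V .k2 ;; neq .t .d2 ;;
      .op .k2 (.addc .k2 1)) ;; neq .prod .d

/-- Multiply the random vector by the claimed determinant. -/
def scale : Stmt :=
  .loop .iB .m (.load .t .V .iB ;; .op .t (.mam .d .t .zero .q) ;; .store .V .iB .t)

/-- All checks with one modulus and one vector. -/
def round : Stmt :=
  drawModulus ;; drawVector ;; loadResidues ;;
    matvec .U .V ;; truncate ;; matvec .Y .U1 ;; diagLoop ;; scale ;; checkInit ;;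
      .loop .iX .K checkStep ;; checkLast ;; checkSquares

section

variable {n Q : ℕ} {C : List Bool} {δ : ℤ} {j jR : ℕ} {B : Prop} {σ : State}

lemma leads_truncate (v u : ℕ → ZMod (Q + 1)) :
    Leads tapes ω (At n Q C δ j jR B [(.V, v), (.U, u)]) truncate
      (At n Q C δ j jR B [(.V, v), (.U, u), (.U1, trunc n u)]) := by
  intro σ h
  refine ⟨h.toEnv.den rfl rfl, (den_reg rfl σ).trans h.idx, (den_reg rfl σ).trans h.iR,
    by rw [den_reg rfl, h.bad], ?_⟩
  have key : ∀ i < n + n, (truncate.den tapes ω σ).arr .U1 i ≤ Q ∧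
      ((truncate.den tapes ω σ).arr .U1 i : ZMod (Q + 1)) = trunc n u i := by
    rw [← h.m]
    refine loop_induction' (i := .iB) (x := .m) (s := _)
      (fun t τ => ∀ i < t, τ.arr .U1 i ≤ Q ∧ (τ.arr .U1 i : ZMod (Q + 1)) = trunc n u i) σ
      (by simp) ?_
    rintro t ht τ hi hr ha h2 i hit
    rw [h.m] at ht
    have e1 : τ.reg .n = n := (hr .n rfl (by decide)).trans h.dim
    have e2 : τ.arr .U = σ.arr .U := ha .U rfl
    have hu := h.vec (.U, u) (by simp) t ht
    have e : ((Stmt.op .t (.const 0) ;; .op .u (.sub .n .iB) ;; .ifz .u .skip (.load .t .U .iB) ;;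
        .store .U1 .iB .t).den tapes ω τ).arr .U1 i =
        if i = t then (if t < n then σ.arr .U t else 0) else τ.arr .U1 i := by
      by_cases htn : t < n
      · simp [Stmt.den, Op.eval, hi, e1, e2, htn, Nat.sub_ne_zero_of_lt htn]
      · simp [Stmt.den, Op.eval, hi, e1, htn, Nat.sub_eq_zero_of_le (not_lt.1 htn)]
    rw [setR_arr, e, trunc]
    split_ifs with h3 h4 h5 h6 h7
    all_goals first
      | (subst h3; exact hu)
      | (subst h3; omega)
      | (subst h3; simp; done)
      | exact (h2 i (by omega)).imp id fun h => by rw [h, trunc]; simp [*]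
  intro p hp
  simp only [List.mem_cons, List.not_mem_nil, or_false] at hp
  rcases hp with rfl | rfl | rfl
  · rw [den_arr rfl]; exact h.vec _ (by simp)
  · rw [den_arr rfl]; exact h.vec _ (by simp)
  · exact key

lemma leads_diagLoop (v u y : ℕ → ZMod (Q + 1)) :
    Leads tapes ω (At n Q C δ j jR B [(.V, v), (.U, u), (.Y, y)]) diagLoop
      (At n Q C δ j jR ((B ∧ ∀ i < n, y i + res Q C (1 + i) * u (n + i) = v (n + i)) ∧
        ∏ i ∈ Finset.range n, res Q C (1 + i) = δ) [(.V, v)]) := by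
  intro σ h
  refine ⟨h.toEnv.den rfl rfl, (den_reg rfl σ).trans h.idx, (den_reg rfl σ).trans h.iR, ?_, ?_⟩
  swap
  · intro p hp
    rw [List.mem_singleton.1 hp, den_arr rfl]; exact h.vec _ (by simp)
  have key := loop_induction' (tapes := tapes) (ω := ω) (i := .iB) (x := .n)
    (s := .op .y (.addc .iB 1) ;; .load .e (.val 4) .y ;;
      .op .prod (.mam .prod .e .zero .q) ;; .load .t .Y .iB ;; .load .d1 .U .k2 ;;
      .op .t (.mam .e .d1 .t .q) ;; .load .d2 .V .k2 ;; neq .t .d2 ;; .op .k2 (.addc .k2 1))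
    (fun t τ => τ.reg .k2 = n + t ∧ τ.reg .prod ≤ Q ∧
      (τ.reg .prod : ZMod (Q + 1)) = ∏ i ∈ range t, res Q C (1 + i) ∧
      (τ.reg .bad = 0 ↔ B ∧ ∀ i < t, y i + res Q C (1 + i) * u (n + i) = v (n + i)))
    ((Stmt.op .prod (.mam .one .one .zero .q) ;; .op .k2 (.addc .n 0)).den tapes ω σ) ?_ ?_
  · have e0 : ((Stmt.op .prod (.mam .one .one .zero .q) ;; .op .k2 (.addc .n 0)).den tapes ω
        σ).reg .n = n := by simp [Stmt.den, h.dim]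
    rw [e0] at key
    obtain ⟨k1, k2, k3, k4⟩ := key
    obtain ⟨σ₁, hσ₁⟩ : ∃ s, s = (Stmt.op .prod (.mam .one .one .zero .q) ;;
      .op .k2 (.addc .n 0)).den tapes ω σ := ⟨_, rfl⟩
    rw [← hσ₁] at k1 k2 k3 k4
    have e : diagLoop.den tapes ω σ = (neq .prod .d).den tapes ω ((Stmt.loop .iB .n
      (.op .y (.addc .iB 1) ;; .load .e (.val 4) .y ;;
      .op .prod (.mam .prod .e .zero .q) ;; .load .t .Y .iB ;; .load .d1 .U .k2 ;;
      .op .t (.mam .e .d1 .t .q) ;; .load .d2 .V .k2 ;; neq .t .d2 ;;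
      .op .k2 (.addc .k2 1))).den tapes ω σ₁) := by rw [hσ₁]; rfl
    rw [e, neq_spec _ _ (by decide) (by decide), k4, den_reg (r := .d) rfl]
    have ed : σ₁.reg .d = σ.reg .d := by rw [hσ₁]; simp [Stmt.den]
    rw [ed]
    refine and_congr_right fun _ => ?_
    rw [← k3, ← h.d, natCast_inj_of_le k2 h.d_le]
  · simp only [Stmt.den, Op.eval, setR_reg, reduceCtorEq, if_false, if_true, h.one, h.zero,
      h.q, h.dim, h.bad, setR_arr]
    refine ⟨by simp, mod_succ_le _ _, ?_, by simp⟩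
    rw [cast_mod_succ]; simp
  · rintro t ht τ hi hr ha ⟨k1, k2, k3, k4⟩
    simp only [Stmt.den, Op.eval, setR_reg, reduceCtorEq, if_false, h.dim] at ht
    have a4 : τ.arr (.val 4) = σ.arr (.val 4) := ha (.val 4) rfl
    have aY : τ.arr .Y = σ.arr .Y := ha .Y rfl
    have aU : τ.arr .U = σ.arr .U := ha .U rfl
    have aV : τ.arr .V = σ.arr .V := ha .V rfl
    have eq : τ.reg .q = Q := ((hr .q rfl (by decide)).trans (by simp [Stmt.den])).trans h.q
    have ez : τ.reg .zero = 0 :=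
      ((hr .zero rfl (by decide)).trans (by simp [Stmt.den])).trans h.zero
    have ht' : t + 1 < numTokens n := by rw [numTokens, off]; omega
    have vy := h.vec (.Y, y) (by simp) t (by omega)
    have vu := h.vec (.U, u) (by simp) (n + t) (by omega)
    have vv := h.vec (.V, v) (by simp) (n + t) (by omega)
    simp only at vy vu vv
    simp only [Stmt.den, Op.eval, setR_reg, setR_arr, reduceCtorEq, if_false, if_true]
    rw [den_reg (s := neq .t .d2) rfl, den_reg (s := neq .t .d2) rfl,
      neq_spec _ _ (by decide) (by decide)]
    simp only [setR_reg, setR_arr, reduceCtorEq, if_false, if_true, hi, k1, a4, aY, aU,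
      aV, eq, ez]
    refine ⟨by ring, mod_succ_le _ _, ?_, ?_⟩
    · rw [cast_mod_succ, prod_range_succ, ← k3]
      push_cast
      rw [h.val _ ht', add_comm 1 t, add_zero]
    · rw [k4, Nat.forall_lt_succ_right, and_assoc]
      refine and_congr_right fun _ => and_congr_right fun _ => ?_
      rw [← natCast_inj_of_le (mod_succ_le _ _) vv.1, cast_mod_succ]
      push_cast
      rw [h.val _ ht', vy.2, vu.2, vv.2, add_comm 1 t, add_comm (y t)]

lemma leads_scale (v : ℕ → ZMod (Q + 1)) :
    Leads tapes ω (At n Q C δ j jR B [(.V, v)]) scale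
      (At n Q C δ j jR B [(.V, fun i => (δ : ZMod (Q + 1)) * v i)]) := by
  intro σ h
  refine ⟨h.toEnv.den rfl rfl, (den_reg rfl σ).trans h.idx, (den_reg rfl σ).trans h.iR,
    by rw [den_reg rfl, h.bad], fun p hp => ?_⟩
  rw [List.mem_singleton.1 hp]
  have key := loop_induction' (tapes := tapes) (ω := ω) (i := .iB) (x := .m)
    (s := .load .t .V .iB ;; .op .t (.mam .d .t .zero .q) ;; .store .V .iB .t)
    (fun t τ => ∀ i < n + n, τ.arr .V i ≤ Q ∧ (τ.arr .V i : ZMod (Q + 1)) =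
      if i < t then (δ : ZMod (Q + 1)) * v i else v i) σ
    (by simpa using h.vec (.V, v) (by simp)) ?_
  · rw [h.m] at key
    intro i hi
    have := key i hi
    rw [if_pos hi] at this
    exact this
  · rintro t ht τ hi hr ha h2 i hit
    rw [h.m] at ht
    have e1 : τ.reg .d = σ.reg .d := hr .d rfl (by decide)
    have e2 : τ.reg .zero = 0 := (hr .zero rfl (by decide)).trans h.zero
    have e3 : τ.reg .q = Q := (hr .q rfl (by decide)).trans h.q
    simp only [Stmt.den, Op.eval, State.setR_reg, State.setR_arr, State.setA_arr, State.setA_reg,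
      reduceCtorEq, if_false, if_true, hi, e1, e2, e3, true_and, add_zero]
    by_cases h3 : i = t
    · subst h3
      have := (h2 i hit).2
      rw [if_neg (lt_irrefl i)] at this
      rw [if_pos rfl, if_pos (by omega), cast_mod_succ]
      push_cast
      rw [h.d, this]
      exact ⟨mod_succ_le _ _, rfl⟩
    · have := h2 i hit
      rw [if_neg h3]
      by_cases h4 : i < t
      · rw [if_pos h4] at this; rwa [if_pos (by omega)]
      · rw [if_neg h4] at this; rwa [if_neg (by omega)]

lemma leads_steps (y : ℕ → ZMod (Q + 1)) :
    Leads tapes ω (At n Q C δ j 2 B [(.V, y)]) (.loop .iX .K checkStep)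
      (fun σ => ∃ j, At n Q C δ j (2 + 2 * depth n) (B ∧ ∀ k < depth n, ∀ i < n + n,
        mat n (res Q C) (2 + 2 * k) (mat n (res Q C) (2 + 2 * k) y) i =
        mat n (res Q C) 0 (mat n (res Q C) (3 + 2 * k) y) i +
          res Q C 0 * mat n (res Q C) (4 + 2 * k) y i) [(.V, y)] σ) := by
  intro σ h
  have set : ∀ {j jR : ℕ} {B : Prop} {τ : State} (k : ℕ), At n Q C δ j jR B [(.V, y)] τ →
      At n Q C δ j jR B [(.V, y)] (τ.setR .iX k) := fun k h =>
    ⟨h.toEnv.den (tapes := []) (ω := fun _ => false) (s := .op .iX (.const k)) rfl rfl,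
      by simp [h.idx], by simp [h.iR], by simp [h.bad], h.vec⟩
  rw [← h.K]
  refine loop_induction (i := .iX) (x := .K) (s := checkStep)
    (fun t τ => ∃ j, At n Q C δ j (2 + 2 * t) (B ∧ ∀ k < t, ∀ i < n + n,
      mat n (res Q C) (2 + 2 * k) (mat n (res Q C) (2 + 2 * k) y) i =
      mat n (res Q C) 0 (mat n (res Q C) (3 + 2 * k) y) i +
        res Q C 0 * mat n (res Q C) (4 + 2 * k) y i) [(.V, y)] τ) σ
    ⟨j, (set 0 h).weaken (by simp) fun p hp => .inl hp⟩ ?_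
  rintro t ht τ - ⟨j, hj⟩
  rw [h.K] at ht
  refine ⟨1, (set _ (leads_checkStep y ht τ hj)).weaken ?_ fun p hp => .inl hp⟩
  rw [Nat.forall_lt_succ_right, and_assoc]

lemma leads_checks (w : ℕ → ZMod (Q + 1)) {M : ℕ → (ℕ → ZMod (Q + 1)) → ℕ → ZMod (Q + 1)}
    {y : ℕ → ZMod (Q + 1)} (hM : M = mat n (res Q C))
    (hy : y = fun j => (δ : ZMod (Q + 1)) * w j) :
    Leads tapes ω (At n Q C δ 0 0 B [(.V, w)]) (matvec .U .V ;; truncate ;;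
      matvec .Y .U1 ;; diagLoop ;; scale ;; checkInit ;; .loop .iX .K checkStep ;; checkLast ;;
      checkSquares) (fun σ' => σ'.reg .bad = 0 ↔ (((((B ∧
      ∀ i < n, M 1 (trunc n (M 0 w)) i + res Q C (1 + i) * M 0 w (n + i) = w (n + i)) ∧
      ∏ i ∈ range n, res Q C (1 + i) = δ) ∧ (∀ i < n + n, M 2 y i = y i)) ∧
      (∀ k < depth n, ∀ i < n + n, M (2 + 2 * k) (M (2 + 2 * k) y) i =
        M 0 (M (3 + 2 * k) y) i + res Q C 0 * M (4 + 2 * k) y i)) ∧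
      (∀ i < n + n, M (2 + 2 * depth n) y i = 0)) ∧
      ∀ i < n + n, M 0 (squares n (res Q C) y) i = y i + 3 * M (7 + 2 * depth n) y i) := by
  rw [hM, hy]
  exact (leads_matvec .U .V w (by omega) (by decide) (by simp)
    (vs' := [(.V, w), (.U, mat n (res Q C) 0 w)]) (by simp)).seq
    ((leads_truncate _ _).seq ((leads_matvec .Y .U1 (trunc n (mat n (res Q C) 0 w)) (by omega)
    (by decide) (by simp) (vs' := [(.V, w), (.U, mat n (res Q C) 0 w),
      (.Y, mat n (res Q C) 1 (trunc n (mat n (res Q C) 0 w)))]) (by simp)).seq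
    ((leads_diagLoop _ _ _).seq ((leads_scale _).seq ((leads_checkInit _).seq
    ((leads_steps _).seq ((Leads.exists fun _ => leads_checkLast _).seq
    (leads_checkSquares _))))))))

end

section

variable {c r n l L len : ℕ} {C : List Bool} {δ : ℤ}

lemma loadResidues_spec (hd : tapes.getD 3 [] = encodeInt δ) (hC : tapes.getD 4 [] = C)
    (hl : C.length = l) (hlb : l ≤ (limits c).certBits n L)
    (hδ : δ.natAbs.size ≤ (limits c).numBits n L) (σ : State)
    (ha : HasParams c r n L len l σ) (hO : ∀ i, σ.arr .O i = 0)
    {v : ℕ → ZMod (σ.reg .q + 1)} (hv : ∀ i < n + n, σ.arr .V i ≤ σ.reg .q ∧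
      (σ.arr .V i : ZMod (σ.reg .q + 1)) = v i) :
    At n (σ.reg .q) C δ 0 0 (σ.reg .bad = 0) [(.V, v)] (loadResidues.den tapes ω σ) := by
  have hdd := decode_ints [δ] 0 (by simp)
  simp only [List.flatMap_cons, List.flatMap_nil, List.append_nil, List.getElem_cons_zero, tpos]
    at hdd
  have enb : (limits c).numBits n L = detConst c * (n * (n.size * L)) := by simp only [limits]; ring
  have ecb : (limits c).certBits n L = certConst c * (n.size * (n * (n * (n.size * L)))) := by
    simp only [limits]; ring
  have s3 := tokInt_spec (ω := ω) 3 .nb1 hd σ rfl (ha.get .zero) 0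
  have hok := s3.2 (s3.1.2 (by
    rw [tpos, tpos, hdd.1, ha.get .nb1]
    simp only [par]; omega))
  obtain ⟨σ₁, hσ₁⟩ : ∃ s, s = (tokInt 3 .nb1).den tapes ω σ := ⟨_, rfl⟩
  obtain ⟨σ₂, hσ₂⟩ : ∃ s, s = (Stmt.load .d (.val 3) .zero).den tapes ω σ₁ := ⟨_, rfl⟩
  obtain ⟨σ₃, hσ₃⟩ : ∃ s, s = (tokInt 4 .itC).den tapes ω σ₂ := ⟨_, rfl⟩
  have e : loadResidues.den tapes ω σ =
      (σ₃.setR .idx (σ₃.reg .n1)).setR .iR (σ₃.reg .n1) := by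
    rw [hσ₃, hσ₂, hσ₁]
    simp [loadResidues, Stmt.den, Op.eval]
  have a1 : HasParams c r n L len l σ₁ := hσ₁ ▸ agree_den ha rfl
  have a2 : HasParams c r n L len l σ₂ := hσ₂ ▸ agree_den a1 rfl
  have a3 : HasParams c r n L len l σ₃ := hσ₃ ▸ agree_den a2 rfl
  have q2 : σ₂.reg .q = σ.reg .q := by rw [hσ₂, den_reg rfl, hσ₁, den_reg rfl]
  have d3 : σ₃.reg .d = σ₁.arr (.val 3) 0 := by
    rw [hσ₃, den_reg rfl, hσ₂]
    simp only [Stmt.den, setR_reg, if_true]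
    rw [a1.get .zero]; rfl
  rw [← hσ₁] at hok
  have ok4 : ∀ k < numTokens n, TokOk C 1 (tapeSymbol C 0 % 2) (σ.reg .q) 4 σ₃.arr k := by
    intro k hk
    have h := tokInt_spec (ω := ω) 4 .itC hC σ₂ rfl (a2.get .zero) k
    rw [← hσ₃, q2] at h
    refine h.2 (h.1.2 ?_)
    have := tpos_le C 1 (k + 1)
    rw [a2.get .itC]
    simp only [par]
    omega
  have a4 : HasParams c r n L len l (loadResidues.den tapes ω σ) := agree_den ha rfl
  rw [e] at a4
  have n1 : σ₃.reg .n1 = off n 0 := (a3.get .n1).trans (by simp [par, off])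
  rw [e]
  refine ⟨⟨?_, a4.get .m, a4.get .n, a4.get .n1,
    a4.get .zero, a4.get .one, a4.get .three,
    a4.get .K, ?_, ?_, ?_, fun k hk => (ok4 k hk).val_le,
    fun k hk => (ok4 k hk).val⟩, ?_, ?_, ?_, ?_⟩
  · rw [setR_reg, setR_reg, if_neg (by decide), if_neg (by decide), hσ₃, den_reg rfl, q2]
  · rw [setR_reg, setR_reg, if_neg (by decide), if_neg (by decide), d3]
    exact hok.val_le
  · rw [setR_reg, setR_reg, if_neg (by decide), if_neg (by decide), d3, hok.val]
    congr 1
    exact hdd.2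
  · intro i
    rw [setR_arr, setR_arr, hσ₃, den_arr rfl, hσ₂, den_arr rfl, hσ₁, den_arr rfl, hO]
  · simp [n1]
  · simp [n1]
  · rw [setR_reg, setR_reg, if_neg (by decide), if_neg (by decide), hσ₃, den_reg rfl,
      hσ₂, den_reg rfl, hσ₁, den_reg rfl]
  · intro p hp
    rw [List.mem_singleton.1 hp, setR_arr, setR_arr, hσ₃, den_arr rfl, hσ₂, den_arr rfl,
      hσ₁, den_arr rfl]
    exact hv

lemma passes_iff (Q : ℕ) (v : ℕ → ℕ) : Passes n C δ Q v ↔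
    ∃ M w y, M = mat n (res Q C) ∧ w = (fun j => (v j : ZMod (Q + 1))) ∧
      y = (fun j => (δ : ZMod (Q + 1)) * w j) ∧
      (∀ i < n, M 1 (trunc n (M 0 w)) i + res Q C (1 + i) * M 0 w (n + i) = w (n + i)) ∧
      ∏ i ∈ range n, res Q C (1 + i) = δ ∧ (∀ i < n + n, M 2 y i = y i) ∧
      (∀ k < depth n, ∀ i < n + n, M (2 + 2 * k) (M (2 + 2 * k) y) i =
        M 0 (M (3 + 2 * k) y) i + res Q C 0 * M (4 + 2 * k) y i) ∧
      (∀ i < n + n, M (2 + 2 * depth n) y i = 0) ∧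
      ∀ i < n + n, M 0 (squares n (res Q C) y) i = y i + 3 * M (7 + 2 * depth n) y i := by
  constructor
  · rintro ⟨⟨h1, h2, h3, h4, h5⟩, h6⟩
    exact ⟨_, _, _, rfl, rfl, rfl, h1, h6, h2, h3, h4, h5⟩
  · rintro ⟨_, _, _, rfl, rfl, rfl, h1, h6, h2, h3, h4, h5⟩
    exact ⟨⟨h1, h2, h3, h4, h5⟩, h6⟩

/-- A round tosses the coins for modulus and vector, and then makes all checks. -/
lemma round_spec (hd : tapes.getD 3 [] = encodeInt δ) (hC : tapes.getD 4 [] = C)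
    (hl : C.length = l) (hlb : l ≤ (limits c).certBits n L)
    (hδ : δ.natAbs.size ≤ (limits c).numBits n L) (σ : State)
    (ha : HasParams c r n L len l σ) (hO : ∀ i, σ.arr .O i = 0) :
    (round.den tapes ω σ).tossed = σ.tossed + (modBits n l + (n + n)) ∧
    ((round.den tapes ω σ).reg .bad = 0 ↔ σ.reg .bad = 0 ∧
      Passes n C δ (coinNum (fun i => ω (σ.tossed + i)) (modBits n l))
        fun j => (ω (σ.tossed + (modBits n l + j))).toNat) := by
  have ecb : (limits c).certBits n L = certConst c * (n.size * (n * (n * (n.size * L)))) := by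
    simp only [limits]; ring
  have hlen : min (certConst c * (n.size * (n * (n * (n.size * L)))) + 1) l = l := by omega
  have vbb : ∀ τ : State, HasParams c r n L len l τ → τ.reg .bb = modBits n l :=
    fun τ hτ => by rw [hτ.get .bb]; simp only [par, hlen]
  have vbig : 2 ^ σ.reg .bb ≤ σ.reg .big := by
    rw [vbb σ ha, ha.get .big]
    simp only [par, hlen]
    exact two_pow_modBits_le n l
  obtain ⟨σ₁, hσ₁⟩ : ∃ s, s = drawModulus.den tapes ω σ := ⟨_, rfl⟩
  obtain ⟨σ₂, hσ₂⟩ : ∃ s, s = drawVector.den tapes ω σ₁ := ⟨_, rfl⟩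
  obtain ⟨rest, hrest⟩ : ∃ s, s = loadResidues ;; matvec .U .V ;; truncate ;; matvec .Y .U1 ;;
    diagLoop ;; scale ;; checkInit ;; .loop .iX .K checkStep ;; checkLast ;; checkSquares := ⟨_, rfl⟩
  have e : round.den tapes ω σ = rest.den tapes ω σ₂ := by
    rw [hrest, hσ₂, hσ₁, round]; simp only [Stmt.den]
  have ht : rest.wt = false := by rw [hrest]; rfl
  have a1 : HasParams c r n L len l σ₁ := hσ₁ ▸ agree_den ha rfl
  have a2 : HasParams c r n L len l σ₂ := hσ₂ ▸ agree_den a1 rfl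
  obtain ⟨t1, q1⟩ := drawModulus_spec (tapes := tapes) (ω := ω) σ vbig
  rw [← hσ₁, vbb σ ha] at t1 q1
  obtain ⟨t2, v2⟩ := drawVector_spec (tapes := tapes) (ω := ω) σ₁ (a1.get .one)
    (a1.get .zero)
  have hm : σ₁.reg .m = n + n := a1.get .m
  have q2 : σ₂.reg .q = σ₁.reg .q := by rw [hσ₂, den_reg rfl]
  have hb : σ₂.reg .bad = σ.reg .bad := by rw [hσ₂, den_reg rfl, hσ₁, den_reg rfl]
  rw [← hσ₂, hm] at t2 v2
  rw [← q2, t1] at v2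
  refine ⟨by rw [e, den_tossed ht, t2, t1, add_assoc], ?_⟩
  rw [e, ← hb, ← q1, ← q2]
  obtain ⟨Q, hQ⟩ : ∃ Q, Q = σ₂.reg .q := ⟨_, rfl⟩
  obtain ⟨w, hw⟩ : ∃ w : ℕ → ZMod (Q + 1), w = fun j =>
    (((ω (σ.tossed + (modBits n l + j))).toNat : ℕ) : ZMod (Q + 1)) := ⟨_, rfl⟩
  obtain ⟨M, hM⟩ : ∃ M, M = mat n (res Q C) := ⟨_, rfl⟩
  obtain ⟨y, hy⟩ : ∃ y, y = fun j => (δ : ZMod (Q + 1)) * w j := ⟨_, rfl⟩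
  have h0 := loadResidues_spec (ω := ω) hd hC hl hlb hδ σ₂ a2 (fun i => by
    rw [hσ₂, den_arr rfl, hσ₁, den_arr rfl, hO]) (v := fun j =>
    (((ω (σ.tossed + (modBits n l + j))).toNat : ℕ) : ZMod (σ₂.reg .q + 1)))
    (fun i hi => by rw [← add_assoc]; exact v2 i hi)
  subst hQ
  rw [← hw] at h0
  have key := leads_checks (tapes := tapes) (ω := ω) w hM hy _ h0
  rw [passes_iff, hrest, Stmt.den]
  refine key.trans ⟨?_, ?_⟩
  · rintro ⟨⟨⟨⟨⟨⟨b, h1⟩, h2⟩, h3⟩, h4⟩, h5⟩, h6⟩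
    exact ⟨b, M, w, y, hM, hw, hy, h1, h2, h3, h4, h5, h6⟩
  · rintro ⟨b, M', w', y', hM', hw', hy', h1, h2, h3, h4, h5, h6⟩
    obtain rfl : M' = M := hM'.trans hM.symm
    obtain rfl : w' = w := hw'.trans hw.symm
    obtain rfl : y' = y := hy'.trans hy.symm
    exact ⟨⟨⟨⟨⟨⟨b, h1⟩, h2⟩, h3⟩, h4⟩, h5⟩, h6⟩

/-- The rounds. -/
def rounds : Stmt := .loop .kB .rr round

lemma rounds_spec (hd : tapes.getD 3 [] = encodeInt δ) (hC : tapes.getD 4 [] = C)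
    (hl : C.length = l) (hlb : l ≤ (limits c).certBits n L)
    (hδ : δ.natAbs.size ≤ (limits c).numBits n L) (σ : State) (ht : σ.tossed = 0)
    (ha : HasParams c r n L len l σ) (hO : ∀ i, σ.arr .O i = 0) :
    (rounds.den tapes ω σ).reg .bad = 0 ↔ σ.reg .bad = 0 ∧ ∀ t < r * modBits n l, Passes n C δ
      (coinNum (fun i => ω (t * (modBits n l + (n + n)) + i)) (modBits n l))
      fun j => (ω (t * (modBits n l + (n + n)) + (modBits n l + j))).toNat := by
  have ecb : (limits c).certBits n L = certConst c * (n.size * (n * (n * (n.size * L)))) := by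
    simp only [limits]; ring
  have hlen : min (certConst c * (n.size * (n * (n * (n.size * L)))) + 1) l = l := by omega
  have hrr : σ.reg .rr = r * modBits n l := by
    rw [ha.get .rr]; simp only [par, hlen]
  have key := loop_induction' (tapes := tapes) (ω := ω) (i := .kB) (x := .rr) (s := round)
    (fun k τ => τ.tossed = k * (modBits n l + (n + n)) ∧ (τ.reg .bad = 0 ↔ σ.reg .bad = 0 ∧
      ∀ t < k, Passes n C δ
      (coinNum (fun i => ω (t * (modBits n l + (n + n)) + i)) (modBits n l))
      fun j => (ω (t * (modBits n l + (n + n)) + (modBits n l + j))).toNat)) σ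
    (by simp [ht]) ?_
  · rw [hrr] at key; exact key.2
  · rintro k - τ hi hr hA ⟨h1, h2⟩
    have aτ : HasParams c r n L len l τ := agree_of_loop ha hr rfl rfl
    obtain ⟨s1, s2⟩ := round_spec (ω := ω) hd hC hl hlb hδ τ aτ (fun i => by rw [hA .O rfl, hO])
    simp only [State.setR_reg, reduceCtorEq, if_false, State.setR_tossed]
    refine ⟨by rw [s1, h1]; ring, ?_⟩
    rw [s2, h2, h1, Nat.forall_lt_succ_right, and_assoc]

end

end DetCert
set_option linter.constructorNameAsVariable false

/-! ### The program of the verifier -/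

namespace DetCert

open RAM Stmt

variable {tapes : List (List Bool)} {ω : ℕ → Bool}

/-- The checks after the parameters have been computed. -/
def checks : Stmt := readMessages ;; copyCheck ;; horner ;; rounds

/-- All that the verifier does once the length of the input is known. -/
def verify (c r : ℕ) : Stmt := readInput ;; params c r ;; checks

lemma checks_spec {c r n : ℕ} (hn : 0 < n) {A : IntMat n} {g : ℤ[X]} {lam : ℕ}
    (hlam : lam < c * n) {x : ℤ × List Bool} {len : ℕ} (ht : tapes = verifierTapes A g lam x)
    (σ : State) (h : Ready (encodeMatrix A) n σ)
    (ha : HasParams c r n (entryBits A) len x.2.length σ) :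
    (checks.den tapes ω σ).reg .bad = 0 ↔
      (charpolyCertificate (detCert r) (limits c) c n).accepts A g lam x ω := by
  obtain ⟨δ, C⟩ := x
  have h0 : tapes.getD 0 [] = encodeMatrix A := by rw [ht]; rfl
  have h1 : tapes.getD 1 [] = encodePoly g := by rw [ht]; rfl
  have h2 : tapes.getD 2 [] = encodeNat lam := by rw [ht]; rfl
  have h3 : tapes.getD 3 [] = encodeInt δ := by rw [ht]; rfl
  have h4 : tapes.getD 4 [] = C := by rw [ht]; rfl
  clear ht
  obtain ⟨s1, s1'⟩ := readMessages_spec (ω := ω) hn hlam h1 h2 h3 h4 rfl σ h ha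
  have a1 := agree_den (tapes := tapes) (ω := ω) (s := readMessages) ha rfl
  have t1 := (den_tossed (tapes := tapes) (ω := ω) (s := readMessages) rfl σ).trans h.tossed
  have o1 : ∀ i, (readMessages.den tapes ω σ).arr .O i = 0 := fun i => by
    rw [den_arr rfl, h.zeros]
  simp only [checks, Stmt.den]
  generalize readMessages.den tapes ω σ = σ₁ at *
  have a2 := agree_den (tapes := tapes) (ω := ω) (s := copyCheck) a1 rfl
  have t2 := (den_tossed (tapes := tapes) (ω := ω) (s := copyCheck) rfl σ₁).trans t1
  have o2 : ∀ i, (copyCheck.den tapes ω σ₁).arr .O i = 0 := fun i => by rw [den_arr rfl, o1]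
  have a3 := agree_den (tapes := tapes) (ω := ω) (s := horner) a2 rfl
  have t3 := (den_tossed (tapes := tapes) (ω := ω) (s := horner) rfl _).trans t2
  have o3 : ∀ i, (horner.den tapes ω (copyCheck.den tapes ω σ₁)).arr .O i = 0 := fun i => by
    rw [den_arr rfl, o2]
  have main : ∀ (_ : C.length ≤ (limits c).certBits n (entryBits A))
      (_ : (∀ i, (g.coeff i).natAbs.size ≤ (limits c).numBits n (entryBits A)) ∧ g.degree = n)
      (_ : δ.natAbs.size ≤ (limits c).numBits n (entryBits A)) (_ : σ₁.reg .bad = 0), _ :=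
    fun hl hg hδ hb =>
      have f1 := s1' hb
      have e2 := copyCheck_spec hn h0 h2 h4 σ₁ f1 a1 hlam
      have e3 := horner_spec hn hlam h1 h3 _
        (f1.den (tapes := tapes) (ω := ω) (s := copyCheck) rfl rfl) a2 (one_le_entryBits A)
        (natDegree_eq_of_degree_eq_some hg.2) hg.1 hδ
      have e4 := rounds_spec (ω := ω) h3 h4 rfl hl hδ _ t3 a3 o3
      e4.trans (and_congr_left' (e3.trans (and_congr_left' e2)))
  constructor
  · intro hb
    have b1 : σ₁.reg .bad = 0 := bad_den (s := copyCheck) rfl _ (bad_den (s := horner) rfl _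
      (bad_den (s := rounds) rfl _ hb))
    obtain ⟨k1, k2, k3, k4⟩ := s1.1 b1
    obtain ⟨⟨⟨-, m1⟩, m2⟩, m3⟩ := (main k1 k2 k3 b1).1 hb
    exact ⟨⟨k2.1, k3, k1⟩, k2.2, m2, m1, k4, m3⟩
  · rintro ⟨⟨k2, k3, k1⟩, k2', m2, m1, k4, m3⟩
    have b1 := s1.2 ⟨k1, ⟨k2, k2'⟩, k3, k4⟩
    exact (main k1 ⟨k2, k2'⟩ k3 b1).2 ⟨⟨⟨b1, m1⟩, m2⟩, m3⟩

/-- The verifier decides as the protocol says, in the time that follows from the parameters. -/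
lemma verify_spec {c r n : ℕ} (hn : 0 < n) {A : IntMat n} {g : ℤ[X]} {lam : ℕ}
    (hlam : lam < c * n) {x : ℤ × List Bool} (ht : tapes = verifierTapes A g lam x) :
    Triple tapes ω (par c r n (entryBits A) (encodeMatrix A).length x.2.length)
      (fun σ => σ = start (encodeMatrix A).length) (verify c r) (fun σ => σ.reg .bad = 0 ↔
        (charpolyCertificate (detCert r) (limits c) c n).accepts A g lam x ω) := by
  refine (readInput_spec (by rw [ht]; rfl)).seq ((params_spec (by rw [ht]; rfl)).seq
    fun σ ⟨h, ha⟩ => ?_)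
  have ha' := fun x hx => ha x ((by decide : ∀ x ∈ keepRegs, x ∈ paramRegs) x hx)
  exact ⟨checks_spec hn hlam ht σ h ha', tb_le_of_agree ha' rfl⟩

end DetCert

namespace RAM

variable {tapes : List (List Bool)} {ω : ℕ → Bool}

/-- Count the bits of tape `0` in the cell of register `len`. -/
def measureInput : List Instr :=
  [.read 0 0 2, .const 1 2, .sub 0 1 0, .jumpZero 0 8, .const 1 1, .add 2 2 1, .const 1 0,
    .jumpZero 1 0]

/-- Count the bits of the input, run a structured program, and accept if register `bad` is zero. -/
def Stmt.toProgram (s : Stmt) : Program :=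
  measureInput ++ (s.code 8 ++
    [.jumpZero Reg.bad.adr (8 + (s.code 8).length + 2), .halt false, .halt true])

lemma tapeSymbol_of_lt {w : List Bool} {i : ℕ} (h : i < w.length) : tapeSymbol w i < 2 := by
  rw [tapeSymbol, List.getElem?_eq_getElem h]
  exact Bool.toNat_lt _

open DetCert in
lemma reach_measureInput (rest : List Instr) (w : ℕ)
    (hw : (tapes.getD 0 []).length < 2 ^ w) :
    ∃ c', Reach (measureInput ++ rest) tapes ω ⟨0, 0, fun _ => 0⟩ c'
      (((tapes.getD 0 []).length + 1) * (2 * w + 12) ^ 2) ∧ c'.pc = 8 ∧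
      Repr c' (start (tapes.getD 0 []).length) := by
  obtain ⟨W, hW⟩ : ∃ W, W = tapes.getD 0 [] := ⟨_, rfl⟩
  rw [← hW] at hw ⊢
  have size_le : ∀ {k : ℕ}, k ≤ W.length → k.size ≤ w := fun h => size_le_of_lt (by omega)
  have s2 : ∀ {k : ℕ}, k ≤ 2 → k.size ≤ 2 := fun h => size_le_of_lt (by omega)
  have key : ∀ k ≤ W.length, ∃ m, m 2 = k ∧ Repr ⟨0, 0, m⟩ (start k) ∧
      Reach (measureInput ++ rest) tapes ω ⟨0, 0, fun _ => 0⟩ ⟨0, 0, m⟩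
        (k * (2 * w + 12) ^ 2) := by
    intro k
    induction k with
    | zero =>
      refine fun _ => ⟨fun _ => 0, rfl, ⟨rfl, fun r => ?_, fun _ _ => rfl⟩,
        (Reach.refl _).mono (Nat.zero_le _)⟩
      simp [start]
    | succ k ih =>
      intro hk
      obtain ⟨m, h2, hm, hr⟩ := ih (by omega)
      have h1 := tapeSymbol_of_lt (show k < W.length by omega)
      have hne : 2 - tapeSymbol W k ≠ 0 := by omega
      refine ⟨Function.update (Function.update (Function.update m 0 (2 - tapeSymbol W k)) 1 0) 2
        (k + 1), by simp, ?_, (hr.trans (T' := (2 * w + 12) ^ 2) ⟨8, (1 + k.size) + (1 + Nat.size 2)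
          + (1 + Nat.size 2 + (tapeSymbol W k).size) + (1 + (2 - tapeSymbol W k).size)
          + (1 + Nat.size 1) + (1 + k.size + Nat.size 1) + (1 + Nat.size 0) + (1 + Nat.size 0), ?_,
            fun f t => ?_⟩).mono (by rw [add_mul, one_mul])⟩
      · have : start (k + 1) = (start k).setR .len (k + 1) := by
          ext1
          · funext r; by_cases hr : r = .len <;> simp [start, hr]
          · rfl
          · rfl
        rw [this]
        refine hm.setR rfl fun p hp => ?_
        have : p ≠ 0 := by omega
        have : p ≠ 1 := by omega
        simp [Function.update_apply, Reg.adr, Reg.num, Reg.ctorIdx, *]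
      · have := size_le (show k ≤ W.length by omega)
        have := s2 h1.le
        have := s2 (Nat.sub_le 2 (tapeSymbol W k))
        have := s2 (k := 2) le_rfl
        simp only [Nat.size_zero, Nat.size_one]
        nlinarith
      · simp only [measureInput, List.cons_append, List.nil_append, Program.exec,
          List.getElem?_cons_zero, List.getElem?_cons_succ, Instr.next, Config.write, ← hW,
          Instr.cost, Function.update_apply, h2, hne, if_true, if_false, zero_add, Nat.reduceAdd,
          Nat.reduceEqDiff, zero_ne_one, one_ne_zero, OfNat.ofNat_ne_zero, OfNat.ofNat_ne_one,
          OfNat.zero_ne_ofNat, OfNat.one_ne_ofNat]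
        congr 1
        · congr 1
          funext p
          simp only [Function.update_apply]
          split_ifs <;> simp_all
        · ring
  obtain ⟨m, h2, hm, hr⟩ := key _ le_rfl
  have h1 := tapeSymbol_of_le (le_refl W.length)
  refine ⟨⟨8, 0, Function.update (Function.update (Function.update m 0 2) 1 2) 0 0⟩,
    (hr.trans (T' := (2 * w + 12) ^ 2) ⟨4, (1 + W.length.size) + (1 + Nat.size 2)
          + (1 + Nat.size 2 + Nat.size 2) + (1 + Nat.size 0), ?_,
            fun f t => ?_⟩).mono (by rw [add_mul, one_mul]), rfl, hm.congr rfl fun p hp => ?_⟩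
  · have := size_le (le_refl W.length)
    have := s2 (k := 2) le_rfl
    simp only [Nat.size_zero]
    nlinarith
  · simp only [measureInput, List.cons_append, List.nil_append, Program.exec,
      List.getElem?_cons_zero, List.getElem?_cons_succ, Instr.next, Config.write, ← hW,
      Instr.cost, Function.update_apply, h2, h1, if_true, if_false, zero_add, Nat.reduceAdd,
      zero_ne_one, one_ne_zero, OfNat.ofNat_ne_zero, OfNat.ofNat_ne_one, Nat.sub_self]
    congr 1
  · have : p ≠ 0 := by omega
    have : p ≠ 1 := by omega
    simp [Function.update_apply, *]

lemma exec_add {V : Program} {f : ℕ} {s : Config} {t : ℕ} {x : Bool × ℕ}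
    (h : V.exec tapes ω f s t = some x) (g : ℕ) : V.exec tapes ω (f + g) s t = some x := by
  induction f generalizing s t with
  | zero => simp [Program.exec] at h
  | succ f ih =>
    rw [Nat.add_right_comm]
    rw [Program.exec] at h ⊢
    split at h <;> first | exact h | exact ih h

/-- Verdict and cost of a run are unique. -/
lemma haltsWith_unique {V : Program} {v v' : Bool} {t t' : ℕ} (h : V.HaltsWith tapes ω v t)
    (h' : V.HaltsWith tapes ω v' t') : v = v' ∧ t = t' := by
  obtain ⟨f, hf⟩ := h
  obtain ⟨f', hf'⟩ := h'
  have := exec_add hf f'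
  rw [add_comm, exec_add hf' f, Option.some.injEq, Prod.mk.injEq] at this
  exact ⟨this.1.symm, this.2.symm⟩

open DetCert in
/-- The compiled program halts with the verdict that register `bad` gives. The cost is bounded in
terms of a bound `T` for the number of instructions; no number gets more than `w` digits. -/
lemma toProgram_spec {s : Stmt} (hs : s.wf = true) {len : ℕ} (hlen : (tapes.getD 0 []).length = len)
    {T w : ℕ} (hT : s.tb tapes ω (start len) ≤ T) (hw : len + (s.kb + 1) * T < 2 ^ w) :
    ∃ t ≤ (len + T + 2) * (2 * w + 12) ^ 2, s.toProgram.HaltsWith tapes ω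
      (decide ((s.den tapes ω (start len)).reg .bad = 0)) t := by
  have hw' : len + (s.kb + 1) * s.tb tapes ω (start len) < 2 ^ w :=
    (Nat.add_le_add_left (Nat.mul_le_mul_left _ hT) _).trans_lt hw
  obtain ⟨c, h1, h2, h3⟩ := reach_measureInput (tapes := tapes) (ω := ω) (s.code 8 ++
    [.jumpZero Reg.bad.adr (8 + (s.code 8).length + 2), .halt false, .halt true]) w (by omega)
  have hV : CodeAt s.toProgram 8 _ := codeAt_of_eq (pre := measureInput) (post := [])
    (List.append_nil _).symm
  obtain ⟨v1, v2, v3, v4, -⟩ := codeAt_append.1 hV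
  rw [hlen, ← Stmt.toProgram] at h1
  obtain ⟨c', g1, g2, g3, g4⟩ := Stmt.code_spec (tapes := tapes) (ω := ω) (κ := s.kb + 1) (by omega) s
    hs (Nat.le_succ _) (start len) _ c 8 len h2 v1 (hlen ▸ h3)
    ⟨fun r => by simp only [start]; split_ifs <;> omega, fun _ _ => Nat.zero_le _⟩ hw'
  have g5 := Reach.jump (tapes := tapes) (ω := ω) g2 v2
  obtain ⟨k, cost, hcost, hk⟩ := (h1.trans g1).trans g5
  have hb : ((s.den tapes ω (start len)).reg .bad).size ≤ w := size_le_of_lt (by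
    have := g4.1 .bad; omega)
  rw [g3.2.1] at hcost hk
  refine ⟨cost + 1, ?_, 1 + k, ?_⟩
  · have : s.tb tapes ω (start len) * (2 * w + 12) ^ 2 ≤ T * (2 * w + 12) ^ 2 :=
      Nat.mul_le_mul_right _ hT
    nlinarith
  · rw [hk]
    simp only [zero_add, Program.exec]
    split_ifs with h0
    · simp [v4, h0]
    · simp [v3, h0]

end RAM
set_option linter.constructorNameAsVariable false

/-! ### Growth of costs -/

namespace RAM.Stmt

/-- Loops are nested in such a way that the number of instructions grows to degrees at most `a` and
`b` in two variables if the values of the loop bounds grow to the degrees `d`. -/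
def degLe (d : Reg → ℕ × ℕ) : Stmt → ℕ → ℕ → Bool
  | seq s t, a, b => degLe d s a b && degLe d t a b
  | ifz _ s t, a, b => degLe d s a b && degLe d t a b
  | loop _ x s, a, b => Nat.ble (d x).1 a && Nat.ble (d x).2 b &&
      degLe d s (a - (d x).1) (b - (d x).2)
  | _, _, _ => true

end RAM.Stmt

namespace DetCert

open RAM Stmt

/-- The sizes on which the cost depends: dimension and bit size of the matrix, lengths of the input
and of the certificate of the determinant. -/
structure Sizes where
  n : ℕ
  L : ℕ
  len : ℕ
  l : ℕ
  n_pos : 0 < n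
  L_pos : 0 < L
  len_le : len ≤ 2 * n.size + 1 + 2 * (n * n * L) + 2 * (n * n)

/-- The quantity is at most `n ^ (a + o(1)) * L ^ (b + o(1))`. -/
def Growth (a b : ℕ) (f : Sizes → ℕ) : Prop :=
  ∀ ε : ℝ, 0 < ε → ∃ B : ℝ, 0 ≤ B ∧ ∀ s, (f s : ℝ) ≤ B * (s.n : ℝ) ^ (a + ε) * (s.L : ℝ) ^ (b + ε)

namespace Growth

variable {a b a' b' : ℕ} {f g : Sizes → ℕ}

lemma one_le_n (s : Sizes) : (1 : ℝ) ≤ s.n := by exact_mod_cast s.n_pos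

lemma one_le_L (s : Sizes) : (1 : ℝ) ≤ s.L := by exact_mod_cast s.L_pos

lemma one_le (s : Sizes) {x y : ℝ} (hx : 0 ≤ x) (hy : 0 ≤ y) :
    1 ≤ (s.n : ℝ) ^ x * (s.L : ℝ) ^ y :=
  one_le_mul_of_one_le_of_one_le (Real.one_le_rpow (one_le_n s) hx) (Real.one_le_rpow (one_le_L s) hy)

lemma of_le (hg : Growth a b g) (h : ∀ s, f s ≤ g s) : Growth a b f := fun ε hε => by
  obtain ⟨B, h0, hB⟩ := hg ε hε
  exact ⟨B, h0, fun s => (Nat.cast_le.2 (h s)).trans (hB s)⟩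

lemma mono (hf : Growth a b f) (ha : a ≤ a') (hb : b ≤ b') (hg : ∀ s, g s = f s) :
    Growth a' b' g := fun ε hε => by
  obtain ⟨B, h0, hB⟩ := hf ε hε
  refine ⟨B, h0, fun s => (hg s ▸ hB s).trans ?_⟩
  have h1 := one_le_n s
  have h2 := one_le_L s
  gcongr

lemma add (hf : Growth a b f) (hg : Growth a' b' g) : Growth (max a a') (max b b') fun s => f s + g s :=
  fun ε hε => by
  obtain ⟨B, h0, hB⟩ := hf.mono (le_max_left _ a') (le_max_left _ b') (fun _ => rfl) ε hε
  obtain ⟨B', h0', hB'⟩ := hg.mono (le_max_right a _) (le_max_right b _) (fun _ => rfl) ε hε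
  refine ⟨B + B', by positivity, fun s => ?_⟩
  rw [add_mul, add_mul, Nat.cast_add]
  exact add_le_add (hB s) (hB' s)

lemma mul (hf : Growth a b f) (hg : Growth a' b' g) : Growth (a + a') (b + b') fun s => f s * g s :=
  fun ε hε => by
  obtain ⟨B, h0, hB⟩ := hf (ε / 2) (by positivity)
  obtain ⟨B', h0', hB'⟩ := hg (ε / 2) (by positivity)
  refine ⟨B * B', by positivity, fun s => ?_⟩
  have h1 := one_le_n s
  have h2 := one_le_L s
  have e : ∀ (x : ℝ) (a b : ℕ), 0 < x → x ^ (((a + b : ℕ) : ℝ) + ε) =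
      x ^ ((a : ℝ) + ε / 2) * x ^ ((b : ℝ) + ε / 2) := fun x a b hx => by
    rw [← Real.rpow_add hx]
    congr 1
    push_cast
    ring
  rw [e _ _ _ (by linarith), e _ _ _ (by linarith), Nat.cast_mul]
  refine (mul_le_mul (hB s) (hB' s) (by positivity) (by positivity)).trans_eq ?_
  ring

lemma const (k : ℕ) : Growth 0 0 fun _ => k := fun ε hε => by
  refine ⟨k, by positivity, fun s => ?_⟩
  rw [mul_assoc]
  exact le_mul_of_one_le_right (by positivity) (one_le s (by simpa using hε.le) (by simpa using hε.le))

lemma dim : Growth 1 0 Sizes.n := fun ε hε => by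
  refine ⟨1, by positivity, fun s => ?_⟩
  rw [one_mul, Nat.cast_one, Real.rpow_add (zero_lt_one.trans_le (one_le_n s)), Real.rpow_one, mul_assoc]
  exact le_mul_of_one_le_right (by positivity) (one_le s hε.le (by simpa using hε.le))

lemma bits : Growth 0 1 Sizes.L := fun ε hε => by
  refine ⟨1, by positivity, fun s => ?_⟩
  rw [one_mul, Nat.cast_one, Real.rpow_add (zero_lt_one.trans_le (one_le_L s)), Real.rpow_one,
    mul_left_comm]
  exact le_mul_of_one_le_right (by positivity) (one_le s (by simpa using hε.le) hε.le)

lemma size_le_rpow (m : ℕ) {δ : ℝ} (hδ : 0 < δ) :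
    (m.size : ℝ) ≤ 1 + (m : ℝ) ^ δ / (δ * Real.log 2) := by
  have hl := Real.log_pos one_lt_two
  rcases Nat.eq_zero_or_pos m with rfl | hm
  · rw [Nat.size_zero, Nat.cast_zero]; positivity
  obtain ⟨k, hk⟩ : ∃ k, m.size = k + 1 := ⟨m.size - 1, by have := Nat.size_pos.2 hm; omega⟩
  have h1 : 2 ^ k ≤ m := Nat.lt_size.1 (by omega)
  have h2 : (k : ℝ) * Real.log 2 ≤ Real.log m := by
    rw [← Real.log_pow]
    exact Real.log_le_log (by positivity) (by exact_mod_cast h1)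
  have h3 := h2.trans (Real.log_le_rpow_div (Nat.cast_nonneg m) hδ)
  rw [hk, ← div_div, Nat.cast_succ, add_comm]
  exact add_le_add_right ((le_div_iff₀ hl).2 h3) 1

/-- The number of digits of a quantity of polynomial growth is `(n L) ^ o(1)`. -/
lemma size (hf : Growth a b f) : Growth 0 0 fun s => (f s).size := fun ε hε => by
  obtain ⟨B, h0, hB⟩ := hf 1 one_pos
  obtain ⟨δ, hδ⟩ : ∃ δ, δ = ε / (a + b + 1) := ⟨_, rfl⟩
  have hδ0 : 0 < δ := by rw [hδ]; positivity
  have hl := Real.log_pos one_lt_two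
  refine ⟨1 + B ^ δ / (δ * Real.log 2), by positivity, fun s => ?_⟩
  have h1 := one_le_n s
  have h2 := one_le_L s
  have hd : ∀ k : ℕ, (k : ℝ) ≤ (a : ℝ) + b → ((k : ℝ) + 1) * δ ≤ ε := fun k hk => by
    rw [hδ, mul_div_assoc', div_le_iff₀ (by positivity), mul_comm]
    gcongr
  have e : ∀ {x : ℝ} (k : ℕ), 1 ≤ x → (k : ℝ) ≤ (a : ℝ) + b → (x ^ ((k : ℝ) + 1)) ^ δ ≤ x ^ ε :=
    fun k hx hk => by
      rw [← Real.rpow_mul (by linarith)]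
      exact Real.rpow_le_rpow_of_exponent_le hx (hd k hk)
  have h3 : (f s : ℝ) ^ δ ≤ B ^ δ * ((s.n : ℝ) ^ ε * (s.L : ℝ) ^ ε) := by
    refine (Real.rpow_le_rpow (Nat.cast_nonneg _) (hB s) hδ0.le).trans ?_
    rw [mul_assoc, Real.mul_rpow h0 (by positivity), Real.mul_rpow (by positivity) (by positivity)]
    exact mul_le_mul_of_nonneg_left (mul_le_mul (e _ h1 (by simp)) (e _ h2 (by simp))
      (by positivity) (by positivity)) (by positivity)
  have h4 := one_le s hε.le hε.le
  simp only [Nat.cast_zero, zero_add, mul_assoc]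
  refine (size_le_rpow (f s) hδ0).trans ?_
  rw [add_mul, one_mul, div_mul_eq_mul_div]
  gcongr

/-- The nesting of the loops decides how the time bound of a program grows. -/
lemma stb {ρ : Sizes → Reg → ℕ} {δ : Reg → ℕ × ℕ}
    (h : ∀ x, Growth (δ x).1 (δ x).2 fun s => ρ s x) (t : Stmt) (ht : t.degLe δ a b = true) :
    Growth a b fun s => t.stb (ρ s) := by
  induction t generalizing a b with
  | seq s t ihs iht =>
    simp only [degLe, Bool.and_eq_true] at ht
    exact ((ihs ht.1).add (iht ht.2)).mono (by simp) (by simp) fun _ => rfl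
  | ifz x s t ihs iht =>
    simp only [degLe, Bool.and_eq_true] at ht
    exact (((const 3).add (ihs ht.1)).add (iht ht.2)).mono (by simp) (by simp) fun _ => rfl
  | loop i x t ih =>
    simp only [degLe, Bool.and_eq_true, Nat.ble_eq] at ht
    exact ((const 3).add ((h x).mul ((const 7).add (ih ht.2)))).mono (by simp; omega)
      (by simp; omega) fun _ => rfl
  | _ => exact (const 5).mono (Nat.zero_le _) (Nat.zero_le _) fun _ => rfl

end Growth

/-- The degrees to which the parameters grow. -/
def parDeg : Reg → ℕ × ℕ
  | .n | .m | .n1 | .m4 | .cn => (1, 0)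
  | .idx0 | .prod | .nT => (2, 0)
  | .L | .k1 | .hd | .S1 => (0, 1)
  | .k2 | .nb | .nb1 | .S => (1, 1)
  | .len | .oB | .iR | .d | .cb | .cb1 | .G | .lenC | .itC | .x | .big => (2, 1)
  | _ => (0, 0)

lemma growth_par (c r : ℕ) (x : Reg) :
    Growth (parDeg x).1 (parDeg x).2 fun s => par c r s.n s.L s.len s.l x := by
  have n := Growth.dim
  have L := Growth.bits
  have s := n.size
  have k := Growth.const
  have k1 := s.mul L
  have k2 := n.mul k1
  have nb1 := ((k (detConst c)).mul k2).add (k 1)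
  have iR := n.mul k2
  have d := s.mul iR
  have cb := (k (certConst c)).mul d
  have len := Growth.of_le (((((k 2).mul s).add (k 1)).add ((k 2).mul ((n.mul n).mul L))).add
      ((k 2).mul (n.mul n))) Sizes.len_le
  have m := n.add n
  have n1 := n.add (k 1)
  have nT := n1.add (((k 8).add ((k 2).mul (s.add (k 4)))).mul (m.mul m))
  have lenC := (cb.add (k 1)).of_le (f := fun t => par c r t.n t.L t.len t.l .lenC) fun _ =>
    min_le_left _ _
  have y := (lenC.add n).add (k 1)
  have bb := ((k 512).mul (y.size.mul y)).size
  have w {x : Reg} {a b : ℕ} {f : Sizes → ℕ} (h : Growth a b f) (ha : a ≤ (parDeg x).1 := by decide)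
      (hb : b ≤ (parDeg x).2 := by decide)
      (e : ∀ s, par c r s.n s.L s.len s.l x = f s := by intro; rfl) :
      Growth (parDeg x).1 (parDeg x).2 fun s => par c r s.n s.L s.len s.l x :=
    h.mono ha hb e
  cases x
  case len => exact w len
  case oB => exact w ((k 2).mul len)
  case n => exact n
  case sz => exact s
  case idx0 => exact w (n.mul n)
  case L => exact L
  case m => exact m
  case n1 => exact n1
  case m4 => exact w ((k 4).mul n)
  case cn => exact w ((k c).mul n)
  case K => exact w (s.add (k 4))
  case nm => exact w ((k 16).add ((k 2).mul s))
  case k1 => exact w k1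
  case hd => exact w ((k _).mul k1)
  case S1 => exact w (((k _).mul k1).add (k 2))
  case k2 => exact w k2
  case nb => exact w ((k _).mul k2)
  case nb1 => exact w nb1
  case S => exact w ((k _).mul k2)
  case iR => exact w iR
  case d => exact w d
  case cb => exact w cb
  case cb1 => exact w (cb.add (k 1))
  case G => exact w (((n1.mul nb1).add s).add (k 2))
  case prod => exact w (m.mul m)
  case nT => exact w nT
  case lenC => exact w lenC
  case itC => exact w ((lenC.add (k 1)).add nT)
  case x => exact w y
  case h => exact w y.size
  case big => exact w ((k 1024).mul (y.size.mul y))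
  case bb => exact w bb
  case rr => exact w ((k r).mul bb)
  all_goals exact k _

lemma growth_verify (c r : ℕ) :
    Growth 2 1 fun s => (verify c r).stb (par c r s.n s.L s.len s.l) :=
  Growth.stb (growth_par c r) (verify c r) rfl

end DetCert
set_option linter.constructorNameAsVariable false

/-! ### Running time and communication -/

namespace DetCert

open RAM Stmt

/-- The sizes of an input of the verifier. -/
def sizes {n : ℕ} (hn : 0 < n) (A : IntMat n) (l : ℕ) : Sizes where
  n := n
  L := entryBits A
  len := (encodeMatrix A).length
  l := l
  n_pos := hn
  L_pos := one_le_entryBits A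
  len_le := by
    have h := List.sum_le_card_nsmul ((entries A).map fun z => z.natAbs.size) (entryBits A) (by
      intro x hx
      obtain ⟨z, hz, rfl⟩ := List.mem_map.1 hx
      obtain ⟨k, rfl⟩ := (List.mem_ofFn' _ _).1 hz
      exact natAbs_size_le_entryBits A _ _)
    rw [List.length_map, entries, List.length_ofFn, smul_eq_mul] at h
    rw [length_encodeMatrix, entries]
    omega

/-- The bound for the cost of the program of the verifier. The middle factor bounds the number of
instructions, and the last one the cost of each. -/
def costBound (c r : ℕ) (s : Sizes) : ℕ :=
  (c * s.n).size + (s.len + (verify c r).stb (par c r s.n s.L s.len s.l) + 2) *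
    (2 * (s.len + ((verify c r).kb + 1) * (verify c r).stb (par c r s.n s.L s.len s.l)).size + 12) ^ 2

lemma growth_costBound (c r : ℕ) : Growth 2 1 (costBound c r) := by
  have k := Growth.const
  have len : Growth 2 1 Sizes.len := growth_par c r .len
  have t := growth_verify c r
  have w := ((k 2).mul (len.add ((k ((verify c r).kb + 1)).mul t)).size).add (k 12)
  exact (((k c).mul Growth.dim).size.add (((len.add t).add (k 2)).mul (w.mul w))).mono (by decide)
    (by decide) fun _ => by rw [costBound, pow_two]

/-- The verdict of the program of the verifier, and its cost. -/
lemma haltsWith_verify {c r n : ℕ} (hn : 0 < n) (A : IntMat n) (g : ℤ[X]) {lam : ℕ}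
    (hlam : lam < c * n) (x : ℤ × List Bool) (ω : ℕ → Bool) :
    ∃ (v : Bool) (t : ℕ), (verify c r).toProgram.HaltsWith (verifierTapes A g lam x) ω v t ∧
      (v = true ↔ (charpolyCertificate (detCert r) (limits c) c n).accepts A g lam x ω) ∧
      (c * n).size + t ≤ costBound c r (sizes hn A x.2.length) := by
  obtain ⟨h1, h2⟩ := verify_spec (r := r) (ω := ω) hn hlam rfl _ rfl
  obtain ⟨t, ht, h⟩ := toProgram_spec (s := verify c r) rfl
    (len := (encodeMatrix A).length) rfl h2 (Nat.lt_size_self _)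
  exact ⟨_, t, h, by rw [decide_eq_true_eq, h1], Nat.add_le_add_left ht _⟩

/-- The bound for the number of bits of the messages. -/
def bitsBound (c : ℕ) (s : Sizes) : ℕ :=
  2 * (s.n + 1).size + 1 + (2 * ((s.n + 1) * (limits c).numBits s.n s.L) + 2 * (s.n + 1)) +
    (2 * (c * s.n).size + 1) + (2 * (limits c).numBits s.n s.L + 2) + (limits c).certBits s.n s.L

lemma growth_bitsBound (c : ℕ) : Growth 2 1 (bitsBound c) := by
  have k := Growth.const
  have n := Growth.dim
  have nb := (k (detConst c)).mul ((n.mul n.size).mul Growth.bits)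
  have cb := (k (certConst c)).mul (((n.mul n).mul (n.size.mul n.size)).mul Growth.bits)
  have n1 := n.add (k 1)
  exact ((((((k 2).mul n1.size).add (k 1)).add (((k 2).mul (n1.mul nb)).add ((k 2).mul n1))).add
    (((k 2).mul ((k c).mul n).size).add (k 1))).add (((k 2).mul nb).add (k 2))).add cb |>.mono
      (by decide) (by decide) fun _ => rfl

lemma transcriptBits_le {K : DetCertificate} {c n : ℕ} (hn : 0 < n)
    {A : IntMat n} {g : ℤ[X]} {lam : ℕ} (hlam : lam < c * n) {x : ℤ × List Bool}
    {ω : ℕ → Bool} (h : (charpolyCertificate K (limits c) c n).accepts A g lam x ω) :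
    transcriptBits g lam x ≤ bitsBound c (sizes hn A x.2.length) := by
  obtain ⟨⟨h1, h2, h3⟩, h4, -⟩ := h
  have hd : g.natDegree = n := natDegree_eq_of_degree_eq_some h4
  have hs := List.sum_le_card_nsmul (((List.range (n + 1)).map g.coeff).map fun z => z.natAbs.size)
    ((limits c).numBits n (entryBits A)) (by
      intro x hx
      simp only [List.map_map, List.mem_map, List.mem_range] at hx
      obtain ⟨i, -, rfl⟩ := hx
      exact h1 i)
  have hl : (encodePoly g).length = 2 * (n + 1).size + 1 + (2 *
      (((List.range (n + 1)).map g.coeff).map fun z => z.natAbs.size).sum + 2 * (n + 1)) := by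
    rw [encodePoly, hd, List.length_append, length_encodeNat, ← List.flatMap_map,
      length_flatMap_encodeInt, List.length_map, List.length_range]
  have e := Nat.size_le_size hlam.le
  simp only [List.length_map, List.length_range, smul_eq_mul] at hs
  simp only [transcriptBits, length_encodeNat, length_encodeInt, hl]
  change _ ≤ 2 * (n + 1).size + 1 + (2 * ((n + 1) * (limits c).numBits n (entryBits A)) +
    2 * (n + 1)) + (2 * (c * n).size + 1) + (2 * (limits c).numBits n (entryBits A) + 2) +
      (limits c).certBits n (entryBits A)
  omega

end DetCert

theorem mainTheorem5 (c : ℕ) (hc : 2 < c) (η : ℝ) (hη : 0 < η) :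
    ∃ (K : DetCertificate) (F : SizeLimits) (V : Program),
      -- `K` is a certificate for determinants
      K.PerfectlyComplete ∧ K.SoundWithError η ∧
      -- the protocol is perfectly complete and sound
      (∀ n : ℕ, 0 < n → (charpolyCertificate K F c n).PerfectlyComplete) ∧
      (∀ n : ℕ, 0 < n → (charpolyCertificate K F c n).SoundWithError (1 / c + η)) ∧
      -- `V` carries out the verifier's checks, whatever the prover sends
      (∀ n : ℕ, 0 < n → ∀ (A : Matrix (Fin n) (Fin n) ℤ) (g : ℤ[X]), ∀ lam < c * n,
        ∀ (r : ℤ × List Bool) (ω : ℕ → Bool), ∃ (verdict : Bool) (t : ℕ),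
          V.HaltsWith (verifierTapes A g lam r) ω verdict t ∧
          (verdict = true ↔ (charpolyCertificate K F c n).accepts A g lam r ω)) ∧
      -- bit operations, including those for drawing the challenge, and bit space
      (∀ ε : ℝ, 0 < ε → ∃ B : ℝ,
        ∀ n : ℕ, 0 < n → ∀ (A : Matrix (Fin n) (Fin n) ℤ) (g : ℤ[X]), ∀ lam < c * n,
        ∀ (r : ℤ × List Bool) (ω : ℕ → Bool),
          (∀ (verdict : Bool) (t : ℕ), V.HaltsWith (verifierTapes A g lam r) ω verdict t →
            (((c * n).size + t : ℕ) : ℝ) ≤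
              B * (n : ℝ) ^ (2 + ε) * (entryBits A : ℝ) ^ (1 + ε)) ∧
          ((charpolyCertificate K F c n).accepts A g lam r ω →
            (transcriptBits g lam r : ℝ) ≤
              B * (n : ℝ) ^ (2 + ε) * (entryBits A : ℝ) ^ (1 + ε))) := by
  obtain ⟨r, hr⟩ := DetCert.exists_detCert_soundWithError hη
  refine ⟨DetCert.detCert r, DetCert.limits c, (DetCert.verify c r).toProgram, DetCert.detCert_perfectlyComplete r, hr,
    fun n hn => DetCert.perfectlyComplete r hn,
    fun n hn => DetCert.soundWithError _ _ hη hr (by omega) hn, fun n hn A g lam hlam x ω => ?_,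
    fun ε hε => ?_⟩
  · obtain ⟨v, t, h, hv, -⟩ := DetCert.haltsWith_verify hn A g hlam x ω
    exact ⟨v, t, h, hv⟩
  · obtain ⟨B, h0, hB⟩ := DetCert.growth_costBound c r ε hε
    obtain ⟨B', h0', hB'⟩ := DetCert.growth_bitsBound c ε hε
    refine ⟨B + B', fun n hn A g lam hlam x ω => ⟨fun v t h => ?_, fun h => ?_⟩⟩
    · obtain ⟨v', t', h', -, ht⟩ := DetCert.haltsWith_verify (r := r) hn A g hlam x ω
      rw [(RAM.haltsWith_unique h h').2]
      refine (Nat.cast_le.2 ht).trans ((hB (DetCert.sizes hn A x.2.length)).trans ?_)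
      rw [Nat.cast_ofNat, Nat.cast_one]
      gcongr
      · exact le_add_of_nonneg_right h0'
      · exact le_rfl
      · exact le_rfl
    · refine (Nat.cast_le.2 (DetCert.transcriptBits_le hn hlam h)).trans
        ((hB' (DetCert.sizes hn A x.2.length)).trans ?_)
      rw [Nat.cast_ofNat, Nat.cast_one]
      gcongr
      · exact le_add_of_nonneg_left h0
      · exact le_rfl
      · exact le_rfl
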